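/- **Setting.** Let $\mathbb T=\mathbb R/\mathbb Z$ with normalized Lebesgue measure $\operatorname{mes}$, identified with the unit circle of $\mathbb C$, and for $z\in\mathbb C$ write $z+k\omega:=ze^{2\pi ik\omega}$. Fix $\alpha>1$ and $\omega\in(0,1)$ such that for some $C_\omega>0$, $\operatorname{dist}(n\omega,\mathbb Z)\ge C_\omega/(n(\log n)^\alpha)$ for all integers $n\ge 2$. Let $\mathcal A_\rho=\{z\in\mathbb C:1-\rho<|z|<1+\rho\}$ and fix $0<\rho_0<\rho<1$. Let $a,b$ be analytic on the closure of $\mathcal A_\rho$, with $a$ real on $\mathbb T$ and $b$ not identically zero, and put $\tilde b(z)=\overline{b(1/\bar z)}$. For $E\in\mathbb C$ and $n\ge1$ let $$M^a_n(z)=\prod_{j=n-1}^{0}\begin{pmatrix}a(z+j\omega)-E&-\tilde b(z+j\omega)\\ b(z+(j+1)\omega)&0\end{pmatrix},\qquad M_n(z)=\Big(\prod_{j=1}^nb(z+j\omega)\Big)^{-1}M^a_n(z),\qquad M^u_n(z)=\frac{M_n(z)}{\sqrt{|\det M_n(z)|}}$$ (the last two wherever they are defined, which on $\mathbb T$ is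 almost everywhere). With $\|\cdot\|$ the operator norm on $\mathbb C^2$ put $L_n=\frac1n\int_{\mathbb T}\log\|M_n(x)\|\,dx$ and $L=\lim_{n\to\infty}L_n$, and define $L^a_n,L^a$ and $L^u_n,L^u$ in the same way from $M^a_n$ and $M^u_n$. Put $\|f\|_\infty=\sup_{\mathcal A_\rho}|f|$, $D(r)=\int_{\mathbb T}\log|b(rx)|\,dx$ and $\|b\|_*=\|b\|_\infty+\sup_{r\in(1-\rho_0,1+\rho_0)}|D(r)|$. **Theorem.** Let $\gamma>0$ and $A,B,R\ge0$. There is a constant $c_0>0$ depending only on $\alpha,\omega,\rho_0,\rho,\gamma,A,B,R$, and for each $p>\alpha+2$ a constant $C_0>0$ depending only on the same data and $p$, such that for all $a,b,E$ as above with $\|a\|_\infty\le A$, $\|b\|_*\le B$, $|E|\le R$ and $L=L(E)\ge\gamma$ the following holds. The integrals defining $L_n,L^a_n,L^u_n$ ($n\ge1$) converge, the limits $L,L^a,L^u$ exist, and for every $\delta>0$ and every integer $n>1$ $$\operatorname{mes}\{x\in\mathbb T:|\log\|M^a_n(x)\|-nL^a_n|>\delta n\}<\exp(-c_0\delta n+C_0(\log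 n)^p),$$ $$\operatorname{mes}\{x\in\mathbb T:|\log\|M^u_n(x)\|-nL^u_n|>\delta n\}<\exp(-c_0\delta n+C_0(\log n)^p),$$ and both estimates also hold with $L^a_n$ replaced by $L^a$ and $L^u_n$ replaced by $L^u$, respectively. -/

import Mathlib

open MeasureTheory Filter Topology
open scoped ENNReal NNReal Matrix.Norms.L2Operator

noncomputable section

namespace JacobiCocycle

/-- The Diophantine condition `‖nω‖ ≥ C_ω / (n (log n)^α)`, where `‖·‖` is the distance to the
nearest integer. It is imposed for `n ≥ 2`, where `log n > 0`. -/
def IsDiophantine (α ω : ℝ) : Prop :=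
  ∃ C : ℝ, 0 < C ∧ ∀ n : ℕ, 2 ≤ n →
    C / ((n : ℝ) * Real.log n ^ α) ≤ |(n : ℝ) * ω - round ((n : ℝ) * ω)|

/-- The annulus `𝒜_ρ = {z : 1 - ρ < |z| < 1 + ρ}`. -/
def annulus (ρ : ℝ) : Set ℂ := {z | ‖z‖ ∈ Set.Ioo (1 - ρ) (1 + ρ)}

/-- The point `e^{2πix}` of the unit circle of `ℂ` identified with `x ∈ 𝕋 = ℝ/ℤ`. -/
def pt (x : UnitAddCircle) : ℂ := (AddCircle.toCircle x : ℂ)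

/-- The convention `z + kω := z e^{2πikω}`. -/
def rot (ω : ℝ) (k : ℕ) (z : ℂ) : ℂ :=
  z * Complex.exp (2 * Real.pi * Complex.I * k * ω)

/-- `b̃(z)`, the complex conjugate of `b(1 / z̄)`. -/
def tilde (b : ℂ → ℂ) (z : ℂ) : ℂ :=
  starRingEnd ℂ (b (1 / starRingEnd ℂ z))

/-- The analytic one-step matrix `[[a(z) - E, -b̃(z)], [b(z + ω), 0]]`. -/
def step (a b : ℂ → ℂ) (ω : ℝ) (E z : ℂ) : Matrix (Fin 2) (Fin 2) ℂ :=
  !![a z - E, -tilde b z; b (rot ω 1 z), 0]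

/-- The fundamental matrix `M_n(z)`: the ordered product over `j = n - 1, …, 0` of
`b(z + (j+1)ω)⁻¹ [[a(z + jω) - E, -b̃(z + jω)], [b(z + (j+1)ω), 0]]`. -/
def M (a b : ℂ → ℂ) (ω : ℝ) (E : ℂ) : ℕ → ℂ → Matrix (Fin 2) (Fin 2) ℂ
  | 0, _ => 1
  | n + 1, z => ((b (rot ω (n + 1) z))⁻¹ • step a b ω E (rot ω n z)) * M a b ω E n z

/-- The analytic transfer matrix `M^a_n`: the ordered product of the one-step matrices. It equals
`(∏_{j=1}^n b(z + jω)) M_n(z)` wherever `M_n` is defined, see `Ma_eq`. -/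
def Ma (a b : ℂ → ℂ) (ω : ℝ) (E : ℂ) : ℕ → ℂ → Matrix (Fin 2) (Fin 2) ℂ
  | 0, _ => 1
  | n + 1, z => step a b ω E (rot ω n z) * Ma a b ω E n z

/-- The unimodular matrix `M^u_n(z) = |det M_n(z)|^{-1/2} M_n(z)`. -/
def Mu (a b : ℂ → ℂ) (ω : ℝ) (E : ℂ) (n : ℕ) (z : ℂ) : Matrix (Fin 2) (Fin 2) ℂ :=
  (((Real.sqrt ‖(M a b ω E n z).det‖)⁻¹ : ℝ) : ℂ) • M a b ω E n z

theorem Ma_eq (a b : ℂ → ℂ) (ω : ℝ) (E : ℂ) (n : ℕ) (z : ℂ)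
    (hb : ∀ j ∈ Finset.Icc 1 n, b (rot ω j z) ≠ 0) :
    Ma a b ω E n z = (∏ j ∈ Finset.Icc 1 n, b (rot ω j z)) • M a b ω E n z := by
  induction n with
  | zero => simp [Ma, M]
  | succ n ih =>
    have h1 : b (rot ω (n + 1) z) ≠ 0 := hb _ (by simp)
    rw [Ma, M, ih fun j hj => hb j (by simp at hj ⊢; omega),
      Finset.prod_Icc_succ_top (by omega), Matrix.mul_smul, Matrix.smul_mul, smul_smul,
      mul_assoc, mul_inv_cancel₀ h1, mul_one]

/-- `log ‖A‖`, with the operator norm of `A` acting on the Euclidean space `ℂ²`. -/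
def logNorm (A : Matrix (Fin 2) (Fin 2) ℂ) : ℝ := Real.log ‖A‖

/-- `(1/n) ∫_𝕋 log ‖F_n(x)‖ dx` for a sequence of matrix functions `F_n`; for `F = M, M^a, M^u`
these are `L_n`, `L^a_n`, `L^u_n`. -/
def finiteExponent (F : ℕ → ℂ → Matrix (Fin 2) (Fin 2) ℂ) (n : ℕ) : ℝ :=
  (1 / (n : ℝ)) * ∫ x : UnitAddCircle, logNorm (F n (pt x))

/-- The limit of `(1/n) ∫_𝕋 log ‖F_n(x)‖ dx` as `n → ∞`; for `F = M, M^a, M^u` these are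
`L`, `L^a`, `L^u`. -/
def exponent (F : ℕ → ℂ → Matrix (Fin 2) (Fin 2) ℂ) : ℝ :=
  limUnder atTop (finiteExponent F)

/-- All integrals `∫_𝕋 log ‖F_n(x)‖ dx`, `n ≥ 1`, converge, and the limit defining `exponent F`
exists. -/
def HasExponent (F : ℕ → ℂ → Matrix (Fin 2) (Fin 2) ℂ) : Prop :=
  (∀ n : ℕ, 1 ≤ n → Integrable (fun x : UnitAddCircle => logNorm (F n (pt x)))) ∧
    Tendsto (finiteExponent F) atTop (𝓝 (exponent F))

/-- `D(r) = ∫_𝕋 log |b(rx)| dx`. -/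
def logMean (b : ℂ → ℂ) (r : ℝ) : ℝ :=
  ∫ x : UnitAddCircle, Real.log ‖b ((r : ℂ) * pt x)‖

/-- `‖f‖_∞`, the supremum of `|f|` over the annulus `𝒜_ρ`. -/
def supNorm (ρ : ℝ) (f : ℂ → ℂ) : ℝ≥0∞ := ⨆ z ∈ annulus ρ, ‖f z‖ₑ

/-- `‖b‖_* = ‖b‖_∞ + sup_{r ∈ (1-ρ₀, 1+ρ₀)} |D(r)|`. -/
def starNorm (ρ₀ ρ : ℝ) (b : ℂ → ℂ) : ℝ≥0∞ :=
  supNorm ρ b + ⨆ r ∈ Set.Ioo (1 - ρ₀) (1 + ρ₀), ‖logMean b r‖ₑ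

/-- The set of `x ∈ 𝕋` with `|log ‖F_n(x)‖ - nℓ| > δn`. -/
def deviationSet (F : ℕ → ℂ → Matrix (Fin 2) (Fin 2) ℂ) (n : ℕ) (ℓ δ : ℝ) :
    Set UnitAddCircle :=
  {x | δ * n < |logNorm (F n (pt x)) - n * ℓ|}

end JacobiCocycle

end

/-! ### Small divisors: sums of inverse distances to the integers -/

namespace JacobiCocycle

/-! Write `u_n` for the logarithm of the entry norm of `M^a_n`, `β` for `log |b|` on the circle, and
`D` for the mean of `β`. The determinant of `M^a_n` is, up to modulus, a product of values of `b`,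
so its logarithm is a sum of two Birkhoff sums of `β`, and the exponent of `M` is `L^a - D`. The
hypothesis `L ≥ γ` is thus a gap between the singular values of long products. The norm of `M^u_n`
differs from that of `M^a_n` by Birkhoff sums of `β`, so everything reduces to `u_n` and `β`.

The first ingredient is a quantitative Birkhoff theorem (`rotSum_log_norm_bounds`). Let `f` be
analytic on an annulus with `log |f| ≤ W H` there and mean of `log |f|` at least `-W H` on the
circle. Then a Birkhoff sum of `log |f|` over `k` steps exceeds its mean by at most a multiple of `W
(log k)^(α+2)`, and the exponential moment of its defect divided by `W` is at most `exp (K (log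
k)^(α+2))`. To see this, split off the at most `O(W)` zeros near the circle. The zero-free factor
has exponentially decaying Fourier coefficients, hence bounded Birkhoff discrepancy. A single
logarithmic pole is treated by its Fourier series and small divisor sums; an orbit of length `k`
comes very close to the pole at most once, which is why only the lower bound is probabilistic.
`rotSum_log_norm_pi_bounds` extends this to the maximum of several analytic functions, hence to
`u_n` with `W = n`.

The second ingredient is almost invariance: unless a determinant is unusually small, `u_n (x + kω)`
and `u_n x` differ by `O(k)`. Averaging over `εn` shifts and using the first ingredient shows that
`u_n` is within `O(εn)` of its mean off a set of exponentially small measure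
(`exists_concentration`).

The third is the avalanche principle. On good blocks of length `l` the gap gives `u_{ml} ≈ ∑ u_{2l}
- ∑ u_l` with exponentially small error. Integrating the case `m = 4` gives a recursion for the
means along dyadic scales, and hence their rate of convergence to `L^a`. Averaging the expansion
over `l` consecutive starting points turns the block sums into full Birkhoff sums of `u_{2l}` and
`u_l`. By the first ingredient these deviate by `O(l²)` off a set of measure `e^{-cl}`, and division
by `l` leaves a deviation `O(l)` of `u_n` for every `l` between a multiple of `(log n)^(α+2)` and
`n/3` (`exists_large_deviation`).

Taking `l` proportional to `δn` makes the exponent linear in `δ`. Smaller `δn` makes the claimed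
bound exceed one, and very large `δn` is controlled by the determinant alone. The constant `c₀` does
not see `p`, which enters only when `(log n)^(α+2)` is replaced by `(log n)^p`. -/

theorem sum_inv_le_of_separated (s : Finset ℕ) (y : ℕ → ℝ) {d : ℝ} (hd : 0 < d) (hd1 : d ≤ 1)
    (h1 : ∀ m ∈ s, d ≤ y m) (h2 : ∀ m ∈ s, y m ≤ 1)
    (hsep : ∀ m ∈ s, ∀ k ∈ s, m < k → d ≤ |y m - y k|) :
    ∑ m ∈ s, (y m)⁻¹ ≤ d⁻¹ * (1 + Real.log d⁻¹) := by
  set N := ⌊d⁻¹⌋₊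
  have hN : 1 ≤ N := Nat.le_floor (by simpa using (one_le_inv₀ hd).2 hd1)
  -- Separation puts at most one point in each cell of length `d`, so the sum is compared with `1/d`
  -- times a harmonic sum.
  have hinj : Set.InjOn (fun m => ⌊y m / d⌋₊) s := by
    have key : ∀ m ∈ s, ∀ k ∈ s, m < k → ⌊y m / d⌋₊ ≠ ⌊y k / d⌋₊ := by
      intro m hm k hk hmk he
      have a1 := Nat.floor_le (div_nonneg (hd.le.trans (h1 m hm)) hd.le)
      have a2 := Nat.lt_floor_add_one (y m / d)
      have a3 := Nat.floor_le (div_nonneg (hd.le.trans (h1 k hk)) hd.le)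
      have a4 := Nat.lt_floor_add_one (y k / d)
      rw [he] at a1 a2
      have : |y m / d - y k / d| < 1 := by rw [abs_lt]; constructor <;> linarith
      rw [← sub_div, abs_div, abs_of_pos hd, div_lt_one hd] at this
      exact absurd (hsep m hm k hk hmk) (not_le.2 this)
    intro m hm k hk he
    rcases lt_trichotomy m k with h | h | h
    · exact absurd he (key m hm k hk h)
    · exact h
    · exact absurd he.symm (key k hk m hm h)
  have hmap : ∀ m ∈ s, ⌊y m / d⌋₊ ∈ Finset.Icc 1 N := by
    intro m hm
    rw [Finset.mem_Icc]
    refine ⟨Nat.le_floor (by simpa using (one_le_div hd).2 (h1 m hm)), Nat.floor_mono ?_⟩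
    rw [div_eq_mul_inv]
    exact mul_le_of_le_one_left (by positivity) (h2 m hm)
  calc ∑ m ∈ s, (y m)⁻¹ ≤ ∑ m ∈ s, d⁻¹ * ((⌊y m / d⌋₊ : ℕ) : ℝ)⁻¹ := by
        refine Finset.sum_le_sum fun m hm => ?_
        rw [← mul_inv]
        have hp : 1 ≤ ⌊y m / d⌋₊ := (Finset.mem_Icc.1 (hmap m hm)).1
        have hp' : (0 : ℝ) < (⌊y m / d⌋₊ : ℕ) := by exact_mod_cast hp
        refine inv_anti₀ (by positivity) ?_
        have := Nat.floor_le (div_nonneg (hd.le.trans (h1 m hm)) hd.le)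
        rw [le_div_iff₀ hd] at this
        linarith
    _ = d⁻¹ * ∑ i ∈ s.image (fun m => ⌊y m / d⌋₊), ((i : ℕ) : ℝ)⁻¹ := by
        rw [Finset.sum_image hinj, Finset.mul_sum]
    _ ≤ d⁻¹ * ∑ i ∈ Finset.Icc 1 N, ((i : ℕ) : ℝ)⁻¹ := by
        gcongr
        rw [Finset.image_subset_iff]; exact hmap
    _ ≤ d⁻¹ * (1 + Real.log d⁻¹) := by
        gcongr
        have := harmonic_le_one_add_log N
        rw [harmonic_eq_sum_Icc] at this
        push_cast at this
        refine this.trans ?_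
        have : Real.log N ≤ Real.log d⁻¹ :=
          Real.log_le_log (by exact_mod_cast hN) (Nat.floor_le (by positivity))
        linarith

/-- A uniform form of the Diophantine condition. -/
def UniformDiophantine (α c ω : ℝ) : Prop :=
  ∀ M m : ℕ, 2 ≤ M → 1 ≤ m → m ≤ M →
    c / ((M : ℝ) * Real.log M ^ α) ≤ |(m : ℝ) * ω - round ((m : ℝ) * ω)|

theorem log_natCast_pos {M : ℕ} (hM : 2 ≤ M) : 0 < Real.log M :=
  Real.log_pos (by exact_mod_cast hM)

theorem log_two_le_log_natCast {M : ℕ} (hM : 2 ≤ M) : Real.log 2 ≤ Real.log M :=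
  Real.log_le_log (by norm_num) (by exact_mod_cast hM)

/-- The arithmetic condition says nothing at `n = 1`; there `ω ∈ (0, 1)` is used to see that `ω` is
not an integer. -/
theorem IsDiophantine.uniform {α ω : ℝ} (hα : 0 < α) (hω : ω ∈ Set.Ioo (0 : ℝ) 1)
    (h : IsDiophantine α ω) : ∃ c : ℝ, 0 < c ∧ UniformDiophantine α c ω := by
  obtain ⟨C, hC, h⟩ := h
  have hl2 : 0 < Real.log 2 := Real.log_pos (by norm_num)
  have h0 : 0 < |ω - round ω| := by
    rw [abs_pos, sub_ne_zero]
    intro he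
    have h1 : (0 : ℝ) < (round ω : ℤ) := he ▸ hω.1
    have h2 : ((round ω : ℤ) : ℝ) < 1 := he ▸ hω.2
    have h3 : 0 < round ω := by exact_mod_cast h1
    have h4 : round ω < 1 := by exact_mod_cast h2
    omega
  refine ⟨min C (|ω - round ω| * (2 * Real.log 2 ^ α)), by positivity, fun M m hM hm hmM => ?_⟩
  have hM0 : (0 : ℝ) < M := by positivity
  have hlM := log_natCast_pos hM
  rcases hm.eq_or_lt with rfl | hm2
  · simp only [Nat.cast_one, one_mul]
    rw [div_le_iff₀ (by positivity)]
    refine (min_le_right _ _).trans ?_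
    have : (2 : ℝ) ≤ M := by exact_mod_cast hM
    have := log_two_le_log_natCast hM
    gcongr
  · have hm2' : 2 ≤ m := hm2
    refine le_trans ?_ (h m hm2')
    have hm0 : (0 : ℝ) < m := by positivity
    have := log_natCast_pos hm2'
    have : (m : ℝ) ≤ M := by exact_mod_cast hmM
    gcongr
    exact min_le_left _ _

/-- The signed remainders of `mω`, `m ≤ M`, are separated by the smallest admissible distance,
because a difference of two of them is congruent to `(k - m) ω`. A separated set costs only one
logarithm more than its closest point. -/
theorem sum_inv_dist_le {α c ω : ℝ} (hα : 0 < α) (hc : 0 < c) (h : UniformDiophantine α c ω) :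
    ∃ K : ℝ, 0 < K ∧ ∀ M : ℕ, 2 ≤ M →
      ∑ m ∈ Finset.Icc 1 M, |(m : ℝ) * ω - round ((m : ℝ) * ω)|⁻¹
        ≤ K * (M * Real.log M ^ (α + 1)) := by
  have hl2 : 0 < Real.log 2 := Real.log_pos (by norm_num)
  set K₁ : ℝ := (1 + α) + (1 + |Real.log c|) / Real.log 2
  refine ⟨2 * K₁ / c, by positivity, fun M hM => ?_⟩
  have hM0 : (0 : ℝ) < M := by positivity
  have hlM := log_natCast_pos hM
  set d := c / ((M : ℝ) * Real.log M ^ α) with hd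
  have hd0 : 0 < d := by positivity
  set y : ℕ → ℝ := fun m => (m : ℝ) * ω - round ((m : ℝ) * ω) with hy
  have hy1 : ∀ m, |y m| ≤ 1 / 2 := fun m => abs_sub_round _
  have hdy : ∀ m ∈ Finset.Icc 1 M, d ≤ |y m| := fun m hm =>
    h M m hM (Finset.mem_Icc.1 hm).1 (Finset.mem_Icc.1 hm).2
  have hd1 : d ≤ 1 := (hdy 1 (by simp; omega)).trans ((hy1 1).trans (by norm_num))
  have hsep : ∀ m ∈ Finset.Icc 1 M, ∀ k ∈ Finset.Icc 1 M, m < k → d ≤ |y m - y k| := by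
    intro m hm k hk hmk
    rw [Finset.mem_Icc] at hm hk
    have h1 := h M (k - m) hM (by omega) (by omega)
    have h2 := round_le (((k - m : ℕ) : ℝ) * ω) (round ((k : ℝ) * ω) - round ((m : ℝ) * ω))
    refine h1.trans (h2.trans (le_of_eq ?_))
    rw [abs_sub_comm (y m), Nat.cast_sub hmk.le]
    simp only [hy]; push_cast; congr 1; ring
  have hlog : 1 + Real.log d⁻¹ ≤ K₁ * Real.log M := by
    have e : Real.log d⁻¹ = Real.log M + α * Real.log (Real.log M) - Real.log c := by
      rw [hd, inv_div, Real.log_div (by positivity) hc.ne', Real.log_mul hM0.ne' (by positivity),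
        Real.log_rpow hlM]
    have h1 : Real.log (Real.log M) ≤ Real.log M := Real.log_le_self hlM.le
    have h2 : (1 + |Real.log c|) ≤ (1 + |Real.log c|) / Real.log 2 * Real.log M := by
      rw [div_mul_eq_mul_div, le_div_iff₀ hl2]
      exact mul_le_mul_of_nonneg_left (log_two_le_log_natCast hM) (by positivity)
    have h3 := neg_le_abs (Real.log c)
    have h4 := mul_le_mul_of_nonneg_left h1 hα.le
    rw [e]
    simp only [K₁, add_mul]
    linarith
  have main : ∀ s ⊆ Finset.Icc 1 M, (∀ m ∈ s, ∀ k ∈ s, m < k → d ≤ |(|y m| - |y k|)|) →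
      ∑ m ∈ s, |y m|⁻¹ ≤ d⁻¹ * (K₁ * Real.log M) := by
    intro s hs h'
    refine (sum_inv_le_of_separated s (fun m => |y m|) hd0 hd1 (fun m hm => hdy m (hs hm))
      (fun m _ => (hy1 m).trans (by norm_num)) h').trans ?_
    gcongr
  -- Remainders of opposite sign may have equal absolute values, so the two signs are summed
  -- separately.
  have e1 := main ((Finset.Icc 1 M).filter fun m => 0 ≤ y m) (Finset.filter_subset _ _) (by
    intro m hm k hk hmk
    rw [Finset.mem_filter] at hm hk
    rw [abs_of_nonneg hm.2, abs_of_nonneg hk.2]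
    exact hsep m hm.1 k hk.1 hmk)
  have e2 := main ((Finset.Icc 1 M).filter fun m => ¬ 0 ≤ y m) (Finset.filter_subset _ _) (by
    intro m hm k hk hmk
    rw [Finset.mem_filter, not_le] at hm hk
    rw [abs_of_neg hm.2, abs_of_neg hk.2, ← abs_neg]
    convert hsep m hm.1 k hk.1 hmk using 2
    ring)
  have e3 := Finset.sum_filter_add_sum_filter_not (Finset.Icc 1 M) (fun m => 0 ≤ y m)
    (fun m => |y m|⁻¹)
  have e4 : d⁻¹ * (K₁ * Real.log M) = K₁ / c * (M * Real.log M ^ (α + 1)) := by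
    rw [hd, inv_div, Real.rpow_add_one hlM.ne']; ring
  calc _ = ∑ m ∈ Finset.Icc 1 M, |y m|⁻¹ := rfl
    _ ≤ _ := by rw [← e3]; rw [e4] at e1 e2; linear_combination e1 + e2

/-- On a dyadic block the weight `1/m` cancels the factor `M` of the unweighted bound. Each of the
`J` blocks then costs a power `α + 1`, and their number adds one more. -/
theorem sum_inv_mul_dist_two_pow_le {α c ω : ℝ} (hα : 0 < α) (hc : 0 < c)
    (h : UniformDiophantine α c ω) :
    ∃ K : ℝ, 0 < K ∧ ∀ J : ℕ,
      ∑ m ∈ Finset.Icc (1 : ℕ) (2 ^ J), ((m : ℝ) * |(m : ℝ) * ω - round ((m : ℝ) * ω)|)⁻¹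
        ≤ K * ((J : ℝ) + 1) ^ (α + 2) := by
  obtain ⟨K, hK, hs⟩ := sum_inv_dist_le hα hc h
  set y : ℕ → ℝ := fun m => |(m : ℝ) * ω - round ((m : ℝ) * ω)| with hy
  have hy0 : ∀ m, 0 ≤ y m := fun m => abs_nonneg _
  refine ⟨2 * K + (y 1)⁻¹, by have := hy0 1; positivity, fun J => ?_⟩
  have key : ∑ m ∈ Finset.Icc (1 : ℕ) (2 ^ J), ((m : ℝ) * y m)⁻¹
      ≤ (y 1)⁻¹ + 2 * K * ∑ j ∈ Finset.range J, ((J : ℝ) + 1) ^ (α + 1) := by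
    suffices ∀ I ≤ J, ∑ m ∈ Finset.Icc (1 : ℕ) (2 ^ I), ((m : ℝ) * y m)⁻¹
        ≤ (y 1)⁻¹ + 2 * K * ∑ j ∈ Finset.range I, ((J : ℝ) + 1) ^ (α + 1) from this J le_rfl
    intro I
    induction I with
    | zero => intro _; simp
    | succ I ih =>
      intro hI
      have h2I : (2 : ℕ) ^ I ≤ 2 ^ (I + 1) := Nat.pow_le_pow_right (by norm_num) (by omega)
      have e : Finset.Icc 1 (2 ^ (I + 1)) = Finset.Icc 1 (2 ^ I) ∪ Finset.Ioc (2 ^ I) (2 ^ (I + 1)) := by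
        ext m; simp only [Finset.mem_union, Finset.mem_Icc, Finset.mem_Ioc]; omega
      have hdj : Disjoint (Finset.Icc 1 (2 ^ I)) (Finset.Ioc (2 ^ I) (2 ^ (I + 1))) := by
        rw [Finset.disjoint_left]; intro m; simp only [Finset.mem_Icc, Finset.mem_Ioc]; omega
      rw [e, Finset.sum_union hdj, Finset.sum_range_succ, mul_add, ← add_assoc]
      refine add_le_add (ih (by omega)) ?_
      have hM : 2 ≤ 2 ^ (I + 1) := by
        calc 2 = 2 ^ 1 := rfl
          _ ≤ _ := Nat.pow_le_pow_right (by norm_num) (by omega)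
      calc ∑ m ∈ Finset.Ioc ((2 : ℕ) ^ I) (2 ^ (I + 1)), ((m : ℝ) * y m)⁻¹
          ≤ ∑ m ∈ Finset.Ioc ((2 : ℕ) ^ I) (2 ^ (I + 1)), ((2 : ℝ) ^ I)⁻¹ * (y m)⁻¹ := by
            refine Finset.sum_le_sum fun m hm => ?_
            rw [mul_inv]
            have h1 : (2 : ℝ) ^ I ≤ m := by exact_mod_cast (Finset.mem_Ioc.1 hm).1.le
            have := hy0 m
            gcongr
        _ ≤ ((2 : ℝ) ^ I)⁻¹ * ∑ m ∈ Finset.Icc 1 (2 ^ (I + 1)), (y m)⁻¹ := by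
            rw [← Finset.mul_sum]
            refine mul_le_mul_of_nonneg_left ?_ (by positivity)
            refine Finset.sum_le_sum_of_subset_of_nonneg ?_ fun m _ _ => inv_nonneg.2 (hy0 m)
            intro m; simp only [Finset.mem_Icc, Finset.mem_Ioc]; omega
        _ ≤ ((2 : ℝ) ^ I)⁻¹ * (K * ((2 ^ (I + 1) : ℕ) * Real.log (2 ^ (I + 1) : ℕ) ^ (α + 1))) := by
            gcongr; exact hs _ hM
        _ = 2 * K * Real.log (2 ^ (I + 1) : ℕ) ^ (α + 1) := by
            push_cast; rw [pow_succ]; field_simp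
        _ ≤ 2 * K * ((J : ℝ) + 1) ^ (α + 1) := by
            have := log_natCast_pos hM
            gcongr
            push_cast
            rw [Real.log_pow]
            have h1 : Real.log 2 ≤ 1 := by linarith [Real.log_two_lt_d9]
            have h2 : ((I + 1 : ℕ) : ℝ) ≤ J := by exact_mod_cast hI
            nlinarith [Real.log_two_gt_d9]
  refine key.trans ?_
  rw [Finset.sum_const, Finset.card_range, nsmul_eq_mul]
  have hJ : (0 : ℝ) ≤ J := Nat.cast_nonneg J
  have h1 : (1 : ℝ) ≤ ((J : ℝ) + 1) ^ (α + 2) := Real.one_le_rpow (by linarith) (by linarith)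
  have h2 : (J : ℝ) * ((J : ℝ) + 1) ^ (α + 1) ≤ ((J : ℝ) + 1) ^ (α + 2) := by
    rw [show α + 2 = (α + 1) + 1 by ring, Real.rpow_add_one (by positivity) (α + 1),
      mul_comm]
    exact mul_le_mul_of_nonneg_left (by linarith) (by positivity)
  have h3 := inv_nonneg.2 (hy0 1)
  nlinarith

theorem sum_inv_mul_dist_le {α c ω : ℝ} (hα : 0 < α) (hc : 0 < c)
    (h : UniformDiophantine α c ω) :
    ∃ K : ℝ, 0 < K ∧ ∀ n : ℕ, 2 ≤ n →
      ∑ m ∈ Finset.Icc (1 : ℕ) (n ^ 3), ((m : ℝ) * |(m : ℝ) * ω - round ((m : ℝ) * ω)|)⁻¹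
        ≤ K * Real.log n ^ (α + 2) := by
  obtain ⟨K, hK, hs⟩ := sum_inv_mul_dist_two_pow_le hα hc h
  have hl2 : 0 < Real.log 2 := Real.log_pos (by norm_num)
  refine ⟨K * (7 / Real.log 2) ^ (α + 2), by positivity, fun n hn => ?_⟩
  have hln := log_natCast_pos hn
  have hn1 := log_two_le_log_natCast hn
  set J := 3 * (Nat.log 2 n + 1)
  have hJ : n ^ 3 ≤ 2 ^ J := by
    rw [show J = (Nat.log 2 n + 1) * 3 from mul_comm _ _, pow_mul]
    exact Nat.pow_le_pow_left (Nat.lt_pow_succ_log_self (by norm_num) n).le 3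
  have hlog : (Nat.log 2 n : ℝ) * Real.log 2 ≤ Real.log n := by
    rw [← Real.log_pow]
    refine Real.log_le_log (by positivity) ?_
    exact_mod_cast Nat.pow_log_le_self 2 (by omega)
  calc _ ≤ ∑ m ∈ Finset.Icc (1 : ℕ) (2 ^ J), ((m : ℝ) * |(m : ℝ) * ω - round ((m : ℝ) * ω)|)⁻¹ := by
        refine Finset.sum_le_sum_of_subset_of_nonneg (Finset.Icc_subset_Icc_right hJ)
          fun m _ _ => by positivity
    _ ≤ K * ((J : ℝ) + 1) ^ (α + 2) := hs J
    _ ≤ K * (7 / Real.log 2 * Real.log n) ^ (α + 2) := by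
        gcongr
        rw [div_mul_eq_mul_div, le_div_iff₀ hl2]
        simp only [J]; push_cast; nlinarith
    _ = _ := by rw [Real.mul_rpow (by positivity) hln.le, mul_assoc]

/-! ### Weyl sums on the circle -/

theorem pt_add (x y : UnitAddCircle) : pt (x + y) = pt x * pt y := by
  simp [pt, AddCircle.toCircle_add]

theorem pt_coe (t : ℝ) : pt (t : UnitAddCircle) = Complex.exp (2 * Real.pi * t * Complex.I) := by
  simp [pt, AddCircle.toCircle_apply_mk, Circle.coe_exp]

@[simp] theorem norm_pt (x : UnitAddCircle) : ‖pt x‖ = 1 := Circle.norm_coe _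

theorem pt_ne_zero (x : UnitAddCircle) : pt x ≠ 0 := Circle.coe_ne_zero _

@[simp] theorem pt_zero : pt 0 = 1 := by simp [pt]

theorem pt_neg (x : UnitAddCircle) : pt (-x) = starRingEnd ℂ (pt x) := by
  rw [pt, AddCircle.toCircle_neg, Circle.coe_inv_eq_conj]; rfl

@[fun_prop] theorem continuous_pt : Continuous pt :=
  continuous_subtype_val.comp AddCircle.continuous_toCircle

theorem pt_injective : Function.Injective pt :=
  Subtype.val_injective.comp (AddCircle.injective_toCircle one_ne_zero)

theorem exists_eq_norm_mul_pt (z : ℂ) : ∃ θ : UnitAddCircle, z = ‖z‖ * pt θ := by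
  refine ⟨((z.arg / (2 * Real.pi) : ℝ) : UnitAddCircle), ?_⟩
  rw [pt_coe]
  conv_lhs => rw [← Complex.norm_mul_exp_arg_mul_I z]
  congr 3
  push_cast
  field_simp [Real.pi_ne_zero]

theorem four_mul_dist_le_norm_pt_sub_one (t : ℝ) :
    4 * |t - round t| ≤ ‖pt (t : UnitAddCircle) - 1‖ := by
  set s := t - round t with hs
  have h1 : pt (t : UnitAddCircle) = pt (s : UnitAddCircle) := by
    congr 1
    rw [hs, AddCircle.coe_sub]
    have : (((round t : ℤ) : ℝ) : UnitAddCircle) = 0 := by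
      rw [AddCircle.coe_eq_zero_iff]; exact ⟨round t, by simp⟩
    rw [this, sub_zero]
  have h2 : ‖pt (s : UnitAddCircle) - 1‖ = ‖2 * Real.sin (2 * Real.pi * s / 2)‖ := by
    rw [← Complex.norm_exp_I_mul_ofReal_sub_one, pt_coe]
    congr 3; push_cast; ring
  have h3 : |s| ≤ 1 / 2 := abs_sub_round t
  have h4 := Real.mul_abs_le_abs_sin (x := Real.pi * s) (by
    rw [abs_mul, abs_of_pos Real.pi_pos]; nlinarith [Real.pi_pos])
  rw [h1, h2, norm_mul, Real.norm_eq_abs, Real.norm_eq_abs, show 2 * Real.pi * s / 2 = Real.pi * s by ring]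
  rw [abs_mul, abs_of_pos Real.pi_pos] at h4
  have : 2 / Real.pi * (Real.pi * |s|) = 2 * |s| := by field_simp
  rw [this] at h4
  norm_num
  linarith

/-- The Birkhoff sum of `f` over `n` steps of the rotation by `ω`. -/
noncomputable def rotSum (ω : ℝ) (n : ℕ) (f : UnitAddCircle → ℝ) (x : UnitAddCircle) : ℝ :=
  ∑ k ∈ Finset.range n, f (x + ((k * ω : ℝ) : UnitAddCircle))

theorem norm_sum_pt_pow_le (ω : ℝ) (n m : ℕ) :
    ‖∑ k ∈ Finset.range n, pt ((k * ω : ℝ) : UnitAddCircle) ^ m‖ ≤ n := by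
  refine (norm_sum_le _ _).trans ?_
  simp

/-- The sum is geometric with ratio `u = e(mω)`, and `|u - 1|` is at least four times the distance
of `mω` to the integers. -/
theorem norm_sum_pt_pow_le_inv (ω : ℝ) (n m : ℕ) (h : 0 < |(m : ℝ) * ω - round ((m : ℝ) * ω)|) :
    ‖∑ k ∈ Finset.range n, pt ((k * ω : ℝ) : UnitAddCircle) ^ m‖
      ≤ |(m : ℝ) * ω - round ((m : ℝ) * ω)|⁻¹ := by
  set u := pt ((m * ω : ℝ) : UnitAddCircle)
  have h1 := four_mul_dist_le_norm_pt_sub_one ((m : ℝ) * ω)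
  have hu : u ≠ 1 := by
    intro hu
    change _ ≤ ‖u - 1‖ at h1
    rw [hu, sub_self, norm_zero] at h1; linarith
  have h2 : ∀ k : ℕ, pt ((k * ω : ℝ) : UnitAddCircle) ^ m = u ^ k := by
    intro k
    simp only [u, pt_coe, ← Complex.exp_nat_mul]
    congr 1; push_cast; ring
  simp_rw [h2]
  rw [geom_sum_eq hu, norm_div, div_le_iff₀ (norm_pos_iff.2 (sub_ne_zero.2 hu)), inv_mul_eq_div,
    le_div_iff₀ h]
  have h3 : ‖u ^ n - 1‖ ≤ 2 := by
    refine (norm_sub_le _ _).trans ?_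
    rw [norm_pow, norm_pt]; norm_num
  have : |(m : ℝ) * ω - round ((m : ℝ) * ω)| ≤ 1 / 2 := abs_sub_round _
  change _ ≤ ‖u - 1‖ at h1
  nlinarith [norm_nonneg (u ^ n - 1)]

/-! ### Birkhoff sums of a logarithmic singularity -/

/-- The logarithm `log |1 - r e(x)|`. -/
noncomputable def logFactor (r : ℝ) (x : UnitAddCircle) : ℝ := Real.log ‖1 - r * pt x‖

theorem hasSum_rotSum_logFactor {r : ℝ} (hr0 : 0 ≤ r) (hr : r < 1) (ω : ℝ) (n : ℕ)
    (x : UnitAddCircle) :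
    HasSum (fun m : ℕ => ((r * pt x) ^ m / m
      * ∑ k ∈ Finset.range n, pt ((k * ω : ℝ) : UnitAddCircle) ^ m).re)
      (-rotSum ω n (logFactor r) x) := by
  have key : ∀ y : UnitAddCircle, HasSum (fun m : ℕ => ((r * pt y) ^ m / m).re) (-logFactor r y) := by
    intro y
    have h1 : ‖(r : ℂ) * pt y‖ < 1 := by simpa [abs_of_nonneg hr0] using hr
    have := Complex.hasSum_re (Complex.hasSum_taylorSeries_neg_log h1)
    rwa [Complex.neg_re, Complex.log_re] at this
  rw [rotSum, ← Finset.sum_neg_distrib]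
  have := hasSum_sum (s := Finset.range n) fun k _ => key (x + ((k * ω : ℝ) : UnitAddCircle))
  convert this using 2 with m
  rw [← Complex.re_sum, Finset.mul_sum]
  congr 1
  refine Finset.sum_congr rfl fun k _ => ?_
  rw [pt_add]; ring

theorem one_sub_sq_inv_bounds {n : ℕ} (hn : 2 ≤ n) :
    (3 : ℝ) / 4 ≤ 1 - ((n : ℝ) ^ 2)⁻¹ ∧ 1 - ((n : ℝ) ^ 2)⁻¹ < 1 := by
  have h2 : (2 : ℝ) ≤ n := by exact_mod_cast hn
  have h3 : ((n : ℝ) ^ 2)⁻¹ ≤ (4 : ℝ)⁻¹ := inv_anti₀ (by norm_num) (by nlinarith)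
  have h4 : 0 < ((n : ℝ) ^ 2)⁻¹ := by positivity
  constructor <;> linarith

/-- In the power series of `log (1 - z)` the frequencies up to `n³` are paid for by the small
divisor sum. At distance `n⁻²` inside the circle the remaining ones contribute at most one. -/
theorem abs_rotSum_logFactor_le_of_le {α c ω : ℝ} (hα : 0 < α) (hc : 0 < c)
    (h : UniformDiophantine α c ω) :
    ∃ K : ℝ, 0 < K ∧ ∀ n : ℕ, 2 ≤ n → ∀ r : ℝ, 0 ≤ r → r ≤ 1 - ((n : ℝ) ^ 2)⁻¹ →
      ∀ x, |rotSum ω n (logFactor r) x| ≤ K * Real.log n ^ (α + 2) := by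
  obtain ⟨K, hK, hs⟩ := sum_inv_mul_dist_le hα hc h
  have hl2 : 0 < Real.log 2 := Real.log_pos (by norm_num)
  refine ⟨K + (Real.log 2 ^ (α + 2))⁻¹, by positivity, fun n hn r hr0 hr x => ?_⟩
  have hn0 : (0 : ℝ) < n := by positivity
  have hr1 : r < 1 := hr.trans_lt (one_sub_sq_inv_bounds hn).2
  set A : ℕ → ℂ := fun m => ∑ k ∈ Finset.range n, pt ((k * ω : ℝ) : UnitAddCircle) ^ m
  have hsum := hasSum_rotSum_logFactor hr0 hr1 ω n x
  set F : ℕ → ℝ := fun m => ((r * pt x) ^ m / m * A m).re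
  have hF : ∀ m, |F m| ≤ r ^ m / m * ‖A m‖ := by
    intro m
    refine (Complex.abs_re_le_norm _).trans (le_of_eq ?_)
    simp [abs_of_nonneg hr0]
  have hF1 : ∀ m ∈ Finset.Icc (1 : ℕ) (n ^ 3),
      |F m| ≤ ((m : ℝ) * |(m : ℝ) * ω - round ((m : ℝ) * ω)|)⁻¹ := by
    intro m hm
    rw [Finset.mem_Icc] at hm
    have hm0 : (0 : ℝ) < m := by exact_mod_cast hm.1
    have hpos : 0 < |(m : ℝ) * ω - round ((m : ℝ) * ω)| := by
      refine lt_of_lt_of_le ?_ (h (m + 1) m (by omega) hm.1 (by omega))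
      have := log_natCast_pos (M := m + 1) (by omega)
      positivity
    refine (hF m).trans ?_
    rw [mul_inv, div_eq_mul_inv]
    have h1 : r ^ m ≤ 1 := pow_le_one₀ hr0 hr1.le
    calc r ^ m * (m : ℝ)⁻¹ * ‖A m‖ ≤ 1 * (m : ℝ)⁻¹ * |(m : ℝ) * ω - round ((m : ℝ) * ω)|⁻¹ := by
          gcongr
          exact norm_sum_pt_pow_le_inv ω n m hpos
      _ = _ := by ring
  -- Beyond `n³` the factor `1/m` beats the trivial bound `n` for the Weyl sum by `n⁻²`, which
  -- offsets the geometric sum `1/(1 - r) ≤ n²`.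
  have hF2 : ∀ i : ℕ, |F (i + (n ^ 3 + 1))| ≤ ((n : ℝ) ^ 2)⁻¹ * r ^ i := by
    intro i
    refine (hF _).trans ?_
    have h1 : r ^ (i + (n ^ 3 + 1)) ≤ r ^ i := pow_le_pow_of_le_one hr0 hr1.le (by omega)
    have h2 : ‖A (i + (n ^ 3 + 1))‖ ≤ n := norm_sum_pt_pow_le ω n _
    have h3 : (n : ℝ) ^ 3 ≤ ((i + (n ^ 3 + 1) : ℕ) : ℝ) := by push_cast; linarith [(Nat.cast_nonneg i : (0:ℝ) ≤ i)]
    calc r ^ (i + (n ^ 3 + 1)) / ((i + (n ^ 3 + 1) : ℕ) : ℝ) * ‖A (i + (n ^ 3 + 1))‖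
        ≤ r ^ i / (n : ℝ) ^ 3 * n := by gcongr
      _ = _ := by field_simp
  have hgeo := (hasSum_geometric_of_lt_one hr0 hr1).mul_left ((n : ℝ) ^ 2)⁻¹
  have htail : |∑' i, F (i + (n ^ 3 + 1))| ≤ 1 := by
    refine (tsum_of_norm_bounded (f := fun i => F (i + (n ^ 3 + 1))) hgeo hF2).trans ?_
    rw [← mul_inv]
    refine inv_le_one_of_one_le₀ ?_
    have : ((n : ℝ) ^ 2)⁻¹ ≤ 1 - r := by linarith
    calc (1 : ℝ) = (n : ℝ) ^ 2 * ((n : ℝ) ^ 2)⁻¹ := by field_simp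
      _ ≤ _ := by gcongr
  have hsplit := hsum.summable.sum_add_tsum_nat_add (n ^ 3 + 1)
  rw [hsum.tsum_eq] at hsplit
  have hF0 : F 0 = 0 := by simp [F]
  have hhead : |∑ m ∈ Finset.range (n ^ 3 + 1), F m| ≤ K * Real.log n ^ (α + 2) := by
    rw [Finset.sum_range_succ', hF0, add_zero]
    have : ∑ m ∈ Finset.range (n ^ 3), F (m + 1) = ∑ m ∈ Finset.Icc (1 : ℕ) (n ^ 3), F m := by
      rw [Finset.range_eq_Ico, Finset.sum_Ico_add' F 0 (n ^ 3) 1]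
      refine Finset.sum_congr ?_ fun _ _ => rfl
      ext m; simp only [Finset.mem_Ico, Finset.mem_Icc]; omega
    rw [this]
    exact (Finset.abs_sum_le_sum_abs _ _).trans ((Finset.sum_le_sum hF1).trans (hs n hn))
  have hone : 1 ≤ (Real.log 2 ^ (α + 2))⁻¹ * Real.log n ^ (α + 2) := by
    rw [inv_mul_eq_div, one_le_div (by positivity)]
    exact Real.rpow_le_rpow hl2.le (log_two_le_log_natCast hn) (by linarith)
  rw [← abs_neg, ← hsplit, add_mul]
  exact (abs_add_le _ _).trans (add_le_add hhead (htail.trans hone))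

theorem norm_one_sub_mul_pt_sq (r : ℝ) (x : UnitAddCircle) :
    ‖1 - r * pt x‖ ^ 2 = (1 - r) ^ 2 + r * ‖pt x - 1‖ ^ 2 := by
  have h : ‖pt x‖ ^ 2 = 1 := by rw [norm_pt]; norm_num
  rw [← Complex.normSq_eq_norm_sq, Complex.normSq_apply] at h ⊢
  rw [← Complex.normSq_eq_norm_sq, Complex.normSq_apply]
  simp only [Complex.sub_re, Complex.one_re, Complex.re_ofReal_mul, Complex.sub_im, Complex.one_im,
    Complex.im_ofReal_mul]
  linear_combination (r ^ 2 - r) * h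

theorem norm_pt_sub_one_le_two (x : UnitAddCircle) : ‖pt x - 1‖ ≤ 2 := by
  refine (norm_sub_le _ _).trans ?_
  rw [norm_pt]; norm_num

/-- By `|1 - r e|² = (1 - r)² + r |e - 1|²`, moving the radius out from `s` increases the modulus by
at most the factor `s^(-1/2)`. Hence the bound at radius `1 - n⁻²` also serves radii up to one from
above. -/
theorem logFactor_le_of_le {s r : ℝ} (hs0 : 0 < s) (hsr : s ≤ r) (hr : r ≤ 1)
    {x : UnitAddCircle} (hx : (r : ℂ) * pt x ≠ 1) :
    logFactor r x ≤ logFactor s x + Real.log s⁻¹ / 2 := by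
  have h1 : 0 < ‖1 - r * pt x‖ := norm_pos_iff.2 (sub_ne_zero.2 hx.symm)
  have hs1 : s ≤ 1 := hsr.trans hr
  have h2 : ‖1 - r * pt x‖ ^ 2 ≤ s⁻¹ * ‖1 - s * pt x‖ ^ 2 := by
    rw [norm_one_sub_mul_pt_sq, norm_one_sub_mul_pt_sq, mul_add, ← mul_assoc, inv_mul_cancel₀ hs0.ne', one_mul]
    have : (1 - s) ^ 2 ≤ s⁻¹ * (1 - s) ^ 2 :=
      le_mul_of_one_le_left (sq_nonneg _) ((one_le_inv₀ hs0).2 hs1)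
    nlinarith [sq_nonneg ‖pt x - 1‖]
  have h3 : 0 < ‖1 - s * pt x‖ := by
    by_contra h
    have : ‖1 - s * pt x‖ = 0 := le_antisymm (not_lt.1 h) (norm_nonneg _)
    rw [this] at h2
    nlinarith [sq_pos_of_pos h1]
  have h4 := Real.log_le_log (by positivity) h2
  rw [Real.log_mul (by positivity) (by positivity), Real.log_pow, Real.log_pow] at h4
  push_cast at h4
  simp only [logFactor]
  linarith

/-- The converse comparison has a loss which blows up only when `e(x)` is within about `1 - s` of
the singularity. -/
theorem logFactor_ge_of_le {s r : ℝ} (hs0 : 0 < s) (hsr : s ≤ r)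
    {x : UnitAddCircle} (hx : pt x ≠ 1) :
    logFactor s x - Real.log (1 + (1 - s) ^ 2 / (s * ‖pt x - 1‖ ^ 2)) / 2 ≤ logFactor r x := by
  have ht : 0 < ‖pt x - 1‖ := norm_pos_iff.2 (sub_ne_zero.2 hx)
  have h0 : s * ‖pt x - 1‖ ^ 2 ≤ ‖1 - r * pt x‖ ^ 2 := by
    rw [norm_one_sub_mul_pt_sq]
    nlinarith [sq_nonneg (1 - r), sq_nonneg ‖pt x - 1‖]
  have hp : 0 < s * ‖pt x - 1‖ ^ 2 := by positivity
  have h2 : ‖1 - s * pt x‖ ^ 2 ≤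
      ‖1 - r * pt x‖ ^ 2 * (1 + (1 - s) ^ 2 / (s * ‖pt x - 1‖ ^ 2)) := by
    rw [norm_one_sub_mul_pt_sq s]
    have : (1 - s) ^ 2 ≤ ‖1 - r * pt x‖ ^ 2 * ((1 - s) ^ 2 / (s * ‖pt x - 1‖ ^ 2)) := by
      rw [mul_div_assoc', le_div_iff₀ hp, mul_comm]
      gcongr
    linarith
  have h3 : 0 < ‖1 - s * pt x‖ ^ 2 := by
    rw [norm_one_sub_mul_pt_sq s]; positivity
  have h4 := Real.log_le_log h3 h2
  have h5 : (0 : ℝ) < ‖1 - r * pt x‖ := by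
    by_contra h
    have : ‖1 - r * pt x‖ = 0 := le_antisymm (not_lt.1 h) (norm_nonneg _)
    rw [this] at h0; linarith
  rw [Real.log_mul (by positivity) (by positivity), Real.log_pow, Real.log_pow] at h4
  push_cast at h4
  simp only [logFactor]
  linarith

theorem log_natCast_rpow_le {β : ℝ} (hβ : 0 < β) (n : ℕ) :
    Real.log n ^ β ≤ β ^ β * n := by
  rcases Nat.eq_zero_or_pos n with rfl | hn
  · simp [hβ.ne']
  have h0 : 0 ≤ Real.log n := Real.log_natCast_nonneg n
  have h1 := Real.log_le_rpow_div (x := n) (Nat.cast_nonneg n) (ε := β⁻¹) (by positivity)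
  calc Real.log n ^ β ≤ ((n : ℝ) ^ β⁻¹ / β⁻¹) ^ β := by gcongr
    _ = β ^ β * n := by
      rw [div_inv_eq_mul, Real.mul_rpow (by positivity) hβ.le, ← Real.rpow_mul (by positivity),
        inv_mul_cancel₀ hβ.ne', Real.rpow_one, mul_comm]

/-- Two points of an orbit of length `n` cannot both be very close to `1`, by the Diophantine
condition. All but one of the losses are therefore `O(1/n)`, and the exceptional one is bounded by
the logarithm of its distance. -/
theorem sum_log_correction_le {α c ω : ℝ} (hα : 0 < α) (hc : 0 < c)
    (h : UniformDiophantine α c ω) :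
    ∃ K : ℝ, 0 < K ∧ ∀ n : ℕ, 2 ≤ n → ∀ s : ℝ, s = 1 - ((n : ℝ) ^ 2)⁻¹ → ∀ x : UnitAddCircle,
      (∀ k < n, pt (x + ((k * ω : ℝ) : UnitAddCircle)) ≠ 1) →
      ∃ k < n, ∑ j ∈ Finset.range n, Real.log (1 + (1 - s) ^ 2 /
          (s * ‖pt (x + ((j * ω : ℝ) : UnitAddCircle)) - 1‖ ^ 2)) / 2
        ≤ K + Real.log (4 / ‖pt (x + ((k * ω : ℝ) : UnitAddCircle)) - 1‖) := by
  refine ⟨(2 * α) ^ (2 * α) / (4 * c ^ 2), by positivity, fun n hn s hs x hx => ?_⟩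
  have hn0 : (0 : ℝ) < n := by positivity
  have hln := log_natCast_pos hn
  have hsb : 3 / 4 ≤ s ∧ s < 1 := hs ▸ one_sub_sq_inv_bounds hn
  have hs0 : 0 < s := by linarith
  set t : ℕ → ℝ := fun j => ‖pt (x + ((j * ω : ℝ) : UnitAddCircle)) - 1‖ with ht
  set H : ℕ → ℝ := fun j => Real.log (1 + (1 - s) ^ 2 / (s * t j ^ 2)) / 2 with hH
  change ∃ k < n, ∑ j ∈ Finset.range n, H j ≤ _ + Real.log (4 / t k)
  have ht0 : ∀ j < n, 0 < t j := fun j hj => norm_pos_iff.2 (sub_ne_zero.2 (hx j hj))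
  have ht2 : ∀ j, t j ≤ 2 := fun j => norm_pt_sub_one_le_two _
  -- Two points within `d` of `1` would be less than `2d` apart, whereas the Diophantine condition
  -- keeps them at least four times `c / (n (log n)^α)`, that is `2d`, apart.
  set d := 2 * (c / ((n : ℝ) * Real.log n ^ α)) with hd
  have hd0 : 0 < d := by positivity
  have hsmall : ∀ j < n, d ≤ t j → H j ≤ (2 * α) ^ (2 * α) / (4 * c ^ 2) / n := by
    intro j hj hdj
    have hp : 0 ≤ (1 - s) ^ 2 / (s * t j ^ 2) := by positivity
    have h1 : H j ≤ (1 - s) ^ 2 / (s * t j ^ 2) / 2 := by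
      simp only [hH]
      have := Real.log_le_sub_one_of_pos (x := 1 + (1 - s) ^ 2 / (s * t j ^ 2)) (by linarith)
      linarith
    have h2 : (1 - s) ^ 2 / (s * t j ^ 2) ≤ (1 - s) ^ 2 / (1 / 2 * d ^ 2) := by
      gcongr; linarith
    have h3 : (1 - s) ^ 2 / (1 / 2 * d ^ 2) / 2 = Real.log n ^ (2 * α) / (4 * c ^ 2) / (n : ℝ) ^ 2 := by
      rw [hs, hd, mul_comm 2 α, Real.rpow_mul hln.le, Real.rpow_two]
      field_simp
      ring
    have h4 := log_natCast_rpow_le (β := 2 * α) (by positivity) n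
    calc H j ≤ (1 - s) ^ 2 / (1 / 2 * d ^ 2) / 2 := by linarith
      _ = Real.log n ^ (2 * α) / (4 * c ^ 2) / (n : ℝ) ^ 2 := h3
      _ ≤ ((2 * α) ^ (2 * α) * n) / (4 * c ^ 2) / (n : ℝ) ^ 2 := by gcongr
      _ = _ := by field_simp
  have hall : ∀ S ⊆ Finset.range n, (∀ j ∈ S, d ≤ t j) →
      ∑ j ∈ S, H j ≤ (2 * α) ^ (2 * α) / (4 * c ^ 2) := by
    intro S hS hSd
    calc ∑ j ∈ S, H j ≤ ∑ j ∈ S, (2 * α) ^ (2 * α) / (4 * c ^ 2) / n :=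
          Finset.sum_le_sum fun j hj => hsmall j (Finset.mem_range.1 (hS hj)) (hSd j hj)
      _ ≤ ∑ j ∈ Finset.range n, (2 * α) ^ (2 * α) / (4 * c ^ 2) / n :=
          Finset.sum_le_sum_of_subset_of_nonneg hS fun _ _ _ => by positivity
      _ = _ := by rw [Finset.sum_const, Finset.card_range, nsmul_eq_mul]; field_simp
  by_cases hex : ∃ k < n, t k < d
  · obtain ⟨k, hk, hkd⟩ := hex
    refine ⟨k, hk, ?_⟩
    rw [← Finset.sum_erase_add _ _ (Finset.mem_range.2 hk)]
    refine add_le_add (hall _ (Finset.erase_subset _ _) ?_) ?_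
    · intro j hj
      rw [Finset.mem_erase, Finset.mem_range] at hj
      by_contra hjd
      rw [not_le] at hjd
      have key : ∀ i j : ℕ, i < j → j < n → t i < d → t j < d → False := by
        intro i j hij hjn hi hj'
        have h1 := h n (j - i) hn (by omega) (by omega)
        have h2 := four_mul_dist_le_norm_pt_sub_one (((j - i : ℕ) : ℝ) * ω)
        have h3 : ‖pt (((((j - i : ℕ) : ℝ) * ω : ℝ)) : UnitAddCircle) - 1‖ ≤ t j + t i := by
          have e : pt (x + ((j * ω : ℝ) : UnitAddCircle)) = pt (x + ((i * ω : ℝ) : UnitAddCircle)) *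
              pt (((((j - i : ℕ) : ℝ) * ω : ℝ)) : UnitAddCircle) := by
            rw [← pt_add, add_assoc, ← AddCircle.coe_add]
            congr 3; rw [Nat.cast_sub hij.le]; ring
          calc _ = ‖pt (x + ((i * ω : ℝ) : UnitAddCircle)) *
                (pt (((((j - i : ℕ) : ℝ) * ω : ℝ)) : UnitAddCircle) - 1)‖ := by
                  rw [norm_mul, norm_pt, one_mul]
            _ = ‖(pt (x + ((j * ω : ℝ) : UnitAddCircle)) - 1)
                - (pt (x + ((i * ω : ℝ) : UnitAddCircle)) - 1)‖ := by rw [e]; congr 1; ring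
            _ ≤ _ := norm_sub_le _ _
        linarith
      rcases lt_or_gt_of_ne hj.1 with hlt | hlt
      · exact key j k hlt hk hjd hkd
      · exact key k j hlt hj.2 hkd hjd
    · have htk := ht0 k hk
      have h1 : 1 + (1 - s) ^ 2 / (s * t k ^ 2) ≤ (4 / t k) ^ 2 := by
        have h3 : (1 - s) ^ 2 ≤ s := by nlinarith
        have h4 : (1 - s) ^ 2 / (s * t k ^ 2) ≤ 1 / t k ^ 2 := by
          rw [div_le_div_iff₀ (by positivity) (by positivity)]; nlinarith [sq_nonneg (t k)]
        have h5 : 1 ≤ 4 / t k ^ 2 := by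
          rw [one_le_div (by positivity)]; nlinarith [ht2 k]
        have h6 : (4 / t k) ^ 2 = 4 * (4 / t k ^ 2) := by rw [div_pow]; ring
        have h7 : 1 / t k ^ 2 = 4 / t k ^ 2 / 4 := by ring
        rw [h6]; linarith
      have h2 := Real.log_le_log (by positivity) h1
      rw [Real.log_pow] at h2
      push_cast at h2
      simp only [hH]; linarith
  · push Not at hex
    refine ⟨0, by omega, ?_⟩
    have h1 := hall _ subset_rfl fun j hj => hex j (Finset.mem_range.1 hj)
    have h2 : 0 ≤ Real.log (4 / t 0) := by
      refine Real.log_nonneg ?_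
      rw [one_le_div (ht0 0 (by omega))]; linarith [ht2 0]
    linarith

theorem one_le_mul_log_rpow {β : ℝ} (hβ : 0 < β) {n : ℕ} (hn : 2 ≤ n) :
    1 ≤ (Real.log 2 ^ β)⁻¹ * Real.log n ^ β := by
  have hl2 : 0 < Real.log 2 := Real.log_pos (by norm_num)
  rw [inv_mul_eq_div, one_le_div (by positivity)]
  exact Real.rpow_le_rpow hl2.le (log_two_le_log_natCast hn) hβ.le

/-- Radii below `1 - n⁻²` are covered by the Fourier estimate and larger ones by comparison with
that radius. The nonvanishing hypotheses are needed because `Real.log 0 = 0`: at a singularity the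
summand is not `-∞`, and even the upper bound would require an argument. -/
theorem rotSum_logFactor_bounds {α c ω : ℝ} (hα : 0 < α) (hc : 0 < c)
    (h : UniformDiophantine α c ω) :
    ∃ K : ℝ, 0 < K ∧ ∀ n : ℕ, 2 ≤ n → ∀ r : ℝ, 0 ≤ r → r ≤ 1 → ∀ x : UnitAddCircle,
      ((∀ k < n, (r : ℂ) * pt (x + ((k * ω : ℝ) : UnitAddCircle)) ≠ 1) →
        rotSum ω n (logFactor r) x ≤ K * Real.log n ^ (α + 2)) ∧
      ((∀ k < n, pt (x + ((k * ω : ℝ) : UnitAddCircle)) ≠ 1) → ∃ k < n,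
        -(K * Real.log n ^ (α + 2)) - Real.log (4 / ‖pt (x + ((k * ω : ℝ) : UnitAddCircle)) - 1‖)
          ≤ rotSum ω n (logFactor r) x) := by
  obtain ⟨K₁, hK₁, h1⟩ := abs_rotSum_logFactor_le_of_le hα hc h
  obtain ⟨K₂, hK₂, h2⟩ := sum_log_correction_le hα hc h
  have hl2 : 0 < Real.log 2 := Real.log_pos (by norm_num)
  refine ⟨K₁ + (K₂ + 1) * (Real.log 2 ^ (α + 2))⁻¹, by positivity, fun n hn r hr0 hr1 x => ?_⟩
  have hone := one_le_mul_log_rpow (β := α + 2) (by positivity) hn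
  have hln := log_natCast_pos hn
  have hKK : K₁ * Real.log n ^ (α + 2) + (K₂ + 1) ≤
      (K₁ + (K₂ + 1) * (Real.log 2 ^ (α + 2))⁻¹) * Real.log n ^ (α + 2) := by
    nlinarith
  have hpos : 0 ≤ K₁ * Real.log n ^ (α + 2) := by positivity
  have hn0 : (0 : ℝ) < n := by positivity
  obtain ⟨hs1, hs2⟩ := one_sub_sq_inv_bounds hn
  set s := 1 - ((n : ℝ) ^ 2)⁻¹ with hs
  have hlog4 : ∀ k < n, (∀ k < n, pt (x + ((k * ω : ℝ) : UnitAddCircle)) ≠ 1) →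
      0 ≤ Real.log (4 / ‖pt (x + ((k * ω : ℝ) : UnitAddCircle)) - 1‖) := by
    intro k hk hx
    refine Real.log_nonneg ?_
    rw [one_le_div (norm_pos_iff.2 (sub_ne_zero.2 (hx k hk)))]
    linarith [norm_pt_sub_one_le_two (x + ((k * ω : ℝ) : UnitAddCircle))]
  rcases le_total r s with hrs | hrs
  · have h3 := abs_le.1 (h1 n hn r hr0 hrs x)
    refine ⟨fun _ => by linarith [h3.2], fun hx => ⟨0, by omega, ?_⟩⟩
    linarith [h3.1, hlog4 0 (by omega) hx]
  · have h3 := abs_le.1 (h1 n hn s (by linarith) le_rfl x)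
    refine ⟨fun hx => ?_, fun hx => ?_⟩
    · have h4 : rotSum ω n (logFactor r) x ≤ rotSum ω n (logFactor s) x + n * (Real.log s⁻¹ / 2) := by
        rw [rotSum, rotSum]
        calc _ ≤ ∑ k ∈ Finset.range n, (logFactor s (x + ((k * ω : ℝ) : UnitAddCircle)) + Real.log s⁻¹ / 2) :=
              Finset.sum_le_sum fun k hk =>
                logFactor_le_of_le (by linarith) hrs hr1 (hx k (Finset.mem_range.1 hk))
          _ = _ := by rw [Finset.sum_add_distrib, Finset.sum_const, Finset.card_range, nsmul_eq_mul]
      have h5 : Real.log s⁻¹ ≤ 2 / n := by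
        have hs0 : 0 < s := by linarith
        refine (Real.log_le_sub_one_of_pos (by positivity)).trans ?_
        have h6 : s⁻¹ - 1 = (1 - s) / s := by field_simp
        rw [h6, div_le_div_iff₀ hs0 hn0]
        have h7 : (1 - s) * n = 1 / n := by rw [hs]; field_simp; ring
        have h8 : (1 : ℝ) / n ≤ 1 := by
          rw [div_le_one hn0]; exact_mod_cast (by omega : 1 ≤ n)
        rw [h7]; linarith
      have h6 : n * (Real.log s⁻¹ / 2) ≤ 1 := by
        calc n * (Real.log s⁻¹ / 2) ≤ n * (2 / n / 2) := by gcongr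
          _ = 1 := by field_simp
      linarith [h3.2]
    · obtain ⟨k, hk, h4⟩ := h2 n hn s rfl x hx
      refine ⟨k, hk, ?_⟩
      have h5 : rotSum ω n (logFactor s) x - ∑ j ∈ Finset.range n, Real.log (1 + (1 - s) ^ 2 /
          (s * ‖pt (x + ((j * ω : ℝ) : UnitAddCircle)) - 1‖ ^ 2)) / 2
          ≤ rotSum ω n (logFactor r) x := by
        rw [rotSum, rotSum, ← Finset.sum_sub_distrib]
        exact Finset.sum_le_sum fun k hk =>
          logFactor_ge_of_le (by linarith) hrs (hx k (Finset.mem_range.1 hk))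
      linarith [h3.1]

/-! ### Logarithmic poles anywhere in the plane, and their superpositions -/

instance : NullSingletonClass (volume : Measure UnitAddCircle) where
  measure_singleton x := by
    rw [← Metric.closedBall_zero, AddCircle.volume_closedBall]; simp

instance : IsProbabilityMeasure (volume : Measure UnitAddCircle) := ⟨UnitAddCircle.measure_univ⟩

/-- The function `log |e(x) - ζ|` on the circle, normalized to have mean zero. -/
noncomputable def poleFun (ζ : ℂ) (x : UnitAddCircle) : ℝ :=
  Real.log ‖pt x - ζ‖ - Real.posLog ‖ζ‖

theorem norm_pt_sub_mul_pt (r : ℝ) (x θ : UnitAddCircle) :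
    ‖pt x - r * pt θ‖ = ‖1 - r * pt (x - θ)‖ := by
  have h1 : pt x = pt θ * pt (x - θ) := by rw [← pt_add]; congr 1; abel
  have h2 : pt (x - θ) * starRingEnd ℂ (pt (x - θ)) = 1 := by
    rw [Complex.mul_conj, Complex.normSq_eq_norm_sq, norm_pt]; norm_num
  calc ‖pt x - r * pt θ‖ = ‖pt θ * (pt (x - θ) * starRingEnd ℂ (1 - r * pt (x - θ)))‖ := by
        congr 1
        simp only [map_sub, map_one, map_mul, Complex.conj_ofReal]
        rw [h1]
        linear_combination (r * pt θ : ℂ) * h2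
    _ = _ := by
        simp only [norm_mul, norm_pt, one_mul, Complex.norm_conj]

/-- Reflection in the circle sends a pole `ζ` outside to radius `1/|ζ|`; the change of `log |e(x) -
ζ|` is exactly the mean that is subtracted. This makes all later bounds uniform in `ζ`. -/
theorem exists_poleFun_eq_logFactor (ζ : ℂ) : ∃ (θ : UnitAddCircle) (r : ℝ), 0 ≤ r ∧ r ≤ 1 ∧
    ∀ x, poleFun ζ x = logFactor r (x - θ) ∧ (pt x ≠ ζ → (r : ℂ) * pt (x - θ) ≠ 1) := by
  obtain ⟨θ, hθ⟩ := exists_eq_norm_mul_pt ζ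
  rcases le_or_gt ‖ζ‖ 1 with h | h
  · refine ⟨θ, ‖ζ‖, norm_nonneg _, h, fun x => ?_⟩
    have h1 : ‖pt x - ζ‖ = ‖1 - (‖ζ‖ : ℝ) * pt (x - θ)‖ := by
      conv_lhs => rw [hθ]
      exact norm_pt_sub_mul_pt _ _ _
    refine ⟨?_, fun hx h2 => hx ?_⟩
    · rw [poleFun, Real.posLog_eq_zero_iff _ |>.2 (by simpa using h), sub_zero, h1, logFactor]
    · rw [h2, sub_self, norm_zero, norm_eq_zero, sub_eq_zero] at h1
      exact h1
  · have h0 : 0 < ‖ζ‖ := by linarith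
    refine ⟨θ, ‖ζ‖⁻¹, by positivity, inv_le_one_of_one_le₀ h.le, fun x => ?_⟩
    have h1 : ‖pt x - ζ‖ = ‖ζ‖ * ‖1 - (‖ζ‖⁻¹ : ℝ) * pt (x - θ)‖ := by
      conv_lhs => rw [hθ]
      rw [norm_pt_sub_mul_pt]
      have h2 : ‖pt (x - θ) - ((‖ζ‖ : ℝ) : ℂ) * pt 0‖ = ‖1 - (‖ζ‖ : ℝ) * pt (x - θ)‖ := by
        rw [norm_pt_sub_mul_pt, sub_zero]
      rw [← h2, pt_zero, mul_one, norm_sub_rev]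
      conv_rhs => rw [← abs_of_pos h0, ← Real.norm_eq_abs, ← Complex.norm_real, ← norm_mul]
      congr 1
      have : (‖ζ‖ : ℂ) ≠ 0 := by exact_mod_cast h0.ne'
      push_cast
      simp only [Complex.norm_real, norm_norm]
      rw [mul_sub, mul_one, ← mul_assoc, mul_inv_cancel₀ this, one_mul]
    have h3 : (((‖ζ‖⁻¹ : ℝ)) : ℂ) * pt (x - θ) ≠ 1 := by
      intro h4
      have := congrArg norm h4
      rw [norm_mul, norm_pt, Complex.norm_real, norm_one, mul_one, norm_inv, norm_norm] at this
      rw [inv_eq_one] at this; linarith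
    refine ⟨?_, fun _ => h3⟩
    rw [poleFun, h1, Real.log_mul h0.ne' (norm_ne_zero_iff.2 (sub_ne_zero.2 h3.symm)),
      Real.posLog_eq_log (by rw [abs_of_pos h0]; exact h.le), logFactor]
    ring

theorem rotSum_comp_sub (ω : ℝ) (n : ℕ) (f : UnitAddCircle → ℝ) (x θ : UnitAddCircle) :
    rotSum ω n (fun y => f (y - θ)) x = rotSum ω n f (x - θ) := by
  refine Finset.sum_congr rfl fun k _ => ?_
  simp only [add_sub_right_comm]

theorem lintegral_dist_rpow_lt_top :
    ∫⁻ x : UnitAddCircle, ENNReal.ofReal ((4 / ‖pt x - 1‖) ^ (2⁻¹ : ℝ)) < ∞ := by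
  rw [← AddCircle.lintegral_preimage 1 0]
  have h1 : IntegrableOn (fun x : ℝ => x ^ (-2⁻¹ : ℝ) + (1 - x) ^ (-2⁻¹ : ℝ)) (Set.Ioc 0 (0 + 1)) := by
    have a1 : IntervalIntegrable (fun x : ℝ => x ^ (-2⁻¹ : ℝ)) volume 0 1 :=
      intervalIntegral.intervalIntegrable_rpow' (by norm_num)
    have a2 := (a1.comp_sub_left 1).symm
    simp only [sub_zero, sub_self] at a2
    have := a1.add a2
    rw [intervalIntegrable_iff_integrableOn_Ioc_of_le zero_le_one] at this
    simpa using this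
  refine lt_of_le_of_lt (setLIntegral_mono_ae' measurableSet_Ioc ?_) h1.lintegral_lt_top
  have h2 : ∀ᵐ x : ℝ, x ≠ 1 := by
    rw [ae_iff]; simp
  filter_upwards [h2] with x hx1 hx
  rw [zero_add] at hx
  have hx0 : 0 < x := hx.1
  have hx1 : x < 1 := lt_of_le_of_ne hx.2 hx1
  refine ENNReal.ofReal_le_ofReal ?_
  have hd := four_mul_dist_le_norm_pt_sub_one x
  rw [abs_sub_round_eq_min, Int.fract_eq_self.2 ⟨hx0.le, hx1⟩] at hd
  have key : ∀ y : ℝ, 0 < y → 4 * y ≤ ‖pt (x : UnitAddCircle) - 1‖ →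
      (4 / ‖pt (x : UnitAddCircle) - 1‖) ^ (2⁻¹ : ℝ) ≤ y ^ (-2⁻¹ : ℝ) := by
    intro y hy h
    rw [Real.rpow_neg hy.le, ← Real.inv_rpow hy.le]
    refine Real.rpow_le_rpow (by positivity) ?_ (by norm_num)
    rw [div_le_iff₀ (by linarith), inv_mul_eq_div, le_div_iff₀ hy]
    linarith
  have p1 : 0 ≤ x ^ (-2⁻¹ : ℝ) := by positivity
  have p2 : 0 ≤ (1 - x) ^ (-2⁻¹ : ℝ) := Real.rpow_nonneg (by linarith) _
  rcases min_cases x (1 - x) with ⟨h, _⟩ | ⟨h, _⟩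
  · rw [h] at hd
    linarith [key x hx0 hd]
  · rw [h] at hd
    linarith [key (1 - x) (by linarith) hd]

theorem ae_forall_pt_ne (ω : ℝ) (n : ℕ) (θ : UnitAddCircle) (ζ : ℂ) :
    ∀ᵐ x : UnitAddCircle, ∀ k < n, pt (x - θ + ((k * ω : ℝ) : UnitAddCircle)) ≠ ζ := by
  rw [ae_all_iff]; intro k
  by_cases h : ∃ y, pt y = ζ
  · obtain ⟨y, rfl⟩ := h
    have : ∀ᵐ x : UnitAddCircle, x ≠ y - ((k * ω : ℝ) : UnitAddCircle) + θ := by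
      rw [ae_iff]; simp
    filter_upwards [this] with x hx _ he
    apply hx
    rw [← pt_injective he]; abel
  · exact .of_forall fun x _ he => h ⟨_, he⟩

theorem log_natCast_le_mul_rpow {β : ℝ} (hβ : 1 ≤ β) {n : ℕ} (hn : 2 ≤ n) :
    Real.log n ≤ (Real.log 2 ^ (β - 1))⁻¹ * Real.log n ^ β := by
  have hl2 : 0 < Real.log 2 := Real.log_pos (by norm_num)
  have hln := log_natCast_pos hn
  rw [inv_mul_eq_div, le_div_iff₀ (by positivity)]
  calc Real.log n * Real.log 2 ^ (β - 1) ≤ Real.log n * Real.log n ^ (β - 1) := by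
        have := log_two_le_log_natCast hn
        have : 0 ≤ β - 1 := by linarith
        gcongr
    _ = Real.log n ^ β := by rw [mul_comm, ← Real.rpow_add_one hln.ne']; ring_nf

/-- The half in the exponent turns the logarithmic loss of the closest visit into `dist^(-1/2)`,
which is integrable. -/
theorem rotSum_poleFun_bounds {α c ω : ℝ} (hα : 0 < α) (hc : 0 < c)
    (h : UniformDiophantine α c ω) :
    ∃ K : ℝ, 0 < K ∧ ∀ n : ℕ, 2 ≤ n → ∀ ζ : ℂ,
      (∀ x : UnitAddCircle, (∀ k < n, pt (x + ((k * ω : ℝ) : UnitAddCircle)) ≠ ζ) →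
        rotSum ω n (poleFun ζ) x ≤ K * Real.log n ^ (α + 2)) ∧
      ∫⁻ x, ENNReal.ofReal (Real.exp (-(rotSum ω n (poleFun ζ) x / 2)))
        ≤ ENNReal.ofReal (Real.exp (K * Real.log n ^ (α + 2))) := by
  obtain ⟨K, hK, hb⟩ := rotSum_logFactor_bounds hα hc h
  have hI := lintegral_dist_rpow_lt_top
  set I := ∫⁻ x : UnitAddCircle, ENNReal.ofReal ((4 / ‖pt x - 1‖) ^ (2⁻¹ : ℝ)) with hIdef
  have hl2 : 0 < Real.log 2 := Real.log_pos (by norm_num)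
  refine ⟨K + (Real.log 2 ^ (α + 2 - 1))⁻¹ + I.toReal * (Real.log 2 ^ (α + 2))⁻¹, by positivity,
    fun n hn ζ => ?_⟩
  have hln := log_natCast_pos hn
  have hn0 : (0 : ℝ) < n := by positivity
  obtain ⟨θ, r, hr0, hr1, hζ⟩ := exists_poleFun_eq_logFactor ζ
  have hfun : poleFun ζ = fun y => logFactor r (y - θ) := funext fun y => (hζ y).1
  have hle : K * Real.log n ^ (α + 2) ≤ (K + (Real.log 2 ^ (α + 2 - 1))⁻¹ +
      I.toReal * (Real.log 2 ^ (α + 2))⁻¹) * Real.log n ^ (α + 2) := by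
    gcongr
    rw [add_assoc]
    exact le_add_of_nonneg_right (by positivity)
  refine ⟨fun x hx => ?_, ?_⟩
  · rw [hfun, rotSum_comp_sub]
    refine ((hb n hn r hr0 hr1 (x - θ)).1 fun k hk => ?_).trans hle
    have := (hζ _).2 (hx k hk)
    rwa [show x + ((k * ω : ℝ) : UnitAddCircle) - θ = x - θ + ((k * ω : ℝ) : UnitAddCircle) by abel]
      at this
  · have hmeas : ∀ k : ℕ, Measurable fun x : UnitAddCircle => ENNReal.ofReal
        ((4 / ‖pt (x - θ + ((k * ω : ℝ) : UnitAddCircle)) - 1‖) ^ (2⁻¹ : ℝ)) := by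
      intro k
      have h1 : Measurable fun x : UnitAddCircle => ‖pt (x - θ + ((k * ω : ℝ) : UnitAddCircle)) - 1‖ :=
        Continuous.measurable (by fun_prop)
      exact ((h1.const_div 4).pow_const _).ennreal_ofReal
    -- The index of the closest visit depends on `x`, so it is replaced by the sum over all `k < n`.
    -- The factor `n` gained after integration is absorbed since `log n` is at most a multiple of
    -- `(log n)^(α+2)`.
    have hpt : ∀ᵐ x : UnitAddCircle, ENNReal.ofReal (Real.exp (-(rotSum ω n (poleFun ζ) x / 2))) ≤
        ENNReal.ofReal (Real.exp (K * Real.log n ^ (α + 2))) * ∑ k ∈ Finset.range n, ENNReal.ofReal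
        ((4 / ‖pt (x - θ + ((k * ω : ℝ) : UnitAddCircle)) - 1‖) ^ (2⁻¹ : ℝ)) := by
      filter_upwards [ae_forall_pt_ne ω n θ 1] with x hx
      obtain ⟨k, hk, hk2⟩ := (hb n hn r hr0 hr1 (x - θ)).2 hx
      rw [hfun, rotSum_comp_sub]
      have ht : 0 < ‖pt (x - θ + ((k * ω : ℝ) : UnitAddCircle)) - 1‖ :=
        norm_pos_iff.2 (sub_ne_zero.2 (hx k hk))
      have h1 : Real.exp (-(rotSum ω n (logFactor r) (x - θ) / 2)) ≤
          Real.exp (K * Real.log n ^ (α + 2)) *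
            (4 / ‖pt (x - θ + ((k * ω : ℝ) : UnitAddCircle)) - 1‖) ^ (2⁻¹ : ℝ) := by
        rw [Real.rpow_def_of_pos (div_pos four_pos ht), ← Real.exp_add, Real.exp_le_exp]
        have : 0 ≤ K * Real.log n ^ (α + 2) := by positivity
        linarith
      refine (ENNReal.ofReal_le_ofReal h1).trans ?_
      rw [ENNReal.ofReal_mul (by positivity)]
      gcongr
      exact Finset.single_le_sum (f := fun k : ℕ => ENNReal.ofReal
        ((4 / ‖pt (x - θ + ((k * ω : ℝ) : UnitAddCircle)) - 1‖) ^ (2⁻¹ : ℝ)))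
        (fun _ _ => zero_le) (Finset.mem_range.2 hk)
    refine (lintegral_mono_ae hpt).trans ?_
    rw [lintegral_const_mul _ (Finset.measurable_sum _ fun k _ => hmeas k),
      lintegral_finsetSum _ fun k _ => hmeas k]
    have htr : ∀ k : ℕ, ∫⁻ x : UnitAddCircle, ENNReal.ofReal
        ((4 / ‖pt (x - θ + ((k * ω : ℝ) : UnitAddCircle)) - 1‖) ^ (2⁻¹ : ℝ)) = I := by
      intro k
      have := lintegral_add_right_eq_self (μ := (volume : Measure UnitAddCircle))
        (fun x => ENNReal.ofReal ((4 / ‖pt x - 1‖) ^ (2⁻¹ : ℝ))) (-θ + ((k * ω : ℝ) : UnitAddCircle))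
      rw [hIdef, ← this]
      simp only [sub_eq_add_neg, add_assoc]
    simp only [htr, Finset.sum_const, Finset.card_range, nsmul_eq_mul]
    rw [show I = ENNReal.ofReal I.toReal from (ENNReal.ofReal_toReal hI.ne).symm,
      ENNReal.toReal_ofReal ENNReal.toReal_nonneg, ← ENNReal.ofReal_natCast, ← ENNReal.ofReal_mul hn0.le,
      ← ENNReal.ofReal_mul (by positivity)]
    refine ENNReal.ofReal_le_ofReal ?_
    have e1 : (n : ℝ) ≤ Real.exp ((Real.log 2 ^ (α + 2 - 1))⁻¹ * Real.log n ^ (α + 2)) := by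
      rw [← Real.log_le_iff_le_exp hn0]
      exact log_natCast_le_mul_rpow (by linarith) hn
    have e2 : I.toReal ≤ Real.exp (I.toReal * (Real.log 2 ^ (α + 2))⁻¹ * Real.log n ^ (α + 2)) := by
      have h1 := one_le_mul_log_rpow (β := α + 2) (by positivity) hn
      have h2 : I.toReal ≤ I.toReal * (Real.log 2 ^ (α + 2))⁻¹ * Real.log n ^ (α + 2) := by
        rw [mul_assoc]; exact le_mul_of_one_le_right ENNReal.toReal_nonneg h1
      linarith [Real.add_one_le_exp (I.toReal * (Real.log 2 ^ (α + 2))⁻¹ * Real.log n ^ (α + 2))]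
    rw [add_mul, add_mul, Real.exp_add, Real.exp_add, mul_assoc]
    gcongr

/-- By convexity of the exponential, a weighted average of pole functions has no worse exponential
moment than a single one. The weights are `d u / N`, so the bound does not depend on the number or
position of the poles. -/
theorem lintegral_exp_sum_poleFun_le {ω : ℝ} {n : ℕ} {B : ℝ≥0∞} (hB1 : 1 ≤ B)
    (hB : ∀ ζ : ℂ, ∫⁻ x, ENNReal.ofReal (Real.exp (-(rotSum ω n (poleFun ζ) x / 2))) ≤ B)
    (s : Finset ℂ) (d : ℂ → ℕ) {N : ℝ} (hN : 0 < N) (hdN : (∑ u ∈ s, d u : ℕ) ≤ N) :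
    ∫⁻ x, ENNReal.ofReal (Real.exp (-(∑ u ∈ s, d u * rotSum ω n (poleFun u) x) / (2 * N))) ≤ B := by
  have hmeas : ∀ ζ, Measurable fun x : UnitAddCircle => ENNReal.ofReal
      (Real.exp (-(rotSum ω n (poleFun ζ) x / 2))) := by
    intro ζ
    have h1 : Measurable (poleFun ζ) := by
      have : Measurable fun x : UnitAddCircle => ‖pt x - ζ‖ := Continuous.measurable (by fun_prop)
      exact this.log.sub_const _
    have h2 : Measurable fun x => rotSum ω n (poleFun ζ) x :=
      Finset.measurable_sum _ fun k _ => h1.comp (measurable_id.add_const _)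
    exact ((h2.div_const 2).neg.exp).ennreal_ofReal
  set w : ℂ → ℝ := fun u => d u / N
  have hw0 : ∀ u, 0 ≤ w u := fun u => by positivity
  have hw1 : 0 ≤ 1 - ∑ u ∈ s, w u := by
    rw [← Finset.sum_div, sub_nonneg, div_le_one hN]
    push_cast at hdN
    exact hdN
  have hpt : ∀ x, ENNReal.ofReal (Real.exp (-(∑ u ∈ s, d u * rotSum ω n (poleFun u) x) / (2 * N))) ≤
      ENNReal.ofReal (1 - ∑ u ∈ s, w u) + ∑ u ∈ s, ENNReal.ofReal (w u) *
        ENNReal.ofReal (Real.exp (-(rotSum ω n (poleFun u) x / 2))) := by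
    intro x
    -- The total weight may be less than one; the missing mass is placed at the point `0`, where the
    -- exponential is one, which `B ≥ 1` covers.
    have h1 := convexOn_exp.map_add_sum_le (t := s) (w := w)
      (p := fun u => -(rotSum ω n (poleFun u) x / 2)) (v := 1 - ∑ u ∈ s, w u) (q := 0)
      (fun u _ => hw0 u) (by ring) (fun _ _ => Set.mem_univ _) hw1 (Set.mem_univ _)
    simp only [smul_eq_mul, mul_zero, zero_add, Real.exp_zero, mul_one] at h1
    have h2 : ∑ u ∈ s, w u * -(rotSum ω n (poleFun u) x / 2) =
        -(∑ u ∈ s, d u * rotSum ω n (poleFun u) x) / (2 * N) := by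
      rw [← Finset.sum_neg_distrib, Finset.sum_div]
      refine Finset.sum_congr rfl fun u _ => ?_
      simp only [w]; field_simp
    rw [h2] at h1
    refine (ENNReal.ofReal_le_ofReal h1).trans ?_
    rw [ENNReal.ofReal_add hw1 (Finset.sum_nonneg fun u _ => mul_nonneg (hw0 u) (Real.exp_pos _).le),
      ENNReal.ofReal_sum_of_nonneg fun u _ => mul_nonneg (hw0 u) (Real.exp_pos _).le]
    gcongr with u hu
    rw [ENNReal.ofReal_mul (hw0 u)]
  calc _ ≤ _ := lintegral_mono hpt
    _ = ENNReal.ofReal (1 - ∑ u ∈ s, w u) + ∑ u ∈ s, ENNReal.ofReal (w u) *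
        ∫⁻ x, ENNReal.ofReal (Real.exp (-(rotSum ω n (poleFun u) x / 2))) := by
      rw [lintegral_add_left measurable_const, lintegral_const, measure_univ, mul_one,
        lintegral_finsetSum _ fun u _ => (hmeas u).const_mul _]
      congr 1
      exact Finset.sum_congr rfl fun u _ => lintegral_const_mul _ (hmeas u)
    _ ≤ ENNReal.ofReal (1 - ∑ u ∈ s, w u) * B + ∑ u ∈ s, ENNReal.ofReal (w u) * B := by
      gcongr with u hu
      · exact le_mul_of_one_le_right' hB1
      · exact hB u
    _ = B := by
      rw [← Finset.sum_mul, ← add_mul, ← ENNReal.ofReal_sum_of_nonneg fun u _ => hw0 u,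
        ← ENNReal.ofReal_add hw1 (Finset.sum_nonneg fun u _ => hw0 u)]
      simp

/-! ### Analytic functions without zeros on an annulus -/

/-- The closed annulus `e^{-s} ≤ |z| ≤ e^s`. -/
def closedAnnulus (s : ℝ) : Set ℂ := {z | Real.exp (-s) ≤ ‖z‖ ∧ ‖z‖ ≤ Real.exp s}

/-- The point of the circle of radius `e^t` with argument `2πx`. -/
noncomputable def circ (t : ℝ) (x : UnitAddCircle) : ℂ := (Real.exp t : ℝ) * pt x

@[simp] theorem norm_circ (t : ℝ) (x : UnitAddCircle) : ‖circ t x‖ = Real.exp t := by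
  rw [circ, norm_mul, norm_pt, mul_one, Complex.norm_real, Real.norm_eq_abs, Real.abs_exp]

@[simp] theorem circ_zero (x : UnitAddCircle) : circ 0 x = pt x := by simp [circ]

theorem circ_mem {s t : ℝ} (ht : |t| ≤ s) (x : UnitAddCircle) : circ t x ∈ closedAnnulus s := by
  rw [abs_le] at ht
  simp only [closedAnnulus, Set.mem_ofPred_eq, norm_circ, Real.exp_le_exp]
  exact ht

theorem pt_mem {s : ℝ} (hs : 0 ≤ s) (x : UnitAddCircle) : pt x ∈ closedAnnulus s := by
  simpa using circ_mem (t := 0) (by simpa using hs) x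

theorem continuous_circ (t : ℝ) : Continuous (circ t) := continuous_const.mul continuous_pt

theorem continuous_uncurry_circ : Continuous fun p : ℝ × UnitAddCircle => circ p.1 p.2 := by
  unfold circ
  fun_prop

theorem continuous_comp_circ {E : Type*} [TopologicalSpace E] {f : ℂ → E} {s t : ℝ}
    (hf : ContinuousOn f (closedAnnulus s)) (ht : |t| ≤ s) : Continuous fun x => f (circ t x) :=
  hf.comp_continuous (continuous_circ t) (circ_mem ht)

theorem circ_coe (t θ : ℝ) :
    circ t (θ : UnitAddCircle) = circleMap 0 (Real.exp t) (2 * Real.pi * θ) := by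
  rw [circ, pt_coe, circleMap, zero_add]; push_cast; rfl

theorem circ_coe' (t θ : ℝ) :
    circ t (θ : UnitAddCircle) = Complex.exp (t + 2 * Real.pi * θ * Complex.I) := by
  rw [circ, pt_coe, Complex.exp_add, Complex.ofReal_exp]

theorem circleAverage_eq_integral {E : Type*} [NormedAddCommGroup E] [NormedSpace ℝ E]
    (f : ℂ → E) (t : ℝ) :
    Real.circleAverage f 0 (Real.exp t) = ∫ x : UnitAddCircle, f (circ t x) := by
  rw [Real.circleAverage_def, ← UnitAddCircle.intervalIntegral_preimage 0, zero_add]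
  simp only [circ_coe]
  rw [intervalIntegral.integral_comp_mul_left (fun θ => f (circleMap 0 (Real.exp t) θ))
    (by positivity)]
  simp

theorem _root_.CircleIntegrable.integrable_comp_circ {f : ℂ → ℝ} {t : ℝ}
    (hf : CircleIntegrable f 0 (Real.exp t))
    (hm : AEStronglyMeasurable (fun x : UnitAddCircle => f (circ t x))) :
    Integrable fun x : UnitAddCircle => f (circ t x) := by
  have hmp := UnitAddCircle.measurePreserving_mk 0
  rw [← hmp.integrable_comp hm]
  have h2 := (hf.comp_mul_left (c := 2 * Real.pi))
  simp only [zero_div, ne_eq, mul_eq_zero, OfNat.ofNat_ne_zero, Real.pi_ne_zero, or_self,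
    not_false_eq_true, div_self] at h2
  rw [intervalIntegrable_iff_integrableOn_Ioc_of_le zero_le_one] at h2
  simp only [zero_add]
  refine h2.congr_fun (fun θ _ => ?_) measurableSet_Ioc
  simp only [Function.comp_apply, circ_coe]

theorem integral_log_norm_circ_sub {t : ℝ} {u : ℂ} (hu : u ≠ 0) :
    ∫ x : UnitAddCircle, Real.log ‖circ t x - u‖ = max t (Real.log ‖u‖) := by
  rw [← circleAverage_eq_integral (fun z => Real.log ‖z - u‖),
    circleAverage_log_norm_sub_const_eq_log_radius_add_posLog (Real.exp_pos t).ne']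
  have hu0 : 0 < ‖u‖ := norm_pos_iff.2 hu
  rw [Real.log_exp, zero_sub, norm_neg, Real.posLog, Real.log_mul (by positivity) hu0.ne',
    Real.log_inv, Real.log_exp]
  rcases max_cases t (Real.log ‖u‖) with ⟨h1, h2⟩ | ⟨h1, h2⟩ <;> rw [h1]
  · rw [max_eq_left (by linarith)]; ring
  · rw [max_eq_right (by linarith)]; ring

theorem aestronglyMeasurable_log_norm {f : UnitAddCircle → ℂ} (hf : Continuous f) :
    AEStronglyMeasurable (fun x => Real.log ‖f x‖) :=
  (hf.norm.measurable.log).aestronglyMeasurable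

theorem integrable_log_norm_circ_sub (t : ℝ) (u : ℂ) :
    Integrable fun x : UnitAddCircle => Real.log ‖circ t x - u‖ :=
  CircleIntegrable.integrable_comp_circ (f := fun z => Real.log ‖z - u‖)
    (circleIntegrable_log_norm_sub_const _)
    (aestronglyMeasurable_log_norm ((continuous_circ t).sub continuous_const))

/-- The circular mean is the contour integral of `F(z)/z` up to a constant, so Cauchy's theorem on
the annulus makes it independent of the radius. -/
theorem integral_comp_circ_eq_of_analytic {F : ℂ → ℂ} {s t : ℝ}
    (hF : AnalyticOnNhd ℂ F (closedAnnulus s)) (ht : |t| ≤ s) :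
    ∫ x : UnitAddCircle, F (circ t x) = ∫ x : UnitAddCircle, F (pt x) := by
  have key : ∀ a b : ℝ, |a| ≤ s → |b| ≤ s → a ≤ b →
      ∫ x : UnitAddCircle, F (circ b x) = ∫ x : UnitAddCircle, F (circ a x) := by
    intro a b ha hb hab
    rw [← circleAverage_eq_integral F, ← circleAverage_eq_integral F,
      Real.circleAverage_eq_circleIntegral (Real.exp_pos _).ne',
      Real.circleAverage_eq_circleIntegral (Real.exp_pos _).ne']
    congr 1
    have hsub : Metric.closedBall (0 : ℂ) (Real.exp b) \ Metric.ball 0 (Real.exp a) ⊆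
        closedAnnulus s := by
      intro z hz
      simp only [Set.mem_sdiff, Metric.mem_closedBall, dist_zero_right, Metric.mem_ball, not_lt] at hz
      rw [abs_le] at ha hb
      exact ⟨(Real.exp_le_exp.2 ha.1).trans hz.2, hz.1.trans (Real.exp_le_exp.2 hb.2)⟩
    refine Complex.circleIntegral_sub_center_inv_smul_eq_of_differentiable_on_annulus_off_countable
      (Real.exp_pos a) (Real.exp_le_exp.2 hab) Set.countable_empty (hF.continuousOn.mono hsub) ?_
    intro z hz
    refine (hF z (hsub ?_)).differentiableAt
    have := hz.1
    exact ⟨Metric.ball_subset_closedBall this.1, fun h => this.2 (Metric.ball_subset_closedBall h)⟩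
  have h0 : |(0 : ℝ)| ≤ s := by simpa using (abs_nonneg t).trans ht
  rcases le_total t 0 with h | h
  · simpa using (key t 0 ht h0 h).symm
  · simpa using key 0 t h0 ht h

theorem hasDerivAt_log_norm {w : ℝ → ℂ} {w' : ℂ} {θ : ℝ} (hw : HasDerivAt w w' θ) (h0 : w θ ≠ 0) :
    HasDerivAt (fun y => Real.log ‖w y‖) (w' / w θ).re θ := by
  have h1 := hw.norm_sq
  have hn : 0 < ‖w θ‖ := norm_pos_iff.2 h0
  have h2 := (h1.log (by positivity)).const_mul (1 / 2 : ℝ)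
  have e : (fun y => (1 / 2 : ℝ) * Real.log (‖w y‖ ^ 2)) = fun y => Real.log ‖w y‖ := by
    funext y; rw [Real.log_pow]; push_cast; ring
  rw [e] at h2
  refine h2.congr_deriv ?_
  rw [Complex.inner, Complex.div_re, Complex.normSq_eq_norm_sq]
  simp only [Complex.mul_re, Complex.conj_re, Complex.conj_im]
  field_simp
  ring

section ZeroFree

variable {g : ℂ → ℂ} {s : ℝ}

/-- `z g'(z) / g(z)`. -/
noncomputable def eulerLogDeriv (g : ℂ → ℂ) (z : ℂ) : ℂ := z * (deriv g z / g z)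

theorem analyticOnNhd_eulerLogDeriv (hg : AnalyticOnNhd ℂ g (closedAnnulus s))
    (h0 : ∀ z ∈ closedAnnulus s, g z ≠ 0) : AnalyticOnNhd ℂ (eulerLogDeriv g) (closedAnnulus s) :=
  fun z hz => analyticAt_id.mul (((hg z hz).deriv).div (hg z hz) (h0 z hz))

theorem hasDerivAt_log_norm_comp_circ_angle (hg : AnalyticOnNhd ℂ g (closedAnnulus s))
    (h0 : ∀ z ∈ closedAnnulus s, g z ≠ 0) {t : ℝ} (ht : |t| ≤ s) (θ : ℝ) :
    HasDerivAt (fun y : ℝ => Real.log ‖g (circ t (y : UnitAddCircle))‖)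
      (2 * Real.pi * Complex.I * eulerLogDeriv g (circ t (θ : UnitAddCircle))).re θ := by
  have hz := circ_mem ht (θ : UnitAddCircle)
  have h1 : HasDerivAt (fun y : ℝ => circ t (y : UnitAddCircle))
      (circ t (θ : UnitAddCircle) * (2 * Real.pi * Complex.I)) θ := by
    simp only [circ_coe']
    have h2 : HasDerivAt (fun y : ℝ => (t + 2 * Real.pi * y * Complex.I : ℂ))
        (2 * Real.pi * Complex.I) θ := by
      have := (((Complex.ofRealCLM.hasDerivAt (x := θ)).const_mul (2 * Real.pi : ℂ)).mul_const
        Complex.I).const_add (t : ℂ)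
      simpa using this
    exact h2.cexp
  have h3 := (hg _ hz).differentiableAt.hasDerivAt.comp θ h1
  have h4 := hasDerivAt_log_norm h3 (h0 _ hz)
  refine h4.congr_deriv ?_
  simp only [eulerLogDeriv, Function.comp_apply]
  congr 1
  ring

theorem hasDerivAt_log_norm_comp_circ_radius (hg : AnalyticOnNhd ℂ g (closedAnnulus s))
    (h0 : ∀ z ∈ closedAnnulus s, g z ≠ 0) {t : ℝ} (ht : |t| ≤ s) (x : UnitAddCircle) :
    HasDerivAt (fun y : ℝ => Real.log ‖g (circ y x)‖) (eulerLogDeriv g (circ t x)).re t := by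
  have hz := circ_mem ht x
  have h1 : HasDerivAt (fun y : ℝ => circ y x) (circ t x) t := by
    have := ((Real.hasDerivAt_exp t).ofReal_comp).mul_const (pt x)
    exact this
  have h3 := (hg _ hz).differentiableAt.hasDerivAt.comp t h1
  have h4 := hasDerivAt_log_norm h3 (h0 _ hz)
  refine h4.congr_deriv ?_
  simp only [eulerLogDeriv, Function.comp_apply]
  congr 1
  ring

/-- The radial derivative of `log |g|` is the real part of `z g'/g`, whose circular mean is
constant. The mean of `log |g|` is therefore affine in the logarithm of the radius. -/
theorem integral_log_norm_add_neg (hg : AnalyticOnNhd ℂ g (closedAnnulus s))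
    (h0 : ∀ z ∈ closedAnnulus s, g z ≠ 0) {t : ℝ} (ht : |t| ≤ s) :
    (∫ x : UnitAddCircle, Real.log ‖g (circ t x)‖) + ∫ x : UnitAddCircle, Real.log ‖g (circ (-t) x)‖
      = 2 * ∫ x : UnitAddCircle, Real.log ‖g (pt x)‖ := by
  have hψ := analyticOnNhd_eulerLogDeriv hg h0
  set c := ∫ x : UnitAddCircle, eulerLogDeriv g (pt x) with hc
  have hcont : ∀ t, |t| ≤ s → Continuous fun x : UnitAddCircle => Real.log ‖g (circ t x)‖ :=
    fun t ht => (continuous_comp_circ hg.continuousOn ht).norm.log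
      fun x => norm_ne_zero_iff.2 (h0 _ (circ_mem ht x))
  have hint : ∀ {f : UnitAddCircle → ℝ}, Continuous f → Integrable f := fun hf =>
    hf.integrable_of_hasCompactSupport (HasCompactSupport.of_compactSpace _)
  have key : ∀ t, |t| ≤ s → ∫ x : UnitAddCircle, Real.log ‖g (circ t x)‖ =
      (∫ x : UnitAddCircle, Real.log ‖g (pt x)‖) + t * c.re := by
    intro t ht
    have hmem : ∀ τ ∈ Set.uIcc 0 t, |τ| ≤ s := fun τ hτ => by
      refine le_trans ?_ ht
      rcases Set.mem_uIcc.1 hτ with h | h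
      · rw [abs_of_nonneg h.1, abs_of_nonneg (h.1.trans h.2)]; exact h.2
      · rw [abs_of_nonpos h.2, abs_of_nonpos (h.1.trans h.2)]; linarith
    have h1 : ∀ x : UnitAddCircle, Real.log ‖g (circ t x)‖ - Real.log ‖g (pt x)‖ =
        ∫ τ in (0 : ℝ)..t, (eulerLogDeriv g (circ τ x)).re := by
      intro x
      rw [intervalIntegral.integral_eq_sub_of_hasDerivAt (f := fun y => Real.log ‖g (circ y x)‖)
        (fun τ hτ => hasDerivAt_log_norm_comp_circ_radius hg h0 (hmem τ hτ) x), circ_zero]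
      refine ContinuousOn.intervalIntegrable ?_
      refine Complex.continuous_re.comp_continuousOn (hψ.continuousOn.comp ?_ fun τ hτ => circ_mem (hmem τ hτ) x)
      exact (continuous_uncurry_circ.comp (by fun_prop : Continuous fun τ : ℝ => (τ, x))).continuousOn
    have h2 : ∫ x : UnitAddCircle, (Real.log ‖g (circ t x)‖ - Real.log ‖g (pt x)‖) = t * c.re := by
      simp_rw [h1]
      rw [← intervalIntegral_integral_swap]
      · have h3 : ∀ τ ∈ Set.uIcc 0 t, ∫ x : UnitAddCircle, (eulerLogDeriv g (circ τ x)).re = c.re := by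
          intro τ hτ
          rw [hc, ← integral_comp_circ_eq_of_analytic hψ (hmem τ hτ)]
          exact integral_re (𝕜 := ℂ) (μ := (volume : Measure UnitAddCircle))
            ((continuous_comp_circ hψ.continuousOn (hmem τ hτ)).integrable_of_hasCompactSupport
              (HasCompactSupport.of_compactSpace _))
        rw [intervalIntegral.integral_congr h3]
        simp
      · have h5 : ContinuousOn (Function.uncurry fun (τ : ℝ) (x : UnitAddCircle) =>
            (eulerLogDeriv g (circ τ x)).re) (Set.uIcc 0 t ×ˢ Set.univ) := by
          refine Complex.continuous_re.comp_continuousOn (hψ.continuousOn.comp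
            continuous_uncurry_circ.continuousOn fun p hp => circ_mem (hmem _ hp.1) _)
        have h6 := (h5.integrableOn_compact (μ := (volume : Measure ℝ).prod volume)
          (isCompact_uIcc.prod isCompact_univ)).mono_set
            (Set.prod_mono Set.uIoc_subset_uIcc subset_rfl)
        rwa [IntegrableOn, ← Measure.prod_restrict, Measure.restrict_univ] at h6
    have h0s : |(0 : ℝ)| ≤ s := by simpa using (abs_nonneg t).trans ht
    have h7 := hint (hcont 0 h0s)
    simp only [circ_zero] at h7
    rw [integral_sub (hint (hcont t ht)) h7] at h2
    linarith
  rw [key t ht, key (-t) (by rwa [abs_neg])]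
  ring

/-- Integration by parts in the angle expresses a Fourier coefficient of `log |g|` through two
Laurent coefficients of `z g'/g`, whose dependence on the radius is explicit. No branch of `log g`
is needed, and none need exist on the annulus. -/
theorem integral_log_norm_mul_zpow_eq (hg : AnalyticOnNhd ℂ g (closedAnnulus s))
    (h0 : ∀ z ∈ closedAnnulus s, g z ≠ 0) {t : ℝ} (ht : |t| ≤ s) (m : ℤ) :
    2 * m * ∫ x : UnitAddCircle, (Real.log ‖g (circ t x)‖ : ℂ) * pt x ^ (-m) =
      Real.exp (m * t) * (∫ x : UnitAddCircle, eulerLogDeriv g (pt x) * pt x ^ (-m)) -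
      Real.exp (-(m * t)) * starRingEnd ℂ (∫ x : UnitAddCircle, eulerLogDeriv g (pt x) * pt x ^ m) := by
  have hψ := analyticOnNhd_eulerLogDeriv hg h0
  have hzp : ∀ m : ℤ, Continuous fun x : UnitAddCircle => pt x ^ m := fun m =>
    continuous_pt.zpow₀ m fun x => .inl (pt_ne_zero x)
  have hint : ∀ {f : UnitAddCircle → ℂ}, Continuous f → Integrable f := fun hf =>
    hf.integrable_of_hasCompactSupport (HasCompactSupport.of_compactSpace _)
  have hcψ := continuous_comp_circ hψ.continuousOn ht
  have hcoef : ∀ m : ℤ, ∫ x : UnitAddCircle, eulerLogDeriv g (circ t x) * pt x ^ (-m) =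
      Real.exp (m * t) * ∫ x : UnitAddCircle, eulerLogDeriv g (pt x) * pt x ^ (-m) := by
    intro m
    have hF : AnalyticOnNhd ℂ (fun z => eulerLogDeriv g z * z ^ (-m)) (closedAnnulus s) := by
      intro z hz
      refine (hψ z hz).mul (analyticAt_id.zpow ?_)
      have : 0 < ‖z‖ := (Real.exp_pos _).trans_le hz.1
      exact norm_pos_iff.1 this
    rw [← integral_comp_circ_eq_of_analytic hF ht, ← integral_const_mul]
    refine integral_congr_ae (.of_forall fun x => ?_)
    simp only [circ, mul_zpow]
    have e : ((Real.exp t : ℝ) : ℂ) ^ (-m) = ((Real.exp (-(m * t)) : ℝ) : ℂ) := by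
      rw [Complex.ofReal_exp, ← Complex.exp_int_mul, Complex.ofReal_exp]
      congr 1; push_cast; ring
    have e2 : ((Real.exp (m * t) : ℝ) : ℂ) * ((Real.exp (-(m * t)) : ℝ) : ℂ) = 1 := by
      rw [← Complex.ofReal_mul, ← Real.exp_add]; simp
    rw [e]
    linear_combination (-(eulerLogDeriv g (((Real.exp t : ℝ) : ℂ) * pt x) * pt x ^ (-m))) * e2
  have hlog : Continuous fun x : UnitAddCircle => (Real.log ‖g (circ t x)‖ : ℂ) :=
    Complex.continuous_ofReal.comp ((continuous_comp_circ hg.continuousOn ht).norm.log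
      fun x => norm_ne_zero_iff.2 (h0 _ (circ_mem ht x)))
  have hparts : ∫ x : UnitAddCircle,
      (((2 * Real.pi * Complex.I * eulerLogDeriv g (circ t x)).re : ℂ) * pt x ^ (-m)
        - 2 * Real.pi * Complex.I * m * ((Real.log ‖g (circ t x)‖ : ℂ) * pt x ^ (-m))) = 0 := by
    rw [← UnitAddCircle.intervalIntegral_preimage 0, zero_add]
    rw [intervalIntegral.integral_eq_sub_of_hasDerivAt
      (f := fun θ : ℝ => (Real.log ‖g (circ t (θ : UnitAddCircle))‖ : ℂ) * pt (θ : UnitAddCircle) ^ (-m))]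
    · have : ((1 : ℝ) : UnitAddCircle) = ((0 : ℝ) : UnitAddCircle) := by
        rw [AddCircle.coe_period]; rfl
      rw [this, sub_self]
    · intro θ _
      have h1 := (hasDerivAt_log_norm_comp_circ_angle hg h0 ht θ).ofReal_comp
      have h2 : HasDerivAt (fun y : ℝ => pt (y : UnitAddCircle) ^ (-m))
          (pt (θ : UnitAddCircle) ^ (-m) * (-(2 * Real.pi * Complex.I * m))) θ := by
        have e : ∀ y : ℝ, pt (y : UnitAddCircle) ^ (-m) =
            Complex.exp (y * (-(2 * Real.pi * Complex.I * m))) := by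
          intro y; rw [pt_coe, ← Complex.exp_int_mul]; congr 1; push_cast; ring
        simp only [e]
        have h3 : HasDerivAt (fun y : ℝ => (y * (-(2 * Real.pi * Complex.I * m)) : ℂ))
            (-(2 * Real.pi * Complex.I * m)) θ := by
          simpa using (Complex.ofRealCLM.hasDerivAt (x := θ)).mul_const (-(2 * Real.pi * Complex.I * m))
        exact h3.cexp
      refine (h1.fun_mul h2).congr_deriv ?_
      ring
    · refine Continuous.intervalIntegrable ?_ _ _
      refine Continuous.comp (g := fun x : UnitAddCircle =>
        (((2 * Real.pi * Complex.I * eulerLogDeriv g (circ t x)).re : ℂ) * pt x ^ (-m)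
        - 2 * Real.pi * Complex.I * m * ((Real.log ‖g (circ t x)‖ : ℂ) * pt x ^ (-m)))) ?_
        (AddCircle.continuous_mk' 1)
      exact ((Complex.continuous_ofReal.comp (Complex.continuous_re.comp (continuous_const.mul hcψ))).mul
        (hzp _)).sub (continuous_const.mul (hlog.mul (hzp _)))
  have hre : ∀ x : UnitAddCircle, ((2 * Real.pi * Complex.I * eulerLogDeriv g (circ t x)).re : ℂ) * pt x ^ (-m)
      = Real.pi * Complex.I * (eulerLogDeriv g (circ t x) * pt x ^ (-m)
        - starRingEnd ℂ (eulerLogDeriv g (circ t x) * pt x ^ m)) := by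
    intro x
    have e1 : starRingEnd ℂ (pt x ^ m) = pt x ^ (-m) := by
      rw [map_zpow₀, zpow_neg, ← inv_zpow]
      congr 1
      rw [Complex.inv_def, Complex.normSq_eq_norm_sq, norm_pt]; simp
    rw [map_mul, e1, ← sub_mul, ← mul_assoc]
    congr 1
    apply Complex.ext <;> simp <;> ring
  simp only [hre] at hparts
  rw [integral_sub, integral_const_mul, integral_const_mul, integral_sub] at hparts
  · have e2 : ∫ x : UnitAddCircle, starRingEnd ℂ (eulerLogDeriv g (circ t x) * pt x ^ m) =
        starRingEnd ℂ (∫ x : UnitAddCircle, eulerLogDeriv g (circ t x) * pt x ^ m) := integral_conj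
    have e3 := hcoef (-m)
    simp only [neg_neg] at e3
    rw [e2, hcoef m, e3, map_mul, Complex.conj_ofReal] at hparts
    have hpi : (Real.pi * Complex.I : ℂ) ≠ 0 := by
      simp [Real.pi_ne_zero]
    apply mul_left_cancel₀ hpi
    push_cast at hparts ⊢
    rw [neg_mul] at hparts
    linear_combination -hparts
  · exact hint (hcψ.mul (hzp _))
  · exact hint (Complex.continuous_conj.comp (hcψ.mul (hzp _)))
  · exact hint (continuous_const.mul ((hcψ.mul (hzp _)).sub
      (Complex.continuous_conj.comp (hcψ.mul (hzp _)))))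
  · exact hint (continuous_const.mul (hlog.mul (hzp _)))

/-- Since `log |g|` is harmonic, its `m`-th Fourier coefficient combines `e^{mt}` and `e^{-mt}`, and
its even part in `t` is a hyperbolic cosine. This is the source of exponential decay: coefficients
on the unit circle equal those on the two outer circles divided by `2 cosh (mt)`. -/
theorem integral_log_norm_mul_zpow_add_neg (hg : AnalyticOnNhd ℂ g (closedAnnulus s))
    (h0 : ∀ z ∈ closedAnnulus s, g z ≠ 0) {t : ℝ} (ht : |t| ≤ s) {m : ℤ} (hm : m ≠ 0) :
    (∫ x : UnitAddCircle, (Real.log ‖g (circ t x)‖ : ℂ) * pt x ^ (-m)) +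
      ∫ x : UnitAddCircle, (Real.log ‖g (circ (-t) x)‖ : ℂ) * pt x ^ (-m) =
      2 * Real.cosh (m * t) * ∫ x : UnitAddCircle, (Real.log ‖g (pt x)‖ : ℂ) * pt x ^ (-m) := by
  have h1 := integral_log_norm_mul_zpow_eq hg h0 ht m
  have h2 := integral_log_norm_mul_zpow_eq hg h0 (t := -t) (by rwa [abs_neg]) m
  have h3 := integral_log_norm_mul_zpow_eq hg h0 (t := 0) (by simpa using (abs_nonneg t).trans ht) m
  simp only [circ_zero, mul_zero, neg_zero, Real.exp_zero, Complex.ofReal_one, one_mul] at h3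
  rw [mul_neg, neg_neg] at h2
  have hm' : (2 * m : ℂ) ≠ 0 := by
    simp [hm]
  apply mul_left_cancel₀ hm'
  rw [Real.cosh_eq, mul_add, h1, h2]
  push_cast at h1 h2 h3 ⊢
  linear_combination (-(2 * ((Complex.exp (m * t) + Complex.exp (-(m * t))) / 2))) * h3

end ZeroFree

/-! ### Zeros on an annulus and the splitting of `log |f|` -/

theorem isPreconnected_closedAnnulus (s : ℝ) : IsPreconnected (closedAnnulus s) := by
  have h : closedAnnulus s = Complex.exp '' (Complex.re ⁻¹' Set.Icc (-s) s) := by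
    ext z
    simp only [closedAnnulus, Set.mem_ofPred_eq, Set.mem_image, Set.mem_preimage, Set.mem_Icc]
    constructor
    · intro hz
      have h0 : 0 < ‖z‖ := (Real.exp_pos _).trans_le hz.1
      refine ⟨Complex.log z, ?_, Complex.exp_log (norm_pos_iff.1 h0)⟩
      rw [Complex.log_re]
      exact ⟨(Real.le_log_iff_exp_le h0).2 hz.1, (Real.log_le_iff_le_exp h0).2 hz.2⟩
    · rintro ⟨w, hw, rfl⟩
      rw [Complex.norm_exp, Real.exp_le_exp, Real.exp_le_exp]
      exact hw
  rw [h]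
  refine IsPreconnected.image ?_ _ Complex.continuous_exp.continuousOn
  exact (convex_Icc (-s) s).is_linear_preimage Complex.reLm.isLinear |>.isPreconnected

theorem isCompact_closedAnnulus (s : ℝ) : IsCompact (closedAnnulus s) := by
  refine Metric.isCompact_of_isClosed_isBounded ?_ ?_
  · exact (isClosed_le continuous_const continuous_norm).inter
      (isClosed_le continuous_norm continuous_const)
  · refine (Metric.isBounded_closedBall (x := (0 : ℂ)) (r := Real.exp s)).subset fun z hz => ?_
    rw [mem_closedBall_zero_iff]; exact hz.2

theorem closedAnnulus_mem_nhds {s : ℝ} (hs : 0 < s) : closedAnnulus s ∈ 𝓝 (1 : ℂ) := by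
  have h1 : {z : ℂ | Real.exp (-s) < ‖z‖} ∈ 𝓝 (1 : ℂ) :=
    (isOpen_lt continuous_const continuous_norm).mem_nhds (by simp [hs])
  have h2 : {z : ℂ | ‖z‖ < Real.exp s} ∈ 𝓝 (1 : ℂ) :=
    (isOpen_lt continuous_norm continuous_const).mem_nhds (by simp [hs])
  filter_upwards [h1, h2] with z hz1 hz2 using ⟨le_of_lt hz1, le_of_lt hz2⟩

theorem exists_zero_factorization {s : ℝ} (hs : 0 < s) {f : ℂ → ℂ}
    (hf : AnalyticOnNhd ℂ f (closedAnnulus s)) (hne : ∃ z ∈ closedAnnulus s, f z ≠ 0) :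
    ∃ (Z : Finset ℂ) (d : ℂ → ℕ) (g : ℂ → ℂ), (∀ u ∈ Z, u ∈ closedAnnulus s) ∧
      (∀ u ∈ Z, d u ≠ 0) ∧ AnalyticOnNhd ℂ g (closedAnnulus s) ∧
      (∀ z ∈ closedAnnulus s, g z ≠ 0) ∧
      ∀ z ∈ closedAnnulus s, f z = (∏ u ∈ Z, (z - u) ^ d u) * g z := by
  set U := closedAnnulus s
  have hm : MeromorphicOn f U := hf.meromorphicOn
  obtain ⟨z₁, hz₁, hfz₁⟩ := hne
  have hord : ∀ u : U, meromorphicOrderAt f u ≠ ⊤ := by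
    intro u
    refine hm.meromorphicOrderAt_ne_top_of_isPreconnected (isPreconnected_closedAnnulus s) hz₁ u.2 ?_
    rw [meromorphicOrderAt_ne_top_iff_eventually_ne_zero (hm z₁ hz₁)]
    exact ((hf z₁ hz₁).continuousAt.eventually_ne hfz₁).filter_mono nhdsWithin_le_nhds
  set D := MeromorphicOn.divisor f U
  have hfin : D.support.Finite := D.finiteSupport (isCompact_closedAnnulus s)
  obtain ⟨g, hg, hg0, hfg⟩ := hm.extract_zeros_poles hord hfin
  have hD0 : ∀ u, 0 ≤ D u := fun u => MeromorphicOn.AnalyticOnNhd.divisor_nonneg hf u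
  have hprod : ∀ z, (∏ᶠ u, (· - u) ^ D u : ℂ → ℂ) z =
      ∏ u ∈ hfin.toFinset, (z - u) ^ (D u).toNat := by
    intro z
    rw [Function.FactorizedRational.finprod_eq_fun hfin]
    change ∏ᶠ u, (z - u) ^ D u = _
    rw [finprod_eq_prod_of_mulSupport_subset (s := hfin.toFinset)]
    · refine Finset.prod_congr rfl fun u _ => ?_
      rw [← zpow_natCast, Int.toNat_of_nonneg (hD0 u)]
    · intro u hu
      rw [Set.Finite.coe_toFinset]
      by_contra h
      have : D u = 0 := by simpa using h
      simp [this] at hu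
  refine ⟨hfin.toFinset, fun u => (D u).toNat, g, ?_, ?_, hg, fun z hz => hg0 ⟨z, hz⟩, ?_⟩
  · intro u hu
    exact D.supportWithinDomain (hfin.mem_toFinset.1 hu)
  · intro u hu
    have h1 : D u ≠ 0 := hfin.mem_toFinset.1 hu
    have := hD0 u
    change (D u).toNat ≠ 0
    omega
  -- The extraction of zeros gives equality only off a discrete set; both sides are analytic, so the
  -- identity theorem removes the exception.
  · have hP : AnalyticOnNhd ℂ (fun z => (∏ u ∈ hfin.toFinset, (z - u) ^ (D u).toNat) * g z) U := by
      intro z hz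
      refine AnalyticAt.mul ?_ (hg z hz)
      exact Finset.analyticAt_fun_prod _ fun u _ => (analyticAt_id.sub analyticAt_const).pow _
    have h1U : (1 : ℂ) ∈ U := mem_of_mem_nhds (closedAnnulus_mem_nhds hs)
    have hacc : AccPt (1 : ℂ) (𝓟 U) :=
      (accPt_principal_iff_nhdsWithin).2 (by
        rw [show U \ {(1 : ℂ)} = U ∩ {(1 : ℂ)}ᶜ from rfl, Set.inter_comm,
          nhdsWithin_inter_of_mem' (mem_nhdsWithin_of_mem_nhds (closedAnnulus_mem_nhds hs))]
        infer_instance)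
    have heq : f =ᶠ[codiscreteWithin U] fun z => (∏ u ∈ hfin.toFinset, (z - u) ^ (D u).toNat) * g z := by
      refine hfg.trans (.of_forall fun z => ?_)
      simp only [Pi.smul_apply', smul_eq_mul]
      rw [hprod]
    have hev := (hf 1 h1U).meromorphicAt.eventuallyEq_nhdsNE_of_eventuallyEq_codiscreteWithin
      (hP 1 h1U).meromorphicAt h1U hacc heq
    exact hf.eqOn_of_preconnected_of_frequently_eq hP (isPreconnected_closedAnnulus s) h1U hev.frequently

theorem integrable_of_continuous {E : Type*} [NormedAddCommGroup E] {f : UnitAddCircle → E}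
    (hf : Continuous f) : Integrable f :=
  hf.integrable_of_hasCompactSupport (HasCompactSupport.of_compactSpace _)

theorem ae_ne_const {f : UnitAddCircle → ℂ} (hf : Function.Injective f) (u : ℂ) :
    ∀ᵐ x : UnitAddCircle, f x ≠ u := by
  rw [ae_iff]
  simp only [ne_eq, not_not]
  exact Set.Subsingleton.measure_zero (fun a ha b hb => hf (ha.trans hb.symm)) _

theorem circ_injective (t : ℝ) : Function.Injective (circ t) := fun x y h => by
  refine pt_injective (mul_left_cancel₀ ?_ h)
  exact_mod_cast (Real.exp_pos t).ne'

theorem log_norm_prod_mul {Z : Finset ℂ} {d : ℂ → ℕ} {z w : ℂ} (hz : ∀ u ∈ Z, z ≠ u) (hw : w ≠ 0) :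
    Real.log ‖(∏ u ∈ Z, (z - u) ^ d u) * w‖ = ∑ u ∈ Z, d u * Real.log ‖z - u‖ + Real.log ‖w‖ := by
  have h : ∀ u ∈ Z, ‖z - u‖ ^ d u ≠ 0 := fun u hu =>
    pow_ne_zero _ (norm_ne_zero_iff.2 (sub_ne_zero.2 (hz u hu)))
  rw [norm_mul, norm_prod]
  simp only [norm_pow]
  rw [Real.log_mul (Finset.prod_ne_zero_iff.2 h) (norm_ne_zero_iff.2 hw), Real.log_prod h]
  simp only [Real.log_pow]

theorem integral_log_norm_prod_mul {Z : Finset ℂ} {d : ℂ → ℕ} {G : ℂ → ℂ} {t : ℝ}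
    (hZ : ∀ u ∈ Z, u ≠ 0) (hG : Continuous fun x => G (circ t x)) (hG0 : ∀ x, G (circ t x) ≠ 0) :
    ∫ x : UnitAddCircle, Real.log ‖(∏ u ∈ Z, (circ t x - u) ^ d u) * G (circ t x)‖ =
      ∑ u ∈ Z, d u * max t (Real.log ‖u‖) + ∫ x : UnitAddCircle, Real.log ‖G (circ t x)‖ := by
  have hae : ∀ᵐ x : UnitAddCircle, ∀ u ∈ Z, circ t x ≠ u :=
    (Finset.eventually_all Z).2 fun u _ => ae_ne_const (circ_injective t) u
  have h1 : (fun x : UnitAddCircle => Real.log ‖(∏ u ∈ Z, (circ t x - u) ^ d u) * G (circ t x)‖) =ᵐ[volume]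
      fun x => ∑ u ∈ Z, d u * Real.log ‖circ t x - u‖ + Real.log ‖G (circ t x)‖ := by
    filter_upwards [hae] with x hx using log_norm_prod_mul hx (hG0 x)
  have h2 : ∀ u ∈ Z, Integrable fun x : UnitAddCircle => d u * Real.log ‖circ t x - u‖ :=
    fun u _ => (integrable_log_norm_circ_sub t u).const_mul _
  rw [integral_congr_ae h1, integral_add (integrable_finsetSum _ h2)
    (integrable_of_continuous (hG.norm.log fun x => norm_ne_zero_iff.2 (hG0 x))),
    integral_finsetSum _ h2]
  congr 1
  refine Finset.sum_congr rfl fun u hu => ?_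
  rw [integral_const_mul, integral_log_norm_circ_sub (hZ u hu)]

theorem integral_le_of_forall_le {u : UnitAddCircle → ℝ} {A : ℝ} (hA : 0 ≤ A) (h : ∀ x, u x ≤ A) :
    ∫ x, u x ≤ A := by
  by_cases hu : Integrable u
  · calc ∫ x, u x ≤ ∫ _ : UnitAddCircle, A := integral_mono hu (integrable_const _) h
      _ = A := by simp
  · rw [integral_undef hu]; exact hA

theorem log_norm_le_of_norm_le_exp {z : ℂ} {A : ℝ} (hA : 0 ≤ A) (h : ‖z‖ ≤ Real.exp A) :
    Real.log ‖z‖ ≤ A := by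
  rcases eq_or_ne z 0 with rfl | hz
  · simpa using hA
  · exact (Real.log_le_iff_le_exp (norm_pos_iff.2 hz)).2 h

theorem volume_eq_haarAddCircle :
    (volume : Measure UnitAddCircle) = AddCircle.haarAddCircle := by
  rw [AddCircle.volume_eq_smul_haarAddCircle]; simp

theorem fourier_eq_pt_zpow (m : ℤ) (x : UnitAddCircle) : fourier m x = pt x ^ m := by
  rw [fourier_apply, AddCircle.toCircle_zsmul, Circle.coe_zpow]; rfl

theorem norm_sum_pt_zpow (ω : ℝ) (n : ℕ) (m : ℤ) :
    ‖∑ k ∈ Finset.range n, pt ((k * ω : ℝ) : UnitAddCircle) ^ m‖ =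
      ‖∑ k ∈ Finset.range n, pt ((k * ω : ℝ) : UnitAddCircle) ^ m.natAbs‖ := by
  rcases Int.natAbs_eq m with h | h
  · conv_lhs => rw [h]
    simp only [zpow_natCast]
  · conv_lhs => rw [h]
    rw [← Complex.norm_conj, map_sum]
    congr 1
    refine Finset.sum_congr rfl fun k _ => ?_
    rw [zpow_neg, zpow_natCast, map_inv₀, map_pow, ← pt_neg, ← inv_pow]
    congr 1
    have : pt (-((k * ω : ℝ) : UnitAddCircle)) * pt ((k * ω : ℝ) : UnitAddCircle) = 1 := by
      rw [← pt_add, neg_add_cancel, pt_zero]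
    exact inv_eq_of_mul_eq_one_right this

theorem summable_exp_mul_sq {σ : ℝ} (hσ : 0 < σ) :
    Summable fun m : ℤ => Real.exp (-(σ * |(m : ℝ)|)) * (|(m : ℝ)| + 1) ^ 2 := by
  have hr : ‖Real.exp (-σ)‖ < 1 := by
    rw [Real.norm_eq_abs, Real.abs_exp, Real.exp_lt_one_iff]; linarith
  have h2 := summable_pow_mul_geometric_of_norm_lt_one 2 hr
  have h1 := summable_pow_mul_geometric_of_norm_lt_one 1 hr
  have h0 := summable_pow_mul_geometric_of_norm_lt_one 0 hr
  have hN : Summable fun m : ℕ => Real.exp (-(σ * (m : ℝ))) * ((m : ℝ) + 1) ^ 2 := by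
    refine ((h2.add (h1.mul_left 2)).add h0).congr fun m => ?_
    rw [show -(σ * (m : ℝ)) = m * (-σ) by ring, Real.exp_nat_mul]
    ring
  refine Summable.of_nat_of_neg ?_ ?_
  · simpa using hN
  · simpa using hN

/-- Exponential decay of the coefficients beats the Weyl sums, which grow at most quadratically in
the frequency. The discrepancy is therefore bounded uniformly in `n`. -/
theorem abs_rotSum_sub_le_of_fourier {α c ω σ : ℝ} (hα : 0 < α) (hc : 0 < c) (hσ : 0 < σ)
    (h : UniformDiophantine α c ω) : ∃ K : ℝ, 0 < K ∧ ∀ (A : ℝ) (u : UnitAddCircle → ℝ), 0 ≤ A →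
      Continuous u →
      (∀ m : ℤ, m ≠ 0 → ‖∫ x, (u x : ℂ) * pt x ^ (-m)‖ ≤ A * Real.exp (-(σ * |(m : ℝ)|))) →
      ∀ n x, |rotSum ω n u x - n * ∫ y, u y| ≤ K * A := by
  set G : ℤ → ℝ := fun m => Real.exp (-(σ * |(m : ℝ)|)) * (|(m : ℝ)| + 1) ^ 2 with hG
  have hGs : Summable G := summable_exp_mul_sq hσ
  have hG0 : ∀ m, 0 ≤ G m := fun m => by positivity
  refine ⟨α ^ α / c * (∑' m, G m) + 1, by have : 0 ≤ ∑' m, G m := tsum_nonneg hG0; positivity, ?_⟩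
  intro A u hA hu hcoef n x
  set U : C(UnitAddCircle, ℂ) := ⟨fun x => (u x : ℂ), by fun_prop⟩
  have hFC : ∀ m : ℤ, fourierCoeff U m = ∫ x, (u x : ℂ) * pt x ^ (-m) := by
    intro m
    rw [fourierCoeff, ← volume_eq_haarAddCircle]
    refine integral_congr_ae (.of_forall fun x => ?_)
    simp only [fourier_eq_pt_zpow, smul_eq_mul, U, ContinuousMap.coe_mk]
    ring
  have hsum : Summable (fourierCoeff U) := by
    rw [← summable_norm_iff]
    have h1 : Summable fun m : ℤ => A * G m := hGs.mul_left A
    refine Summable.of_norm_bounded_eventually h1 ?_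
    rw [Filter.eventually_cofinite]
    refine (Set.finite_singleton (0 : ℤ)).subset fun m hm => ?_
    by_contra hm0
    apply hm
    rw [norm_norm, hFC]
    refine (hcoef m hm0).trans ?_
    gcongr
    exact le_mul_of_one_le_right (Real.exp_pos _).le (one_le_pow₀ (by linarith [abs_nonneg (m : ℝ)]))
  set Dk : ℤ → ℂ := fun m => ∑ k ∈ Finset.range n, pt ((k * ω : ℝ) : UnitAddCircle) ^ m with hDk
  set F : ℤ → ℂ := fun m => fourierCoeff U m * (pt x ^ m * Dk m)
  have hS : HasSum F (rotSum ω n u x : ℂ) := by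
    have h1 := hasSum_sum (s := Finset.range n) fun k _ =>
      has_pointwise_sum_fourier_series_of_summable hsum (x + ((k * ω : ℝ) : UnitAddCircle))
    have e1 : (rotSum ω n u x : ℂ) = ∑ k ∈ Finset.range n, U (x + ((k * ω : ℝ) : UnitAddCircle)) := by
      simp [rotSum, U]
    rw [e1]
    convert h1 using 2 with m
    simp only [F, hDk, Finset.mul_sum]
    refine Finset.sum_congr rfl fun k _ => ?_
    rw [fourier_eq_pt_zpow, pt_add, mul_zpow, smul_eq_mul]
  have hF0 : F 0 = ((n * ∫ y, u y : ℝ) : ℂ) := by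
    simp only [F, hDk, hFC, zpow_zero, Finset.sum_const, Finset.card_range, neg_zero, mul_one,
      nsmul_eq_mul, one_mul]
    rw [integral_complex_ofReal]; push_cast; ring
  -- The zero frequency is `n` times the mean; removing it leaves the discrepancy.
  have hS' := hasSum_ite_sub_hasSum hS 0
  rw [hF0, ← Complex.ofReal_sub] at hS'
  have hbd := HasSum.norm_le_of_bounded hS' ((hGs.hasSum).mul_left (A * (α ^ α / c))) (fun m => by
    split_ifs with hm
    · rw [norm_zero]; have := hG0 m; positivity
    · simp only [F]
      rw [norm_mul, norm_mul, norm_zpow, norm_pt, one_zpow, one_mul, hFC]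
      have hj : 1 ≤ m.natAbs := Int.natAbs_pos.2 hm
      have hdist := h (m.natAbs + 1) m.natAbs (by omega) hj (by omega)
      have hlog := log_natCast_pos (M := m.natAbs + 1) (by omega)
      have hcast : ((m.natAbs + 1 : ℕ) : ℝ) = |(m : ℝ)| + 1 := by
        push_cast; rw [Nat.cast_natAbs]; push_cast; ring
      have hp : 0 < c / (((m.natAbs + 1 : ℕ) : ℝ) * Real.log ((m.natAbs + 1 : ℕ) : ℝ) ^ α) := by positivity
      have hD : ‖Dk m‖ ≤ α ^ α / c * (|(m : ℝ)| + 1) ^ 2 := by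
        rw [hDk, norm_sum_pt_zpow]
        refine (norm_sum_pt_pow_le_inv ω n _ (hp.trans_le hdist)).trans ((inv_anti₀ hp hdist).trans ?_)
        rw [inv_div]
        have := log_natCast_rpow_le hα (m.natAbs + 1)
        calc _ ≤ ((m.natAbs + 1 : ℕ) : ℝ) * (α ^ α * ((m.natAbs + 1 : ℕ) : ℝ)) / c := by gcongr
          _ = _ := by rw [hcast]; ring
      calc _ ≤ (A * Real.exp (-(σ * |(m : ℝ)|))) * (α ^ α / c * (|(m : ℝ)| + 1) ^ 2) := by
            gcongr; exact hcoef m hm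
        _ = _ := by simp only [hG]; ring)
  rw [Complex.norm_real, Real.norm_eq_abs] at hbd
  refine hbd.trans ?_
  nlinarith

theorem norm_le_of_norm_le_on_boundary {s A : ℝ} {F : ℂ → ℂ}
    (hF : AnalyticOnNhd ℂ F (closedAnnulus s))
    (hb : ∀ z, ‖z‖ = Real.exp (-s) ∨ ‖z‖ = Real.exp s → ‖F z‖ ≤ A) {z : ℂ}
    (hz1 : Real.exp (-s) < ‖z‖) (hz2 : ‖z‖ < Real.exp s) : ‖F z‖ ≤ A := by
  set U : Set ℂ := {z | Real.exp (-s) < ‖z‖} ∩ {z | ‖z‖ < Real.exp s}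
  have hUo : IsOpen U := (isOpen_lt continuous_const continuous_norm).inter
    (isOpen_lt continuous_norm continuous_const)
  have hsub : closure U ⊆ closedAnnulus s :=
    closure_minimal (fun z hz => ⟨le_of_lt hz.1, le_of_lt hz.2⟩) (isCompact_closedAnnulus s).isClosed
  refine Complex.norm_le_of_forall_mem_frontier_norm_le (U := U) ?_
    (hF.differentiableOn.mono hsub).diffContOnCl ?_ (subset_closure ⟨hz1, hz2⟩)
  · exact (isCompact_closedAnnulus s).isBounded.subset (subset_closure.trans hsub)
  · intro w hw
    rw [hUo.frontier_eq] at hw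
    have h1 := hsub hw.1
    refine hb w ?_
    by_contra hcon
    rw [not_or] at hcon
    exact hw.2 ⟨lt_of_le_of_ne h1.1 (Ne.symm hcon.1), lt_of_le_of_ne h1.2 hcon.2⟩

theorem log_norm_mem_of_mem {s : ℝ} {u : ℂ} (hu : u ∈ closedAnnulus s) :
    u ≠ 0 ∧ -s ≤ Real.log ‖u‖ ∧ Real.log ‖u‖ ≤ s := by
  have h0 : 0 < ‖u‖ := (Real.exp_pos _).trans_le hu.1
  exact ⟨norm_pos_iff.1 h0, (Real.le_log_iff_exp_le h0).2 hu.1, (Real.log_le_iff_le_exp h0).2 hu.2⟩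

/-- Jensen's formula on an annulus bounds the number of zeros in the middle of it. -/
theorem sum_zeros_le {s A : ℝ} (hs : 0 < s) (hA : 0 ≤ A) {f g : ℂ → ℂ} {Z : Finset ℂ} {d : ℂ → ℕ}
    (hZ : ∀ u ∈ Z, u ∈ closedAnnulus s) (hg : AnalyticOnNhd ℂ g (closedAnnulus s))
    (hg0 : ∀ z ∈ closedAnnulus s, g z ≠ 0)
    (hfac : ∀ z ∈ closedAnnulus s, f z = (∏ u ∈ Z, (z - u) ^ d u) * g z)
    (hup : ∀ z ∈ closedAnnulus s, ‖f z‖ ≤ Real.exp A)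
    (hlow : -A ≤ ∫ x : UnitAddCircle, Real.log ‖f (pt x)‖) :
    ((∑ u ∈ Z with |Real.log ‖u‖| ≤ s / 2, d u : ℕ) : ℝ) ≤ 8 / s * A := by
  have hform : ∀ t, |t| ≤ s → ∫ x : UnitAddCircle, Real.log ‖f (circ t x)‖ =
      ∑ u ∈ Z, d u * max t (Real.log ‖u‖) + ∫ x : UnitAddCircle, Real.log ‖g (circ t x)‖ := by
    intro t ht
    rw [← integral_log_norm_prod_mul (fun u hu => (log_norm_mem_of_mem (hZ u hu)).1)
      (continuous_comp_circ hg.continuousOn ht) fun x => hg0 _ (circ_mem ht x)]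
    refine integral_congr_ae (.of_forall fun x => ?_)
    simp only [hfac _ (circ_mem ht x)]
  have hss : |s| ≤ s := (abs_of_pos hs).le
  have h1 := hform s hss
  have h2 := hform (-s) (by rwa [abs_neg])
  have h3 := hform 0 (by simpa using hs.le)
  have h4 := integral_log_norm_add_neg hg hg0 hss
  have h5 : ∀ t, |t| ≤ s → ∫ x : UnitAddCircle, Real.log ‖f (circ t x)‖ ≤ A := fun t ht =>
    integral_le_of_forall_le hA fun x => log_norm_le_of_norm_le_exp hA (hup _ (circ_mem ht x))
  have h6 := h5 s hss
  have h7 := h5 (-s) (by rwa [abs_neg])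
  simp only [circ_zero] at h3
  -- Second difference of Jensen's formula over the radii `e^s, 1, e^{-s}`: the zero-free factor
  -- drops out, being affine, and a zero `u` contributes `s - |log |u||`, which is at least `s/2`
  -- for those counted.
  have hsum : ∑ u ∈ Z, d u * (max s (Real.log ‖u‖) + max (-s) (Real.log ‖u‖) - 2 * max 0 (Real.log ‖u‖))
      ≤ 4 * A := by
    simp only [mul_add, mul_sub, Finset.sum_add_distrib, Finset.sum_sub_distrib]
    have e : ∀ x : ℂ, (d x : ℝ) * (2 * max 0 (Real.log ‖x‖)) = 2 * (d x * max 0 (Real.log ‖x‖)) :=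
      fun x => by ring
    simp only [e, ← Finset.mul_sum]
    linarith
  have hterm : ∀ u ∈ Z, max s (Real.log ‖u‖) + max (-s) (Real.log ‖u‖) - 2 * max 0 (Real.log ‖u‖) =
      s - |Real.log ‖u‖| := by
    intro u hu
    obtain ⟨_, ha, hb⟩ := log_norm_mem_of_mem (hZ u hu)
    rw [max_eq_left hb, max_eq_right ha]
    rcases le_total 0 (Real.log ‖u‖) with h | h
    · rw [max_eq_right h, abs_of_nonneg h]; ring
    · rw [max_eq_left h, abs_of_nonpos h]; ring
  have hlow2 : ∑ u ∈ Z with |Real.log ‖u‖| ≤ s / 2, (d u : ℝ) * (s / 2) ≤ 4 * A := by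
    refine le_trans ?_ hsum
    rw [Finset.sum_filter]
    refine Finset.sum_le_sum fun u hu => ?_
    rw [hterm u hu]
    have hb := abs_le.2 (log_norm_mem_of_mem (hZ u hu)).2
    split_ifs with hc
    · exact mul_le_mul_of_nonneg_left (by linarith) (by positivity)
    · exact mul_nonneg (by positivity) (by linarith)
  rw [← Finset.sum_mul] at hlow2
  push_cast
  rw [div_mul_eq_mul_div, le_div_iff₀ hs]
  linarith

/-- Only the zeros with `|log |u|| ≤ s/2` are divided out; Jensen's formula bounds their number by
`O(W)`. The quotient `F` has no zeros on the half annulus. Its upper bound comes from the maximum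
principle and its mean from that of `f`; together they bound `log |F|` in `L¹` on the circles of
radius `e^{±s/2}`, and the hyperbolic cosine identity turns this into Fourier decay on the unit
circle. -/
theorem exists_poleFun_decomposition {s H : ℝ} (hs : 0 < s) (hH : 0 ≤ H) :
    ∃ K : ℝ, 0 < K ∧ ∀ (W : ℝ) (f : ℂ → ℂ), 1 ≤ W → AnalyticOnNhd ℂ f (closedAnnulus s) →
      (∃ x, f (pt x) ≠ 0) → (∀ z ∈ closedAnnulus s, ‖f z‖ ≤ Real.exp (W * H)) →
      -(W * H) ≤ ∫ x : UnitAddCircle, Real.log ‖f (pt x)‖ →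
      ∃ (Z : Finset ℂ) (d : ℂ → ℕ) (h : UnitAddCircle → ℝ), (∑ u ∈ Z, d u : ℕ) ≤ K * W ∧
        Continuous h ∧
        (∀ m : ℤ, m ≠ 0 → ‖∫ x, (h x : ℂ) * pt x ^ (-m)‖ ≤ K * W * Real.exp (-(s / 2 * |(m : ℝ)|))) ∧
        (∀ x, f (pt x) ≠ 0 → (∀ u ∈ Z, pt x ≠ u) ∧
          Real.log ‖f (pt x)‖ - ∫ y : UnitAddCircle, Real.log ‖f (pt y)‖ =
            ∑ u ∈ Z, d u * poleFun u x + (h x - ∫ y, h y)) ∧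
        ∀ᵐ x : UnitAddCircle, f (pt x) ≠ 0 := by
  -- A lower bound for the distance from the boundary of the large annulus to the zeros divided out;
  -- the inner boundary circle is the closer one.
  set κ := Real.exp (-(s / 2)) - Real.exp (-s) with hκ
  have hκ0 : 0 < κ := sub_pos.2 (Real.exp_lt_exp.2 (by linarith))
  have hκ1 : κ < 1 := by
    have h1 : Real.exp (-(s / 2)) < 1 := Real.exp_lt_one_iff.2 (by linarith)
    have h2 := Real.exp_pos (-s)
    linarith
  set K₁ := 8 / s * H
  have hK₁ : 0 ≤ K₁ := by positivity
  set H₂ := H + K₁ * Real.log κ⁻¹ with hH₂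
  have hlogκ : 0 ≤ Real.log κ⁻¹ := Real.log_nonneg ((one_le_inv₀ hκ0).2 hκ1.le)
  have hH₂0 : 0 ≤ H₂ := by positivity
  refine ⟨K₁ + 2 * (3 * H₂ + 2 * H + 2 * K₁ * s) + 1, by positivity, ?_⟩
  intro W f hW hf hne hup hlow
  have hW0 : 0 < W := by linarith
  have hWH : 0 ≤ W * H := by positivity
  obtain ⟨x₀, hx₀⟩ := hne
  obtain ⟨Z, d, g, hZ, hd, hg, hg0, hfac⟩ := exists_zero_factorization hs hf ⟨_, pt_mem hs.le x₀, hx₀⟩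
  have hJ := sum_zeros_le hs hWH hZ hg hg0 hfac hup hlow
  set Zi := Z.filter fun u => |Real.log ‖u‖| ≤ s / 2 with hZi
  set Zo := Z.filter fun u => ¬ |Real.log ‖u‖| ≤ s / 2 with hZo
  have hJ' : ((∑ u ∈ Zi, d u : ℕ) : ℝ) ≤ K₁ * W := hJ.trans (le_of_eq (by simp only [K₁]; ring))
  set F : ℂ → ℂ := fun z => (∏ u ∈ Zo, (z - u) ^ d u) * g z with hFdef
  have hFan : AnalyticOnNhd ℂ F (closedAnnulus s) := fun z hz =>
    (Finset.analyticAt_fun_prod _ fun u _ => (analyticAt_id.sub analyticAt_const).pow _).mul (hg z hz)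
  have hfF : ∀ z ∈ closedAnnulus s, f z = (∏ u ∈ Zi, (z - u) ^ d u) * F z := by
    intro z hz
    rw [hfac z hz, hFdef, ← mul_assoc, Finset.prod_filter_mul_prod_filter_not]
  have hhalf : closedAnnulus (s / 2) ⊆ closedAnnulus s := fun z hz =>
    ⟨(Real.exp_le_exp.2 (by linarith)).trans hz.1, hz.2.trans (Real.exp_le_exp.2 (by linarith))⟩
  have hF0 : ∀ z ∈ closedAnnulus (s / 2), F z ≠ 0 := by
    intro z hz
    refine mul_ne_zero (Finset.prod_ne_zero_iff.2 fun u hu => pow_ne_zero _ (sub_ne_zero.2 ?_))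
      (hg0 z (hhalf hz))
    rintro rfl
    have := (Finset.mem_filter.1 hu).2
    exact this (abs_le.2 (log_norm_mem_of_mem hz).2)
  have hFan2 : AnalyticOnNhd ℂ F (closedAnnulus (s / 2)) := hFan.mono hhalf
  have hZi0 : ∀ u ∈ Zi, u ∈ closedAnnulus s := fun u hu => hZ u (Finset.mem_filter.1 hu).1
  have hbdry : ∀ z, ‖z‖ = Real.exp (-s) ∨ ‖z‖ = Real.exp s → ‖F z‖ ≤ Real.exp (W * H₂) := by
    intro z hz
    have hzs : z ∈ closedAnnulus s := by
      have : Real.exp (-s) ≤ Real.exp s := Real.exp_le_exp.2 (by linarith)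
      rcases hz with h | h <;> simp only [closedAnnulus, Set.mem_ofPred_eq, h] <;> exact ⟨by linarith, by linarith⟩
    have hdist : ∀ u ∈ Zi, κ ≤ ‖z - u‖ := by
      intro u hu
      obtain ⟨hu0, -, -⟩ := log_norm_mem_of_mem (hZi0 u hu)
      have hn := norm_pos_iff.2 hu0
      have hul := abs_le.1 (Finset.mem_filter.1 hu).2
      have hu1 := (Real.le_log_iff_exp_le hn).1 hul.1
      have hu2 := (Real.log_le_iff_le_exp hn).1 hul.2
      rcases hz with h | h
      · have := norm_sub_norm_le u z
        rw [norm_sub_rev] at this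
        linarith
      · have h1 := norm_sub_norm_le z u
        have h2 : κ ≤ Real.exp s - Real.exp (s / 2) := by
          have e1 : Real.exp s = Real.exp (3 * s / 2) * Real.exp (-(s / 2)) := by
            rw [← Real.exp_add]; congr 1; ring
          have e2 : Real.exp (s / 2) = Real.exp (3 * s / 2) * Real.exp (-s) := by
            rw [← Real.exp_add]; congr 1; ring
          rw [e1, e2, ← mul_sub, ← hκ]
          exact le_mul_of_one_le_left hκ0.le (Real.one_le_exp (by positivity))
        linarith
    have hprod : Real.exp (-(K₁ * W * Real.log κ⁻¹)) ≤ ‖∏ u ∈ Zi, (z - u) ^ d u‖ := by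
      rw [norm_prod]
      calc Real.exp (-(K₁ * W * Real.log κ⁻¹)) ≤ Real.exp (-((∑ u ∈ Zi, d u : ℕ) * Real.log κ⁻¹)) := by
            gcongr
        _ = κ ^ (∑ u ∈ Zi, d u) := by
            rw [Real.log_inv, mul_neg, neg_neg, Real.exp_nat_mul, Real.exp_log hκ0]
        _ = ∏ u ∈ Zi, κ ^ d u := (Finset.prod_pow_eq_pow_sum _ _ _).symm
        _ ≤ ∏ u ∈ Zi, ‖(z - u) ^ d u‖ := by
            refine Finset.prod_le_prod (fun _ _ => by positivity) fun u hu => ?_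
            rw [norm_pow]
            exact pow_le_pow_left₀ hκ0.le (hdist u hu) _
    have h1 := hup z hzs
    rw [hfF z hzs, norm_mul] at h1
    have h2 : Real.exp (-(K₁ * W * Real.log κ⁻¹)) * ‖F z‖ ≤ Real.exp (W * H) :=
      (mul_le_mul_of_nonneg_right hprod (norm_nonneg _)).trans h1
    rw [Real.exp_neg, inv_mul_eq_div, div_le_iff₀ (Real.exp_pos _), ← Real.exp_add] at h2
    refine h2.trans (le_of_eq ?_)
    rw [hH₂]; ring_nf
  have hFup : ∀ t, |t| ≤ s / 2 → ∀ x, Real.log ‖F (circ t x)‖ ≤ W * H₂ := by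
    intro t ht x
    refine log_norm_le_of_norm_le_exp (by positivity) (norm_le_of_norm_le_on_boundary hFan hbdry ?_ ?_)
    · rw [norm_circ, Real.exp_lt_exp]; linarith [(abs_le.1 ht).1]
    · rw [norm_circ, Real.exp_lt_exp]; linarith [(abs_le.1 ht).2]
  have hFcont : ∀ t, |t| ≤ s / 2 → Continuous fun x => Real.log ‖F (circ t x)‖ := fun t ht =>
    (continuous_comp_circ hFan2.continuousOn ht).norm.log
      fun x => norm_ne_zero_iff.2 (hF0 _ (circ_mem ht x))
  have h0half : |(0 : ℝ)| ≤ s / 2 := by simp; linarith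
  have hmean : ∫ x : UnitAddCircle, Real.log ‖f (pt x)‖ =
      ∑ u ∈ Zi, d u * max 0 (Real.log ‖u‖) + ∫ x : UnitAddCircle, Real.log ‖F (pt x)‖ := by
    have := integral_log_norm_prod_mul (Z := Zi) (d := d) (G := F) (t := 0)
      (fun u hu => (log_norm_mem_of_mem (hZi0 u hu)).1)
      (continuous_comp_circ hFan2.continuousOn h0half) fun x => hF0 _ (circ_mem h0half x)
    simp only [circ_zero] at this
    rw [← this]
    refine integral_congr_ae (.of_forall fun x => ?_)
    simp only [hfF _ (pt_mem hs.le x)]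
  have hFmean : -(W * H) - K₁ * W * s ≤ ∫ x : UnitAddCircle, Real.log ‖F (pt x)‖ := by
    have : ∑ u ∈ Zi, d u * max 0 (Real.log ‖u‖) ≤ K₁ * W * s := by
      calc ∑ u ∈ Zi, d u * max 0 (Real.log ‖u‖) ≤ ∑ u ∈ Zi, d u * s :=
            Finset.sum_le_sum fun u hu => mul_le_mul_of_nonneg_left
              (max_le hs.le (log_norm_mem_of_mem (hZi0 u hu)).2.2) (by positivity)
        _ = ((∑ u ∈ Zi, d u : ℕ) : ℝ) * s := by rw [← Finset.sum_mul]; push_cast; rfl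
        _ ≤ _ := by gcongr
    linarith
  -- An upper bound `M ≥ 0` for `v = log |F|` gives `|v| ≤ 2M - v`, so a lower bound for the mean
  -- suffices. The mean at `t` is twice that at `0` minus that at `-t`, which is bounded above.
  have hL1 : ∀ t, |t| = s / 2 → ∫ x : UnitAddCircle, |Real.log ‖F (circ t x)‖| ≤
      W * (3 * H₂ + 2 * H + 2 * K₁ * s) := by
    intro t ht
    have hle : |t| ≤ s / 2 := ht.le
    have hle' : |-t| ≤ s / 2 := by rwa [abs_neg]
    have h1 := integral_log_norm_add_neg hFan2 hF0 hle
    have h2 : ∫ x : UnitAddCircle, Real.log ‖F (circ (-t) x)‖ ≤ W * H₂ :=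
      integral_le_of_forall_le (by positivity) (hFup (-t) hle')
    have hint := integrable_of_continuous (hFcont t hle)
    have h3 : ∫ x : UnitAddCircle, |Real.log ‖F (circ t x)‖| ≤
        ∫ x : UnitAddCircle, (2 * (W * H₂) - Real.log ‖F (circ t x)‖) := by
      refine integral_mono hint.abs ((integrable_const _).sub hint) fun x => ?_
      have := hFup t hle x
      have h4 : 0 ≤ W * H₂ := by positivity
      simp only [abs_le]
      constructor <;> linarith
    rw [integral_sub (integrable_const _) hint] at h3
    simp only [integral_const, probReal_univ, smul_eq_mul, one_mul] at h3
    linarith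
  refine ⟨Zi, d, fun x => Real.log ‖F (pt x)‖, ?_, ?_, ?_, ?_, ?_⟩
  · refine hJ'.trans ?_
    gcongr
    have : 0 ≤ 3 * H₂ + 2 * H + 2 * K₁ * s := by positivity
    linarith
  · simpa using hFcont 0 h0half
  · intro m hm
    have hthalf : |s / 2| ≤ s / 2 := (abs_of_pos (by linarith)).le
    have h1 := integral_log_norm_mul_zpow_add_neg hFan2 hF0 hthalf hm
    have h2 : ∀ t, |t| = s / 2 → ‖∫ x : UnitAddCircle, (Real.log ‖F (circ t x)‖ : ℂ) * pt x ^ (-m)‖ ≤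
        W * (3 * H₂ + 2 * H + 2 * K₁ * s) := by
      intro t ht
      refine (norm_integral_le_integral_norm _).trans (le_trans (le_of_eq ?_) (hL1 t ht))
      refine integral_congr_ae (.of_forall fun x => ?_)
      simp only [norm_mul, norm_zpow, norm_pt, one_zpow, mul_one, Complex.norm_real, Real.norm_eq_abs]
    have h3 := h2 (s / 2) (abs_of_pos (by linarith))
    have h4 := h2 (-(s / 2)) (by rw [abs_neg, abs_of_pos (by linarith)])
    have h5 := norm_add_le (∫ x : UnitAddCircle, (Real.log ‖F (circ (s / 2) x)‖ : ℂ) * pt x ^ (-m))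
      (∫ x : UnitAddCircle, (Real.log ‖F (circ (-(s / 2)) x)‖ : ℂ) * pt x ^ (-m))
    rw [h1, norm_mul, ← Complex.ofReal_ofNat, ← Complex.ofReal_mul, Complex.norm_real, Real.norm_eq_abs,
      abs_of_pos (by have := Real.cosh_pos (m * (s / 2)); positivity)] at h5
    have h6 : Real.exp (s / 2 * |(m : ℝ)|) ≤ 2 * Real.cosh (m * (s / 2)) := by
      rw [← Real.cosh_abs, abs_mul, abs_of_pos (by linarith : 0 < s / 2), Real.cosh_eq, mul_comm (s / 2)]
      have := Real.exp_pos (-(|(m : ℝ)| * (s / 2)))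
      linarith
    set I := ‖∫ x : UnitAddCircle, (Real.log ‖F (pt x)‖ : ℂ) * pt x ^ (-m)‖
    have h7 : Real.exp (s / 2 * |(m : ℝ)|) * I ≤ 2 * (W * (3 * H₂ + 2 * H + 2 * K₁ * s)) := by
      refine (mul_le_mul_of_nonneg_right h6 (norm_nonneg _)).trans ?_
      linarith
    rw [Real.exp_neg, ← div_eq_mul_inv, le_div_iff₀ (Real.exp_pos _), mul_comm]
    refine h7.trans ?_
    have : 0 ≤ K₁ * W := by positivity
    linarith
  · intro x hx
    have hxm := pt_mem hs.le x
    have hne : ∀ u ∈ Zi, pt x ≠ u := by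
      intro u hu he
      apply hx
      rw [hfac _ hxm]
      have huZ := (Finset.mem_filter.1 hu).1
      rw [Finset.prod_eq_zero huZ, zero_mul]
      rw [he, sub_self, zero_pow (hd u huZ)]
    refine ⟨hne, ?_⟩
    rw [hmean, hfF _ hxm, log_norm_prod_mul hne (hF0 _ (pt_mem (by linarith) x))]
    have : ∑ u ∈ Zi, (d u : ℝ) * poleFun u x = ∑ u ∈ Zi, d u * Real.log ‖pt x - u‖ -
        ∑ u ∈ Zi, d u * max 0 (Real.log ‖u‖) := by
      rw [← Finset.sum_sub_distrib]
      refine Finset.sum_congr rfl fun u _ => ?_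
      rw [poleFun, Real.posLog]; ring
    rw [this]; ring
  · have hae : ∀ᵐ x : UnitAddCircle, ∀ u ∈ Z, pt x ≠ u :=
      (Finset.eventually_all Z).2 fun u _ => ae_ne_const pt_injective u
    filter_upwards [hae] with x hx
    rw [hfac _ (pt_mem hs.le x)]
    exact mul_ne_zero (Finset.prod_ne_zero_iff.2 fun u hu => pow_ne_zero _ (sub_ne_zero.2 (hx u hu)))
      (hg0 _ (pt_mem hs.le x))

/-! ### Birkhoff sums of `log |f|` for analytic `f` -/

theorem rotSum_sub_mul (ω : ℝ) (n : ℕ) (f : UnitAddCircle → ℝ) (c : ℝ) (x : UnitAddCircle) :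
    rotSum ω n f x - n * c = rotSum ω n (fun y => f y - c) x := by
  simp [rotSum, Finset.sum_sub_distrib]

theorem ae_forall_add {P : UnitAddCircle → Prop} (h : ∀ᵐ x, P x) (ω : ℝ) :
    ∀ᵐ x : UnitAddCircle, ∀ k : ℕ, P (x + ((k * ω : ℝ) : UnitAddCircle)) := by
  rw [ae_all_iff]
  intro k
  exact (measurePreserving_add_right volume (((k * ω : ℝ) : UnitAddCircle))).quasiMeasurePreserving.ae h

/-- Both parts follow from the splitting into `O(W)` poles and a smooth remainder. The moment
exponent must be of order `1/W` because the number of poles is. The constants `K` and `τ` depend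
neither on `f` nor on `W`, so that the bounds can later be used with `W` equal to the length of a
matrix product. -/
theorem rotSum_log_norm_bounds {α c ω s H : ℝ} (hα : 0 < α) (hc : 0 < c)
    (h : UniformDiophantine α c ω) (hs : 0 < s) (hH : 0 ≤ H) :
    ∃ K τ : ℝ, 0 < K ∧ 0 < τ ∧ ∀ (W : ℝ) (f : ℂ → ℂ), 1 ≤ W → AnalyticOnNhd ℂ f (closedAnnulus s) →
      (∃ x, f (pt x) ≠ 0) → (∀ z ∈ closedAnnulus s, ‖f z‖ ≤ Real.exp (W * H)) →
      -(W * H) ≤ ∫ x : UnitAddCircle, Real.log ‖f (pt x)‖ → ∀ n : ℕ, 2 ≤ n →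
      (∀ x : UnitAddCircle, (∀ k < n, f (pt (x + ((k * ω : ℝ) : UnitAddCircle))) ≠ 0) →
        rotSum ω n (fun x => Real.log ‖f (pt x)‖) x - n * ∫ x : UnitAddCircle, Real.log ‖f (pt x)‖ ≤
          W * (K * Real.log n ^ (α + 2))) ∧
      ∫⁻ x, ENNReal.ofReal (Real.exp (-(τ / W) * (rotSum ω n (fun x => Real.log ‖f (pt x)‖) x -
        n * ∫ x : UnitAddCircle, Real.log ‖f (pt x)‖))) ≤
          ENNReal.ofReal (Real.exp (K * Real.log n ^ (α + 2))) := by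
  obtain ⟨K₁, hK₁, hdec⟩ := exists_poleFun_decomposition hs hH
  obtain ⟨K₂, hK₂, hfou⟩ := abs_rotSum_sub_le_of_fourier hα hc (half_pos hs) h
  obtain ⟨K₃, hK₃, hpole⟩ := rotSum_poleFun_bounds hα hc h
  have hl2 : 0 < Real.log 2 := Real.log_pos (by norm_num)
  set I₂ := (Real.log 2 ^ (α + 2))⁻¹ with hI₂
  have hI₂0 : 0 < I₂ := by positivity
  refine ⟨K₁ * K₃ + K₂ * K₁ * I₂ + K₂ * I₂ + K₃, 1 / (2 * K₁), by positivity, by positivity, ?_⟩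
  intro W f hW hf hne hup hlow n hn
  have hW0 : 0 < W := by linarith
  obtain ⟨Z, d, h, hd, hhc, hhf, heq, hae⟩ := hdec W f hW hf hne hup hlow
  have hl : 1 ≤ I₂ * Real.log n ^ (α + 2) := one_le_mul_log_rpow (by positivity) hn
  have hln : 0 < Real.log n := log_natCast_pos hn
  have hlq : 0 < Real.log n ^ (α + 2) := by positivity
  have hrot := fun x => hfou (K₁ * W) h (by positivity) hhc hhf n x
  have hid : ∀ x : UnitAddCircle, (∀ k < n, f (pt (x + ((k * ω : ℝ) : UnitAddCircle))) ≠ 0) →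
      rotSum ω n (fun x => Real.log ‖f (pt x)‖) x - n * ∫ x : UnitAddCircle, Real.log ‖f (pt x)‖ =
        ∑ u ∈ Z, d u * rotSum ω n (poleFun u) x + (rotSum ω n h x - n * ∫ y, h y) := by
    intro x hx
    rw [rotSum_sub_mul, rotSum_sub_mul]
    simp only [rotSum, Finset.mul_sum]
    rw [Finset.sum_comm, ← Finset.sum_add_distrib]
    exact Finset.sum_congr rfl fun k hk => (heq _ (hx k (Finset.mem_range.1 hk))).2
  constructor
  · intro x hx
    rw [hid x hx]
    have h1 : ∑ u ∈ Z, d u * rotSum ω n (poleFun u) x ≤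
        ∑ u ∈ Z, d u * (K₃ * Real.log n ^ (α + 2)) := by
      refine Finset.sum_le_sum fun u hu => mul_le_mul_of_nonneg_left ?_ (Nat.cast_nonneg _)
      exact (hpole n hn u).1 x fun k hk => (heq _ (hx k hk)).1 u hu
    rw [← Finset.sum_mul] at h1
    have h2 : (∑ u ∈ Z, (d u : ℝ)) * (K₃ * Real.log n ^ (α + 2)) ≤
        K₁ * W * (K₃ * Real.log n ^ (α + 2)) := by
      gcongr
      exact_mod_cast hd
    have h3 := (abs_le.1 (hrot x)).2
    have h4 : K₂ * (K₁ * W) ≤ K₂ * (K₁ * W) * (I₂ * Real.log n ^ (α + 2)) :=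
      le_mul_of_one_le_right (by positivity) hl
    have h5 : 0 ≤ W * ((K₂ * I₂ + K₃) * Real.log n ^ (α + 2)) := by positivity
    nlinarith
  · have hB1 : 1 ≤ ENNReal.ofReal (Real.exp (K₃ * Real.log n ^ (α + 2))) := by
      rw [ENNReal.one_le_ofReal]
      exact Real.one_le_exp (by positivity)
    have hN : 0 < K₁ * W := by positivity
    have h1 := lintegral_exp_sum_poleFun_le hB1 (fun ζ => (hpole n hn ζ).2) Z d hN hd
    calc _ ≤ ∫⁻ x, ENNReal.ofReal (Real.exp (K₂ / 2)) * ENNReal.ofReal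
          (Real.exp (-(∑ u ∈ Z, d u * rotSum ω n (poleFun u) x) / (2 * (K₁ * W)))) := by
          refine lintegral_mono_ae ?_
          filter_upwards [ae_forall_add hae ω] with x hx
          rw [hid x fun k _ => hx k, ← ENNReal.ofReal_mul (Real.exp_pos _).le, ← Real.exp_add]
          refine ENNReal.ofReal_le_ofReal (Real.exp_le_exp.2 ?_)
          have h3 := (abs_le.1 (hrot x)).1
          set S := ∑ u ∈ Z, d u * rotSum ω n (poleFun u) x
          set T := rotSum ω n h x - n * ∫ y, h y
          have : -(1 / (2 * K₁) / W) * (S + T) = -T / (2 * (K₁ * W)) + -S / (2 * (K₁ * W)) := by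
            field_simp; ring
          rw [this]
          have : -T / (2 * (K₁ * W)) ≤ K₂ / 2 := by
            rw [div_le_iff₀ (by positivity)]; nlinarith
          linarith
      _ ≤ _ := by
        rw [lintegral_const_mul' _ _ ENNReal.ofReal_ne_top]
        refine (mul_le_mul_right h1 _).trans ?_
        rw [← ENNReal.ofReal_mul (Real.exp_pos _).le, ← Real.exp_add]
        refine ENNReal.ofReal_le_ofReal (Real.exp_le_exp.2 ?_)
        have h4 : K₂ ≤ K₂ * (I₂ * Real.log n ^ (α + 2)) := le_mul_of_one_le_right (by positivity) hl
        have h5 : 0 ≤ (K₁ * K₃ + K₂ * K₁ * I₂) * Real.log n ^ (α + 2) := by positivity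
        nlinarith

/-! ### From one analytic function to the maximum of several -/

theorem norm_pi_pow {m : ℕ} (v : Fin m → ℂ) {N : ℕ} (hN : N ≠ 0) : ‖fun i => v i ^ N‖ = ‖v‖ ^ N := by
  apply le_antisymm
  · refine (pi_norm_le_iff_of_nonneg (by positivity)).2 fun i => ?_
    rw [norm_pow]
    exact pow_le_pow_left₀ (norm_nonneg _) (norm_le_pi_norm v i) _
  · rcases isEmpty_or_nonempty (Fin m) with h | h
    · rw [Subsingleton.elim v 0]; simp [hN]
    · obtain ⟨i, hi⟩ := Finite.exists_max fun i => ‖v i‖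
      calc ‖v‖ ^ N ≤ ‖v i‖ ^ N :=
            pow_le_pow_left₀ (norm_nonneg _) ((pi_norm_le_iff_of_nonneg (norm_nonneg _)).2 hi) _
        _ = ‖v i ^ N‖ := (norm_pow _ _).symm
        _ ≤ _ := norm_le_pi_norm (fun i => v i ^ N) i

theorem natCast_le_exp_mul_log_two (m : ℕ) : (m : ℝ) ≤ Real.exp (m * Real.log 2) := by
  rw [mul_comm, Real.exp_mul, Real.exp_log (by norm_num), Real.rpow_natCast]
  exact_mod_cast m.lt_two_pow_self.le

theorem norm_sum_mul_pt_pow_le {m : ℕ} (v : Fin m → ℂ) (w : UnitAddCircle) :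
    ‖∑ i, v i * pt w ^ (i : ℕ)‖ ≤ Real.exp (m * Real.log 2) * ‖v‖ := by
  refine (norm_sum_le _ _).trans ?_
  calc ∑ i, ‖v i * pt w ^ (i : ℕ)‖ ≤ ∑ _i : Fin m, ‖v‖ := by
        refine Finset.sum_le_sum fun i _ => ?_
        rw [norm_mul, norm_pow, norm_pt, one_pow, mul_one]
        exact norm_le_pi_norm v i
    _ = m * ‖v‖ := by simp
    _ ≤ _ := by gcongr; exact natCast_le_exp_mul_log_two m

theorem log_norm_sum_mul_pt_pow_le {m : ℕ} {v : Fin m → ℂ} {w : UnitAddCircle}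
    (h : ∑ i, v i * pt w ^ (i : ℕ) ≠ 0) :
    Real.log ‖∑ i, v i * pt w ^ (i : ℕ)‖ ≤ Real.log ‖v‖ + m * Real.log 2 := by
  have h0 : v ≠ 0 := by rintro rfl; simp at h
  rw [add_comm, ← Real.log_exp (m * Real.log 2), ← Real.log_mul (Real.exp_pos _).ne'
    (norm_ne_zero_iff.2 h0)]
  refine Real.log_le_log (norm_pos_iff.2 h) ?_
  exact norm_sum_mul_pt_pow_le v w

theorem sum_mul_pt_pow_eq_eval {m : ℕ} (v : Fin m → ℂ) (z : ℂ) :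
    ∑ i, v i * z ^ (i : ℕ) = (Polynomial.ofFn m v).eval z := by
  rw [Polynomial.ofFn_eq_sum_monomial, Polynomial.eval_finsetSum]
  simp

theorem ae_sum_mul_pt_pow_ne_zero {m : ℕ} {v : Fin m → ℂ} (hv : v ≠ 0) :
    ∀ᵐ w : UnitAddCircle, ∑ i, v i * pt w ^ (i : ℕ) ≠ 0 := by
  have hp : Polynomial.ofFn m v ≠ 0 := fun h => hv (Polynomial.injective_ofFn m (by simpa using h))
  have h1 : ∀ᵐ w : UnitAddCircle, ∀ u ∈ (Polynomial.ofFn m v).roots.toFinset, pt w ≠ u := by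
    rw [Filter.eventually_all_finset]
    exact fun u _ => ae_ne_const pt_injective u
  filter_upwards [h1] with w hw h0
  rw [sum_mul_pt_pow_eq_eval] at h0
  exact hw (pt w) (by simp [hp, h0]) rfl

/-- The mean of the logarithm of a polynomial on the circle is its logarithmic Mahler measure, which
controls the coefficients up to binomial factors. A random phase `w` thus loses on average only a
constant depending on `m`. -/
theorem lintegral_log_norm_sum_mul_pt_pow_le {m : ℕ} {v : Fin m → ℂ} (hv : v ≠ 0) :
    ∫⁻ w : UnitAddCircle, ENNReal.ofReal (Real.log ‖v‖ + m * Real.log 2 -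
      Real.log ‖∑ i, v i * pt w ^ (i : ℕ)‖) ≤ ENNReal.ofReal (2 * (m * Real.log 2)) := by
  have hp : Polynomial.ofFn m v ≠ 0 := fun h => hv (Polynomial.injective_ofFn m (by simpa using h))
  set p := Polynomial.ofFn m v with hpdef
  have hm : 1 ≤ m := by
    rcases Nat.eq_zero_or_pos m with rfl | h
    · exact absurd (Subsingleton.elim v 0) hv
    · exact h
  have hcirc : ∀ w, circ 0 w = pt w := fun w => by simp [circ_zero]
  have hint : Integrable fun w : UnitAddCircle => Real.log ‖∑ i, v i * pt w ^ (i : ℕ)‖ := by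
    simp only [sum_mul_pt_pow_eq_eval]
    have h1 : CircleIntegrable (fun z => Real.log ‖p.eval z‖) 0 (Real.exp 0) := by
      rw [Real.exp_zero, circleIntegrable_def]
      exact p.intervalIntegrable_mahlerMeasure
    have h2 := h1.integrable_comp_circ (aestronglyMeasurable_log_norm
      ((p.continuous).comp (continuous_circ 0)))
    simpa only [hcirc] using h2
  have hval : ∫ w : UnitAddCircle, Real.log ‖∑ i, v i * pt w ^ (i : ℕ)‖ = Real.log p.mahlerMeasure := by
    have h1 := circleAverage_eq_integral (fun z => Real.log ‖p.eval z‖) 0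
    rw [Real.exp_zero, ← Polynomial.logMahlerMeasure_def,
      Polynomial.logMahlerMeasure_eq_log_MahlerMeasure] at h1
    rw [h1]
    simp only [hcirc, sum_mul_pt_pow_eq_eval, hpdef]
  have hlow : Real.log ‖v‖ ≤ m * Real.log 2 + Real.log p.mahlerMeasure := by
    have hpos := p.mahlerMeasure_pos_of_ne_zero hp
    rw [← Real.log_exp (m * Real.log 2), ← Real.log_mul (Real.exp_pos _).ne' hpos.ne']
    refine Real.log_le_log (norm_pos_iff.2 hv) ?_
    refine (pi_norm_le_iff_of_nonneg (by positivity)).2 fun i => ?_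
    have h1 := p.norm_coeff_le_choose_mul_mahlerMeasure i
    rw [hpdef, Polynomial.ofFn_coeff_eq_val_of_lt v i.2] at h1
    refine h1.trans (mul_le_mul_of_nonneg_right ?_ hpos.le)
    rw [mul_comm (m : ℝ), Real.exp_mul, Real.exp_log (by norm_num), Real.rpow_natCast]
    have h2 : p.natDegree ≤ m := (Polynomial.ofFn_natDegree_lt hm v).le
    calc ((p.natDegree.choose i : ℕ) : ℝ) ≤ (2 ^ p.natDegree : ℕ) := by
          exact_mod_cast Nat.choose_le_two_pow _ _
      _ ≤ (2 : ℝ) ^ m := by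
          push_cast
          exact pow_le_pow_right₀ (by norm_num) h2
  have hint2 : Integrable fun w : UnitAddCircle => Real.log ‖v‖ + m * Real.log 2 -
      Real.log ‖∑ i, v i * pt w ^ (i : ℕ)‖ := (integrable_const _).sub hint
  rw [← ofReal_integral_eq_lintegral_ofReal hint2]
  · refine ENNReal.ofReal_le_ofReal ?_
    rw [integral_sub (integrable_const _) hint, hval]
    simp
    linarith
  · filter_upwards [ae_sum_mul_pt_pow_ne_zero hv] with w hw
    have := log_norm_sum_mul_pt_pow_le hw
    simp only [Pi.zero_apply]
    linarith

/-- By Fubini the loss averaged over both `x` and `w` is bounded independently of `N`; some phase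
`w` does no worse than average and avoids the null set of bad phases. -/
theorem exists_generic_combination {m : ℕ} {f : UnitAddCircle → Fin m → ℂ} (hf : Continuous f)
    {ν : Measure UnitAddCircle} [SFinite ν] (hν : ∀ᵐ x ∂ν, f x ≠ 0) {N : ℕ} (hN : N ≠ 0) :
    ∃ w : UnitAddCircle, (∀ᵐ x ∂ν, ∑ i, f x i ^ N * pt w ^ (i : ℕ) ≠ 0) ∧
      ∫⁻ x, ENNReal.ofReal (N * Real.log ‖f x‖ + m * Real.log 2 -
        Real.log ‖∑ i, f x i ^ N * pt w ^ (i : ℕ)‖) ∂ν ≤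
          ENNReal.ofReal (2 * (m * Real.log 2)) * ν Set.univ := by
  have hc : Continuous fun q : UnitAddCircle × UnitAddCircle =>
      ∑ i, f q.1 i ^ N * pt q.2 ^ (i : ℕ) := by
    have := continuous_pt
    fun_prop
  have hm1 : Measurable fun q : UnitAddCircle × UnitAddCircle =>
      ENNReal.ofReal (N * Real.log ‖f q.1‖ + m * Real.log 2 -
        Real.log ‖∑ i, f q.1 i ^ N * pt q.2 ^ (i : ℕ)‖) := by
    have h1 : Measurable fun q : UnitAddCircle × UnitAddCircle => Real.log ‖f q.1‖ :=
      (Continuous.measurable (by fun_prop)).log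
    have h2 := (hc.norm.measurable).log
    exact (((h1.const_mul _).add_const _).sub h2).ennreal_ofReal
  have hne : ∀ x, f x ≠ 0 → (fun i => f x i ^ N) ≠ 0 := by
    intro x hx h0
    apply hx
    funext i
    have := congrFun h0 i
    simpa [hN] using this
  have h1 : ∀ᵐ w : UnitAddCircle, ∀ᵐ x ∂ν, ∑ i, f x i ^ N * pt w ^ (i : ℕ) ≠ 0 := by
    rw [← Measure.ae_ae_comm (p := fun x w => ∑ i, f x i ^ N * pt w ^ (i : ℕ) ≠ 0)]
    · filter_upwards [hν] with x hx
      exact ae_sum_mul_pt_pow_ne_zero (hne x hx)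
    · exact (hc.measurable (measurableSet_singleton 0)).compl
  have h2 : ∫⁻ w : UnitAddCircle, ∫⁻ x, ENNReal.ofReal (N * Real.log ‖f x‖ + m * Real.log 2 -
        Real.log ‖∑ i, f x i ^ N * pt w ^ (i : ℕ)‖) ∂ν ≤
          ENNReal.ofReal (2 * (m * Real.log 2)) * ν Set.univ := by
    rw [lintegral_lintegral_swap (f := fun w x => ENNReal.ofReal (N * Real.log ‖f x‖ +
      m * Real.log 2 - Real.log ‖∑ i, f x i ^ N * pt w ^ (i : ℕ)‖))
      (hm1.comp measurable_swap).aemeasurable, ← lintegral_const]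
    refine lintegral_mono_ae ?_
    filter_upwards [hν] with x hx
    have := lintegral_log_norm_sum_mul_pt_pow_le (hne x hx)
    rwa [norm_pi_pow _ hN, Real.log_pow] at this
  obtain ⟨w, hw, hle⟩ := exists_notMem_null_le_lintegral (μ := (volume : Measure UnitAddCircle))
    (hm1.lintegral_prod_left' (μ := ν)).aemeasurable (mem_ae_iff.1 h1)
  exact ⟨w, by simpa using hw, hle.trans h2⟩

theorem ae_comp_pt_ne_zero {f : ℂ → ℂ} {s : ℝ} (hs : 0 < s) (hf : AnalyticOnNhd ℂ f (closedAnnulus s))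
    (hne : ∃ x, f (pt x) ≠ 0) : ∀ᵐ x : UnitAddCircle, f (pt x) ≠ 0 := by
  obtain ⟨x₀, hx₀⟩ := hne
  obtain ⟨Z, d, g, hZ, hd, hg, hg0, hfac⟩ := exists_zero_factorization hs hf ⟨_, pt_mem hs.le x₀, hx₀⟩
  have h1 : ∀ᵐ x : UnitAddCircle, ∀ u ∈ Z, pt x ≠ u := by
    rw [Filter.eventually_all_finset]
    exact fun u _ => ae_ne_const pt_injective u
  filter_upwards [h1] with x hx
  rw [hfac _ (pt_mem hs.le x)]
  exact mul_ne_zero (Finset.prod_ne_zero_iff.2 fun u hu => pow_ne_zero _ (sub_ne_zero.2 (hx u hu)))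
    (hg0 _ (pt_mem hs.le x))

theorem continuous_comp_pt {f : ℂ → ℂ} {s : ℝ} (hs : 0 < s) (hf : AnalyticOnNhd ℂ f (closedAnnulus s)) :
    Continuous fun x => f (pt x) :=
  hf.continuousOn.comp_continuous continuous_pt (pt_mem hs.le)

theorem integrable_log_norm_comp_pt {f : ℂ → ℂ} {s : ℝ} (hs : 0 < s)
    (hf : AnalyticOnNhd ℂ f (closedAnnulus s)) :
    Integrable fun x : UnitAddCircle => Real.log ‖f (pt x)‖ := by
  have hcirc : ∀ w, circ 0 w = pt w := fun w => by simp [circ_zero]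
  have h1 : CircleIntegrable (fun z => Real.log ‖f z‖) 0 (Real.exp 0) := by
    refine MeromorphicOn.circleIntegrable_log_norm fun z hz => (hf z ?_).meromorphicAt
    have : ‖z‖ = 1 := by simpa using hz
    simp only [closedAnnulus, Set.mem_ofPred_eq, this]
    exact ⟨Real.exp_le_one_iff.2 (by linarith), Real.one_le_exp hs.le⟩
  have h2 := h1.integrable_comp_circ (aestronglyMeasurable_log_norm (by
    simpa only [hcirc] using continuous_comp_pt hs hf))
  simpa only [hcirc] using h2

theorem integrable_log_norm_pi_comp_pt {m : ℕ} {F : Fin m → ℂ → ℂ} {s : ℝ} (hs : 0 < s)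
    (hF : ∀ i, AnalyticOnNhd ℂ (F i) (closedAnnulus s)) (hne : ∃ i x, F i (pt x) ≠ 0) :
    Integrable fun x : UnitAddCircle => Real.log ‖fun i => F i (pt x)‖ := by
  obtain ⟨i, hi⟩ := hne
  have hc : Continuous fun x => fun i => F i (pt x) :=
    continuous_pi fun i => continuous_comp_pt hs (hF i)
  have h1 := integrable_log_norm_comp_pt hs (hF i)
  have h2 : Integrable fun x : UnitAddCircle => ‖fun i => F i (pt x)‖ := integrable_of_continuous hc.norm
  refine Integrable.mono' (h1.abs.add h2) (hc.norm.measurable.log.aestronglyMeasurable) ?_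
  filter_upwards [ae_comp_pt_ne_zero hs (hF i) hi] with x hx
  have h3 : ‖F i (pt x)‖ ≤ ‖fun i => F i (pt x)‖ := norm_le_pi_norm (fun i => F i (pt x)) i
  have h4 := Real.log_le_log (norm_pos_iff.2 hx) h3
  have h5 := Real.log_le_self (norm_nonneg (fun i => F i (pt x)))
  have h6 := neg_abs_le (Real.log ‖F i (pt x)‖)
  have h7 := norm_nonneg (fun i => F i (pt x))
  have h8 := abs_nonneg (Real.log ‖F i (pt x)‖)
  rw [Real.norm_eq_abs, abs_le]
  simp only [Pi.add_apply]
  constructor <;> linarith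

/-- The function `∑ F_i^N e(iw)` has log-modulus equal to `N` times the maximum of the `log |F_i|`
up to an error whose integral is bounded independently of `N`. The measure `ν` is left free so that
it can charge prescribed points besides Lebesgue measure. -/
theorem exists_generic_analytic_combination {m : ℕ} {F : Fin m → ℂ → ℂ} {s H V : ℝ} (hs : 0 < s)
    (hF : ∀ i, AnalyticOnNhd ℂ (F i) (closedAnnulus s)) (hne : ∃ i x, F i (pt x) ≠ 0)
    (hup : ∀ i, ∀ z ∈ closedAnnulus s, ‖F i z‖ ≤ Real.exp H)
    {ν : Measure UnitAddCircle} [SFinite ν] (hV : 0 ≤ V) (hνV : ν Set.univ = ENNReal.ofReal V)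
    (hle : volume ≤ ν) (hν : ∀ᵐ x ∂ν, (fun i => F i (pt x)) ≠ 0) {N : ℕ} (hN : N ≠ 0) :
    ∃ G : ℂ → ℂ, AnalyticOnNhd ℂ G (closedAnnulus s) ∧ (∀ᵐ x ∂ν, G (pt x) ≠ 0) ∧
      (∀ z ∈ closedAnnulus s, ‖G z‖ ≤ Real.exp (N * H + m * Real.log 2)) ∧
      (∀ x, G (pt x) ≠ 0 → Real.log ‖G (pt x)‖ ≤ N * Real.log ‖fun i => F i (pt x)‖ + m * Real.log 2) ∧
      N * (∫ x : UnitAddCircle, Real.log ‖fun i => F i (pt x)‖) - V * (2 * (m * Real.log 2)) ≤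
        ∫ x : UnitAddCircle, Real.log ‖G (pt x)‖ ∧
      ∫⁻ x, ENNReal.ofReal (N * Real.log ‖fun i => F i (pt x)‖ - Real.log ‖G (pt x)‖) ∂ν ≤
        ENNReal.ofReal (V * (2 * (m * Real.log 2))) := by
  have hl2 : 0 < Real.log 2 := Real.log_pos (by norm_num)
  have hκ : 0 ≤ m * Real.log 2 := by positivity
  have hc : Continuous fun x => fun i => F i (pt x) :=
    continuous_pi fun i => continuous_comp_pt hs (hF i)
  obtain ⟨w, hw, hint⟩ := exists_generic_combination hc hν hN
  have hGan : AnalyticOnNhd ℂ (fun z => ∑ i, F i z ^ N * pt w ^ (i : ℕ)) (closedAnnulus s) :=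
    fun z hz => Finset.analyticAt_fun_sum _ fun i _ => ((hF i z hz).pow _).mul analyticAt_const
  have hle1 : ∀ x, ∑ i, F i (pt x) ^ N * pt w ^ (i : ℕ) ≠ 0 →
      Real.log ‖∑ i, F i (pt x) ^ N * pt w ^ (i : ℕ)‖ ≤
        N * Real.log ‖fun i => F i (pt x)‖ + m * Real.log 2 := by
    intro x hx
    have := log_norm_sum_mul_pt_pow_le (v := fun i => F i (pt x) ^ N) hx
    rwa [norm_pi_pow _ hN, Real.log_pow] at this
  refine ⟨fun z => ∑ i, F i z ^ N * pt w ^ (i : ℕ), hGan, hw, fun z hz => ?_, hle1, ?_, ?_⟩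
  · refine (norm_sum_mul_pt_pow_le (fun i => F i z ^ N) w).trans ?_
    rw [add_comm, Real.exp_add]
    gcongr
    refine (pi_norm_le_iff_of_nonneg (by positivity)).2 fun i => ?_
    rw [norm_pow, Real.exp_nat_mul]
    exact pow_le_pow_left₀ (norm_nonneg _) (hup i z hz) _
  · have hu := integrable_log_norm_pi_comp_pt hs hF hne
    have hg := integrable_log_norm_comp_pt hs hGan
    have hint4 : Integrable fun x : UnitAddCircle => N * Real.log ‖fun i => F i (pt x)‖ +
        m * Real.log 2 := (hu.const_mul _).add (integrable_const _)
    have hint3 : Integrable fun x : UnitAddCircle => N * Real.log ‖fun i => F i (pt x)‖ +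
        m * Real.log 2 - Real.log ‖∑ i, F i (pt x) ^ N * pt w ^ (i : ℕ)‖ := hint4.sub hg
    have h1 := (lintegral_mono' hle le_rfl).trans hint
    rw [hνV, ← ENNReal.ofReal_mul (by positivity), ← ofReal_integral_eq_lintegral_ofReal hint3,
      ENNReal.ofReal_le_ofReal_iff (by positivity),
      integral_sub hint4 hg, integral_add (hu.const_mul _) (integrable_const _), integral_const_mul] at h1
    · simp only [integral_const, probReal_univ, smul_eq_mul, one_mul] at h1
      linarith
    · filter_upwards [hle.absolutelyContinuous.ae_le hw] with x hx
      have := hle1 x hx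
      simp only [Pi.zero_apply]
      linarith
  · refine le_trans (lintegral_mono fun x => ENNReal.ofReal_le_ofReal ?_) (hint.trans (le_of_eq ?_))
    · linarith
    · rw [hνV, ← ENNReal.ofReal_mul (by positivity), mul_comm]

/-- The scalar theorem is applied to a generic combination of `N`-th powers, with `N W` in place of
`W`. After division by `N` the main terms do not depend on `N`, while the approximation errors are
`O(1/N)` and vanish as `N → ∞`. -/
theorem rotSum_log_norm_pi_bounds {α c ω s H : ℝ} (m : ℕ) (hα : 0 < α) (hc : 0 < c)
    (h : UniformDiophantine α c ω) (hs : 0 < s) (hH : 0 ≤ H) :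
    ∃ K τ : ℝ, 0 < K ∧ 0 < τ ∧ ∀ (W : ℝ) (F : Fin m → ℂ → ℂ), 1 ≤ W →
      (∀ i, AnalyticOnNhd ℂ (F i) (closedAnnulus s)) → (∃ i x, F i (pt x) ≠ 0) →
      (∀ i, ∀ z ∈ closedAnnulus s, ‖F i z‖ ≤ Real.exp (W * H)) →
      -(W * H) ≤ ∫ x : UnitAddCircle, Real.log ‖fun i => F i (pt x)‖ → ∀ n : ℕ, 2 ≤ n →
      (∀ x : UnitAddCircle, (∀ k < n, (fun i => F i (pt (x + ((k * ω : ℝ) : UnitAddCircle)))) ≠ 0) →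
        rotSum ω n (fun x => Real.log ‖fun i => F i (pt x)‖) x -
          n * ∫ x : UnitAddCircle, Real.log ‖fun i => F i (pt x)‖ ≤ W * (K * Real.log n ^ (α + 2))) ∧
      ∫⁻ x, ENNReal.ofReal (Real.exp (-(τ / W) *
        (rotSum ω n (fun x => Real.log ‖fun i => F i (pt x)‖) x -
          n * ∫ x : UnitAddCircle, Real.log ‖fun i => F i (pt x)‖))) ≤
          ENNReal.ofReal (Real.exp (K * Real.log n ^ (α + 2))) := by
  have hl2 : 0 < Real.log 2 := Real.log_pos (by norm_num)
  set κ := m * Real.log 2 with hκdef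
  have hκ : 0 ≤ κ := by positivity
  -- The slack `2κ` pays for the loss `V (2κ)` in the mean, given `V ≤ N`, and for the factor `2^m`
  -- in the sup bound. It keeps the scalar constants independent of `N`.
  obtain ⟨K, τ, hK, hτ, hscal⟩ := rotSum_log_norm_bounds (H := H + 2 * κ) hα hc h hs (by positivity)
  refine ⟨K, τ, hK, hτ, ?_⟩
  intro W F hW hF hne hup hlow n hn
  have hW0 : 0 < W := by linarith
  obtain ⟨i₀, hi₀⟩ := id hne
  have hu := integrable_log_norm_pi_comp_pt hs hF hne
  have haeF : ∀ᵐ x : UnitAddCircle, (fun i => F i (pt x)) ≠ 0 := by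
    filter_upwards [ae_comp_pt_ne_zero hs (hF i₀) hi₀] with x hx h0
    exact hx (congrFun h0 i₀)
  set u : UnitAddCircle → ℝ := fun x => Real.log ‖fun i => F i (pt x)‖ with hudef
  set I := ∫ x, u x with hI
  -- the approximation at stage `N`
  have key : ∀ (ν : Measure UnitAddCircle) [SFinite ν] (V : ℝ), 1 ≤ V → ν Set.univ = ENNReal.ofReal V →
      volume ≤ ν → (∀ᵐ x ∂ν, (fun i => F i (pt x)) ≠ 0) → ∀ N : ℕ, V ≤ N → ∃ G : ℂ → ℂ,
        (∀ᵐ x ∂ν, G (pt x) ≠ 0) ∧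
        (∀ x, G (pt x) ≠ 0 → Real.log ‖G (pt x)‖ ≤ N * u x + κ) ∧
        N * I - V * (2 * κ) ≤ ∫ x : UnitAddCircle, Real.log ‖G (pt x)‖ ∧
        (∫ x : UnitAddCircle, Real.log ‖G (pt x)‖) ≤ N * I + κ ∧
        ∫⁻ x, ENNReal.ofReal (N * u x - Real.log ‖G (pt x)‖) ∂ν ≤ ENNReal.ofReal (V * (2 * κ)) ∧
        (∀ x : UnitAddCircle, (∀ k < n, G (pt (x + ((k * ω : ℝ) : UnitAddCircle))) ≠ 0) →
          rotSum ω n (fun x => Real.log ‖G (pt x)‖) x - n * ∫ x : UnitAddCircle, Real.log ‖G (pt x)‖ ≤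
            (N * W) * (K * Real.log n ^ (α + 2))) ∧
        ∫⁻ x, ENNReal.ofReal (Real.exp (-(τ / (N * W)) * (rotSum ω n (fun x => Real.log ‖G (pt x)‖) x -
          n * ∫ x : UnitAddCircle, Real.log ‖G (pt x)‖))) ≤
            ENNReal.ofReal (Real.exp (K * Real.log n ^ (α + 2))) := by
    intro ν _ V hV hνV hle hν N hVN
    have hN1 : (1 : ℝ) ≤ N := hV.trans hVN
    have hN0 : N ≠ 0 := by rintro rfl; norm_num at hN1
    obtain ⟨G, hGan, hG0, hGup, hGle, hGint, hGl⟩ := exists_generic_analytic_combination hs hF hne hup (by linarith) hνV hle hν hN0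
    have hGae : ∀ᵐ x : UnitAddCircle, G (pt x) ≠ 0 := hle.absolutelyContinuous.ae_le hG0
    have hNW : 1 ≤ N * W := one_le_mul_of_one_le_of_one_le hN1 hW
    have hκNW : κ ≤ N * W * κ := le_mul_of_one_le_left hκ hNW
    have h1 := hscal (N * W) G hNW hGan (by
        obtain ⟨x, hx⟩ := hGae.exists
        exact ⟨x, hx⟩)
      (fun z hz => (hGup z hz).trans (Real.exp_le_exp.2 (by nlinarith))) (by
        refine le_trans ?_ hGint
        have a1 : N * (-(W * H)) ≤ N * I := mul_le_mul_of_nonneg_left hlow (by positivity)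
        have a2 : V * (2 * κ) ≤ N * W * (2 * κ) := by
          refine mul_le_mul_of_nonneg_right ?_ (by positivity)
          nlinarith
        linarith) n hn
    refine ⟨G, hG0, hGle, hGint, ?_, hGl, h1.1, h1.2⟩
    have h2 := integral_mono_ae (integrable_log_norm_comp_pt hs hGan)
      ((hu.const_mul (N : ℝ)).add (integrable_const κ)) (hGae.mono fun x hx => hGle x hx)
    refine h2.trans (le_of_eq ?_)
    simp only [Pi.add_apply]
    rw [integral_add (hu.const_mul _) (integrable_const _), integral_const_mul]
    simp [hI]
  constructor
  · intro x₀ hx₀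
    -- Unit masses at the orbit points make the phase `w` generic there too: an integral bound
    -- against `ν` then bounds the loss at each of these points.
    set ν : Measure UnitAddCircle :=
      volume + ∑ k ∈ Finset.range n, Measure.dirac (x₀ + ((k * ω : ℝ) : UnitAddCircle)) with hν
    have hνV : ν Set.univ = ENNReal.ofReal (1 + n) := by
      rw [ENNReal.ofReal_add (by norm_num) (by positivity)]
      simp [hν]
    have hle : volume ≤ ν := Measure.le_add_right le_rfl
    have hdle : ∀ k < n, Measure.dirac (x₀ + ((k * ω : ℝ) : UnitAddCircle)) ≤ ν := by
      intro k hk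
      refine le_trans ?_ (Measure.le_add_left le_rfl)
      exact Finset.single_le_sum (f := fun k : ℕ => Measure.dirac (x₀ + ((k * ω : ℝ) : UnitAddCircle)))
        (fun _ _ => Measure.zero_le _) (Finset.mem_range.2 hk)
    have hae : ∀ᵐ x ∂ν, (fun i => F i (pt x)) ≠ 0 := by
      rw [hν, ae_add_measure_iff]
      refine ⟨haeF, ?_⟩
      rw [ae_finsetSum_measure_iff]
      intro k hk
      rw [ae_dirac_eq]
      exact hx₀ k (Finset.mem_range.1 hk)
    have hN : ∀ N : ℕ, (1 + n : ℝ) ≤ N → rotSum ω n u x₀ - n * I ≤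
        W * (K * Real.log n ^ (α + 2)) + n * ((1 + n) * (2 * κ) + κ) / N := by
      intro N hnN
      have hN0 : (0 : ℝ) < N := by linarith [(Nat.cast_nonneg n : (0 : ℝ) ≤ n)]
      obtain ⟨G, hG0, hGle, hGint, hGint2, hGl, hGi, -⟩ := key ν (1 + n) (by simp) hνV hle hae N hnN
      have h1 : ∀ k < n, G (pt (x₀ + ((k * ω : ℝ) : UnitAddCircle))) ≠ 0 := by
        intro k hk
        have := (hdle k hk).absolutelyContinuous.ae_le hG0
        rw [ae_dirac_eq] at this
        exact this
      have h2 : ∀ k < n, N * u (x₀ + ((k * ω : ℝ) : UnitAddCircle)) -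
          Real.log ‖G (pt (x₀ + ((k * ω : ℝ) : UnitAddCircle)))‖ ≤ (1 + n) * (2 * κ) := by
        intro k hk
        have := (lintegral_mono' (hdle k hk) le_rfl).trans hGl
        rw [lintegral_dirac] at this
        exact (ENNReal.ofReal_le_ofReal_iff (by positivity)).1 this
      have h3 := hGi x₀ h1
      have h4 : N * rotSum ω n u x₀ ≤ rotSum ω n (fun x => Real.log ‖G (pt x)‖) x₀ +
          n * ((1 + n) * (2 * κ)) := by
        have : ∑ k ∈ Finset.range n, (N * u (x₀ + ((k * ω : ℝ) : UnitAddCircle)) -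
          Real.log ‖G (pt (x₀ + ((k * ω : ℝ) : UnitAddCircle)))‖) ≤
            ∑ _k ∈ Finset.range n, (1 + n) * (2 * κ) :=
          Finset.sum_le_sum fun k hk => h2 k (Finset.mem_range.1 hk)
        rw [Finset.sum_sub_distrib, ← Finset.mul_sum] at this
        simp only [Finset.sum_const, Finset.card_range, nsmul_eq_mul] at this
        simp only [rotSum]
        linarith
      have h5 : n * (∫ x : UnitAddCircle, Real.log ‖G (pt x)‖) ≤ n * (N * I + κ) := by gcongr
      rw [← sub_le_iff_le_add', le_div_iff₀ hN0]
      nlinarith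
    have hlim : Tendsto (fun N : ℕ => W * (K * Real.log n ^ (α + 2)) +
        n * ((1 + n) * (2 * κ) + κ) / N) atTop (𝓝 (W * (K * Real.log n ^ (α + 2)) + 0)) :=
      tendsto_const_nhds.add (tendsto_const_div_atTop_nhds_zero_nat _)
    rw [add_zero] at hlim
    refine ge_of_tendsto hlim ?_
    filter_upwards [eventually_ge_atTop (1 + n)] with N hN'
    exact hN N (by exact_mod_cast hN')
  · have hN : ∀ N : ℕ, 1 ≤ N → ∫⁻ x, ENNReal.ofReal (Real.exp (-(τ / W) * (rotSum ω n u x - n * I))) ≤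
        ENNReal.ofReal (Real.exp (K * Real.log n ^ (α + 2) + (τ / W * (n * (3 * κ))) / N)) := by
      intro N hN1
      have hN0 : (0 : ℝ) < N := by positivity
      obtain ⟨G, hG0, hGle, hGint, -, -, -, hGi⟩ := key volume 1 le_rfl (by simp) le_rfl haeF N
        (by exact_mod_cast hN1)
      set J := ∫ x : UnitAddCircle, Real.log ‖G (pt x)‖
      rw [add_comm, Real.exp_add, ENNReal.ofReal_mul (Real.exp_pos _).le]
      refine le_trans ?_ (mul_le_mul_right hGi _)
      rw [← lintegral_const_mul' _ _ ENNReal.ofReal_ne_top]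
      refine lintegral_mono_ae ?_
      filter_upwards [ae_forall_add hG0 ω] with x hx
      rw [← ENNReal.ofReal_mul (Real.exp_pos _).le, ← Real.exp_add]
      refine ENNReal.ofReal_le_ofReal (Real.exp_le_exp.2 ?_)
      have h4 : rotSum ω n (fun x => Real.log ‖G (pt x)‖) x ≤ N * rotSum ω n u x + n * κ := by
        have : ∑ k ∈ Finset.range n, Real.log ‖G (pt (x + ((k * ω : ℝ) : UnitAddCircle)))‖ ≤
            ∑ k ∈ Finset.range n, (N * u (x + ((k * ω : ℝ) : UnitAddCircle)) + κ) :=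
          Finset.sum_le_sum fun k _ => hGle _ (hx k)
        rw [Finset.sum_add_distrib, ← Finset.mul_sum] at this
        simp only [Finset.sum_const, Finset.card_range, nsmul_eq_mul] at this
        exact this
      have h5 : n * (N * I - 2 * κ) ≤ n * J := by
        gcongr
        linarith
      have h6 : τ / (N * W) * (rotSum ω n (fun x => Real.log ‖G (pt x)‖) x - n * J) ≤
          τ / (N * W) * (N * (rotSum ω n u x - n * I) + n * (3 * κ)) :=
        mul_le_mul_of_nonneg_left (by linarith) (by positivity)
      have h7 : τ / (N * W) * (N * (rotSum ω n u x - n * I) + n * (3 * κ)) =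
          τ / W * (rotSum ω n u x - n * I) + τ / W * (n * (3 * κ)) / N := by
        field_simp
      linarith
    have hlim : Tendsto (fun N : ℕ => ENNReal.ofReal (Real.exp (K * Real.log n ^ (α + 2) +
        (τ / W * (n * (3 * κ))) / N))) atTop
        (𝓝 (ENNReal.ofReal (Real.exp (K * Real.log n ^ (α + 2) + 0)))) :=
      ENNReal.tendsto_ofReal ((Real.continuous_exp.tendsto _).comp
        (tendsto_const_nhds.add (tendsto_const_div_atTop_nhds_zero_nat _)))
    rw [add_zero] at hlim
    refine ge_of_tendsto hlim ?_
    filter_upwards [eventually_ge_atTop 1] with N hN'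
    exact hN N hN'

/-! ### The entry norm and the avalanche principle -/

/-- Twice the largest absolute value of an entry of a `2 × 2` matrix. -/
noncomputable def entryNorm (A : Matrix (Fin 2) (Fin 2) ℂ) : ℝ :=
  2 * ‖fun i : Fin (2 * 2) => A (finProdFinEquiv.symm i).1 (finProdFinEquiv.symm i).2‖

theorem norm_entry_le_entryNorm (A : Matrix (Fin 2) (Fin 2) ℂ) (i j : Fin 2) :
    2 * ‖A i j‖ ≤ entryNorm A := by
  have := norm_le_pi_norm
    (fun i : Fin (2 * 2) => A (finProdFinEquiv.symm i).1 (finProdFinEquiv.symm i).2) (finProdFinEquiv (i, j))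
  simp only [Equiv.symm_apply_apply] at this
  rw [entryNorm]
  linarith

theorem entryNorm_le {A : Matrix (Fin 2) (Fin 2) ℂ} {c : ℝ} (h : ∀ i j, 2 * ‖A i j‖ ≤ c) :
    entryNorm A ≤ c := by
  have hc : 0 ≤ c := (by positivity : 0 ≤ 2 * ‖A 0 0‖).trans (h 0 0)
  have : ‖fun i : Fin (2 * 2) => A (finProdFinEquiv.symm i).1 (finProdFinEquiv.symm i).2‖ ≤ c / 2 :=
    (pi_norm_le_iff_of_nonneg (by linarith)).2 fun i => by linarith [h (finProdFinEquiv.symm i).1 (finProdFinEquiv.symm i).2]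
  rw [entryNorm]
  linarith

theorem exists_entryNorm_eq (A : Matrix (Fin 2) (Fin 2) ℂ) : ∃ i j, entryNorm A = 2 * ‖A i j‖ := by
  obtain ⟨⟨i, j⟩, hij⟩ := Finite.exists_max fun p : Fin 2 × Fin 2 => ‖A p.1 p.2‖
  refine ⟨i, j, le_antisymm (entryNorm_le fun k l => ?_) (norm_entry_le_entryNorm A i j)⟩
  have := hij (k, l)
  simp only at this
  linarith

theorem entryNorm_nonneg (A : Matrix (Fin 2) (Fin 2) ℂ) : 0 ≤ entryNorm A := by
  rw [entryNorm]; positivity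

theorem entryNorm_eq_zero_iff {A : Matrix (Fin 2) (Fin 2) ℂ} : entryNorm A = 0 ↔ A = 0 := by
  constructor
  · intro h
    ext i j
    have := norm_entry_le_entryNorm A i j
    rw [h] at this
    simpa using (show ‖A i j‖ ≤ 0 by linarith)
  · rintro rfl
    obtain ⟨i, j, h⟩ := exists_entryNorm_eq 0
    simpa using h

theorem entryNorm_pos {A : Matrix (Fin 2) (Fin 2) ℂ} (h : A.det ≠ 0) : 0 < entryNorm A := by
  refine (entryNorm_nonneg A).lt_of_ne' fun h0 => h ?_
  rw [entryNorm_eq_zero_iff.1 h0]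
  simp

/-- The factor two in the norm absorbs the two terms of each entry of a product. A maximum of
entries is used instead of the operator norm so that the bounds for maxima of analytic functions
apply directly. -/
theorem entryNorm_mul_le (A B : Matrix (Fin 2) (Fin 2) ℂ) :
    entryNorm (A * B) ≤ entryNorm A * entryNorm B := by
  refine entryNorm_le fun i j => ?_
  rw [Matrix.mul_apply, Fin.sum_univ_two]
  have h := norm_add_le (A i 0 * B 0 j) (A i 1 * B 1 j)
  rw [norm_mul, norm_mul] at h
  have h0 := mul_le_mul (norm_entry_le_entryNorm A i 0) (norm_entry_le_entryNorm B 0 j) (by positivity)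
    (entryNorm_nonneg A)
  have h1 := mul_le_mul (norm_entry_le_entryNorm A i 1) (norm_entry_le_entryNorm B 1 j) (by positivity)
    (entryNorm_nonneg A)
  linarith

theorem entryNorm_smul (c : ℂ) (A : Matrix (Fin 2) (Fin 2) ℂ) :
    entryNorm (c • A) = ‖c‖ * entryNorm A := by
  have : (fun i : Fin (2 * 2) => (c • A) (finProdFinEquiv.symm i).1 (finProdFinEquiv.symm i).2) =
      c • fun i : Fin (2 * 2) => A (finProdFinEquiv.symm i).1 (finProdFinEquiv.symm i).2 := rfl
  rw [entryNorm, entryNorm, this, norm_smul]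
  ring

theorem norm_det_le_entryNorm_sq (A : Matrix (Fin 2) (Fin 2) ℂ) : ‖A.det‖ ≤ entryNorm A ^ 2 := by
  rw [Matrix.det_fin_two]
  have h := norm_sub_le (A 0 0 * A 1 1) (A 0 1 * A 1 0)
  rw [norm_mul, norm_mul] at h
  have h0 := mul_le_mul (norm_entry_le_entryNorm A 0 0) (norm_entry_le_entryNorm A 1 1) (by positivity)
    (entryNorm_nonneg A)
  have h1 := mul_le_mul (norm_entry_le_entryNorm A 0 1) (norm_entry_le_entryNorm A 1 0) (by positivity)
    (entryNorm_nonneg A)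
  have h2 := sq_nonneg (entryNorm A)
  nlinarith

theorem entryNorm_adjugate (A : Matrix (Fin 2) (Fin 2) ℂ) : entryNorm A.adjugate = entryNorm A := by
  have key : ∀ A : Matrix (Fin 2) (Fin 2) ℂ, entryNorm A.adjugate ≤ entryNorm A := by
    intro A
    have h := norm_entry_le_entryNorm A
    refine entryNorm_le fun i j => ?_
    rw [Matrix.adjugate_fin_two]
    fin_cases i <;> fin_cases j <;> simp [h]
  refine le_antisymm (key A) ?_
  have := key A.adjugate
  rwa [Matrix.adjugate_adjugate' A, Fintype.card_fin, Nat.sub_self, pow_zero, one_smul] at this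

/-- Multiplication by the adjugate, which has the same entry norm, cancels a factor at the price of
its determinant. -/
theorem norm_det_mul_entryNorm_le (A B : Matrix (Fin 2) (Fin 2) ℂ) :
    ‖A.det‖ * entryNorm B ≤ entryNorm A * entryNorm (A * B) := by
  rw [← entryNorm_smul, ← entryNorm_adjugate A]
  refine le_trans (le_of_eq ?_) (entryNorm_mul_le _ _)
  rw [← mul_assoc, Matrix.adjugate_mul, smul_mul_assoc, one_mul]

theorem norm_det_mul_entryNorm_le' (A B : Matrix (Fin 2) (Fin 2) ℂ) :
    ‖A.det‖ * entryNorm B ≤ entryNorm (B * A) * entryNorm A := by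
  rw [← entryNorm_smul, ← entryNorm_adjugate A]
  refine le_trans (le_of_eq ?_) (entryNorm_mul_le _ _)
  rw [mul_assoc, Matrix.mul_adjugate, mul_smul_comm, mul_one]

/-- For `B` of rank one the difference vanishes. In general it equals, up to sign, `det B` times an
entry of `A` times an entry of `C`; in `Fin 2` the index `k + 1` is the one other than `k`. -/
theorem norm_entry_mul_sub_le (A B C : Matrix (Fin 2) (Fin 2) ℂ) (i j k l : Fin 2) :
    4 * ‖(A * B * C) i j * B k l - (A * B) i l * (B * C) k j‖ ≤ ‖B.det‖ * entryNorm A * entryNorm C := by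
  have h : ‖(A * B * C) i j * B k l - (A * B) i l * (B * C) k j‖ =
      ‖B.det‖ * ‖A i (k + 1)‖ * ‖C (l + 1) j‖ := by
    simp only [Matrix.mul_apply, Fin.sum_univ_two, Matrix.det_fin_two]
    fin_cases k <;> fin_cases l <;> simp <;> rw [← norm_mul, ← norm_mul] <;>
      first
      | (refine congrArg norm ?_; ring1)
      | (rw [← norm_neg]; refine congrArg norm ?_; ring1)
  rw [h]
  have h0 := mul_le_mul (norm_entry_le_entryNorm A i (k + 1)) (norm_entry_le_entryNorm C (l + 1) j)
    (by positivity) (entryNorm_nonneg A)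
  have h1 := mul_le_mul_of_nonneg_left h0 (norm_nonneg B.det)
  linarith

theorem abs_entryNorm_mul_sub_le (A B C : Matrix (Fin 2) (Fin 2) ℂ) :
    |entryNorm (A * B * C) * entryNorm B - entryNorm (A * B) * entryNorm (B * C)| ≤
      ‖B.det‖ * entryNorm A * entryNorm C := by
  rw [abs_le]
  constructor
  · obtain ⟨i, l, h1⟩ := exists_entryNorm_eq (A * B)
    obtain ⟨k, j, h2⟩ := exists_entryNorm_eq (B * C)
    have h3 := norm_entry_mul_sub_le A B C i j k l
    have h4 := norm_sub_norm_le ((A * B) i l * (B * C) k j) ((A * B * C) i j * B k l)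
    rw [norm_sub_rev ((A * B) i l * (B * C) k j), norm_mul, norm_mul] at h4
    have h5 := mul_le_mul (norm_entry_le_entryNorm (A * B * C) i j) (norm_entry_le_entryNorm B k l)
      (by positivity) (entryNorm_nonneg _)
    rw [h1, h2]
    linarith
  · obtain ⟨i, j, h1⟩ := exists_entryNorm_eq (A * B * C)
    obtain ⟨k, l, h2⟩ := exists_entryNorm_eq B
    have h3 := norm_entry_mul_sub_le A B C i j k l
    have h4 := norm_sub_norm_le ((A * B * C) i j * B k l) ((A * B) i l * (B * C) k j)
    rw [norm_mul, norm_mul] at h4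
    have h5 := mul_le_mul (norm_entry_le_entryNorm (A * B) i l) (norm_entry_le_entryNorm (B * C) k j)
      (by positivity) (entryNorm_nonneg _)
    rw [h1, h2]
    linarith

theorem abs_log_sub_log_le {x y m e : ℝ} (hm : 0 < m) (hx : m ≤ x) (hy : m ≤ y) (h : |x - y| ≤ e) :
    |Real.log x - Real.log y| ≤ e / m := by
  have key : ∀ {x y : ℝ}, m ≤ x → m ≤ y → |x - y| ≤ e → Real.log x - Real.log y ≤ e / m := by
    intro x y hx hy h
    have hy0 : 0 < y := hm.trans_le hy
    rw [← Real.log_div (hm.trans_le hx).ne' hy0.ne']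
    refine (Real.log_le_sub_one_of_pos (div_pos (hm.trans_le hx) hy0)).trans ?_
    rw [div_sub_one hy0.ne']
    have he : 0 ≤ e := (abs_nonneg _).trans h
    calc (x - y) / y ≤ e / y := by gcongr; exact (le_abs_self _).trans h
      _ ≤ e / m := by gcongr
  exact abs_sub_le_iff.2 ⟨key hx hy h, key hy hx (by rwa [abs_sub_comm])⟩

/-- A form of the avalanche principle for `2 × 2` matrices. -/
theorem avalanche {B P : ℕ → Matrix (Fin 2) (Fin 2) ℂ} (hP1 : P 1 = B 0)
    (hP : ∀ j, P (j + 1) = B j * P j) {η κ : ℝ} (hη : 0 < η) (hκ : 0 ≤ κ) (hκη : 4 * κ ≤ η ^ 2) {m : ℕ}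
    (hB : ∀ j < m, 0 < entryNorm (B j)) (hdet : ∀ j < m, ‖(B j).det‖ ≤ κ * entryNorm (B j) ^ 2)
    (hBB : ∀ j, j + 1 < m → η * (entryNorm (B (j + 1)) * entryNorm (B j)) ≤ entryNorm (B (j + 1) * B j))
    (hm : 2 ≤ m) :
    |Real.log (entryNorm (P m)) - (∑ j ∈ Finset.range (m - 1), Real.log (entryNorm (B (j + 1) * B j)) -
      ∑ j ∈ Finset.range (m - 2), Real.log (entryNorm (B (j + 1))))| ≤ (4 * κ / η ^ 2) * m := by
  -- The induction carries the non-cancellation `‖P_{j+2}‖ ≥ (η/2) ‖B_{j+1}‖ ‖P_{j+1}‖`, which makes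
  -- the determinant error relatively small at the next step.
  have key : ∀ j, j + 2 ≤ m → 0 < entryNorm (P (j + 1)) ∧
      η / 2 * (entryNorm (B (j + 1)) * entryNorm (P (j + 1))) ≤ entryNorm (P (j + 2)) ∧
      |Real.log (entryNorm (P (j + 2))) -
        (∑ i ∈ Finset.range (j + 1), Real.log (entryNorm (B (i + 1) * B i)) -
          ∑ i ∈ Finset.range j, Real.log (entryNorm (B (i + 1))))| ≤ (4 * κ / η ^ 2) * j := by
    intro j
    induction j with
    | zero =>
      intro hj
      have h2 : P 2 = B 1 * B 0 := by rw [hP 1, hP1]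
      have h0 := hB 0 (by omega)
      have h1 := hB 1 (by omega)
      have h3 := hBB 0 (by omega)
      have h4 : 0 ≤ η * (entryNorm (B 1) * entryNorm (B 0)) := by positivity
      refine ⟨by simpa [hP1] using h0, ?_, by simp [h2]⟩
      simp only [zero_add, hP1, h2] at h3 ⊢
      linarith
    | succ j ih =>
      intro hj
      obtain ⟨hp, hlow, hlog⟩ := ih (by omega)
      have hb1 := hB (j + 1) (by omega)
      have hb2 := hB (j + 2) (by omega)
      have hp2 : 0 < entryNorm (P (j + 2)) := lt_of_lt_of_le (by positivity) hlow
      have hap := abs_entryNorm_mul_sub_le (B (j + 2)) (B (j + 1)) (P (j + 1))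
      rw [mul_assoc, ← hP, ← hP] at hap
      set b1 := entryNorm (B (j + 1))
      set b2 := entryNorm (B (j + 2))
      set p1 := entryNorm (P (j + 1))
      set p2 := entryNorm (P (j + 2))
      set p3 := entryNorm (P (j + 3))
      set d := entryNorm (B (j + 2) * B (j + 1))
      have hd : η * (b2 * b1) ≤ d := hBB (j + 1) (by omega)
      have hd0 : 0 < d := lt_of_lt_of_le (by positivity) hd
      have he : ‖(B (j + 1)).det‖ * b2 * p1 ≤ 2 * κ / η * (b1 * b2 * p2) := by
        have h1 : ‖(B (j + 1)).det‖ * b2 * p1 ≤ κ * b1 ^ 2 * b2 * p1 := by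
          gcongr
          exact hdet (j + 1) (by omega)
        have h2 : κ * b1 ^ 2 * b2 * p1 = 2 * κ / η * b1 * b2 * (η / 2 * (b1 * p1)) := by
          field_simp
        have h3 : 2 * κ / η * b1 * b2 * (η / 2 * (b1 * p1)) ≤ 2 * κ / η * b1 * b2 * p2 := by gcongr
        linarith
      have hbound := hap.trans he
      have hx2 : η * (b1 * b2 * p2) ≤ d * p2 := by
        have := mul_le_mul_of_nonneg_right hd hp2.le
        linarith
      -- This is where `4κ ≤ η²` enters: the error is at most half the main term, so
      -- non-cancellation persists with `η/2` and never degrades further.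
      have hκ2 : 2 * κ / η ≤ η / 2 := by
        rw [div_le_iff₀ hη]; nlinarith
      have hbbp : 0 < b1 * b2 * p2 := by positivity
      have hx1 : η / 2 * (b1 * b2 * p2) ≤ p3 * b1 := by
        have h1 := (abs_le.1 hbound).1
        have h2 := mul_le_mul_of_nonneg_right hκ2 hbbp.le
        linarith
      have hx3 : η / 2 * (b1 * b2 * p2) ≤ d * p2 := by
        have : 0 ≤ η / 2 * (b1 * b2 * p2) := by positivity
        linarith
      have hl := abs_log_sub_log_le (by positivity) hx1 hx3 hbound
      have hp3 : 0 < p3 := by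
        by_contra hcon
        have := mul_nonpos_of_nonpos_of_nonneg (not_lt.1 hcon) hb1.le
        have h3 : 0 < η / 2 * (b1 * b2 * p2) := by positivity
        linarith
      refine ⟨hp2, ?_, ?_⟩
      · have : b1 * (η / 2 * (b2 * p2)) ≤ b1 * p3 := by linarith
        exact le_of_mul_le_mul_left this hb1
      · have h1 : 2 * κ / η * (b1 * b2 * p2) / (η / 2 * (b1 * b2 * p2)) = 4 * κ / η ^ 2 := by
          field_simp
          ring
        rw [h1, Real.log_mul hp3.ne' hb1.ne', Real.log_mul hd0.ne' hp2.ne'] at hl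
        have e1 := Finset.sum_range_succ (fun i => Real.log (entryNorm (B (i + 1) * B i))) (j + 1)
        have e2 := Finset.sum_range_succ (fun i => Real.log (entryNorm (B (i + 1)))) j
        have e3 : Real.log (entryNorm (B (j + 1 + 1) * B (j + 1))) = Real.log d := rfl
        have e4 : Real.log (entryNorm (P (j + 1 + 2))) = Real.log p3 := rfl
        rw [e1, e2, e3, e4]
        rw [abs_le] at hl hlog ⊢
        push_cast
        constructor <;> linarith
  obtain ⟨k, rfl⟩ := Nat.exists_eq_add_of_le' hm
  refine (key k le_rfl).2.2.trans ?_
  push_cast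
  have : 0 ≤ 4 * κ / η ^ 2 := by positivity
  nlinarith

/-! ### Exceptional sets -/

/-- `P` holds outside a set of measure at most `ε`. -/
def HoldsOff (ε : ℝ) (P : UnitAddCircle → Prop) : Prop :=
  volume {x | ¬ P x} ≤ ENNReal.ofReal ε

theorem HoldsOff.mono_ae {ε : ℝ} {P Q : UnitAddCircle → Prop} (h : HoldsOff ε P)
    (hPQ : ∀ᵐ x, P x → Q x) : HoldsOff ε Q := by
  refine le_trans (measure_mono_ae ?_) h
  filter_upwards [hPQ] with x hx hQ hP
  exact hQ (hx hP)

theorem HoldsOff.mono {ε : ℝ} {P Q : UnitAddCircle → Prop} (h : HoldsOff ε P)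
    (hPQ : ∀ x, P x → Q x) : HoldsOff ε Q :=
  h.mono_ae (.of_forall hPQ)

theorem HoldsOff.mono_left {ε ε' : ℝ} {P : UnitAddCircle → Prop} (h : HoldsOff ε P)
    (hε : ε ≤ ε') : HoldsOff ε' P :=
  le_trans h (ENNReal.ofReal_le_ofReal hε)

theorem HoldsOff.and {ε ε' : ℝ} {P Q : UnitAddCircle → Prop} (h : HoldsOff ε P) (h' : HoldsOff ε' Q)
    (hε : 0 ≤ ε) (hε' : 0 ≤ ε') : HoldsOff (ε + ε') fun x => P x ∧ Q x := by
  rw [HoldsOff, ENNReal.ofReal_add hε hε']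
  refine le_trans (measure_mono ?_) ((measure_union_le _ _).trans (add_le_add h h'))
  intro x hx
  simp only [Set.mem_ofPred_eq, Set.mem_union] at hx ⊢
  tauto

theorem HoldsOff.shift {ε : ℝ} {P : UnitAddCircle → Prop} (h : HoldsOff ε P) (a : UnitAddCircle) :
    HoldsOff ε fun x => P (x + a) := by
  have := measure_preimage_add_right (volume : Measure UnitAddCircle) a {x | ¬ P x}
  exact (le_of_eq this).trans h

theorem HoldsOff.forall_lt {ε : ℝ} {n : ℕ} {P : ℕ → UnitAddCircle → Prop} (hε : 0 ≤ ε)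
    (h : ∀ k < n, HoldsOff ε (P k)) : HoldsOff (n * ε) fun x => ∀ k < n, P k x := by
  induction n with
  | zero => simp [HoldsOff]
  | succ n ih =>
    have h1 := (ih fun k hk => h k (by omega)).and (h n (by omega)) (by positivity) hε
    refine (h1.mono_left (le_of_eq (by push_cast; ring))).mono fun x hx k hk => ?_
    rcases Nat.lt_succ_iff_lt_or_eq.1 hk with hk | rfl
    · exact hx.1 k hk
    · exact hx.2

/-- Markov's inequality for `exp (-f)`. -/
theorem HoldsOff.of_lintegral_exp {f : UnitAddCircle → ℝ} (hf : Measurable f) {B : ℝ}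
    (h : ∫⁻ x, ENNReal.ofReal (Real.exp (-f x)) ≤ ENNReal.ofReal (Real.exp B)) (lam : ℝ) :
    HoldsOff (Real.exp (-lam + B)) fun x => -lam ≤ f x := by
  have h1 := mul_meas_ge_le_lintegral (μ := (volume : Measure UnitAddCircle))
    hf.neg.exp.ennreal_ofReal (ENNReal.ofReal (Real.exp lam))
  have h2 : volume {x | ¬ -lam ≤ f x} ≤
      volume {x | ENNReal.ofReal (Real.exp lam) ≤ ENNReal.ofReal (Real.exp ((-f) x))} := by
    refine measure_mono fun x hx => ?_
    simp only [Set.mem_ofPred_eq, not_le, Pi.neg_apply] at hx ⊢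
    exact ENNReal.ofReal_le_ofReal (Real.exp_le_exp.2 (by linarith))
  have h3 : ENNReal.ofReal (Real.exp (-lam + B)) =
      ENNReal.ofReal (Real.exp (-lam)) * ENNReal.ofReal (Real.exp B) := by
    rw [Real.exp_add, ENNReal.ofReal_mul (Real.exp_pos _).le]
  have h4 : ENNReal.ofReal (Real.exp (-lam)) * ENNReal.ofReal (Real.exp lam) = 1 := by
    rw [← ENNReal.ofReal_mul (Real.exp_pos _).le, ← Real.exp_add]
    simp
  calc volume {x | ¬ -lam ≤ f x}
      = ENNReal.ofReal (Real.exp (-lam)) *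
          (ENNReal.ofReal (Real.exp lam) * volume {x | ¬ -lam ≤ f x}) := by
        rw [← mul_assoc, h4, one_mul]
    _ ≤ ENNReal.ofReal (Real.exp (-lam)) * ENNReal.ofReal (Real.exp B) := by
        gcongr
        exact (mul_le_mul_right h2 _).trans (h1.trans h)
    _ = _ := h3.symm

/-- On the exceptional set `E` one has `|f| ≤ s f² + 1/s`, so a second moment bound and a small
measure suffice. The free parameter `s` balances the two terms. -/
theorem HoldsOff.abs_integral_le {f : UnitAddCircle → ℝ} {ε e Q s : ℝ} (hf : Integrable f)
    (hf2 : Integrable fun x => f x ^ 2) (hQ : ∫ x, f x ^ 2 ≤ Q) (hε : 0 ≤ ε) (he : 0 ≤ e) (hs : 0 < s)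
    (h : HoldsOff ε fun x => |f x| ≤ e) : |∫ x, f x| ≤ e + s * Q + ε / s := by
  -- The exceptional set is not known to be measurable.
  set E := toMeasurable volume {x | ¬ |f x| ≤ e}
  have hE : MeasurableSet E := measurableSet_toMeasurable _ _
  have hEvol : volume.real E ≤ ε := by
    rw [measureReal_def, measure_toMeasurable]
    exact ENNReal.toReal_le_of_le_ofReal hε h
  have hind : Integrable (E.indicator fun _ => (1 : ℝ)) := (integrable_const _).indicator hE
  have hpt : ∀ x, |f x| ≤ e + s * f x ^ 2 + s⁻¹ * E.indicator (fun _ => (1 : ℝ)) x := by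
    intro x
    by_cases hx : x ∈ E
    · rw [Set.indicator_of_mem hx, mul_one, ← sq_abs]
      have h1 : 0 ≤ s * (|f x| - s⁻¹) ^ 2 := by positivity
      have h2 : s * (|f x| - s⁻¹) ^ 2 = s * |f x| ^ 2 - 2 * |f x| + s⁻¹ := by
        field_simp
        ring
      have := abs_nonneg (f x)
      linarith
    · rw [Set.indicator_of_notMem hx]
      have h1 : |f x| ≤ e := by
        by_contra hcon
        exact hx (subset_toMeasurable _ _ hcon)
      have : 0 ≤ s * f x ^ 2 := by positivity
      linarith
  have hint : Integrable fun x => e + s * f x ^ 2 := (integrable_const _).add (hf2.const_mul _)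
  have hint2 : Integrable fun x => s⁻¹ * E.indicator (fun _ => (1 : ℝ)) x := hind.const_mul _
  have h1 : ∫ x, |f x| ≤ ∫ x, (e + s * f x ^ 2 + s⁻¹ * E.indicator (fun _ => (1 : ℝ)) x) :=
    integral_mono hf.abs (hint.add hint2) hpt
  have h2 : ∫ x, E.indicator (fun _ => (1 : ℝ)) x = volume.real E := by
    rw [integral_indicator_const _ hE]; simp
  rw [integral_add hint hint2, integral_add (integrable_const _) (hf2.const_mul _),
    integral_const_mul, integral_const_mul, h2] at h1
  simp only [integral_const, probReal_univ, smul_eq_mul, one_mul] at h1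
  have h3 : s⁻¹ * volume.real E ≤ ε / s := by
    rw [div_eq_inv_mul]
    exact mul_le_mul_of_nonneg_left hEvol (by positivity)
  have h4 : s * ∫ x, f x ^ 2 ≤ s * Q := mul_le_mul_of_nonneg_left hQ hs.le
  have h5 : |∫ x, f x| ≤ ∫ x, |f x| := abs_integral_le_integral_abs
  linarith

theorem integral_comp_add (f : UnitAddCircle → ℝ) (a : UnitAddCircle) :
    ∫ x, f (x + a) = ∫ x, f x := integral_add_right_eq_self f a

theorem integrable_rotSum {f : UnitAddCircle → ℝ} (hf : Integrable f) (ω : ℝ) (n : ℕ) :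
    Integrable (rotSum ω n f) :=
  integrable_finsetSum _ fun k _ => hf.comp_add_right (((k * ω : ℝ) : UnitAddCircle))

theorem integral_rotSum {f : UnitAddCircle → ℝ} (hf : Integrable f) (ω : ℝ) (n : ℕ) :
    ∫ x, rotSum ω n f x = n * ∫ x, f x := by
  simp only [rotSum]
  rw [integral_finsetSum _ fun (k : ℕ) _ => hf.comp_add_right (((k * ω : ℝ) : UnitAddCircle))]
  simp [integral_comp_add]

theorem rotSum_add (ω : ℝ) (m n : ℕ) (f : UnitAddCircle → ℝ) (x : UnitAddCircle) :
    rotSum ω (m + n) f x = rotSum ω m f x + rotSum ω n f (x + ((m * ω : ℝ) : UnitAddCircle)) := by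
  simp only [rotSum, Finset.sum_range_add, add_assoc]
  congr 1
  refine Finset.sum_congr rfl fun k _ => ?_
  rw [← AddCircle.coe_add]
  push_cast
  ring_nf

theorem measurable_rotSum {f : UnitAddCircle → ℝ} (hf : Measurable f) (ω : ℝ) (n : ℕ) :
    Measurable (rotSum ω n f) :=
  Finset.measurable_sum _ fun _ _ => hf.comp (measurable_id.add_const _)

theorem rotSum_le {f : UnitAddCircle → ℝ} {H : ℝ} (hf : ∀ x, f x ≤ H) (ω : ℝ) (n : ℕ)
    (x : UnitAddCircle) : rotSum ω n f x ≤ n * H := by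
  refine (Finset.sum_le_sum fun (k : ℕ) _ => hf (x + ((k * ω : ℝ) : UnitAddCircle))).trans
    (le_of_eq ?_)
  simp

theorem sq_rotSum_le (ω : ℝ) (n : ℕ) (f : UnitAddCircle → ℝ) (x : UnitAddCircle) :
    rotSum ω n f x ^ 2 ≤ n * rotSum ω n (fun y => f y ^ 2) x := by
  have := sq_sum_le_card_mul_sum_sq (s := Finset.range n)
    (f := fun k : ℕ => f (x + ((k * ω : ℝ) : UnitAddCircle)))
  simpa [rotSum] using this

/-! ### Cocycles with a gap: determinants and almost invariance -/

/-- The logarithm of the entry norm of a matrix-valued function. -/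
noncomputable def logEntry (A : ℕ → UnitAddCircle → Matrix (Fin 2) (Fin 2) ℂ) (n : ℕ)
    (x : UnitAddCircle) : ℝ :=
  Real.log (entryNorm (A n x))

/-- A cocycle over the rotation by `ω` whose logarithmic norms, and the logarithm `β` of whose
determinants, satisfy large deviation estimates for Birkhoff sums, with exponent `L` at least
`D + γ`, where `D` is the mean of `β`. -/
structure IsGappedCocycle (ω q H K τ γ D L : ℝ) (A : ℕ → UnitAddCircle → Matrix (Fin 2) (Fin 2) ℂ)
    (β : UnitAddCircle → ℝ) : Prop where
  one_le : 1 ≤ H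
  map_add : ∀ m n x, A (m + n) x = A m (x + ((n * ω : ℝ) : UnitAddCircle)) * A n x
  bound : ∀ n x, 1 ≤ n → logEntry A n x ≤ n * H
  measurable : ∀ n, Measurable (logEntry A n)
  integrable : ∀ n, 1 ≤ n → Integrable (logEntry A n)
  measurable_beta : Measurable β
  integrable_beta : Integrable β
  integral_beta : ∫ x, β x = D
  abs_mean_le : |D| ≤ H
  beta_le : ∀ x, β x ≤ H
  det : ∀ᵐ x, ∀ n, (A n x).det ≠ 0 ∧
    Real.log ‖(A n x).det‖ = rotSum ω n β x + rotSum ω n β (x + (ω : UnitAddCircle))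
  upper : ∀ n k : ℕ, 1 ≤ n → 2 ≤ k → ∀ᵐ x, rotSum ω k (logEntry A n) x - k * ∫ x, logEntry A n x ≤
    n * (K * Real.log k ^ q)
  lower : ∀ n k : ℕ, 1 ≤ n → 2 ≤ k → ∫⁻ x, ENNReal.ofReal (Real.exp (-(τ / n) *
    (rotSum ω k (logEntry A n) x - k * ∫ x, logEntry A n x))) ≤
      ENNReal.ofReal (Real.exp (K * Real.log k ^ q))
  upper_beta : ∀ k : ℕ, 2 ≤ k → ∀ᵐ x, rotSum ω k β x - k * D ≤ K * Real.log k ^ q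
  lower_beta : ∀ k : ℕ, 2 ≤ k → ∫⁻ x, ENNReal.ofReal (Real.exp (-τ *
    (rotSum ω k β x - k * D))) ≤ ENNReal.ofReal (Real.exp (K * Real.log k ^ q))
  tendsto : Tendsto (fun n : ℕ => (∫ x, logEntry A n x) / n) atTop (𝓝 L)
  gap : γ ≤ L - D

namespace IsGappedCocycle

variable {ω q H K τ γ D L : ℝ} {A : ℕ → UnitAddCircle → Matrix (Fin 2) (Fin 2) ℂ}
  {β : UnitAddCircle → ℝ}

theorem holdsOff_beta (h : IsGappedCocycle ω q H K τ γ D L A β) (hτ : 0 < τ) {k : ℕ} (hk : 2 ≤ k) (lam : ℝ) :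
    HoldsOff (Real.exp (-(τ * lam) + K * Real.log k ^ q)) fun x => k * D - lam ≤ rotSum ω k β x := by
  have hm : Measurable fun x => τ * (rotSum ω k β x - k * D) :=
    ((measurable_rotSum h.measurable_beta ω k).sub_const _).const_mul _
  refine (HoldsOff.of_lintegral_exp hm (le_of_eq_of_le ?_ (h.lower_beta k hk)) _).mono fun x hx => ?_
  · simp only [neg_mul]
  · have : τ * (-lam) ≤ τ * (rotSum ω k β x - k * D) := by linarith
    have := le_of_mul_le_mul_left this hτ
    linarith

theorem holdsOff_logEntry (h : IsGappedCocycle ω q H K τ γ D L A β) (hτ : 0 < τ) {n k : ℕ} (hn : 1 ≤ n)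
    (hk : 2 ≤ k) (lam : ℝ) :
    HoldsOff (Real.exp (-(τ * lam) + K * Real.log k ^ q)) fun x =>
      k * (∫ x, logEntry A n x) - n * lam ≤ rotSum ω k (logEntry A n) x := by
  have hn0 : (0 : ℝ) < n := by positivity
  have hm : Measurable fun x => τ / n * (rotSum ω k (logEntry A n) x - k * ∫ x, logEntry A n x) :=
    ((measurable_rotSum (h.measurable n) ω k).sub_const _).const_mul _
  refine (HoldsOff.of_lintegral_exp hm (le_of_eq_of_le ?_ (h.lower n k hn hk)) _).mono fun x hx => ?_
  · simp only [neg_mul]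
  · have : τ / n * (-(n * lam)) ≤ τ / n * (rotSum ω k (logEntry A n) x - k * ∫ x, logEntry A n x) := by
      refine le_of_eq_of_le ?_ hx
      field_simp
    have := le_of_mul_le_mul_left this (by positivity)
    linarith

theorem ae_det (h : IsGappedCocycle ω q H K τ γ D L A β) :
    ∀ᵐ x : UnitAddCircle, ∀ k n : ℕ, (A n (x + ((k * ω : ℝ) : UnitAddCircle))).det ≠ 0 ∧
      Real.log ‖(A n (x + ((k * ω : ℝ) : UnitAddCircle))).det‖ =
        rotSum ω n β (x + ((k * ω : ℝ) : UnitAddCircle)) +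
          rotSum ω n β (x + ((k * ω : ℝ) : UnitAddCircle) + (ω : UnitAddCircle)) :=
  ae_forall_add h.det ω

/-- The Birkhoff sum of `β` of length `k` is almost its mean at `x` and `x + ω`. -/
def Regular (ω D : ℝ) (β : UnitAddCircle → ℝ) (k : ℕ) (lam : ℝ) (x : UnitAddCircle) : Prop :=
  k * D - lam ≤ rotSum ω k β x ∧ k * D - lam ≤ rotSum ω k β (x + (ω : UnitAddCircle))

theorem holdsOff_regular (h : IsGappedCocycle ω q H K τ γ D L A β) (hτ : 0 < τ) {k : ℕ} (hk : 2 ≤ k) (lam : ℝ) :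
    HoldsOff (2 * Real.exp (-(τ * lam) + K * Real.log k ^ q)) (Regular ω D β k lam) :=
  (((h.holdsOff_beta hτ hk lam).and ((h.holdsOff_beta hτ hk lam).shift (ω : UnitAddCircle))
    (Real.exp_pos _).le (Real.exp_pos _).le).mono_left (le_of_eq (by ring)))

/-- A Birkhoff sum over `k ≤ m` steps is the one over `m` steps minus the rest, and the rest is
bounded above since `β ≤ H`. One regularity condition at length `m` thus handles all shorter
determinants. -/
theorem neg_log_det_le (h : IsGappedCocycle ω q H K τ γ D L A β) {x : UnitAddCircle} {k m : ℕ} {lam : ℝ}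
    (hkm : k ≤ m) (hx : Real.log ‖(A k x).det‖ = rotSum ω k β x + rotSum ω k β (x + (ω : UnitAddCircle)))
    (hreg : Regular ω D β m lam x) : -Real.log ‖(A k x).det‖ ≤ 2 * lam + 4 * (m * H) := by
  have key : ∀ y, m * D - lam ≤ rotSum ω m β y → -rotSum ω k β y ≤ lam + 2 * (m * H) := by
    intro y hy
    obtain ⟨r, rfl⟩ := Nat.exists_eq_add_of_le hkm
    rw [rotSum_add] at hy
    have h1 := rotSum_le h.beta_le ω r (y + ((k * ω : ℝ) : UnitAddCircle))
    have h2 : -((k + r : ℕ) * H) ≤ (k + r : ℕ) * D := by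
      rw [← mul_neg]
      exact mul_le_mul_of_nonneg_left (abs_le.1 h.abs_mean_le).1 (Nat.cast_nonneg _)
    have h3 : (r : ℝ) * H ≤ (k + r : ℕ) * H := by
      have := h.one_le
      gcongr
      omega
    linarith
  have h1 := key x hreg.1
  have h2 := key _ hreg.2
  rw [hx]
  linarith

theorem logEntry_add_le (h : IsGappedCocycle ω q H K τ γ D L A β) {x : UnitAddCircle} {m n : ℕ}
    (h1 : (A n x).det ≠ 0) (h2 : (A m (x + ((n * ω : ℝ) : UnitAddCircle))).det ≠ 0) :
    logEntry A (m + n) x ≤ logEntry A m (x + ((n * ω : ℝ) : UnitAddCircle)) + logEntry A n x := by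
  rw [logEntry, logEntry, logEntry, ← Real.log_mul (entryNorm_pos h2).ne' (entryNorm_pos h1).ne', h.map_add]
  refine Real.log_le_log (entryNorm_pos ?_) (entryNorm_mul_le _ _)
  rw [Matrix.det_mul]
  exact mul_ne_zero h2 h1

theorem logEntry_le_add_left (h : IsGappedCocycle ω q H K τ γ D L A β) {x : UnitAddCircle} {m n : ℕ}
    (h1 : (A n x).det ≠ 0) (h2 : (A m (x + ((n * ω : ℝ) : UnitAddCircle))).det ≠ 0) :
    logEntry A m (x + ((n * ω : ℝ) : UnitAddCircle)) ≤
      logEntry A (m + n) x + logEntry A n x - Real.log ‖(A n x).det‖ := by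
  have h3 := norm_det_mul_entryNorm_le' (A n x) (A m (x + ((n * ω : ℝ) : UnitAddCircle)))
  rw [← h.map_add] at h3
  have h4 : (A (m + n) x).det ≠ 0 := by
    rw [h.map_add, Matrix.det_mul]; exact mul_ne_zero h2 h1
  have h5 := Real.log_le_log (mul_pos (norm_pos_iff.2 h1) (entryNorm_pos h2)) h3
  rw [Real.log_mul (norm_ne_zero_iff.2 h1) (entryNorm_pos h2).ne',
    Real.log_mul (entryNorm_pos h4).ne' (entryNorm_pos h1).ne'] at h5
  simp only [logEntry]
  linarith

theorem logEntry_le_add_right (h : IsGappedCocycle ω q H K τ γ D L A β) {x : UnitAddCircle} {m n : ℕ}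
    (h1 : (A n x).det ≠ 0) (h2 : (A m (x + ((n * ω : ℝ) : UnitAddCircle))).det ≠ 0) :
    logEntry A n x ≤ logEntry A (m + n) x + logEntry A m (x + ((n * ω : ℝ) : UnitAddCircle)) -
      Real.log ‖(A m (x + ((n * ω : ℝ) : UnitAddCircle))).det‖ := by
  have h3 := norm_det_mul_entryNorm_le (A m (x + ((n * ω : ℝ) : UnitAddCircle))) (A n x)
  rw [← h.map_add] at h3
  have h4 : (A (m + n) x).det ≠ 0 := by
    rw [h.map_add, Matrix.det_mul]; exact mul_ne_zero h2 h1
  have h5 := Real.log_le_log (mul_pos (norm_pos_iff.2 h2) (entryNorm_pos h1)) h3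
  rw [Real.log_mul (norm_ne_zero_iff.2 h2) (entryNorm_pos h1).ne',
    Real.log_mul (entryNorm_pos h2).ne' (entryNorm_pos h4).ne'] at h5
  simp only [logEntry]
  linarith

theorem logEntry_ge (h : IsGappedCocycle ω q H K τ γ D L A β) :
    ∀ᵐ x : UnitAddCircle, ∀ n : ℕ,
      rotSum ω n β x + rotSum ω n β (x + (ω : UnitAddCircle)) ≤ 2 * logEntry A n x := by
  filter_upwards [h.det] with x hx n
  have := Real.log_le_log (norm_pos_iff.2 (hx n).1) (norm_det_le_entryNorm_sq _)
  rw [Real.log_pow] at this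
  rw [← (hx n).2]
  exact_mod_cast this

/-- Almost invariance of the logarithmic norm under short shifts. -/
theorem ae_abs_logEntry_shift_sub_le (h : IsGappedCocycle ω q H K τ γ D L A β) :
    ∀ᵐ x : UnitAddCircle, ∀ (n m k : ℕ) (lam : ℝ), 0 ≤ lam → 1 ≤ n → k ≤ m →
      Regular ω D β m lam x → Regular ω D β m lam (x + ((n * ω : ℝ) : UnitAddCircle)) →
      |logEntry A n (x + ((k * ω : ℝ) : UnitAddCircle)) - logEntry A n x| ≤ 2 * lam + 6 * (m * H) := by
  filter_upwards [h.ae_det] with x hx n m k lam hlam hn hkm hreg hreg'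
  have hH : 0 ≤ H := by linarith [h.one_le]
  rcases Nat.eq_zero_or_pos k with rfl | hk
  · simp only [Nat.cast_zero, zero_mul, AddCircle.coe_zero, add_zero, sub_self, abs_zero]
    positivity
  have hx0 : ∀ n : ℕ, (A n x).det ≠ 0 ∧ Real.log ‖(A n x).det‖ =
      rotSum ω n β x + rotSum ω n β (x + (ω : UnitAddCircle)) := by simpa using hx 0
  have hkH : (k : ℝ) * H ≤ m * H := by gcongr
  have d1 := h.neg_log_det_le hkm (hx0 k).2 hreg
  have d2 := h.neg_log_det_le hkm (hx n k).2 hreg'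
  have b1 := h.bound k x hk
  have b2 := h.bound k (x + ((n * ω : ℝ) : UnitAddCircle)) hk
  -- The product of length `n + k` factors in two ways, as `A_n(x + kω) A_k(x)` and as `A_k(x + nω)
  -- A_n(x)`; removing the short factors costs their norms and determinants.
  have e1 := h.logEntry_le_add_left (m := n) (hx0 k).1 (hx k n).1
  have e2 := h.logEntry_add_le (m := k) (hx0 n).1 (hx n k).1
  have e3 := h.logEntry_le_add_right (m := k) (hx0 n).1 (hx n k).1
  have e4 := h.logEntry_add_le (m := n) (hx0 k).1 (hx k n).1
  rw [add_comm n k] at e1 e4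
  rw [abs_le]
  constructor <;> linarith

end IsGappedCocycle

/-! ### Second moments, means and concentration -/

theorem eventually_mul_log_rpow_le (K q : ℝ) {σ : ℝ} (hσ : 0 < σ) :
    ∀ᶠ k : ℕ in atTop, K * Real.log k ^ q ≤ σ * k := by
  have h1 := (isLittleO_log_rpow_rpow_atTop q one_pos).def (c := σ / (|K| + 1)) (by positivity)
  filter_upwards [tendsto_natCast_atTop_atTop.eventually h1, eventually_ge_atTop 1] with k hk hk1
  have hl : 0 ≤ Real.log k := Real.log_natCast_nonneg k
  have hlq : 0 ≤ Real.log k ^ q := by positivity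
  rw [Real.rpow_one, Real.norm_of_nonneg hlq, Real.norm_of_nonneg (Nat.cast_nonneg k)] at hk
  have h2 : K * Real.log k ^ q ≤ (|K| + 1) * Real.log k ^ q := by
    gcongr
    linarith [le_abs_self K]
  have h3 : (|K| + 1) * Real.log k ^ q ≤ (|K| + 1) * (σ / (|K| + 1) * k) := by gcongr
  have h4 : (|K| + 1) * (σ / (|K| + 1) * k) = σ * k := by
    have : |K| + 1 ≠ 0 := by positivity
    field_simp
  linarith

theorem eventually_le_mul_natCast (B : ℝ) {σ : ℝ} (hσ : 0 < σ) : ∀ᶠ k : ℕ in atTop, B ≤ σ * k := by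
  filter_upwards [eventually_ge_atTop ⌈B / σ⌉₊] with k hk
  have := (div_le_iff₀ hσ).1 (Nat.ceil_le.1 hk)
  linarith

theorem eventually_mul_exp_neg_le (B : ℝ) {c c' : ℝ} (hc : c' < c) :
    ∀ᶠ k : ℕ in atTop, B * Real.exp (-(c * k)) ≤ Real.exp (-(c' * k)) := by
  filter_upwards [eventually_le_mul_natCast (Real.log (|B| + 1)) (sub_pos.2 hc)] with k hk
  have h0 : 0 < |B| + 1 := by positivity
  calc B * Real.exp (-(c * k)) ≤ (|B| + 1) * Real.exp (-(c * k)) := by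
        gcongr
        linarith [le_abs_self B]
    _ = Real.exp (Real.log (|B| + 1) + -(c * k)) := by rw [Real.exp_add, Real.exp_log h0]
    _ ≤ _ := Real.exp_le_exp.2 (by linarith)

namespace IsGappedCocycle

variable {ω q H K τ γ D L : ℝ} {A : ℕ → UnitAddCircle → Matrix (Fin 2) (Fin 2) ℂ}
  {β : UnitAddCircle → ℝ}

theorem integrable_beta_sq (h : IsGappedCocycle ω q H K τ γ D L A β) (hτ : 0 < τ) :
    Integrable (fun x => β x ^ 2) ∧
      ∫ x, β x ^ 2 ≤ H ^ 2 + 2 / τ ^ 2 * Real.exp (3 * τ * H + K * Real.log 2 ^ q) := by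
  set R := 2 / τ ^ 2 * Real.exp (3 * τ * H) with hR
  have hR0 : 0 ≤ R := by positivity
  -- The moment hypothesis starts at two steps. Since `β ≤ H`, a two-step sum is at most `β x + H`,
  -- so its exponential moment controls that of `-β`, and hence `β²` where `β` is negative.
  have hpt : ∀ x, β x ^ 2 ≤ H ^ 2 + R * Real.exp (-τ * (rotSum ω 2 β x - (2 : ℕ) * D)) := by
    intro x
    have h1 : rotSum ω 2 β x ≤ β x + H := by
      simp only [rotSum, Finset.sum_range_succ, Finset.sum_range_zero, Nat.cast_zero, zero_mul,
        AddCircle.coe_zero, add_zero, zero_add]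
      linarith [h.beta_le (x + (((1 : ℕ) * ω : ℝ) : UnitAddCircle))]
    rcases le_total 0 (β x) with h0 | h0
    · have := pow_le_pow_left₀ h0 (h.beta_le x) 2
      have : 0 ≤ R * Real.exp (-τ * (rotSum ω 2 β x - (2 : ℕ) * D)) := by positivity
      linarith
    · have h2 := Real.quadratic_le_exp_of_nonneg (x := τ * -β x) (by nlinarith)
      have h3 : β x ^ 2 ≤ 2 / τ ^ 2 * Real.exp (τ * -β x) := by
        rw [div_mul_eq_mul_div, le_div_iff₀ (by positivity)]
        nlinarith
      have h4 : Real.exp (τ * -β x) ≤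
          Real.exp (3 * τ * H) * Real.exp (-τ * (rotSum ω 2 β x - (2 : ℕ) * D)) := by
        rw [← Real.exp_add]
        refine Real.exp_le_exp.2 ?_
        have h5 := (abs_le.1 h.abs_mean_le).1
        push_cast
        nlinarith
      have h5 : 2 / τ ^ 2 * Real.exp (τ * -β x) ≤
          R * Real.exp (-τ * (rotSum ω 2 β x - (2 : ℕ) * D)) := by
        rw [hR, mul_assoc]; gcongr
      exact (h3.trans h5).trans (le_add_of_nonneg_left (sq_nonneg H))
  have hm := h.measurable_beta
  have hl : ∫⁻ x, ENNReal.ofReal (β x ^ 2) ≤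
      ENNReal.ofReal (H ^ 2 + 2 / τ ^ 2 * Real.exp (3 * τ * H + K * Real.log 2 ^ q)) := by
    calc ∫⁻ x, ENNReal.ofReal (β x ^ 2) ≤ ∫⁻ x, (ENNReal.ofReal (H ^ 2) + ENNReal.ofReal R *
          ENNReal.ofReal (Real.exp (-τ * (rotSum ω 2 β x - (2 : ℕ) * D)))) := by
          refine lintegral_mono fun x => ?_
          rw [← ENNReal.ofReal_mul hR0, ← ENNReal.ofReal_add (sq_nonneg H) (by positivity)]
          exact ENNReal.ofReal_le_ofReal (hpt x)
      _ ≤ ENNReal.ofReal (H ^ 2) + ENNReal.ofReal R * ENNReal.ofReal (Real.exp (K * Real.log (2 : ℕ) ^ q)) := by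
          rw [lintegral_add_left measurable_const, lintegral_const_mul' _ _ ENNReal.ofReal_ne_top]
          simp only [lintegral_const, measure_univ, mul_one]
          gcongr
          exact h.lower_beta 2 le_rfl
      _ = _ := by
          rw [← ENNReal.ofReal_mul hR0, ← ENNReal.ofReal_add (sq_nonneg H) (by positivity), Real.exp_add,
            hR, Nat.cast_ofNat, mul_assoc]
  have hint : Integrable fun x => β x ^ 2 := by
    refine ⟨(hm.pow_const 2).aestronglyMeasurable, ?_⟩
    rw [hasFiniteIntegral_iff_ofReal (.of_forall fun x => sq_nonneg _)]
    exact hl.trans_lt ENNReal.ofReal_lt_top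
  refine ⟨hint, ?_⟩
  rw [← ofReal_integral_eq_lintegral_ofReal hint (.of_forall fun x => sq_nonneg _)] at hl
  exact (ENNReal.ofReal_le_ofReal_iff (by positivity)).1 hl

/-- A bound for the normalized second moments of the logarithmic norms. -/
noncomputable def momentBound (q H K τ : ℝ) : ℝ :=
  2 * H ^ 2 + 2 / τ ^ 2 * Real.exp (3 * τ * H + K * Real.log 2 ^ q)

theorem momentBound_nonneg (q H K τ : ℝ) : 0 ≤ momentBound q H K τ := by
  rw [momentBound]; positivity

/-- The logarithmic norm is bounded above by `nH` and below by half the logarithm of the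
determinant; the latter is a sum of Birkhoff sums, handled by Cauchy–Schwarz. -/
theorem integrable_logEntry_sq (h : IsGappedCocycle ω q H K τ γ D L A β) (hτ : 0 < τ) {n : ℕ} (hn : 1 ≤ n) :
    Integrable (fun x => logEntry A n x ^ 2) ∧ ∫ x, logEntry A n x ^ 2 ≤ n ^ 2 * momentBound q H K τ := by
  obtain ⟨hb, hbQ⟩ := h.integrable_beta_sq hτ
  set β₂ : UnitAddCircle → ℝ := fun x => β x ^ 2 with hβ₂
  have hH : 0 ≤ H := by linarith [h.one_le]
  have hS : Integrable (rotSum ω n β₂) := integrable_rotSum hb ω n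
  have hS' : Integrable fun x => rotSum ω n β₂ (x + (ω : UnitAddCircle)) := hS.comp_add_right _
  have hpt : ∀ᵐ x, logEntry A n x ^ 2 ≤ (n * H) ^ 2 +
      n / 2 * (rotSum ω n β₂ x + rotSum ω n β₂ (x + (ω : UnitAddCircle))) := by
    filter_upwards [h.logEntry_ge] with x hx
    have h1 := sq_rotSum_le ω n β x
    have h2 := sq_rotSum_le ω n β (x + (ω : UnitAddCircle))
    rcases le_total 0 (logEntry A n x) with h0 | h0
    · have h3 := pow_le_pow_left₀ h0 (h.bound n x hn) 2
      nlinarith [sq_nonneg (rotSum ω n β x), sq_nonneg (rotSum ω n β (x + (ω : UnitAddCircle)))]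
    · have h3 := hx n
      have h4 : (2 * logEntry A n x) ^ 2 ≤
          (rotSum ω n β x + rotSum ω n β (x + (ω : UnitAddCircle))) ^ 2 := by
        rw [← neg_sq (2 * _), ← neg_sq (rotSum _ _ _ _ + _)]
        exact pow_le_pow_left₀ (by linarith) (by linarith) 2
      nlinarith [sq_nonneg (rotSum ω n β x - rotSum ω n β (x + (ω : UnitAddCircle))), sq_nonneg (n * H)]
  have hSS : Integrable fun x =>
      n / 2 * (rotSum ω n β₂ x + rotSum ω n β₂ (x + (ω : UnitAddCircle))) := (hS.add hS').const_mul _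
  have hbig : Integrable fun x => (n * H) ^ 2 +
      n / 2 * (rotSum ω n β₂ x + rotSum ω n β₂ (x + (ω : UnitAddCircle))) :=
    (integrable_const _).add hSS
  have hint : Integrable fun x => logEntry A n x ^ 2 := by
    refine hbig.mono' ((h.measurable n).pow_const 2).aestronglyMeasurable ?_
    filter_upwards [hpt] with x hx
    rwa [Real.norm_of_nonneg (sq_nonneg _)]
  refine ⟨hint, (integral_mono_ae hint hbig hpt).trans ?_⟩
  rw [integral_add (integrable_const _) hSS, integral_const_mul,
    integral_add hS hS', integral_comp_add (rotSum ω n β₂), integral_rotSum hb]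
  simp only [integral_const, probReal_univ, smul_eq_mul, one_mul]
  have h6 : (n : ℝ) ^ 2 * ∫ x, β₂ x ≤ n ^ 2 * (H ^ 2 + 2 / τ ^ 2 * Real.exp (3 * τ * H + K * Real.log 2 ^ q)) := by
    gcongr
  rw [momentBound]
  linarith

theorem abs_integral_logEntry_le (h : IsGappedCocycle ω q H K τ γ D L A β) {n : ℕ} (hn : 1 ≤ n) :
    |∫ x, logEntry A n x| ≤ n * H := by
  have h1 : ∫ x, logEntry A n x ≤ n * H := by
    have := integral_mono (h.integrable n hn) (integrable_const (n * H)) fun x => h.bound n x hn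
    simpa using this
  have hS := integrable_rotSum h.integrable_beta ω n
  have h2 := integral_mono_ae (hS.add (hS.comp_add_right (ω : UnitAddCircle)))
    ((h.integrable n hn).const_mul 2) (h.logEntry_ge.mono fun x hx => hx n)
  simp only [Pi.add_apply] at h2
  rw [integral_add hS (hS.comp_add_right (ω : UnitAddCircle)), integral_comp_add (rotSum ω n β),
    integral_rotSum h.integrable_beta, h.integral_beta, integral_const_mul] at h2
  have h3 : (n : ℝ) * -H ≤ n * D := by
    gcongr
    exact (abs_le.1 h.abs_mean_le).1
  rw [abs_le]
  constructor <;> linarith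

theorem integral_logEntry_add_le (h : IsGappedCocycle ω q H K τ γ D L A β) {m n : ℕ} (hm : 1 ≤ m)
    (hn : 1 ≤ n) : ∫ x, logEntry A (m + n) x ≤ (∫ x, logEntry A m x) + ∫ x, logEntry A n x := by
  have hmi := (h.integrable m hm).comp_add_right (((n * ω : ℝ) : UnitAddCircle))
  have h1 := integral_mono_ae (h.integrable (m + n) (by omega)) (hmi.add (h.integrable n hn)) (by
    filter_upwards [h.det, h.ae_det] with x hx hx'
    exact h.logEntry_add_le (hx n).1 (hx' n m).1)
  simp only [Pi.add_apply] at h1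
  rwa [integral_add hmi (h.integrable n hn), integral_comp_add (logEntry A m)] at h1

theorem integral_logEntry_mul_le (h : IsGappedCocycle ω q H K τ γ D L A β) {m k : ℕ} (hm : 1 ≤ m)
    (hk : 1 ≤ k) : ∫ x, logEntry A (k * m) x ≤ k * ∫ x, logEntry A m x := by
  induction k, hk using Nat.le_induction with
  | base => simp
  | succ k hk ih =>
    have h1 := h.integral_logEntry_add_le (m := k * m) (n := m) (Nat.mul_pos hk hm) hm
    rw [add_mul, one_mul]
    push_cast
    linarith

theorem mul_exponent_le (h : IsGappedCocycle ω q H K τ γ D L A β) {n : ℕ} (hn : 1 ≤ n) :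
    n * L ≤ ∫ x, logEntry A n x := by
  have h1 : Tendsto (fun k : ℕ => k * n) atTop atTop := tendsto_id.atTop_mul_const' hn
  have h2 := h.tendsto.comp h1
  have hn0 : (0 : ℝ) < n := by positivity
  rw [mul_comm, ← le_div_iff₀ hn0]
  refine le_of_tendsto h2 ?_
  filter_upwards [eventually_ge_atTop 1] with k hk
  have h3 := h.integral_logEntry_mul_le hn hk
  have hk0 : (0 : ℝ) < k := by positivity
  simp only [Function.comp_apply]
  push_cast
  rw [div_le_div_iff₀ (by positivity) hn0]
  nlinarith

/-- Concentration of the logarithmic norms at scale `ε n`. -/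
theorem exists_concentration {q H K τ γ : ℝ} (hH : 1 ≤ H) (hτ : 0 < τ) {ε : ℝ} (hε : 0 < ε) :
    ∃ c : ℝ, 0 < c ∧ ∃ n₀ : ℕ, ∀ (ω D L : ℝ) (A : ℕ → UnitAddCircle → Matrix (Fin 2) (Fin 2) ℂ)
      (β : UnitAddCircle → ℝ), IsGappedCocycle ω q H K τ γ D L A β → ∀ n : ℕ, n₀ ≤ n →
      HoldsOff (Real.exp (-(c * n))) fun x => |logEntry A n x - ∫ y, logEntry A n y| ≤ ε * n := by
  -- With about `en` shifts the total error is `3en + 6kH`, where `k ≤ 2en`, hence at most `15 H e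
  -- n`.
  set e := ε / (15 * H) with he
  have he0 : 0 < e := by positivity
  set c := min (τ * e / 2) (τ * e ^ 2 / 2) with hc
  have hc0 : 0 < c := by positivity
  set σ := min (τ / 4) (min (τ * e / 2) e) with hσ
  have hσ0 : 0 < σ := by positivity
  obtain ⟨k₀, hk₀⟩ := eventually_atTop.1 (eventually_mul_log_rpow_le K q hσ0)
  have hev := (eventually_le_mul_natCast (max 2 k₀) he0).and
    (eventually_mul_exp_neg_le 5 (half_lt_self hc0))
  obtain ⟨n₀, hn₀⟩ := eventually_atTop.1 hev
  refine ⟨c / 2, by positivity, max n₀ 1, fun ω D L A β h n hn => ?_⟩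
  obtain ⟨hn1, hn2⟩ := hn₀ n ((le_max_left _ _).trans hn)
  have hnpos : 1 ≤ n := (le_max_right _ _).trans hn
  have hn0 : (0 : ℝ) < n := by positivity
  set k := ⌈e * n⌉₊ with hk
  have hken : e * n ≤ k := Nat.le_ceil _
  have hen2 : 2 ≤ e * n := (le_max_left _ _).trans hn1
  have hk2e : (k : ℝ) ≤ 2 * (e * n) := by
    have := (Nat.ceil_lt_add_one (by positivity : 0 ≤ e * n)).le
    linarith
  have hk2 : 2 ≤ k := by exact_mod_cast hen2.trans hken
  have hkk₀ : k₀ ≤ k := by exact_mod_cast ((le_max_right _ _).trans hn1).trans hken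
  have hk0 : (0 : ℝ) < k := by positivity
  have hlog := hk₀ k hkk₀
  have hσ1 : σ * k ≤ τ / 4 * k := by gcongr; exact min_le_left _ _
  have hσ2 : σ * k ≤ τ * e / 2 * k := by
    gcongr; exact (min_le_right _ _).trans (min_le_left _ _)
  have hσ3 : σ * k ≤ e * k := by gcongr; exact (min_le_right _ _).trans (min_le_right _ _)
  have hreg := h.holdsOff_regular hτ hk2 (e * n)
  have hlow := h.holdsOff_logEntry hτ hnpos hk2 (e * k)
  have hE1 : Real.exp (-(τ * (e * n)) + K * Real.log k ^ q) ≤ Real.exp (-(c * n)) := by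
    refine Real.exp_le_exp.2 ?_
    have : c * n ≤ τ * e / 2 * n := by gcongr; exact min_le_left _ _
    nlinarith
  have hE2 : Real.exp (-(τ * (e * k)) + K * Real.log k ^ q) ≤ Real.exp (-(c * n)) := by
    refine Real.exp_le_exp.2 ?_
    have h1 : c * n ≤ τ * e ^ 2 / 2 * n := by gcongr; exact min_le_right _ _
    have h2 : τ * e / 2 * (e * n) ≤ τ * e / 2 * k := by gcongr
    nlinarith
  have hall := ((hreg.and (hreg.shift (((n * ω : ℝ) : UnitAddCircle))) (by positivity) (by positivity)).and
    hlow (by positivity) (by positivity)).mono_left (ε' := Real.exp (-(c / 2 * n))) (by linarith)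
  refine hall.mono_ae ?_
  filter_upwards [h.ae_abs_logEntry_shift_sub_le, h.upper n k hnpos hk2] with x hx hux
  rintro ⟨⟨hr, hr'⟩, hl⟩
  -- The value at `x` is compared with its average over `k` shifts, and that average with the mean
  -- by the Birkhoff estimates.
  have h1 : ∀ j < k, |logEntry A n (x + ((j * ω : ℝ) : UnitAddCircle)) - logEntry A n x| ≤
      2 * (e * n) + 6 * (k * H) := fun j hj => hx n k j (e * n) (by positivity) hnpos hj.le hr hr'
  have h2 : |rotSum ω k (logEntry A n) x - k * logEntry A n x| ≤ k * (2 * (e * n) + 6 * (k * H)) := by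
    rw [rotSum_sub_mul, rotSum]
    refine (Finset.abs_sum_le_sum_abs _ _).trans ((Finset.sum_le_sum fun j hj =>
      h1 j (Finset.mem_range.1 hj)).trans (le_of_eq ?_))
    rw [Finset.sum_const, Finset.card_range, nsmul_eq_mul]
  set a := ∫ y, logEntry A n y
  set v := logEntry A n x
  set S := rotSum ω k (logEntry A n) x
  have h3 : |S - k * a| ≤ n * (e * k) := by
    rw [abs_le]
    have : (n : ℝ) * (K * Real.log k ^ q) ≤ n * (e * k) :=
      mul_le_mul_of_nonneg_left (hlog.trans hσ3) hn0.le
    constructor <;> linarith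
  have h4 : k * |v - a| ≤ k * (3 * (e * n) + 6 * (k * H)) := by
    rw [← abs_of_pos hk0, ← abs_mul, abs_of_pos hk0]
    rw [abs_le] at h2 h3 ⊢
    constructor <;> nlinarith
  have h5 := le_of_mul_le_mul_left h4 hk0
  have h6 : (k : ℝ) * H ≤ 2 * (e * n) * H := by gcongr
  have h7 : 15 * H * (e * n) = ε * n := by rw [he]; field_simp
  nlinarith

end IsGappedCocycle

theorem ae_add {P : UnitAddCircle → Prop} (h : ∀ᵐ x, P x) (a : UnitAddCircle) :
    ∀ᵐ x : UnitAddCircle, P (x + a) :=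
  (measurePreserving_add_right volume a).quasiMeasurePreserving.ae h

theorem eventually_mul_sq_mul_exp_neg_le (B : ℝ) {c c' : ℝ} (hc : c' < c) :
    ∀ᶠ k : ℕ in atTop, B * k ^ 2 * Real.exp (-(c * k)) ≤ Real.exp (-(c' * k)) := by
  set d := (c - c') / 2 with hd
  have hd0 : 0 < d := by rw [hd]; linarith
  filter_upwards [eventually_mul_exp_neg_le (|B| * (2 / d ^ 2)) (by linarith : c' < c - d)] with k hk
  refine le_trans ?_ hk
  have h1 := Real.quadratic_le_exp_of_nonneg (x := d * k) (by positivity)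
  have h2 : (k : ℝ) ^ 2 ≤ 2 / d ^ 2 * Real.exp (d * k) := by
    rw [div_mul_eq_mul_div, le_div_iff₀ (by positivity)]
    nlinarith [mul_nonneg hd0.le (Nat.cast_nonneg k : (0 : ℝ) ≤ k)]
  have h3 : B * (k : ℝ) ^ 2 ≤ |B| * (2 / d ^ 2 * Real.exp (d * k)) := by
    calc B * (k : ℝ) ^ 2 ≤ |B| * k ^ 2 := by gcongr; exact le_abs_self B
      _ ≤ _ := by gcongr
  calc B * k ^ 2 * Real.exp (-(c * k)) ≤ |B| * (2 / d ^ 2 * Real.exp (d * k)) * Real.exp (-(c * k)) := by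
        gcongr
    _ = |B| * (2 / d ^ 2) * (Real.exp (d * k) * Real.exp (-(c * k))) := by ring
    _ = _ := by rw [← Real.exp_add]; ring_nf

theorem add_coe_add_coe (ω : ℝ) (x : UnitAddCircle) (m n : ℕ) :
    x + ((m * ω : ℝ) : UnitAddCircle) + ((n * ω : ℝ) : UnitAddCircle) =
      x + (((m + n : ℕ) * ω : ℝ) : UnitAddCircle) := by
  rw [add_assoc, ← AddCircle.coe_add]
  push_cast
  ring_nf

/-! ### The avalanche expansion and convergence of the means -/

namespace IsGappedCocycle

variable {ω q H K τ γ D L : ℝ} {A : ℕ → UnitAddCircle → Matrix (Fin 2) (Fin 2) ℂ}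
  {β : UnitAddCircle → ℝ}

/-- The logarithmic norms of the blocks of lengths `l` and `2 l` starting at `x` are close to their
means, and the determinant is not too large. -/
def BlockRegular (ω γ D : ℝ) (A : ℕ → UnitAddCircle → Matrix (Fin 2) (Fin 2) ℂ)
    (β : UnitAddCircle → ℝ) (l : ℕ) (x : UnitAddCircle) : Prop :=
  |logEntry A l x - ∫ y, logEntry A l y| ≤ γ / 16 * l ∧
    |logEntry A (2 * l) x - ∫ y, logEntry A (2 * l) y| ≤ γ / 16 * l ∧
    rotSum ω l β x + rotSum ω l β (x + (ω : UnitAddCircle)) ≤ 2 * (l * D) + γ / 16 * l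

/-- The gap makes the determinant of a block much smaller than the square of its norm, and smallness
of `2 ∫ u_l - ∫ u_{2l}` says that neighbouring blocks do not cancel. These are the two hypotheses of
the avalanche principle. -/
theorem abs_logEntry_mul_sub_le (h : IsGappedCocycle ω q H K τ γ D L A β) {x : UnitAddCircle} {l m : ℕ}
    (hl : 1 ≤ l) (hm : 2 ≤ m)
    (hx : ∀ k n : ℕ, (A n (x + ((k * ω : ℝ) : UnitAddCircle))).det ≠ 0 ∧
      Real.log ‖(A n (x + ((k * ω : ℝ) : UnitAddCircle))).det‖ =
        rotSum ω n β (x + ((k * ω : ℝ) : UnitAddCircle)) +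
          rotSum ω n β (x + ((k * ω : ℝ) : UnitAddCircle) + (ω : UnitAddCircle)))
    (hsmall : 2 * (∫ y, logEntry A l y) - ∫ y, logEntry A (2 * l) y ≤ γ / 8 * l)
    (hγl : Real.log 4 ≤ γ * l)
    (hreg : ∀ j < m, BlockRegular ω γ D A β l (x + (((j * l : ℕ) * ω : ℝ) : UnitAddCircle))) :
    |logEntry A (m * l) x -
      (∑ j ∈ Finset.range (m - 1), logEntry A (2 * l) (x + (((j * l : ℕ) * ω : ℝ) : UnitAddCircle)) -
        ∑ j ∈ Finset.range (m - 2), logEntry A l (x + ((((j + 1) * l : ℕ) * ω : ℝ) : UnitAddCircle)))| ≤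
      4 * Real.exp (-(γ * l)) * m := by
  set B : ℕ → Matrix (Fin 2) (Fin 2) ℂ := fun j =>
    A l (x + (((j * l : ℕ) * ω : ℝ) : UnitAddCircle)) with hB
  have hBB : ∀ j, B (j + 1) * B j = A (2 * l) (x + (((j * l : ℕ) * ω : ℝ) : UnitAddCircle)) := by
    intro j
    rw [two_mul, h.map_add, add_coe_add_coe, hB]
    simp only [add_mul, one_mul]
  have hdet : ∀ j, (B j).det ≠ 0 := fun j => (hx (j * l) l).1
  have hgap : l * D + γ * l ≤ ∫ y, logEntry A l y := by
    have h1 := h.mul_exponent_le hl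
    have h2 := mul_le_mul_of_nonneg_left h.gap (Nat.cast_nonneg l : (0 : ℝ) ≤ l)
    linarith
  -- `5/16` adds the defect `2/16` of the means and three deviations of `1/16`. The determinant
  -- would allow `29/16`; `26/16` is enough and makes `κ/η²` equal to `e^{-γl}`.
  have hap := avalanche (B := B) (P := fun j => A (j * l) x) (η := Real.exp (-(5 / 16 * (γ * l))))
    (κ := Real.exp (-(26 / 16 * (γ * l)))) (m := m) (by simp [hB])
    (fun j => by simp only [hB]; rw [← h.map_add, add_mul, one_mul, add_comm]) (Real.exp_pos _)
    (Real.exp_pos _).le ?_ (fun j _ => entryNorm_pos (hdet j)) ?_ ?_ hm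
  · have e1 : 4 * Real.exp (-(26 / 16 * (γ * l))) / Real.exp (-(5 / 16 * (γ * l))) ^ 2 =
        4 * Real.exp (-(γ * l)) := by
      rw [← Real.exp_nat_mul, mul_div_assoc, ← Real.exp_sub]
      congr 2
      push_cast
      ring
    rw [e1] at hap
    simp only [hBB] at hap
    exact hap
  · have e2 : (4 : ℝ) = Real.exp (Real.log 4) := (Real.exp_log (by norm_num)).symm
    rw [← Real.exp_nat_mul]
    nth_rewrite 1 [e2]
    rw [← Real.exp_add]
    refine Real.exp_le_exp.2 ?_
    push_cast
    linarith
  · intro j hj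
    obtain ⟨h1, -, h3⟩ := hreg j hj
    have h4 : Real.log ‖(B j).det‖ ≤ -(26 / 16 * (γ * l)) + 2 * Real.log (entryNorm (B j)) := by
      rw [(hx (j * l) l).2]
      have h5 := (abs_le.1 h1).1
      have h6 : logEntry A l (x + (((j * l : ℕ) * ω : ℝ) : UnitAddCircle)) = Real.log (entryNorm (B j)) := rfl
      rw [h6] at h5
      have h7 : 0 ≤ Real.log 4 := Real.log_nonneg (by norm_num)
      linarith
    calc ‖(B j).det‖ = Real.exp (Real.log ‖(B j).det‖) := (Real.exp_log (norm_pos_iff.2 (hdet j))).symm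
      _ ≤ Real.exp (-(26 / 16 * (γ * l)) + 2 * Real.log (entryNorm (B j))) := Real.exp_le_exp.2 h4
      _ = _ := by
        rw [Real.exp_add, ← Nat.cast_ofNat (n := 2), Real.exp_nat_mul, Real.exp_log (entryNorm_pos (hdet j))]
  · intro j hj
    obtain ⟨h1, h2, -⟩ := hreg j (by omega)
    obtain ⟨h1', -, -⟩ := hreg (j + 1) hj
    have hpos := entryNorm_pos (hdet j)
    have hpos' := entryNorm_pos (hdet (j + 1))
    have hpos2 : 0 < entryNorm (B (j + 1) * B j) := by
      refine entryNorm_pos ?_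
      rw [Matrix.det_mul]; exact mul_ne_zero (hdet _) (hdet _)
    rw [← Real.log_le_log_iff (by positivity) hpos2, Real.log_mul (Real.exp_pos _).ne' (by positivity),
      Real.log_exp, Real.log_mul hpos'.ne' hpos.ne', hBB]
    have h5 := (abs_le.1 h1).2
    have h5' := (abs_le.1 h1').2
    have h6 := (abs_le.1 h2).1
    simp only [logEntry] at h5 h5' h6 hsmall ⊢
    simp only [hB]
    linarith

theorem exists_holdsOff_blockRegular {q H K τ γ : ℝ} (hH : 1 ≤ H) (hτ : 0 < τ) (hγ : 0 < γ) :
    ∃ c : ℝ, 0 < c ∧ ∃ l₀ : ℕ, ∀ (ω D L : ℝ) (A : ℕ → UnitAddCircle → Matrix (Fin 2) (Fin 2) ℂ)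
      (β : UnitAddCircle → ℝ), IsGappedCocycle ω q H K τ γ D L A β → ∀ l : ℕ, l₀ ≤ l →
      HoldsOff (Real.exp (-(c * l))) (BlockRegular ω γ D A β l) := by
  obtain ⟨c₁, hc₁, n₁, h₁⟩ := exists_concentration (q := q) (K := K) (γ := γ) hH hτ (by positivity : 0 < γ / 16)
  obtain ⟨c₂, hc₂, n₂, h₂⟩ := exists_concentration (q := q) (K := K) (γ := γ) hH hτ (by positivity : 0 < γ / 32)
  set c := min c₁ c₂ with hc
  have hc0 : 0 < c := lt_min hc₁ hc₂
  obtain ⟨k₀, hk₀⟩ := eventually_atTop.1 ((eventually_mul_log_rpow_le K q (by positivity : 0 < γ / 32)).and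
    (eventually_mul_exp_neg_le 2 (half_lt_self hc0)))
  refine ⟨c / 2, by positivity, max (max n₁ n₂) (max k₀ 2), fun ω D L A β h l hl => ?_⟩
  have hl1 : n₁ ≤ l := (le_max_left _ _).trans ((le_max_left _ _).trans hl)
  have hl2 : n₂ ≤ l := (le_max_right _ _).trans ((le_max_left _ _).trans hl)
  have hl3 : k₀ ≤ l := (le_max_left _ _).trans ((le_max_right _ _).trans hl)
  have hl4 : 2 ≤ l := (le_max_right _ _).trans ((le_max_right _ _).trans hl)
  obtain ⟨hk1, hk2⟩ := hk₀ l hl3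
  have hl0 : (0 : ℝ) ≤ l := Nat.cast_nonneg l
  have e1 : Real.exp (-(c₁ * l)) ≤ Real.exp (-(c * l)) := by
    refine Real.exp_le_exp.2 (neg_le_neg ?_); gcongr; exact min_le_left _ _
  have e2 : Real.exp (-(c₂ * (2 * l : ℕ))) ≤ Real.exp (-(c * l)) := by
    refine Real.exp_le_exp.2 (neg_le_neg ?_)
    have : c * l ≤ c₂ * l := by gcongr; exact min_le_right _ _
    push_cast
    nlinarith
  have b1 := (h₁ ω D L A β h l hl1).mono_left e1
  have b2 := (h₂ ω D L A β h (2 * l) (by omega)).mono_left e2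
  have hsum : Real.exp (-(c * l)) + Real.exp (-(c * l)) ≤ Real.exp (-(c / 2 * l)) := by linarith
  have hall := (b1.and b2 (Real.exp_pos _).le (Real.exp_pos _).le).mono_left hsum
  refine hall.mono_ae ?_
  have hu' : ∀ᵐ x : UnitAddCircle, rotSum ω l β (x + (ω : UnitAddCircle)) - l * D ≤ K * Real.log l ^ q :=
    ae_add (P := fun y => rotSum ω l β y - l * D ≤ K * Real.log l ^ q) (h.upper_beta l hl4) _
  filter_upwards [h.upper_beta l hl4, hu'] with x hx hx'
  rintro ⟨a1, a2⟩
  refine ⟨a1, a2.trans (le_of_eq ?_), ?_⟩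
  · push_cast; ring
  · linarith

/-- Integrate the avalanche expansion of four blocks. It has three double blocks and two single
ones, each with a translation-invariant mean; second moments control the exceptional set. -/
theorem exists_abs_integral_four_mul_sub_le {q H K τ γ : ℝ} (hH : 1 ≤ H) (hτ : 0 < τ) (hγ : 0 < γ) :
    ∃ l₀ : ℕ, ∀ (ω D L : ℝ) (A : ℕ → UnitAddCircle → Matrix (Fin 2) (Fin 2) ℂ)
      (β : UnitAddCircle → ℝ), IsGappedCocycle ω q H K τ γ D L A β → ∀ l : ℕ, l₀ ≤ l →
      2 * (∫ y, logEntry A l y) - (∫ y, logEntry A (2 * l) y) ≤ γ / 8 * l →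
      |(∫ y, logEntry A (4 * l) y) - 3 * (∫ y, logEntry A (2 * l) y) + 2 * ∫ y, logEntry A l y| ≤ 1 := by
  obtain ⟨c, hc, l₁, hreg⟩ := exists_holdsOff_blockRegular (q := q) (K := K) hH hτ hγ
  set Q := momentBound q H K τ
  have hQ : 0 ≤ Q := momentBound_nonneg _ _ _ _
  -- The three error terms, with prefactors `16`, `180 Q l²` and `4`, are each made at most one
  -- third.
  obtain ⟨l₂, hl₂⟩ := eventually_atTop.1 (((eventually_le_mul_natCast (Real.log 4) hγ).and
    (eventually_mul_exp_neg_le 48 (half_lt_self hγ))).and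
    ((eventually_mul_sq_mul_exp_neg_le (540 * Q) (half_lt_self (half_pos hc))).and
    (eventually_mul_exp_neg_le 12 (half_lt_self (half_pos hc)))))
  refine ⟨max (max l₁ l₂) 1, fun ω D L A β h l hl hsmall => ?_⟩
  have hl1 : l₁ ≤ l := (le_max_left _ _).trans ((le_max_left _ _).trans hl)
  have hl2 : l₂ ≤ l := (le_max_right _ _).trans ((le_max_left _ _).trans hl)
  have hl3 : 1 ≤ l := (le_max_right _ _).trans hl
  obtain ⟨⟨e1, e2⟩, e3, e4⟩ := hl₂ l hl2
  set f₁ : UnitAddCircle → ℝ := logEntry A l with hf₁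
  set f₂ : UnitAddCircle → ℝ := logEntry A (2 * l) with hf₂
  set f₄ : UnitAddCircle → ℝ := logEntry A (4 * l) with hf₄
  have i1 : Integrable f₁ := h.integrable l hl3
  have i2 : Integrable f₂ := h.integrable (2 * l) (by omega)
  have i4 : Integrable f₄ := h.integrable (4 * l) (by omega)
  obtain ⟨q1, Q1⟩ := h.integrable_logEntry_sq hτ hl3
  obtain ⟨q2, Q2⟩ := h.integrable_logEntry_sq hτ (n := 2 * l) (by omega)
  obtain ⟨q4, Q4⟩ := h.integrable_logEntry_sq hτ (n := 4 * l) (by omega)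
  set s₁ : UnitAddCircle := ((((1 * l : ℕ) : ℝ) * ω : ℝ) : UnitAddCircle) with hs₁
  set s₂ : UnitAddCircle := ((((2 * l : ℕ) : ℝ) * ω : ℝ) : UnitAddCircle) with hs₂
  set f : UnitAddCircle → ℝ := fun x =>
    f₄ x - ((f₂ x + f₂ (x + s₁) + f₂ (x + s₂)) - (f₁ (x + s₁) + f₁ (x + s₂))) with hf
  have j2 : Integrable fun x => f₂ x + f₂ (x + s₁) + f₂ (x + s₂) :=
    (i2.add (i2.comp_add_right s₁)).add (i2.comp_add_right s₂)
  have j1 : Integrable fun x => f₁ (x + s₁) + f₁ (x + s₂) :=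
    (i1.comp_add_right s₁).add (i1.comp_add_right s₂)
  have j12 : Integrable fun x => (f₂ x + f₂ (x + s₁) + f₂ (x + s₂)) - (f₁ (x + s₁) + f₁ (x + s₂)) :=
    j2.sub j1
  have hfi : Integrable f := i4.sub j12
  have hfint : ∫ x, f x = (∫ y, f₄ y) - 3 * (∫ y, f₂ y) + 2 * ∫ y, f₁ y := by
    have i22 : Integrable fun x => f₂ x + f₂ (x + s₁) := i2.add (i2.comp_add_right s₁)
    rw [hf, integral_sub i4 j12, integral_sub j2 j1, integral_add i22 (i2.comp_add_right s₂),
      integral_add i2 (i2.comp_add_right s₁), integral_add (i1.comp_add_right s₁) (i1.comp_add_right s₂),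
      integral_comp_add f₂, integral_comp_add f₂, integral_comp_add f₁, integral_comp_add f₁]
    ring
  set F : UnitAddCircle → ℝ := fun x => 6 * (f₄ x ^ 2 + ((f₂ x ^ 2 + (f₂ (x + s₁) ^ 2 + f₂ (x + s₂) ^ 2)) +
    (f₁ (x + s₁) ^ 2 + f₁ (x + s₂) ^ 2))) with hF
  have q2a : Integrable fun x => f₂ (x + s₁) ^ 2 := q2.comp_add_right s₁
  have q2b : Integrable fun x => f₂ (x + s₂) ^ 2 := q2.comp_add_right s₂
  have q1a : Integrable fun x => f₁ (x + s₁) ^ 2 := q1.comp_add_right s₁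
  have q1b : Integrable fun x => f₁ (x + s₂) ^ 2 := q1.comp_add_right s₂
  have q2ab : Integrable fun x => f₂ (x + s₁) ^ 2 + f₂ (x + s₂) ^ 2 := q2a.add q2b
  have q2c : Integrable fun x => f₂ x ^ 2 + (f₂ (x + s₁) ^ 2 + f₂ (x + s₂) ^ 2) := q2.add q2ab
  have q1c : Integrable fun x => f₁ (x + s₁) ^ 2 + f₁ (x + s₂) ^ 2 := q1a.add q1b
  have q12 : Integrable fun x => (f₂ x ^ 2 + (f₂ (x + s₁) ^ 2 + f₂ (x + s₂) ^ 2)) +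
    (f₁ (x + s₁) ^ 2 + f₁ (x + s₂) ^ 2) := q2c.add q1c
  have hFi : Integrable F := (q4.add q12).const_mul 6
  have hfF : ∀ x, f x ^ 2 ≤ F x := by
    intro x
    have key : ∀ a b c d e g : ℝ, (a - ((b + c + d) - (e + g))) ^ 2 ≤
        6 * (a ^ 2 + ((b ^ 2 + (c ^ 2 + d ^ 2)) + (e ^ 2 + g ^ 2))) := by
      intro a b c d e g
      have := sq_sum_le_card_mul_sum_sq (s := Finset.univ) (f := ![a, -b, -c, -d, e, g])
      simp only [Fin.sum_univ_succ, Finset.card_univ, Fintype.card_fin] at this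
      simp at this
      nlinarith
    exact key _ _ _ _ _ _
  have hf2 : Integrable fun x => f x ^ 2 := by
    refine hFi.mono' (hfi.aestronglyMeasurable.pow 2) (.of_forall fun x => ?_)
    rw [Real.norm_of_nonneg (sq_nonneg _)]
    exact hfF x
  have hfQ : ∫ x, f x ^ 2 ≤ 180 * (l ^ 2 * Q) := by
    refine (integral_mono hf2 hFi hfF).trans ?_
    rw [hF, integral_const_mul, integral_add q4 q12, integral_add q2c q1c, integral_add q2 q2ab,
      integral_add q2a q2b, integral_add q1a q1b, integral_comp_add (fun x => f₂ x ^ 2),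
      integral_comp_add (fun x => f₂ x ^ 2), integral_comp_add (fun x => f₁ x ^ 2),
      integral_comp_add (fun x => f₁ x ^ 2)]
    push_cast at Q2 Q4
    linarith
  have hoff : HoldsOff (4 * Real.exp (-(c * l))) fun x => |f x| ≤ 16 * Real.exp (-(γ * l)) := by
    have h1 := HoldsOff.forall_lt (n := 4)
      (P := fun j x => BlockRegular ω γ D A β l (x + (((j * l : ℕ) * ω : ℝ) : UnitAddCircle)))
      (Real.exp_pos (-(c * l))).le fun j _ => (hreg ω D L A β h l hl1).shift _
    refine HoldsOff.mono_ae (by exact_mod_cast h1) ?_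
    filter_upwards [h.ae_det] with x hx hx4
    have h2 := h.abs_logEntry_mul_sub_le hl3 (by norm_num : 2 ≤ 4) hx hsmall e1 hx4
    simp only [Nat.add_one_sub_one, Nat.reduceSub, Finset.sum_range_succ, Finset.sum_range_zero, zero_add,
      zero_mul, Nat.cast_zero, AddCircle.coe_zero, add_zero, Nat.reduceAdd] at h2
    refine h2.trans (le_of_eq ?_)
    push_cast
    ring
  have hfin := hoff.abs_integral_le hfi hf2 hfQ (by positivity) (by positivity)
    (Real.exp_pos (-(c / 2 * l)))
  rw [hfint] at hfin
  have h5 : 4 * Real.exp (-(c * l)) / Real.exp (-(c / 2 * l)) = 4 * Real.exp (-(c / 2 * l)) := by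
    rw [mul_div_assoc, ← Real.exp_sub]
    ring_nf
  rw [h5] at hfin
  have h6 : ∀ t : ℝ, 0 ≤ t → Real.exp (-(t * l)) ≤ 1 := fun t ht =>
    Real.exp_le_one_iff.2 (by simp only [Left.neg_nonpos_iff]; positivity)
  have h7 := h6 (γ / 2) (by positivity)
  have h8 := h6 (c / 2 / 2) (by positivity)
  nlinarith

end IsGappedCocycle

namespace IsGappedCocycle

variable {ω q H K τ γ D L : ℝ} {A : ℕ → UnitAddCircle → Matrix (Fin 2) (Fin 2) ℂ}
  {β : UnitAddCircle → ℝ}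

theorem abs_exponent_le (h : IsGappedCocycle ω q H K τ γ D L A β) (hγ : 0 ≤ γ) : |L| ≤ H := by
  have hlow : -H ≤ L := by
    have := (abs_le.1 h.abs_mean_le).1
    linarith [h.gap]
  have hup := h.mul_exponent_le (n := 1) le_rfl
  have := (abs_le.1 (h.abs_integral_logEntry_le (n := 1) le_rfl)).2
  push_cast at hup this
  exact abs_le.2 ⟨hlow, by linarith⟩

/-- For the means `y_j` at scale `2^j l` the four-block identity makes the defect `2 y_j - y_{j+1}`
grow by at most one per doubling, while the scale doubles. The distance to the limit is thus at most
`∑ 2^{-(j+1)} (E + j) = E + 1`, so one small defect controls all larger scales. -/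
theorem exists_integral_sub_le {q H K τ γ : ℝ} (hH : 1 ≤ H) (hτ : 0 < τ) (hγ : 0 < γ) :
    ∃ l₀ : ℕ, ∀ (ω D L : ℝ) (A : ℕ → UnitAddCircle → Matrix (Fin 2) (Fin 2) ℂ)
      (β : UnitAddCircle → ℝ), IsGappedCocycle ω q H K τ γ D L A β → ∀ l : ℕ, l₀ ≤ l →
      2 * (∫ y, logEntry A l y) - (∫ y, logEntry A (2 * l) y) ≤ γ / 16 * l →
      (∫ y, logEntry A l y) - l * L ≤ 2 * (∫ y, logEntry A l y) - (∫ y, logEntry A (2 * l) y) + 1 := by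
  obtain ⟨l₁, hdouble⟩ := exists_abs_integral_four_mul_sub_le (q := q) (K := K) hH hτ hγ
  obtain ⟨l₂, hl₂⟩ := eventually_atTop.1 (eventually_le_mul_natCast 1 (by positivity : 0 < γ / 16))
  refine ⟨max (max l₁ l₂) 1, fun ω D L A β h l hl hsmall => ?_⟩
  have hl1 : l₁ ≤ l := (le_max_left _ _).trans ((le_max_left _ _).trans hl)
  have hl2 : l₂ ≤ l := (le_max_right _ _).trans ((le_max_left _ _).trans hl)
  have hl3 : 1 ≤ l := (le_max_right _ _).trans hl
  have hl0 : (0 : ℝ) < l := by positivity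
  have hbig := hl₂ l hl2
  set E := 2 * (∫ y, logEntry A l y) - (∫ y, logEntry A (2 * l) y) with hE
  have hE0 : 0 ≤ E := by
    have := h.integral_logEntry_mul_le (k := 2) hl3 (by norm_num)
    push_cast at this
    linarith
  set y : ℕ → ℝ := fun j => ∫ z, logEntry A (2 ^ j * l) z with hy
  have hstep : ∀ j, 2 * y j - y (j + 1) ≤ E + j := by
    intro j
    induction j with
    | zero => simp [hy, hE]
    | succ j ih =>
      have hj : (j : ℝ) ≤ 2 ^ j := by exact_mod_cast j.lt_two_pow_self.le
      have h2j : (1 : ℝ) ≤ 2 ^ j := one_le_pow₀ (by norm_num)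
      have e2 : 2 * (2 ^ j * l) = 2 ^ (j + 1) * l := by ring
      have e4 : 4 * (2 ^ j * l) = 2 ^ (j + 2) * l := by ring
      have h1 := hdouble ω D L A β h (2 ^ j * l)
        (hl1.trans (Nat.le_mul_of_pos_left l (by positivity))) (by
          -- The smallness needed to continue persists: `E + j` stays below `γ/8` times the scale,
          -- since `j ≤ 2^j` and `γl/16 ≥ 1`.
          rw [e2]
          push_cast
          have h3 : γ / 16 * (l : ℝ) ≤ 2 ^ j * (γ / 16 * l) := le_mul_of_one_le_left (by positivity) h2j
          have h4 : (2 : ℝ) ^ j * 1 ≤ 2 ^ j * (γ / 16 * l) := by gcongr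
          simp only [hy] at ih
          linarith)
      rw [e2, e4] at h1
      have h5 := (abs_le.1 h1).1
      simp only [hy] at ih ⊢
      push_cast
      linarith
  have hsum : ∀ j, 2 ^ j * y 0 - y j ≤ 2 ^ j * (E + 1) - (E + j + 1) := by
    intro j
    induction j with
    | zero => simp
    | succ j ih =>
      have := hstep j
      push_cast
      rw [pow_succ]
      linarith
  have hlim : Tendsto (fun j => y j / ((2 ^ j * l : ℕ) : ℝ)) atTop (𝓝 L) :=
    h.tendsto.comp ((tendsto_pow_atTop_atTop_of_one_lt (one_lt_two : (1 : ℕ) < 2)).atTop_mul_const' hl3)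
  have hge : (y 0 - (E + 1)) / l ≤ L := by
    refine ge_of_tendsto hlim (.of_forall fun j => ?_)
    have h1 := hsum j
    have h2 : (0 : ℝ) < 2 ^ j := by positivity
    push_cast
    rw [div_le_div_iff₀ hl0 (by positivity)]
    have h3 : 2 ^ j * (y 0 - (E + 1)) ≤ y j := by
      have : 0 ≤ (j : ℝ) := Nat.cast_nonneg j
      linarith
    nlinarith
  rw [div_le_iff₀ hl0] at hge
  have hy0 : y 0 = ∫ y, logEntry A l y := by simp [hy]
  rw [hy0] at hge
  linarith

/-- The normalized means lie in `[-H, H]`, and each dyadic scale with a large defect lowers them by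
a fixed amount. One of the first `J > 4H/e` scales is therefore good, and it fixes how close the
mean is to the exponent; subadditivity carries this to all longer lengths. The starting scale
depends only on the constants, not on the cocycle. -/
theorem exists_forall_two_mul_integral_sub_le {q H K τ γ : ℝ} (hH : 1 ≤ H) (hτ : 0 < τ) (hγ : 0 < γ) :
    ∃ l₀ : ℕ, ∀ (ω D L : ℝ) (A : ℕ → UnitAddCircle → Matrix (Fin 2) (Fin 2) ℂ)
      (β : UnitAddCircle → ℝ), IsGappedCocycle ω q H K τ γ D L A β → ∀ l : ℕ, l₀ ≤ l →
      2 * (∫ y, logEntry A l y) - (∫ y, logEntry A (2 * l) y) ≤ γ / 16 * l := by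
  obtain ⟨l₁, hchain⟩ := exists_integral_sub_le (q := q) (K := K) hH hτ hγ
  set e := γ / 128 with he
  have he0 : 0 < e := by positivity
  obtain ⟨l₂, hl₂⟩ := eventually_atTop.1 (eventually_le_mul_natCast 1 he0)
  set m₀ := max (max l₁ l₂) 1 with hm₀
  obtain ⟨J, hJ⟩ := exists_nat_gt (4 * H / e)
  rw [div_lt_iff₀ he0] at hJ
  obtain ⟨l₃, hl₃⟩ := eventually_atTop.1 (eventually_le_mul_natCast (2 * ((2 ^ J * m₀ : ℕ) * H) * 4)
    (by positivity : 0 < γ / 16))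
  refine ⟨max l₃ (2 ^ J * m₀), fun ω D L A β h l hl => ?_⟩
  have hm₀1 : 1 ≤ m₀ := le_max_right _ _
  -- a good dyadic scale
  obtain ⟨j, hjJ, hj⟩ : ∃ j < J, 2 * (∫ y, logEntry A (2 ^ j * m₀) y) -
      (∫ y, logEntry A (2 * (2 ^ j * m₀)) y) ≤ e * (2 ^ j * m₀ : ℕ) := by
    by_contra! hcon
    have hm₀0 : (0 : ℝ) < m₀ := by positivity
    have hind : ∀ j ≤ J, 2 * (∫ y, logEntry A (2 ^ j * m₀) y) ≤
        2 ^ j * (2 * (∫ y, logEntry A m₀ y) - j * (e * m₀)) := by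
      intro j
      induction j with
      | zero => simp
      | succ j ih =>
        intro hj
        have h1 := hcon j (by omega)
        have h2 := ih (by omega)
        have e2 : 2 * (2 ^ j * m₀) = 2 ^ (j + 1) * m₀ := by ring
        rw [e2] at h1
        push_cast at h1 ⊢
        rw [pow_succ (2 : ℝ) j]
        linarith
    have h1 := hind J le_rfl
    have h2 := (abs_le.1 (h.abs_integral_logEntry_le (n := 2 ^ J * m₀) (Nat.mul_pos (by positivity) hm₀1))).1
    have h3 := (abs_le.1 (h.abs_integral_logEntry_le hm₀1)).2
    push_cast at h2
    have h4 : (0 : ℝ) < 2 ^ J := by positivity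
    have h5 : 2 ^ J * (2 * (∫ y, logEntry A m₀ y) - J * (e * m₀)) ≤ 2 ^ J * (2 * (m₀ * H) - J * (e * m₀)) := by
      gcongr
    have h6 : 2 ^ J * (-2 * (m₀ * H)) ≤ 2 ^ J * (2 * (m₀ * H) - J * (e * m₀)) := by linarith
    have h7 := le_of_mul_le_mul_left h6 h4
    have h8 : (m₀ : ℝ) * (J * e) ≤ m₀ * (4 * H) := by linarith
    have := le_of_mul_le_mul_left h8 hm₀0
    linarith
  set m := 2 ^ j * m₀ with hm
  have hm₀m : m₀ ≤ m := Nat.le_mul_of_pos_left _ (by positivity)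
  have hm1 : 1 ≤ m := hm₀1.trans hm₀m
  have hmJ : m ≤ 2 ^ J * m₀ := Nat.mul_le_mul_right _ (Nat.pow_le_pow_right (by norm_num) hjJ.le)
  have hme : 1 ≤ e * m := hl₂ m (((le_max_right _ _).trans (le_max_left _ _)).trans hm₀m)
  have hm0 : (0 : ℝ) < m := by positivity
  have h1 := hchain ω D L A β h m (((le_max_left _ _).trans (le_max_left _ _)).trans hm₀m)
    (hj.trans (by rw [he]; nlinarith))
  set a := ∫ y, logEntry A m y
  have ham : a - m * L ≤ 2 * (e * m) := by linarith
  -- transfer to all larger scales by subadditivity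
  have hl1 : 1 ≤ l := hm1.trans (hmJ.trans ((le_max_right _ _).trans hl))
  have hml : m ≤ l := hmJ.trans ((le_max_right _ _).trans hl)
  have hL := h.abs_exponent_le hγ.le
  have hal : (∫ y, logEntry A l y) - l * L ≤ 2 * (e * l) + 2 * (m * H) := by
    set s := l / m with hs
    have hs1 : 1 ≤ s := (Nat.one_le_div_iff hm1).2 hml
    have h2 := h.integral_logEntry_mul_le hm1 hs1
    have h3 : (s : ℝ) * (a - m * L) ≤ s * (2 * (e * m)) := by gcongr
    have hdm : m * s + l % m = l := Nat.div_add_mod l m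
    have hdm' : (m : ℝ) * s + (l % m : ℕ) = l := by exact_mod_cast hdm
    have hmod : ((l % m : ℕ) : ℝ) ≤ m := by exact_mod_cast (Nat.mod_lt l hm1).le
    have hmod0 : (0 : ℝ) ≤ (l % m : ℕ) := Nat.cast_nonneg _
    have h4 : (∫ y, logEntry A l y) ≤ s * a + (l % m : ℕ) * H := by
      rcases Nat.eq_zero_or_pos (l % m) with h0 | h0
      · rw [h0, add_zero] at hdm
        rw [h0, ← hdm, mul_comm m s]
        simpa using h2
      · have h5 := h.integral_logEntry_add_le (m := s * m) (n := l % m) (Nat.mul_pos hs1 hm1) h0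
        rw [mul_comm s m, hdm, mul_comm m s] at h5
        have h6 := (abs_le.1 (h.abs_integral_logEntry_le h0)).2
        linarith
    have h7 : ((l % m : ℕ) : ℝ) * H ≤ m * H := by gcongr
    have h8 : -((l % m : ℕ) * L) ≤ m * H := by
      have h9 : -L ≤ H := (neg_le_abs L).trans hL
      nlinarith
    have h10 : (s : ℝ) * (e * m) ≤ e * l := by nlinarith
    have h11 : (l : ℝ) * L = s * (m * L) + (l % m : ℕ) * L := by rw [← hdm']; ring
    linarith
  have h2l := h.mul_exponent_le (n := 2 * l) (by omega)
  have hfin := hl₃ l ((le_max_left _ _).trans hl)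
  have hmJ' : (m : ℝ) * H ≤ (2 ^ J * m₀ : ℕ) * H := by gcongr
  push_cast at h2l
  have : 4 * (e * l) = γ / 32 * l := by rw [he]; ring
  linarith

end IsGappedCocycle

/-! ### Large deviations at a block scale -/

theorem sum_sum_eq_rotSum (ω : ℝ) (f : UnitAddCircle → ℝ) (x : UnitAddCircle) (l m : ℕ) :
    ∑ k ∈ Finset.range l, ∑ j ∈ Finset.range m,
      f (x + ((k * ω : ℝ) : UnitAddCircle) + (((j * l : ℕ) * ω : ℝ) : UnitAddCircle)) =
        rotSum ω (m * l) f x := by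
  induction m with
  | zero => simp [rotSum]
  | succ m ih =>
    simp only [Finset.sum_range_succ, Finset.sum_add_distrib]
    rw [ih, add_mul, one_mul, rotSum_add]
    congr 1
    refine Finset.sum_congr rfl fun k _ => ?_
    rw [add_right_comm]

namespace IsGappedCocycle

variable {ω q H K τ γ D L : ℝ} {A : ℕ → UnitAddCircle → Matrix (Fin 2) (Fin 2) ℂ}
  {β : UnitAddCircle → ℝ}

/-- Summing the avalanche expansion over the `l` starting points `x + kω` turns block sums with step
`l` into Birkhoff sums with step one. Almost invariance identifies the left side with `l` times the
value at `x`, and dividing by `l` turns errors `O(l²)` into `O(l)`. -/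
theorem abs_logEntry_mul_sub_mean_le (h : IsGappedCocycle ω q H K τ γ D L A β) {x : UnitAddCircle} {l m : ℕ}
    (hl : 1 ≤ l) (hm : 2 ≤ m)
    (hx : ∀ k n : ℕ, (A n (x + ((k * ω : ℝ) : UnitAddCircle))).det ≠ 0 ∧
      Real.log ‖(A n (x + ((k * ω : ℝ) : UnitAddCircle))).det‖ =
        rotSum ω n β (x + ((k * ω : ℝ) : UnitAddCircle)) +
          rotSum ω n β (x + ((k * ω : ℝ) : UnitAddCircle) + (ω : UnitAddCircle)))
    (hsmall : 2 * (∫ y, logEntry A l y) - ∫ y, logEntry A (2 * l) y ≤ γ / 8 * l)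
    (hγl : Real.log 4 ≤ γ * l) (hml : 4 * Real.exp (-(γ * l)) * m ≤ l)
    (hreg : ∀ i < m * l, BlockRegular ω γ D A β l (x + ((i * ω : ℝ) : UnitAddCircle)))
    (hshift : ∀ k < l, |logEntry A (m * l) (x + ((k * ω : ℝ) : UnitAddCircle)) - logEntry A (m * l) x| ≤
      2 * l + 6 * (l * H))
    (h2 : |rotSum ω ((m - 1) * l) (logEntry A (2 * l)) x -
      ((m - 1) * l : ℕ) * ∫ y, logEntry A (2 * l) y| ≤ 2 * (l * l))
    (h1 : |rotSum ω ((m - 2) * l) (logEntry A l) (x + ((l * ω : ℝ) : UnitAddCircle)) -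
      ((m - 2) * l : ℕ) * ∫ y, logEntry A l y| ≤ l * l) :
    |logEntry A (m * l) x - ((m - 1) * (∫ y, logEntry A (2 * l) y) - (m - 2) * ∫ y, logEntry A l y)| ≤
      6 * l + 6 * (l * H) := by
  have hl0 : (0 : ℝ) < l := by positivity
  set v₁ := logEntry A l with hv₁
  set v₂ := logEntry A (2 * l) with hv₂
  set w := logEntry A (m * l) with hw
  have hap : ∀ k < l, |w (x + ((k * ω : ℝ) : UnitAddCircle)) -
      (∑ j ∈ Finset.range (m - 1), v₂ (x + ((k * ω : ℝ) : UnitAddCircle) +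
          (((j * l : ℕ) * ω : ℝ) : UnitAddCircle)) -
        ∑ j ∈ Finset.range (m - 2), v₁ (x + ((l * ω : ℝ) : UnitAddCircle) + ((k * ω : ℝ) : UnitAddCircle) +
          (((j * l : ℕ) * ω : ℝ) : UnitAddCircle)))| ≤ l := by
    intro k hk
    have h3 := h.abs_logEntry_mul_sub_le (x := x + ((k * ω : ℝ) : UnitAddCircle)) hl hm
      (fun i n => by rw [add_coe_add_coe]; exact hx _ _) hsmall hγl (fun j hj => by
        rw [add_coe_add_coe]
        refine hreg _ ?_
        calc k + j * l < l + j * l := by omega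
          _ = (j + 1) * l := by ring
          _ ≤ m * l := Nat.mul_le_mul_right _ hj)
    refine le_trans (le_of_eq ?_) (h3.trans hml)
    congr 3
    refine Finset.sum_congr rfl fun j _ => ?_
    rw [add_coe_add_coe, add_coe_add_coe, add_coe_add_coe]
    congr 5
    ring
  have hsum : |rotSum ω l w x - (rotSum ω ((m - 1) * l) v₂ x -
      rotSum ω ((m - 2) * l) v₁ (x + ((l * ω : ℝ) : UnitAddCircle)))| ≤ l * l := by
    rw [← sum_sum_eq_rotSum, ← sum_sum_eq_rotSum, rotSum, ← Finset.sum_sub_distrib,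
      ← Finset.sum_sub_distrib]
    refine (Finset.abs_sum_le_sum_abs _ _).trans ((Finset.sum_le_sum fun k hk =>
      hap k (Finset.mem_range.1 hk)).trans (le_of_eq ?_))
    rw [Finset.sum_const, Finset.card_range, nsmul_eq_mul]
  have hsh : |rotSum ω l w x - l * w x| ≤ l * (2 * l + 6 * (l * H)) := by
    rw [rotSum_sub_mul, rotSum]
    refine (Finset.abs_sum_le_sum_abs _ _).trans ((Finset.sum_le_sum fun k hk =>
      hshift k (Finset.mem_range.1 hk)).trans (le_of_eq ?_))
    rw [Finset.sum_const, Finset.card_range, nsmul_eq_mul]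
  push_cast [Nat.cast_sub (by omega : 1 ≤ m), Nat.cast_sub (by omega : 2 ≤ m)] at h1 h2
  set a₁ := ∫ y, v₁ y
  set a₂ := ∫ y, v₂ y
  have hfin : l * |w x - ((m - 1) * a₂ - (m - 2) * a₁)| ≤ l * (6 * l + 6 * (l * H)) := by
    rw [← abs_of_pos hl0, ← abs_mul, abs_of_pos hl0]
    rw [abs_le] at h1 h2 hsum hsh ⊢
    constructor <;> linarith
  exact le_of_mul_le_mul_left hfin hl0

/-- Handles the remainder of the division of the length by `l`: multiplying by a short product
changes the logarithmic norm by `O(l)` unless its determinant is too small. -/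
theorem abs_logEntry_add_sub_le (h : IsGappedCocycle ω q H K τ γ D L A β) {x : UnitAddCircle} {l r n : ℕ}
    (hr : r ≤ l)
    (hx : ∀ k n : ℕ, (A n (x + ((k * ω : ℝ) : UnitAddCircle))).det ≠ 0 ∧
      Real.log ‖(A n (x + ((k * ω : ℝ) : UnitAddCircle))).det‖ =
        rotSum ω n β (x + ((k * ω : ℝ) : UnitAddCircle)) +
          rotSum ω n β (x + ((k * ω : ℝ) : UnitAddCircle) + (ω : UnitAddCircle)))
    (hreg : Regular ω D β l l (x + ((n * ω : ℝ) : UnitAddCircle))) :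
    |logEntry A (r + n) x - logEntry A n x| ≤ 2 * l + 5 * (l * H) := by
  have hH : 0 ≤ H := by linarith [h.one_le]
  rcases Nat.eq_zero_or_pos r with rfl | hr0
  · simp only [zero_add, sub_self, abs_zero]; positivity
  have hx0 : (A n x).det ≠ 0 := by simpa using (hx 0 n).1
  have h1 := h.logEntry_add_le hx0 (hx n r).1
  have h2 := h.logEntry_le_add_right hx0 (hx n r).1
  have h3 := h.neg_log_det_le hr (hx n r).2 hreg
  have h4 := h.bound r (x + ((n * ω : ℝ) : UnitAddCircle)) hr0
  have h5 : (r : ℝ) * H ≤ l * H := by gcongr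
  have h6 : 0 ≤ (l : ℝ) * H := by positivity
  rw [abs_le]
  constructor <;> linarith

/-- Large deviations at scale `l` around a combination of means of blocks of lengths `l` and `2 l`. -/
theorem exists_holdsOff_abs_sub_le {q H K τ γ : ℝ} (hq : 1 ≤ q) (hH : 1 ≤ H) (hK : 0 ≤ K) (hτ : 0 < τ)
    (hγ : 0 < γ) :
    ∃ c C : ℝ, 0 < c ∧ 0 < C ∧ ∃ l₀ : ℕ, ∀ (ω D L : ℝ)
      (A : ℕ → UnitAddCircle → Matrix (Fin 2) (Fin 2) ℂ) (β : UnitAddCircle → ℝ),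
      IsGappedCocycle ω q H K τ γ D L A β → ∀ n l : ℕ, l₀ ≤ l → C * Real.log n ^ q ≤ l → 3 * l ≤ n →
      HoldsOff (Real.exp (-(c * l))) fun x => |logEntry A n x -
        n / l * ((∫ y, logEntry A (2 * l) y) - ∫ y, logEntry A l y)| ≤ 26 * H * l := by
  obtain ⟨c₁, hc₁, l₁, hblock⟩ := exists_holdsOff_blockRegular (q := q) (K := K) hH hτ hγ
  obtain ⟨l₂, hsmall⟩ := exists_forall_two_mul_integral_sub_le (q := q) (K := K) hH hτ hγ
  set c₂ := (Real.log 2 ^ (q - 1))⁻¹ with hc₂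
  have hc₂0 : 0 < c₂ := by have := Real.log_pos (by norm_num : (1 : ℝ) < 2); positivity
  set c := min (c₁ / 2) (τ / 2) with hc
  have hc0 : 0 < c := by positivity
  -- The four summands serve, in order, the union bound over `n` starting points, the avalanche
  -- error summed over up to `n` blocks, the moment bound in the exceptional measure, and the upper
  -- deviation.
  set C := c₂ * (2 / c₁) + c₂ / γ + K * (2 / τ) + K with hC
  have hC0 : 0 < C := by positivity
  obtain ⟨l₃, hl₃⟩ := eventually_atTop.1 ((eventually_le_mul_natCast (Real.log 4) hγ).and
    (eventually_mul_exp_neg_le 7 (half_lt_self hc0)))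
  refine ⟨c / 2, C, by positivity, hC0, max (max l₁ l₂) (max l₃ 4), ?_⟩
  intro ω D L A β h n l hl hCl hln
  have hl1 : l₁ ≤ l := (le_max_left _ _).trans ((le_max_left _ _).trans hl)
  have hl2 : l₂ ≤ l := (le_max_right _ _).trans ((le_max_left _ _).trans hl)
  have hl3 : l₃ ≤ l := (le_max_left _ _).trans ((le_max_right _ _).trans hl)
  have hl4 : 4 ≤ l := (le_max_right _ _).trans ((le_max_right _ _).trans hl)
  obtain ⟨hγl, h7⟩ := hl₃ l hl3
  have hl0 : (0 : ℝ) < l := by positivity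
  have hn2 : 2 ≤ n := by omega
  have hn0 : (0 : ℝ) < n := by positivity
  set G := Real.log n ^ q with hG
  have hG0 : 0 ≤ G := by have := Real.log_natCast_nonneg n; positivity
  have hlogn : Real.log n ≤ c₂ * G := log_natCast_le_mul_rpow hq hn2
  have p1 : 0 ≤ c₂ * (2 / c₁) * G := by positivity
  have p2 : 0 ≤ c₂ / γ * G := by positivity
  have p3 : 0 ≤ K * (2 / τ) * G := by positivity
  have p4 : 0 ≤ K * G := by positivity
  have hCl' : c₂ * (2 / c₁) * G + c₂ / γ * G + K * (2 / τ) * G + K * G ≤ l := by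
    rw [← add_mul, ← add_mul, ← add_mul]; exact hCl
  have k1 : Real.log n ≤ c₁ / 2 * l := by
    have : c₁ / 2 * (c₂ * (2 / c₁) * G) ≤ c₁ / 2 * l := by gcongr; linarith
    have e : c₁ / 2 * (c₂ * (2 / c₁) * G) = c₂ * G := by field_simp
    linarith
  have k2 : Real.log n ≤ γ * l := by
    have : γ * (c₂ / γ * G) ≤ γ * l := by gcongr; linarith
    have e : γ * (c₂ / γ * G) = c₂ * G := by field_simp
    linarith
  have k3 : K * G ≤ τ / 2 * l := by
    have : τ / 2 * (K * (2 / τ) * G) ≤ τ / 2 * l := by gcongr; linarith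
    have e : τ / 2 * (K * (2 / τ) * G) = K * G := by field_simp
    linarith
  have k4 : K * G ≤ l := by linarith
  have hmono : ∀ k : ℕ, 2 ≤ k → k ≤ n → K * Real.log k ^ q ≤ K * G := by
    intro k hk hkn
    have h1 : 0 ≤ Real.log k := Real.log_natCast_nonneg k
    have h2 : Real.log k ≤ Real.log n := Real.log_le_log (by positivity) (by exact_mod_cast hkn)
    exact mul_le_mul_of_nonneg_left (Real.rpow_le_rpow h1 h2 (by linarith)) hK
  set m := n / l with hm
  set r := n % l with hr
  have hm3 : 3 ≤ m := (Nat.le_div_iff_mul_le (by omega)).2 hln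
  have hnml : r + m * l = n := by rw [mul_comm]; exact Nat.mod_add_div n l
  have hrl : r < l := Nat.mod_lt n (by omega)
  have hmln : m * l ≤ n := by omega
  have hm1n : (m - 1) * l ≤ n := (Nat.mul_le_mul_right _ (by omega)).trans hmln
  have hm2n : (m - 2) * l ≤ n := (Nat.mul_le_mul_right _ (by omega)).trans hmln
  have hm12 : 2 ≤ (m - 1) * l := le_trans (by omega) (Nat.mul_le_mul (by omega : 1 ≤ m - 1) hl4)
  have hm22 : 2 ≤ (m - 2) * l := le_trans (by omega) (Nat.mul_le_mul (by omega : 1 ≤ m - 2) hl4)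
  have hml1 : 1 ≤ m * l := Nat.mul_pos (by omega) (by omega)
  -- the exceptional sets
  have hexp : ∀ k : ℕ, 2 ≤ k → k ≤ n → Real.exp (-(τ * l) + K * Real.log k ^ q) ≤ Real.exp (-(c * l)) := by
    intro k hk hkn
    have h1 := hmono k hk hkn
    have h2 : c * l ≤ τ / 2 * l := by gcongr; exact min_le_right _ _
    exact Real.exp_le_exp.2 (by linarith)
  have E1 : HoldsOff (Real.exp (-(c * l))) fun x =>
      ∀ i < n, BlockRegular ω γ D A β l (x + ((i * ω : ℝ) : UnitAddCircle)) := by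
    refine (HoldsOff.forall_lt (Real.exp_pos (-(c₁ * l))).le fun i _ =>
      (hblock ω D L A β h l hl1).shift _).mono_left ?_
    have h2 : c * l ≤ c₁ / 2 * l := by gcongr; exact min_le_left _ _
    calc (n : ℝ) * Real.exp (-(c₁ * l)) = Real.exp (Real.log n + -(c₁ * l)) := by
          rw [Real.exp_add, Real.exp_log hn0]
      _ ≤ _ := Real.exp_le_exp.2 (by linarith)
  have hreg := (h.holdsOff_regular hτ (by omega : 2 ≤ l) l).mono_left
    (mul_le_mul_of_nonneg_left (hexp l (by omega) (by omega)) (by norm_num : (0 : ℝ) ≤ 2))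
  have E2 := hreg.and (hreg.shift (((m * l : ℕ) * ω : ℝ) : UnitAddCircle)) (by positivity) (by positivity)
  have E3 := (h.holdsOff_logEntry hτ (by omega : 1 ≤ 2 * l) hm12 l).mono_left (hexp _ hm12 hm1n)
  have E4 := ((h.holdsOff_logEntry hτ (by omega : 1 ≤ l) hm22 l).mono_left (hexp _ hm22 hm2n)).shift
    ((l * ω : ℝ) : UnitAddCircle)
  have hpos := Real.exp_pos (-(c * l))
  have hfinal : (Real.exp (-(c * l)) + (2 * Real.exp (-(c * l)) + 2 * Real.exp (-(c * l)))) +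
      (Real.exp (-(c * l)) + Real.exp (-(c * l))) ≤ Real.exp (-(c / 2 * l)) := by linarith
  have hall := ((E1.and E2 hpos.le (by positivity)).and (E3.and E4 hpos.le hpos.le) (by positivity)
    (by positivity)).mono_left hfinal
  refine hall.mono_ae ?_
  have hu1 := ae_add (P := fun x => rotSum ω ((m - 2) * l) (logEntry A l) x -
    ((m - 2) * l : ℕ) * ∫ x, logEntry A l x ≤ l * (K * Real.log ((m - 2) * l : ℕ) ^ q))
    (h.upper l ((m - 2) * l) (by omega) hm22) ((l * ω : ℝ) : UnitAddCircle)
  filter_upwards [h.ae_det, h.ae_abs_logEntry_shift_sub_le, hu1,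
    h.upper (2 * l) ((m - 1) * l) (by omega) hm12] with x hx hsh hu1 hu2
  rintro ⟨⟨b1, b2, b3⟩, b4, b5⟩
  have hsm := hsmall ω D L A β h l hl2
  have hγl0 : 0 ≤ γ * l := by positivity
  have f1 : |rotSum ω ((m - 1) * l) (logEntry A (2 * l)) x -
      ((m - 1) * l : ℕ) * ∫ y, logEntry A (2 * l) y| ≤ 2 * (l * l) := by
    have h1 : ((2 * l : ℕ) : ℝ) * (K * Real.log ((m - 1) * l : ℕ) ^ q) ≤ (2 * l : ℕ) * l :=
      mul_le_mul_of_nonneg_left ((hmono _ hm12 hm1n).trans k4) (Nat.cast_nonneg _)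
    have h2 : ((2 * l : ℕ) : ℝ) * l = 2 * (l * l) := by push_cast; ring
    rw [h2] at h1 b4
    rw [abs_le]
    constructor <;> linarith
  have f2 : |rotSum ω ((m - 2) * l) (logEntry A l) (x + ((l * ω : ℝ) : UnitAddCircle)) -
      ((m - 2) * l : ℕ) * ∫ y, logEntry A l y| ≤ l * l := by
    have h1 : (l : ℝ) * (K * Real.log ((m - 2) * l : ℕ) ^ q) ≤ l * l :=
      mul_le_mul_of_nonneg_left ((hmono _ hm22 hm2n).trans k4) (Nat.cast_nonneg _)
    rw [abs_le]
    constructor <;> linarith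
  have hml : 4 * Real.exp (-(γ * l)) * m ≤ l := by
    have h1 : (m : ℝ) ≤ n := by exact_mod_cast Nat.div_le_self n l
    have h2 : Real.exp (-(γ * l)) * n ≤ 1 := by
      rw [← Real.exp_log hn0, ← Real.exp_add]
      exact Real.exp_le_one_iff.2 (by linarith)
    have h3 : (4 : ℝ) ≤ l := by exact_mod_cast hl4
    calc 4 * Real.exp (-(γ * l)) * m ≤ 4 * (Real.exp (-(γ * l)) * n) := by
          rw [mul_assoc]; gcongr
      _ ≤ l := by linarith
  have g1 := h.abs_logEntry_mul_sub_mean_le (by omega) (by omega : 2 ≤ m) hx (hsm.trans (by linarith)) hγl hml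
    (fun i hi => b1 i (hi.trans_le hmln))
    (fun k hk => hsh (m * l) l k l hl0.le hml1 hk.le b2 b3) f1 f2
  have g2 := h.abs_logEntry_add_sub_le hrl.le hx b3
  rw [hnml] at g2
  have t1 := abs_le.1 (h.abs_integral_logEntry_le (by omega : 1 ≤ l))
  have t2 := abs_le.1 (h.abs_integral_logEntry_le (by omega : 1 ≤ 2 * l))
  push_cast at t2
  set a₁ := ∫ y, logEntry A l y
  set a₂ := ∫ y, logEntry A (2 * l) y
  have hn' : (n : ℝ) = r + m * l := by exact_mod_cast hnml.symm
  have g3 : |n / l * (a₂ - a₁) - ((m - 1) * a₂ - (m - 2) * a₁)| ≤ 7 * (l * H) := by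
    have e : n / l * (a₂ - a₁) - ((m - 1) * a₂ - (m - 2) * a₁) =
        (r / l) * (a₂ - a₁) + (a₂ - 2 * a₁) := by
      rw [hn']; field_simp; ring
    rw [e]
    have h1 : |(r / l : ℝ)| ≤ 1 := by
      rw [abs_of_nonneg (by positivity), div_le_one hl0]
      exact_mod_cast hrl.le
    have h2 : |a₂ - a₁| ≤ 3 * (l * H) := abs_le.2 ⟨by linarith, by linarith⟩
    have h3 : |a₂ - 2 * a₁| ≤ 4 * (l * H) := abs_le.2 ⟨by linarith, by linarith⟩
    calc _ ≤ |(r / l : ℝ)| * |a₂ - a₁| + |a₂ - 2 * a₁| := by rw [← abs_mul]; exact abs_add_le _ _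
      _ ≤ 1 * (3 * (l * H)) + 4 * (l * H) := by gcongr
      _ = _ := by ring
  -- The errors add up to `8l + 18 l H`, hence the constant `26 H`.
  have hlH : (l : ℝ) ≤ l * H := le_mul_of_one_le_right hl0.le hH
  rw [abs_le] at g1 g2 g3 ⊢
  constructor <;> linarith

end IsGappedCocycle

namespace IsGappedCocycle

variable {ω q H K τ γ D L : ℝ} {A : ℕ → UnitAddCircle → Matrix (Fin 2) (Fin 2) ℂ}
  {β : UnitAddCircle → ℝ}

/-- A deviation bound around any centre `Z` of size `O(n)` locates the mean: with `e^{-t} n² ≤ 1`,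
the second moments contribute only a constant. -/
theorem abs_integral_logEntry_sub_le (h : IsGappedCocycle ω q H K τ γ D L A β) (hτ : 0 < τ) {n : ℕ}
    (hn : 1 ≤ n) {Z e t : ℝ} (hZ : |Z| ≤ 3 * (n * H)) (he : 0 ≤ e) (hnt : 2 * Real.log n ≤ t)
    (hoff : HoldsOff (Real.exp (-(2 * t))) fun x => |logEntry A n x - Z| ≤ e) :
    |(∫ y, logEntry A n y) - Z| ≤ e + (2 * momentBound q H K τ + 18 * H ^ 2) + 1 := by
  obtain ⟨h2, hQ⟩ := h.integrable_logEntry_sq hτ hn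
  have hi := h.integrable n hn
  have hn0 : (0 : ℝ) < n := by positivity
  have hH : 0 ≤ H := by linarith [h.one_le]
  have hf : Integrable fun x => logEntry A n x - Z := hi.sub (integrable_const _)
  have hF : Integrable fun x => 2 * logEntry A n x ^ 2 + 2 * Z ^ 2 := (h2.const_mul 2).add (integrable_const _)
  have hfF : ∀ x, (logEntry A n x - Z) ^ 2 ≤ 2 * logEntry A n x ^ 2 + 2 * Z ^ 2 := fun x => by
    nlinarith [sq_nonneg (logEntry A n x + Z)]
  have hf2 : Integrable fun x => (logEntry A n x - Z) ^ 2 := by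
    refine hF.mono' (hf.aestronglyMeasurable.pow 2) (.of_forall fun x => ?_)
    rw [Real.norm_of_nonneg (sq_nonneg _)]
    exact hfF x
  have hZ2 : Z ^ 2 ≤ 9 * (n ^ 2 * H ^ 2) := by
    have := pow_le_pow_left₀ (abs_nonneg Z) hZ 2
    rw [sq_abs] at this
    linarith
  have hfQ : ∫ x, (logEntry A n x - Z) ^ 2 ≤ n ^ 2 * (2 * momentBound q H K τ + 18 * H ^ 2) := by
    refine (integral_mono hf2 hF hfF).trans ?_
    rw [integral_add (h2.const_mul 2) (integrable_const _), integral_const_mul]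
    simp only [integral_const, probReal_univ, smul_eq_mul, one_mul]
    linarith
  have h3 := hoff.abs_integral_le hf hf2 hfQ (Real.exp_pos _).le he (Real.exp_pos (-t))
  rw [integral_sub hi (integrable_const _)] at h3
  simp only [integral_const, probReal_univ, smul_eq_mul, one_mul] at h3
  have h4 : Real.exp (-(2 * t)) / Real.exp (-t) ≤ 1 := by
    rw [← Real.exp_sub, Real.exp_le_one_iff]
    have : 0 ≤ Real.log n := Real.log_natCast_nonneg n
    linarith
  have h5 : Real.exp (-t) * n ^ 2 ≤ 1 := by
    rw [← Real.exp_log (pow_pos hn0 2), ← Real.exp_add, Real.exp_le_one_iff, Real.log_pow]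
    push_cast
    linarith
  have hM := momentBound_nonneg q H K τ
  have h6 : Real.exp (-t) * (n ^ 2 * (2 * momentBound q H K τ + 18 * H ^ 2)) ≤
      2 * momentBound q H K τ + 18 * H ^ 2 := by
    rw [← mul_assoc]
    exact mul_le_of_le_one_left (by positivity) h5
  linarith

/-- Large deviation estimates at all scales `l` above a power of `log n`. -/
theorem exists_large_deviation {q H K τ γ : ℝ} (hq : 1 ≤ q) (hH : 1 ≤ H) (hK : 0 ≤ K) (hτ : 0 < τ)
    (hγ : 0 < γ) :
    ∃ c C : ℝ, 0 < c ∧ 0 < C ∧ ∃ l₀ : ℕ, ∀ (ω D L : ℝ)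
      (A : ℕ → UnitAddCircle → Matrix (Fin 2) (Fin 2) ℂ) (β : UnitAddCircle → ℝ),
      IsGappedCocycle ω q H K τ γ D L A β → ∀ n l : ℕ, l₀ ≤ l → C * Real.log n ^ q ≤ l → 3 * l ≤ n →
      |(∫ y, logEntry A n y) - n * L| ≤ C * l ∧
        HoldsOff (Real.exp (-(c * l))) fun x => |logEntry A n x - n * L| ≤ C * l := by
  obtain ⟨c, C₁, hc, hC₁, l₁, hdev⟩ := exists_holdsOff_abs_sub_le hq hH hK hτ hγ
  obtain ⟨l₂, hsmall⟩ := exists_forall_two_mul_integral_sub_le (q := q) (K := K) hH hτ hγ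
  obtain ⟨l₃, hchain⟩ := exists_integral_sub_le (q := q) (K := K) hH hτ hγ
  set c₂ := (Real.log 2 ^ (q - 1))⁻¹ with hc₂
  have hc₂0 : 0 < c₂ := by have := Real.log_pos (by norm_num : (1 : ℝ) < 2); positivity
  set Q := 2 * momentBound q H K τ + 18 * H ^ 2 with hQ
  have hQ0 : 0 ≤ Q := by have := momentBound_nonneg q H K τ; positivity
  set C' := 26 * H + Q + 1 with hC'
  have hC'0 : 0 < C' := by positivity
  refine ⟨c, 2 ^ q * C₁ + c₂ * (8 / c) + (5 * C' + 1), hc, by positivity, max (max l₁ l₂) (max l₃ 1), ?_⟩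
  intro ω D L A β h n l hl hCl hln
  have hl1 : l₁ ≤ l := (le_max_left _ _).trans ((le_max_left _ _).trans hl)
  have hl2 : l₂ ≤ l := (le_max_right _ _).trans ((le_max_left _ _).trans hl)
  have hl3 : l₃ ≤ l := (le_max_left _ _).trans ((le_max_right _ _).trans hl)
  have hl4 : 1 ≤ l := (le_max_right _ _).trans ((le_max_right _ _).trans hl)
  have hl0 : (1 : ℝ) ≤ l := by exact_mod_cast hl4
  have hn2 : 2 ≤ n := by omega
  have hn0 : (0 : ℝ) < n := by positivity
  set G := Real.log n ^ q with hG
  have hlog0 : 0 ≤ Real.log n := Real.log_natCast_nonneg n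
  have hG0 : 0 ≤ G := by positivity
  have hlogn : Real.log n ≤ c₂ * G := log_natCast_le_mul_rpow hq hn2
  have hlog2 : Real.log ((2 * n : ℕ) : ℝ) ≤ 2 * Real.log n := by
    push_cast
    rw [Real.log_mul (by norm_num) hn0.ne']
    have : Real.log 2 ≤ Real.log n := Real.log_le_log (by norm_num) (by exact_mod_cast hn2)
    linarith
  have hG2 : Real.log ((2 * n : ℕ) : ℝ) ^ q ≤ 2 ^ q * G := by
    rw [hG, ← Real.mul_rpow (by norm_num) hlog0]
    exact Real.rpow_le_rpow (Real.log_natCast_nonneg _) hlog2 (by linarith)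
  have h2q : (1 : ℝ) ≤ 2 ^ q := Real.one_le_rpow (by norm_num) (by linarith)
  have p1 : 0 ≤ 2 ^ q * C₁ * G := by positivity
  have p2 : 0 ≤ c₂ * (8 / c) * G := by positivity
  have p3 : 0 ≤ (5 * C' + 1) * G := by positivity
  rw [add_mul, add_mul] at hCl
  have k1 : C₁ * Real.log ((2 * n : ℕ) : ℝ) ^ q ≤ l := by
    have : C₁ * Real.log ((2 * n : ℕ) : ℝ) ^ q ≤ C₁ * (2 ^ q * G) := by gcongr
    linarith
  have k2 : C₁ * G ≤ l := by
    have : C₁ * G ≤ 2 ^ q * (C₁ * G) := le_mul_of_one_le_left (by positivity) h2q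
    linarith
  have k3 : 8 * Real.log n ≤ c * l := by
    have h1 : c * (c₂ * (8 / c) * G) ≤ c * l := by gcongr; linarith
    have e : c * (c₂ * (8 / c) * G) = 8 * (c₂ * G) := by field_simp
    linarith
  have d1 := hdev ω D L A β h n l hl1 k2 hln
  have d2 := hdev ω D L A β h (2 * n) l hl1 k1 (by omega)
  have t1 := abs_le.1 (h.abs_integral_logEntry_le hl4)
  have t2 := abs_le.1 (h.abs_integral_logEntry_le (by omega : 1 ≤ 2 * l))
  push_cast at t2
  set W := (∫ y, logEntry A (2 * l) y) - ∫ y, logEntry A l y with hW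
  have hWb : |W| ≤ 3 * (l * H) := abs_le.2 ⟨by linarith, by linarith⟩
  have hZ : ∀ k : ℕ, |(k : ℝ) / l * W| ≤ 3 * (k * H) := by
    intro k
    rw [abs_mul, abs_of_nonneg (by positivity)]
    calc (k : ℝ) / l * |W| ≤ k / l * (3 * (l * H)) := by gcongr
      _ = 3 * (k * H) := by field_simp
  have e1 := h.abs_integral_logEntry_sub_le hτ (by omega : 1 ≤ n) (hZ n) (e := 26 * H * l)
    (by positivity) (t := c * l / 2) (by linarith) (by rwa [mul_div_cancel₀ (c * l) two_ne_zero])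
  have e2 := h.abs_integral_logEntry_sub_le hτ (by omega : 1 ≤ 2 * n) (hZ (2 * n))
    (e := 26 * H * l) (by positivity) (t := c * l / 2) (by linarith)
    (by rwa [mul_div_cancel₀ (c * l) two_ne_zero])
  -- The centres for lengths `n` and `2n` use the same block means and are therefore exactly
  -- proportional. Hence the defect `2 ∫ u_n - ∫ u_{2n}` is `O(l)`, and the chain estimate at scale
  -- `n` bounds `∫ u_n - nL`.
  have hZ2 : ((2 * n : ℕ) : ℝ) / l * W = 2 * (n / l * W) := by push_cast; ring
  rw [hZ2] at e2
  set Z := (n : ℝ) / l * W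
  have hC'l : 26 * H * l + Q + 1 ≤ C' * l := by
    have : (Q + 1) * 1 ≤ (Q + 1) * l := by gcongr
    rw [hC']
    linarith
  have hE := hchain ω D L A β h n (hl3.trans (by omega)) (hsmall ω D L A β h n (hl2.trans (by omega)))
  have hge := h.mul_exponent_le (by omega : 1 ≤ n)
  rw [abs_le] at e1 e2
  set a := ∫ y, logEntry A n y
  have hbig : (5 * C' + 1) * l ≤ (2 ^ q * C₁ + c₂ * (8 / c) + (5 * C' + 1)) * l := by
    have : 0 ≤ 2 ^ q * C₁ + c₂ * (8 / c) := by positivity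
    exact mul_le_mul_of_nonneg_right (by linarith) (by linarith)
  have hup : a - n * L ≤ (3 * C' + 1) * l := by linarith
  have h0 : 0 ≤ C' * l := by positivity
  refine ⟨abs_le.2 ⟨by linarith, by linarith⟩, d1.mono fun x hx => ?_⟩
  rw [abs_le] at hx ⊢
  constructor <;> linarith

end IsGappedCocycle

/-! ### Deviations of all sizes -/

theorem HoldsOff.of_one_le {ε : ℝ} (hε : 1 ≤ ε) (P : UnitAddCircle → Prop) : HoldsOff ε P := by
  refine (prob_le_one).trans ?_
  rw [← ENNReal.ofReal_one]
  exact ENNReal.ofReal_le_ofReal hε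

namespace IsGappedCocycle

variable {ω q H K τ γ D L : ℝ} {A : ℕ → UnitAddCircle → Matrix (Fin 2) (Fin 2) ℂ}
  {β : UnitAddCircle → ℝ}

theorem holdsOff_abs_beta_sub_le (h : IsGappedCocycle ω q H K τ γ D L A β) (hK : 0 ≤ K) (hτ : 0 < τ) {n : ℕ}
    (hn : 2 ≤ n) (t : ℝ) : HoldsOff (Real.exp (-(τ * t) + (1 + τ) * K * Real.log n ^ q))
      fun x => |rotSum ω n β x - n * D| ≤ t := by
  have hG : 0 ≤ K * Real.log n ^ q := mul_nonneg hK (Real.rpow_nonneg (Real.log_natCast_nonneg n) _)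
  rcases lt_or_ge t (K * Real.log n ^ q) with ht | ht
  · refine .of_one_le (Real.one_le_exp ?_) _
    have h1 : τ * t ≤ τ * (K * Real.log n ^ q) := by gcongr
    linarith
  · refine ((h.holdsOff_beta hτ hn t).mono_left (Real.exp_le_exp.2 ?_)).mono_ae ?_
    · have h1 : 0 ≤ τ * (K * Real.log n ^ q) := by positivity
      linarith
    · filter_upwards [h.upper_beta n hn] with x hx hx'
      exact abs_le.2 ⟨by linarith, by linarith⟩

/-- Deviations of order `n` or larger, controlled by the determinant. -/
theorem holdsOff_abs_logEntry_sub_le_of_le (h : IsGappedCocycle ω q H K τ γ D L A β) (hτ : 0 < τ)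
    (hγ : 0 < γ) {n : ℕ} (hn : 2 ≤ n) {t : ℝ} (ht : 4 * (n * H) ≤ t) :
    HoldsOff (Real.exp (-(τ / 2 * t) + (K * Real.log n ^ q + 1)))
      fun x => |logEntry A n x - n * L| ≤ t := by
  have h1 := h.holdsOff_beta hτ hn (t / 2)
  have h2 := h1.and (h1.shift (ω : UnitAddCircle)) (Real.exp_pos _).le (Real.exp_pos _).le
  have hL := abs_le.1 (h.abs_exponent_le hγ.le)
  have hD := abs_le.1 h.abs_mean_le
  have hn0 : (0 : ℝ) < n := by positivity
  have nL : n * L ≤ n * H := by gcongr; exact hL.2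
  have nL' : n * (-H) ≤ n * L := by gcongr; exact hL.1
  have nD' : n * (-H) ≤ n * D := by gcongr; exact hD.1
  have nH : 0 < n * H := by have := h.one_le; positivity
  refine (h2.mono_left ?_).mono_ae ?_
  · have : (2 : ℝ) ≤ Real.exp 1 := by linarith [Real.add_one_le_exp (1 : ℝ)]
    rw [← two_mul, ← add_assoc, Real.exp_add _ 1, mul_comm (Real.exp _) (Real.exp 1),
      show τ * (t / 2) = τ / 2 * t by ring]
    gcongr
  · filter_upwards [h.logEntry_ge] with x hx hx'
    have h3 := hx n
    have h4 := h.bound n x (by omega)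
    exact abs_le.2 ⟨by linarith [hx'.1, hx'.2], by linarith⟩

end IsGappedCocycle

/-- The large deviation theorem for cocycles with a gap. -/
theorem exists_full_deviation {q H K τ γ : ℝ} (hq : 1 ≤ q) (hH : 1 ≤ H) (hK : 0 ≤ K) (hτ : 0 < τ)
    (hγ : 0 < γ) :
    ∃ c C : ℝ, 0 < c ∧ 0 < C ∧ ∀ (ω D L : ℝ)
      (A : ℕ → UnitAddCircle → Matrix (Fin 2) (Fin 2) ℂ) (β : UnitAddCircle → ℝ),
      IsGappedCocycle ω q H K τ γ D L A β → ∀ n : ℕ, 2 ≤ n →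
      |(∫ y, logEntry A n y) - n * L| ≤ C * Real.log n ^ q ∧
        ∀ t : ℝ, HoldsOff (Real.exp (-(c * t) + C * Real.log n ^ q))
          fun x => |logEntry A n x - n * L| ≤ t := by
  obtain ⟨c, C, hc, hC, l₀, hdev⟩ := IsGappedCocycle.exists_large_deviation hq hH hK hτ hγ
  set g := Real.log 2 ^ q with hg
  have hg0 : 0 < g := by have := Real.log_pos (by norm_num : (1 : ℝ) < 2); positivity
  set M := max C (12 * H) with hM
  have hM0 : 0 < M := lt_max_of_lt_left hC
  have hMC : C ≤ M := le_max_left _ _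
  have hMH : 12 * H ≤ M := le_max_right _ _
  set b : ℝ := C + (l₀ + 1) / g with hb
  have hb0 : 0 < b := by positivity
  refine ⟨min (c / M) (τ / 2), (M + c) * b + (K + 1 / g), by positivity, by positivity, ?_⟩
  intro ω D L A β h n hn
  set G := Real.log n ^ q with hG
  have hgG : g ≤ G := Real.rpow_le_rpow (Real.log_nonneg (by norm_num))
    (Real.log_le_log (by norm_num) (by exact_mod_cast hn)) (by linarith)
  have hG0 : 0 < G := hg0.trans_le hgG
  have hbG : C * G + l₀ + 1 ≤ b * G := by
    have : (l₀ + 1) / g * g ≤ (l₀ + 1) / g * G := by gcongr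
    rw [div_mul_cancel₀ _ hg0.ne'] at this
    rw [hb]
    linarith
  have hgG1 : 1 ≤ 1 / g * G := by
    rw [one_div, inv_mul_eq_div, one_le_div hg0]
    exact hgG
  have hn0 : (0 : ℝ) < n := by positivity
  have hKG : 0 ≤ K * G := by positivity
  have hMb : 0 ≤ M * (b * G) := by positivity
  have hcb : 0 ≤ c * (b * G) := by positivity
  have hL := abs_le.1 (h.abs_exponent_le hγ.le)
  have hnL : |(n : ℝ) * L| ≤ n * H := by
    rw [abs_mul, abs_of_pos hn0]
    gcongr
    exact h.abs_exponent_le hγ.le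
  constructor
  · set l := max l₀ ⌈C * G⌉₊ with hl
    have hl1 : (l : ℝ) ≤ b * G := by
      have : (⌈C * G⌉₊ : ℝ) < C * G + 1 := Nat.ceil_lt_add_one (by positivity)
      rw [hl, Nat.cast_max]
      exact max_le (by nlinarith [mul_pos hC hG0]) (by linarith [Nat.cast_nonneg (α := ℝ) l₀])
    have hlM : M * l ≤ M * (b * G) := by gcongr
    suffices |(∫ y, logEntry A n y) - n * L| ≤ M * l by linarith
    rcases le_or_gt (3 * l) n with h3 | h3
    · refine (hdev ω D L A β h n l (le_max_left _ _) ?_ h3).1.trans (by gcongr)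
      exact (Nat.le_ceil _).trans (by exact_mod_cast le_max_right _ _)
    · have h4 : (n : ℝ) ≤ 3 * l := by exact_mod_cast h3.le
      have h5 : n * H ≤ 3 * l * H := by gcongr
      have h6 : 12 * H * l ≤ M * l := by gcongr
      have h7 : 0 ≤ H * l := by positivity
      have := abs_sub (∫ y, logEntry A n y) (n * L)
      linarith [h.abs_integral_logEntry_le (by omega : 1 ≤ n)]
  · intro t
    rcases le_or_gt t 0 with ht | ht
    · refine .of_one_le (Real.one_le_exp ?_) _
      have : min (c / M) (τ / 2) * t ≤ 0 := mul_nonpos_of_nonneg_of_nonpos (by positivity) ht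
      linarith
    rcases le_or_gt (4 * (n * H)) t with ht2 | ht2
    · refine (h.holdsOff_abs_logEntry_sub_le_of_le hτ hγ hn ht2).mono_left (Real.exp_le_exp.2 ?_)
      have : min (c / M) (τ / 2) * t ≤ τ / 2 * t := by gcongr; exact min_le_right _ _
      linarith
    have hct : min (c / M) (τ / 2) * t ≤ c / M * t := by gcongr; exact min_le_left _ _
    -- The largest block scale for which the deviation is still at most `t`. The cap `n/3` is
    -- harmless: here `t < 4nH`, so `t` remains at most a multiple of `l + 1`.
    set l := min ⌊t / C⌋₊ (n / 3) with hl
    have hlt : C * l ≤ t := by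
      have h1 : (l : ℝ) ≤ t / C :=
        (by exact_mod_cast min_le_left _ _ : (l : ℝ) ≤ ⌊t / C⌋₊).trans (Nat.floor_le (by positivity))
      rw [le_div_iff₀ hC] at h1
      linarith
    have htl : t ≤ M * (l + 1) := by
      rcases min_choice ⌊t / C⌋₊ (n / 3) with h1 | h1
      · have h2 := (Nat.lt_floor_add_one (t / C)).le
        rw [div_le_iff₀ hC] at h2
        rw [hl, h1]
        exact h2.trans ((mul_comm _ _).le.trans (by gcongr))
      · have h2 : (n : ℝ) ≤ 3 * (l + 1) := by
          rw [hl, h1]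
          exact_mod_cast (by omega : n ≤ 3 * (n / 3 + 1))
        have h3 : n * H ≤ 3 * (l + 1) * H := by gcongr
        have h4 : 12 * H * (l + 1) ≤ M * (l + 1) := by gcongr
        linarith
    have hct2 : c / M * t ≤ c * (l + 1) := by
      rw [div_mul_eq_mul_div, div_le_iff₀ hM0]
      have := mul_le_mul_of_nonneg_left htl hc.le
      linarith
    have hb1 : c * 1 ≤ c * (b * G) := by
      gcongr
      have : 0 ≤ C * G := by positivity
      linarith [Nat.cast_nonneg (α := ℝ) l₀]
    -- If `l` is too small for the block theorem, then `t` is at most a multiple of `(log n)^q`, and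
    -- the claimed measure bound exceeds one.
    by_cases hgood : l₀ ≤ l ∧ C * G ≤ l
    · refine ((hdev ω D L A β h n l hgood.1 hgood.2 (by omega)).2.mono_left
        (Real.exp_le_exp.2 (by linarith))).mono fun x hx => hx.trans hlt
    · refine .of_one_le (Real.one_le_exp ?_) _
      have h1 : (l : ℝ) + 1 ≤ b * G := by
        by_contra! h2
        refine hgood ⟨?_, by linarith [Nat.cast_nonneg (α := ℝ) l₀]⟩
        have : (l₀ : ℝ) ≤ l := by
          have : 0 ≤ C * G := by positivity
          linarith
        exact_mod_cast this
      have h2 : c * (l + 1) ≤ c * (b * G) := by gcongr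
      linarith

/-! ### Jacobi transfer matrices as a cocycle with a gap -/

theorem rot_pt (ω : ℝ) (k : ℕ) (x : UnitAddCircle) :
    rot ω k (pt x) = pt (x + ((k * ω : ℝ) : UnitAddCircle)) := by
  rw [pt_add, pt_coe, rot]
  congr 2
  push_cast
  ring

theorem rot_rot (ω : ℝ) (m n : ℕ) (z : ℂ) : rot ω m (rot ω n z) = rot ω (m + n) z := by
  rw [rot, rot, rot, mul_assoc, ← Complex.exp_add]
  congr 2
  push_cast
  ring

@[simp] theorem norm_rot (ω : ℝ) (k : ℕ) (z : ℂ) : ‖rot ω k z‖ = ‖z‖ := by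
  rw [rot, norm_mul, show (2 * Real.pi * Complex.I * k * ω : ℂ) = ((2 * Real.pi * k * ω : ℝ) : ℂ) * Complex.I by
    push_cast; ring, Complex.norm_exp_ofReal_mul_I, mul_one]

theorem rot_mem_closedAnnulus {s : ℝ} {z : ℂ} (hz : z ∈ closedAnnulus s) (ω : ℝ) (k : ℕ) :
    rot ω k z ∈ closedAnnulus s := by
  rw [closedAnnulus, Set.mem_ofPred_eq, norm_rot]
  exact hz

theorem one_div_conj_mem_closedAnnulus {s : ℝ} {z : ℂ} (hz : z ∈ closedAnnulus s) :
    1 / starRingEnd ℂ z ∈ closedAnnulus s := by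
  have h0 : 0 < ‖z‖ := (Real.exp_pos _).trans_le hz.1
  rw [closedAnnulus, Set.mem_ofPred_eq, norm_div, norm_one, RCLike.norm_conj, one_div]
  constructor
  · rw [Real.exp_neg]
    exact inv_anti₀ h0 hz.2
  · rw [← neg_neg s, Real.exp_neg (-s)]
    exact inv_anti₀ (Real.exp_pos _) hz.1

theorem closedAnnulus_subset_annulus {ρ : ℝ} (h0 : 0 < ρ) (h1 : ρ < 1) :
    closedAnnulus (Real.log (1 + ρ / 2)) ⊆ annulus ρ := by
  intro z hz
  have hp : 0 < 1 + ρ / 2 := by linarith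
  rw [closedAnnulus, Set.mem_ofPred_eq, Real.exp_neg, Real.exp_log hp] at hz
  refine ⟨lt_of_lt_of_le ?_ hz.1, by linarith [hz.2]⟩
  rw [lt_inv_comm₀ (by linarith) hp, ← one_div, lt_div_iff₀ (by linarith)]
  nlinarith

theorem analyticOnNhd_tilde {b : ℂ → ℂ} {s : ℝ} (hb : AnalyticOnNhd ℂ b (closedAnnulus s)) :
    AnalyticOnNhd ℂ (tilde b) (closedAnnulus s) := by
  intro z hz
  have h0 : z ≠ 0 := norm_pos_iff.1 ((Real.exp_pos _).trans_le hz.1)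
  have h1 := (hb _ (one_div_conj_mem_closedAnnulus hz)).eventually_analyticAt
  have hc : ContinuousAt (fun w : ℂ => 1 / starRingEnd ℂ w) z :=
    continuousAt_const.div Complex.continuous_conj.continuousAt (by simpa using h0)
  rw [Complex.analyticAt_iff_eventually_differentiableAt]
  filter_upwards [hc.eventually h1, eventually_ne_nhds h0] with w hw hw0
  have h2 : DifferentiableAt ℂ (starRingEnd ℂ ∘ b ∘ starRingEnd ℂ) (1 / w) := by
    rw [show (1 / w : ℂ) = starRingEnd ℂ (1 / starRingEnd ℂ w) by simp]
    exact hw.differentiableAt.conj_conj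
  have h3 : DifferentiableAt ℂ (fun w : ℂ => 1 / w) w := by fun_prop (disch := assumption)
  have := DifferentiableAt.comp (g := starRingEnd ℂ ∘ b ∘ starRingEnd ℂ) w h2 h3
  refine this.congr_of_eventuallyEq (.of_forall fun u => ?_)
  simp [tilde]

theorem tilde_pt (b : ℂ → ℂ) (x : UnitAddCircle) : tilde b (pt x) = starRingEnd ℂ (b (pt x)) := by
  have : starRingEnd ℂ (pt x) ≠ 0 := by simpa using pt_ne_zero x
  have h2 : 1 / starRingEnd ℂ (pt x) = pt x := by
    rw [div_eq_iff this, Complex.mul_conj, Complex.normSq_eq_norm_sq, norm_pt]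
    norm_num
  rw [tilde, h2]

theorem Ma_add (a b : ℂ → ℂ) (ω : ℝ) (E : ℂ) (m n : ℕ) (z : ℂ) :
    Ma a b ω E (m + n) z = Ma a b ω E m (rot ω n z) * Ma a b ω E n z := by
  induction m with
  | zero => simp [Ma]
  | succ m ih => rw [Nat.add_right_comm, Ma, Ma, ih, rot_rot, mul_assoc]

theorem det_step (a b : ℂ → ℂ) (ω : ℝ) (E z : ℂ) :
    (step a b ω E z).det = tilde b z * b (rot ω 1 z) := by
  simp [step, Matrix.det_fin_two]

theorem rotSum_succ (ω : ℝ) (n : ℕ) (f : UnitAddCircle → ℝ) (x : UnitAddCircle) :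
    rotSum ω (n + 1) f x = rotSum ω n f x + f (x + ((n * ω : ℝ) : UnitAddCircle)) := by
  rw [rotSum, Finset.sum_range_succ, rotSum]

/-- Each one-step determinant is `b̃(z) b(z + ω)`, and `b̃` has the modulus of `b` on the circle.
This yields two Birkhoff sums, one of them shifted by `ω`. -/
theorem det_Ma {a b : ℂ → ℂ} {ω : ℝ} {E : ℂ} {x : UnitAddCircle}
    (hx : ∀ k : ℕ, b (pt (x + ((k * ω : ℝ) : UnitAddCircle))) ≠ 0) (n : ℕ) :
    (Ma a b ω E n (pt x)).det ≠ 0 ∧ Real.log ‖(Ma a b ω E n (pt x)).det‖ =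
      rotSum ω n (fun y => Real.log ‖b (pt y)‖) x +
        rotSum ω n (fun y => Real.log ‖b (pt y)‖) (x + (ω : UnitAddCircle)) := by
  induction n with
  | zero => simp [Ma, rotSum]
  | succ n ih =>
    have h1 : rot ω 1 (rot ω n (pt x)) = pt (x + (((n + 1 : ℕ) * ω : ℝ) : UnitAddCircle)) := by
      rw [rot_rot, add_comm 1 n, rot_pt]
    have h2 : x + (ω : UnitAddCircle) + ((n * ω : ℝ) : UnitAddCircle) =
        x + (((n + 1 : ℕ) * ω : ℝ) : UnitAddCircle) := by
      rw [add_assoc, ← AddCircle.coe_add]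
      congr 2
      push_cast
      ring
    have h3 : ‖tilde b (pt (x + ((n * ω : ℝ) : UnitAddCircle)))‖ =
        ‖b (pt (x + ((n * ω : ℝ) : UnitAddCircle)))‖ := by rw [tilde_pt, RCLike.norm_conj]
    have h4 : tilde b (pt (x + ((n * ω : ℝ) : UnitAddCircle))) ≠ 0 := by
      rw [← norm_ne_zero_iff, h3, norm_ne_zero_iff]
      exact hx n
    rw [Ma, Matrix.det_mul, det_step, h1, rot_pt]
    refine ⟨mul_ne_zero (mul_ne_zero h4 (hx _)) ih.1, ?_⟩
    rw [norm_mul, norm_mul, Real.log_mul (mul_ne_zero (norm_ne_zero_iff.2 h4) (norm_ne_zero_iff.2 (hx _)))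
      (norm_ne_zero_iff.2 ih.1), Real.log_mul (norm_ne_zero_iff.2 h4) (norm_ne_zero_iff.2 (hx _)), ih.2,
      rotSum_succ, rotSum_succ, h2, h3]
    ring

/-- Quantitative hypotheses on the data of a Jacobi cocycle on the closed annulus of logarithmic
half-width `s`. -/
structure IsBoundedData (s N : ℝ) (a b : ℂ → ℂ) (E : ℂ) : Prop where
  pos : 0 < s
  one_le : 1 ≤ N
  analytic_left : AnalyticOnNhd ℂ a (closedAnnulus s)
  analytic_right : AnalyticOnNhd ℂ b (closedAnnulus s)
  norm_sub_le : ∀ z ∈ closedAnnulus s, ‖a z - E‖ ≤ N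
  norm_le : ∀ z ∈ closedAnnulus s, ‖b z‖ ≤ N
  ne_zero : ∃ x, b (pt x) ≠ 0
  abs_mean_le : |∫ x, Real.log ‖b (pt x)‖| ≤ N

namespace IsBoundedData

variable {s N : ℝ} {a b : ℂ → ℂ} {E : ℂ}

theorem entryNorm_step_le (h : IsBoundedData s N a b E) (ω : ℝ) {z : ℂ} (hz : z ∈ closedAnnulus s) :
    entryNorm (step a b ω E z) ≤ 2 * N := by
  refine entryNorm_le fun i j => ?_
  have h0 := h.one_le
  have h1 := h.norm_sub_le z hz
  have h2 : ‖tilde b z‖ ≤ N := by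
    rw [tilde, RCLike.norm_conj]
    exact h.norm_le _ (one_div_conj_mem_closedAnnulus hz)
  have h3 := h.norm_le _ (rot_mem_closedAnnulus hz ω 1)
  fin_cases i <;> fin_cases j <;> simp [step] <;> linarith

theorem entryNorm_Ma_le (h : IsBoundedData s N a b E) (ω : ℝ) {z : ℂ} (hz : z ∈ closedAnnulus s) {n : ℕ}
    (hn : 1 ≤ n) : entryNorm (Ma a b ω E n z) ≤ Real.exp (n * (2 * N)) := by
  have h0 := h.one_le
  have h1 : 2 * N ≤ Real.exp (2 * N) := by linarith [Real.add_one_le_exp (2 * N)]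
  rw [Real.exp_nat_mul]
  induction n, hn using Nat.le_induction with
  | base =>
    simpa [Ma] using (h.entryNorm_step_le ω (rot_mem_closedAnnulus hz ω 0)).trans h1
  | succ n hn ih =>
    rw [Ma, pow_succ']
    exact (entryNorm_mul_le _ _).trans (mul_le_mul ((h.entryNorm_step_le ω
      (rot_mem_closedAnnulus hz ω n)).trans h1) ih (entryNorm_nonneg _) (Real.exp_pos _).le)

theorem analyticOnNhd_Ma (h : IsBoundedData s N a b E) (ω : ℝ) (n : ℕ) (i j : Fin 2) :
    AnalyticOnNhd ℂ (fun z => Ma a b ω E n z i j) (closedAnnulus s) := by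
  have hrot : ∀ k : ℕ, AnalyticOnNhd ℂ (rot ω k) (closedAnnulus s) := fun k z _ => by
    unfold rot
    fun_prop
  have hcomp : ∀ {f : ℂ → ℂ} (k : ℕ), AnalyticOnNhd ℂ f (closedAnnulus s) →
      AnalyticOnNhd ℂ (fun z => f (rot ω k z)) (closedAnnulus s) := fun k hf =>
    hf.comp (hrot k) fun z hz => rot_mem_closedAnnulus hz ω k
  induction n generalizing i j with
  | zero => exact fun z _ => analyticAt_const
  | succ n ih =>
    have hstep : ∀ i j, AnalyticOnNhd ℂ (fun z => step a b ω E (rot ω n z) i j) (closedAnnulus s) := by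
      intro i j
      fin_cases i <;> fin_cases j <;> simp only [step, Fin.zero_eta, Fin.mk_one, Matrix.of_apply,
        Matrix.cons_val', Matrix.cons_val_zero, Matrix.cons_val_one, Matrix.cons_val_fin_one]
      · exact (hcomp n h.analytic_left).sub analyticOnNhd_const
      · exact (hcomp n (analyticOnNhd_tilde h.analytic_right)).neg
      · exact hcomp n (hcomp 1 h.analytic_right)
      · exact analyticOnNhd_const
    simp only [Ma, Matrix.mul_apply, Fin.sum_univ_two]
    exact ((hstep i 0).mul (ih 0 j)).add ((hstep i 1).mul (ih 1 j))

theorem ae_ne_zero (h : IsBoundedData s N a b E) (ω : ℝ) :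
    ∀ᵐ x : UnitAddCircle, ∀ k : ℕ, b (pt (x + ((k * ω : ℝ) : UnitAddCircle))) ≠ 0 :=
  ae_forall_add (ae_comp_pt_ne_zero h.pos h.analytic_right h.ne_zero) ω

end IsBoundedData

/-- With `entryNorm_le_two_mul_norm` this shows that the entry norm and the operator norm have
logarithms within `log 2`, a discrepancy absorbed by the logarithmic error term. -/
theorem norm_le_entryNorm (A : Matrix (Fin 2) (Fin 2) ℂ) : ‖A‖ ≤ entryNorm A := by
  rw [← Matrix.l2_opNorm_toEuclideanCLM]
  refine ContinuousLinearMap.opNorm_le_bound _ (entryNorm_nonneg A) fun x => ?_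
  have hA := norm_entry_le_entryNorm A
  have h0 := entryNorm_nonneg A
  set c := entryNorm A
  have key : ∀ i, ‖Matrix.toEuclideanCLM (n := Fin 2) (𝕜 := ℂ) A x i‖ ≤ c / 2 * (‖x 0‖ + ‖x 1‖) := by
    intro i
    rw [Matrix.ofLp_toEuclideanCLM, Matrix.mulVec, dotProduct, Fin.sum_univ_two]
    refine (norm_add_le _ _).trans ?_
    rw [norm_mul, norm_mul, mul_add]
    have h1 : ‖A i 0‖ ≤ c / 2 := by linarith [hA i 0]
    have h2 : ‖A i 1‖ ≤ c / 2 := by linarith [hA i 1]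
    gcongr
  refine (abs_le_of_sq_le_sq' ?_ (by positivity)).2
  rw [mul_pow, EuclideanSpace.norm_sq_eq, EuclideanSpace.norm_sq_eq, Fin.sum_univ_two, Fin.sum_univ_two]
  have k0 := pow_le_pow_left₀ (norm_nonneg _) (key 0) 2
  have k1 := pow_le_pow_left₀ (norm_nonneg _) (key 1) 2
  have e : (c / 2 * (‖x 0‖ + ‖x 1‖)) ^ 2 + (c / 2 * (‖x 0‖ + ‖x 1‖)) ^ 2 ≤
      c ^ 2 * (‖x 0‖ ^ 2 + ‖x 1‖ ^ 2) := by
    nlinarith [mul_nonneg (sq_nonneg c) (sq_nonneg (‖x 0‖ - ‖x 1‖))]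
  exact (add_le_add k0 k1).trans e

theorem entryNorm_le_two_mul_norm (A : Matrix (Fin 2) (Fin 2) ℂ) : entryNorm A ≤ 2 * ‖A‖ := by
  refine entryNorm_le fun i j => ?_
  have h1 := (Matrix.toEuclideanCLM (n := Fin 2) (𝕜 := ℂ) A).le_opNorm (PiLp.single 2 j (1 : ℂ))
  rw [PiLp.norm_single, norm_one, mul_one, Matrix.l2_opNorm_toEuclideanCLM] at h1
  have h2 := (PiLp.norm_apply_le _ i).trans h1
  rw [Matrix.ofLp_toEuclideanCLM] at h2
  simp only [PiLp.ofLp_single, Matrix.mulVec_single_one, Matrix.col_apply] at h2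
  linarith

theorem abs_logNorm_sub_log_entryNorm_le {A : Matrix (Fin 2) (Fin 2) ℂ} (h : A.det ≠ 0) :
    |logNorm A - Real.log (entryNorm A)| ≤ Real.log 2 := by
  have h1 := norm_le_entryNorm A
  have h2 := entryNorm_le_two_mul_norm A
  have h3 := entryNorm_pos h
  have h4 : 0 < ‖A‖ := by linarith
  have h5 := Real.log_le_log h4 h1
  have h6 := Real.log_le_log h3 h2
  rw [Real.log_mul two_ne_zero h4.ne'] at h6
  have h7 : 0 ≤ Real.log 2 := Real.log_nonneg (by norm_num)
  rw [logNorm]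
  exact abs_le.2 ⟨by linarith, by linarith⟩

namespace IsBoundedData

variable {s N : ℝ} {a b : ℂ → ℂ} {E : ℂ}

/-- The transfer matrices on the unit circle. -/
noncomputable def transfer (a b : ℂ → ℂ) (ω : ℝ) (E : ℂ) (n : ℕ) (x : UnitAddCircle) :
    Matrix (Fin 2) (Fin 2) ℂ :=
  Ma a b ω E n (pt x)

/-- Twice the entries of `M^a_n`, so that the sup norm is the entry norm. -/
noncomputable def entries (a b : ℂ → ℂ) (ω : ℝ) (E : ℂ) (n : ℕ) (i : Fin (2 * 2)) (z : ℂ) : ℂ :=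
  2 * Ma a b ω E n z (finProdFinEquiv.symm i).1 (finProdFinEquiv.symm i).2

theorem norm_entries (a b : ℂ → ℂ) (ω : ℝ) (E : ℂ) (n : ℕ) (z : ℂ) :
    ‖fun i => entries a b ω E n i z‖ = entryNorm (Ma a b ω E n z) := by
  have : (fun i => entries a b ω E n i z) = (2 : ℂ) • fun i : Fin (2 * 2) =>
    Ma a b ω E n z (finProdFinEquiv.symm i).1 (finProdFinEquiv.symm i).2 := rfl
  rw [this, norm_smul, entryNorm]
  simp

theorem analyticOnNhd_entries (h : IsBoundedData s N a b E) (ω : ℝ) (n : ℕ) (i : Fin (2 * 2)) :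
    AnalyticOnNhd ℂ (entries a b ω E n i) (closedAnnulus s) :=
  analyticOnNhd_const.mul (h.analyticOnNhd_Ma ω n _ _)

theorem norm_entries_le (h : IsBoundedData s N a b E) (ω : ℝ) {n : ℕ} (hn : 1 ≤ n) (i : Fin (2 * 2)) {z : ℂ}
    (hz : z ∈ closedAnnulus s) : ‖entries a b ω E n i z‖ ≤ Real.exp (n * (2 * N)) := by
  refine le_trans ?_ (h.entryNorm_Ma_le ω hz hn)
  rw [← norm_entries]
  exact norm_le_pi_norm (fun i => entries a b ω E n i z) i

theorem exists_entries_ne_zero (h : IsBoundedData s N a b E) (ω : ℝ) (n : ℕ) :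
    ∃ i x, entries a b ω E n i (pt x) ≠ 0 := by
  obtain ⟨x, hx⟩ := (h.ae_ne_zero ω).exists
  by_contra! h0
  have h1 := entryNorm_pos (det_Ma (E := E) (a := a) hx n).1
  rw [← norm_entries, show (fun i => entries a b ω E n i (pt x)) = 0 from funext fun i => h0 i x] at h1
  simp at h1

theorem logEntry_transfer (a b : ℂ → ℂ) (ω : ℝ) (E : ℂ) (n : ℕ) :
    logEntry (transfer a b ω E) n = fun x => Real.log ‖fun i => entries a b ω E n i (pt x)‖ := by
  funext x
  rw [norm_entries]
  rfl

theorem integrable_logEntry (h : IsBoundedData s N a b E) (ω : ℝ) (n : ℕ) :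
    Integrable (logEntry (transfer a b ω E) n) := by
  rw [logEntry_transfer]
  exact integrable_log_norm_pi_comp_pt h.pos (h.analyticOnNhd_entries ω n) (h.exists_entries_ne_zero ω n)

theorem measurable_logEntry (h : IsBoundedData s N a b E) (ω : ℝ) (n : ℕ) :
    Measurable (logEntry (transfer a b ω E) n) := by
  rw [logEntry_transfer]
  exact (continuous_pi fun i => continuous_comp_pt h.pos (h.analyticOnNhd_entries ω n i)).norm.measurable.log

theorem integrable_log_norm (h : IsBoundedData s N a b E) :
    Integrable fun x : UnitAddCircle => Real.log ‖b (pt x)‖ :=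
  integrable_log_norm_comp_pt h.pos h.analytic_right

theorem logEntry_add_le (h : IsBoundedData s N a b E) (ω : ℝ) (m n : ℕ) : ∀ᵐ x : UnitAddCircle,
    logEntry (transfer a b ω E) (m + n) x ≤ logEntry (transfer a b ω E) m (x + ((n * ω : ℝ) : UnitAddCircle)) +
      logEntry (transfer a b ω E) n x := by
  have h1 := ae_add (P := fun x => (Ma a b ω E m (pt x)).det ≠ 0)
    (by filter_upwards [h.ae_ne_zero ω] with x hx using (det_Ma hx m).1) ((n * ω : ℝ) : UnitAddCircle)
  filter_upwards [h.ae_ne_zero ω, h1] with x hx hx1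
  have h2 := entryNorm_pos (det_Ma (E := E) (a := a) hx n).1
  have h3 := entryNorm_pos (det_Ma (E := E) (a := a) hx (m + n)).1
  simp only [logEntry, transfer]
  rw [← Real.log_mul (entryNorm_pos hx1).ne' h2.ne']
  refine Real.log_le_log h3 ?_
  rw [Ma_add, rot_pt]
  exact entryNorm_mul_le _ _

/-- The determinant bounds the mean of the logarithmic norm from below. This gives the mean
condition of the Birkhoff theorem for every `E`, before anything is known about the exponent. -/
theorem integral_logEntry_ge (h : IsBoundedData s N a b E) (ω : ℝ) (n : ℕ) :
    n * ∫ x, Real.log ‖b (pt x)‖ ≤ ∫ x, logEntry (transfer a b ω E) n x := by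
  have hi := integrable_rotSum h.integrable_log_norm ω n
  have hi' := hi.comp_add_right (ω : UnitAddCircle)
  have h1 := integral_mono_ae (hi.add hi') ((h.integrable_logEntry ω n).const_mul 2) (by
    filter_upwards [h.ae_ne_zero ω] with x hx
    have h2 := det_Ma (E := E) (a := a) hx n
    have := Real.log_le_log (norm_pos_iff.2 h2.1) (norm_det_le_entryNorm_sq _)
    rw [Real.log_pow, h2.2] at this
    exact_mod_cast this)
  simp only [Pi.add_apply] at h1
  rw [integral_add hi hi', integral_const_mul, integral_comp_add (rotSum ω n _), integral_rotSum
    h.integrable_log_norm] at h1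
  linarith

/-- Fekete's lemma; the determinant bound keeps the limit finite. -/
theorem exists_tendsto (h : IsBoundedData s N a b E) (ω : ℝ) :
    ∃ L, Tendsto (fun n : ℕ => (∫ x, logEntry (transfer a b ω E) n x) / n) atTop (𝓝 L) := by
  have hsub : Subadditive fun n => ∫ x, logEntry (transfer a b ω E) n x := by
    intro m n
    have hi := (h.integrable_logEntry ω m).comp_add_right ((n * ω : ℝ) : UnitAddCircle)
    have h1 := integral_mono_ae (h.integrable_logEntry ω (m + n)) (hi.add (h.integrable_logEntry ω n))
      (h.logEntry_add_le ω m n)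
    simp only [Pi.add_apply] at h1
    rwa [integral_add hi (h.integrable_logEntry ω n), integral_comp_add (logEntry _ m)] at h1
  refine ⟨_, hsub.tendsto_lim ⟨min (∫ x, Real.log ‖b (pt x)‖) 0, ?_⟩⟩
  rintro _ ⟨n, rfl⟩
  rcases Nat.eq_zero_or_pos n with rfl | hn
  · simp
  · refine (min_le_left _ _).trans ?_
    rw [le_div_iff₀ (by positivity), mul_comm]
    exact h.integral_logEntry_ge ω n

end IsBoundedData

/-- The theorem for maxima of analytic functions is used twice: with `W = n` for the entries of the
`n`-step matrix, and with `W = 1` and all functions equal to `b` for `log |b|`. -/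
theorem exists_isGappedCocycle {α c ω s N : ℝ} (hα : 0 < α) (hc : 0 < c) (hω : UniformDiophantine α c ω)
    (hs : 0 < s) (hN : 1 ≤ N) : ∃ K τ : ℝ, 0 < K ∧ 0 < τ ∧ ∀ (a b : ℂ → ℂ) (E : ℂ) (γ L : ℝ),
      IsBoundedData s N a b E →
      Tendsto (fun n : ℕ => (∫ x, logEntry (IsBoundedData.transfer a b ω E) n x) / n) atTop (𝓝 L) →
      γ ≤ L - ∫ x, Real.log ‖b (pt x)‖ →
      IsGappedCocycle ω (α + 2) (2 * N) K τ γ (∫ x, Real.log ‖b (pt x)‖) L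
        (IsBoundedData.transfer a b ω E) (fun x => Real.log ‖b (pt x)‖) := by
  obtain ⟨K, τ, hK, hτ, hb⟩ := rotSum_log_norm_pi_bounds (H := 2 * N) (2 * 2) hα hc hω hs (by linarith)
  refine ⟨K, τ, hK, hτ, ?_⟩
  intro a b E γ L h hL hγ
  have hD := abs_le.1 h.abs_mean_le
  have hn1 : ∀ {n : ℕ}, 1 ≤ n → (1 : ℝ) ≤ n := fun hn => by exact_mod_cast hn
  have hA := fun (n : ℕ) (hn : 1 ≤ n) => hb n (IsBoundedData.entries a b ω E n) (hn1 hn)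
    (h.analyticOnNhd_entries ω n) (h.exists_entries_ne_zero ω n) (fun i z hz => h.norm_entries_le ω hn i hz) (by
      have h1 := h.integral_logEntry_ge ω n
      have h2 : n * (-(2 * N)) ≤ n * ∫ x, Real.log ‖b (pt x)‖ :=
        mul_le_mul_of_nonneg_left (by linarith) (by positivity)
      rw [IsBoundedData.logEntry_transfer] at h1
      linarith)
  simp only [← IsBoundedData.logEntry_transfer] at hA
  have hbe : Real.exp (1 * (2 * N)) ≥ N := by linarith [Real.add_one_le_exp (1 * (2 * N))]
  have hB := hb 1 (fun _ => b) le_rfl (fun _ => h.analytic_right) ⟨0, h.ne_zero⟩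
    (fun _ z hz => (h.norm_le z hz).trans hbe) (by simp only [pi_norm_const]; linarith)
  simp only [pi_norm_const, one_mul, div_one] at hB
  have hne := h.ae_ne_zero ω
  refine ⟨by linarith, ?_, ?_, h.measurable_logEntry ω, fun n _ => h.integrable_logEntry ω n,
    (continuous_comp_pt hs h.analytic_right).norm.measurable.log, h.integrable_log_norm, rfl,
    h.abs_mean_le.trans (by linarith), ?_, ?_, ?_, fun n k hn hk => (hA n hn k hk).2, ?_,
    fun k hk => (hB k hk).2, hL, hγ⟩
  · intro m n x
    rw [IsBoundedData.transfer, Ma_add, rot_pt]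
    rfl
  · intro n x hn
    rcases (entryNorm_nonneg (Ma a b ω E n (pt x))).eq_or_lt with h0 | h0
    · rw [logEntry, IsBoundedData.transfer, ← h0, Real.log_zero]
      positivity
    · exact (Real.log_le_iff_le_exp h0).2 (h.entryNorm_Ma_le ω (pt_mem hs.le x) hn)
  · intro x
    have h1 := (Real.log_le_self (norm_nonneg _)).trans (h.norm_le _ (pt_mem hs.le x))
    linarith
  · filter_upwards [hne] with x hx n using det_Ma hx n
  · intro n k hn hk
    have h1 := ae_forall_add (P := fun x => (Ma a b ω E n (pt x)).det ≠ 0)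
      (by filter_upwards [hne] with x hx using (det_Ma hx n).1) ω
    filter_upwards [h1] with x hx
    refine (hA n hn k hk).1 x fun j _ h0 => ?_
    have h2 := entryNorm_pos (hx j)
    rw [← IsBoundedData.norm_entries, h0] at h2
    simp at h2
  · intro k hk
    filter_upwards [hne] with x hx
    refine (hB k hk).1 x fun j _ h0 => hx j ?_
    exact congrFun h0 0

/-! ### Exponents of `M`, `M^a` and `M^u` -/

theorem rotSum_add_coe (ω : ℝ) (n : ℕ) (f : UnitAddCircle → ℝ) (x : UnitAddCircle) :
    rotSum ω n f (x + (ω : UnitAddCircle)) =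
      ∑ j ∈ Finset.Icc 1 n, f (x + ((j * ω : ℝ) : UnitAddCircle)) := by
  induction n with
  | zero => simp [rotSum]
  | succ n ih =>
    rw [rotSum_succ, ih, Finset.sum_Icc_succ_top (by omega), add_assoc x, ← AddCircle.coe_add]
    congr 4
    push_cast
    ring

theorem logNorm_smul {c : ℂ} {A : Matrix (Fin 2) (Fin 2) ℂ} (hc : c ≠ 0) (hA : A ≠ 0) :
    logNorm (c • A) = Real.log ‖c‖ + logNorm A := by
  rw [logNorm, norm_smul, Real.log_mul (norm_ne_zero_iff.2 hc) (norm_ne_zero_iff.2 hA), logNorm]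

theorem ne_zero_of_det_ne_zero {A : Matrix (Fin 2) (Fin 2) ℂ} (h : A.det ≠ 0) : A ≠ 0 := by
  rintro rfl
  simp at h

/-- The logarithmic norms of `M_n` and `M^u_n` in terms of that of `M^a_n`. -/
theorem logNorm_M_and_Mu {a b : ℂ → ℂ} {ω : ℝ} {E : ℂ} {x : UnitAddCircle}
    (hx : ∀ k : ℕ, b (pt (x + ((k * ω : ℝ) : UnitAddCircle))) ≠ 0) (n : ℕ) :
    logNorm (M a b ω E n (pt x)) = logNorm (Ma a b ω E n (pt x)) -
        rotSum ω n (fun y => Real.log ‖b (pt y)‖) (x + (ω : UnitAddCircle)) ∧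
      logNorm (Mu a b ω E n (pt x)) = logNorm (Ma a b ω E n (pt x)) -
        (rotSum ω n (fun y => Real.log ‖b (pt y)‖) x +
          rotSum ω n (fun y => Real.log ‖b (pt y)‖) (x + (ω : UnitAddCircle))) / 2 := by
  obtain ⟨hdet, hlog⟩ := det_Ma (E := E) (a := a) hx n
  have hb : ∀ j ∈ Finset.Icc 1 n, b (rot ω j (pt x)) ≠ 0 := fun j _ => by
    rw [rot_pt]
    exact hx j
  have hMa := Ma_eq a b ω E n (pt x) hb
  set c := ∏ j ∈ Finset.Icc 1 n, b (rot ω j (pt x)) with hc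
  have hc0 : c ≠ 0 := Finset.prod_ne_zero_iff.2 hb
  have hclog : Real.log ‖c‖ = rotSum ω n (fun y => Real.log ‖b (pt y)‖) (x + (ω : UnitAddCircle)) := by
    rw [rotSum_add_coe, hc, norm_prod, Real.log_prod fun j hj => norm_ne_zero_iff.2 (hb j hj)]
    exact Finset.sum_congr rfl fun j _ => by rw [rot_pt]
  have hdet2 : (Ma a b ω E n (pt x)).det = c ^ 2 * (M a b ω E n (pt x)).det := by
    rw [hMa, Matrix.det_smul, Fintype.card_fin]
  have hM0 : (M a b ω E n (pt x)).det ≠ 0 := fun h => hdet (by rw [hdet2, h, mul_zero])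
  have hM : logNorm (Ma a b ω E n (pt x)) = Real.log ‖c‖ + logNorm (M a b ω E n (pt x)) := by
    rw [hMa, logNorm_smul hc0 (ne_zero_of_det_ne_zero hM0)]
  have hd : Real.log ‖(Ma a b ω E n (pt x)).det‖ = 2 * Real.log ‖c‖ + Real.log ‖(M a b ω E n (pt x)).det‖ := by
    rw [hdet2, norm_mul, norm_pow, Real.log_mul (pow_ne_zero _ (norm_ne_zero_iff.2 hc0))
      (norm_ne_zero_iff.2 hM0), Real.log_pow]
    push_cast
    rfl
  have hs : 0 < Real.sqrt ‖(M a b ω E n (pt x)).det‖ := Real.sqrt_pos.2 (norm_pos_iff.2 hM0)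
  have hMu : logNorm (Mu a b ω E n (pt x)) =
      -(Real.log ‖(M a b ω E n (pt x)).det‖ / 2) + logNorm (M a b ω E n (pt x)) := by
    rw [Mu, logNorm_smul (by exact_mod_cast (inv_pos.2 hs).ne') (ne_zero_of_det_ne_zero hM0),
      Complex.norm_real, Real.norm_of_nonneg (inv_pos.2 hs).le, Real.log_inv, Real.log_sqrt (norm_nonneg _)]
  rw [hclog] at hM hd
  constructor <;> linarith

/-- The exponents are `limUnder` values, so convergence must be known before they mean anything; the
integrands are needed only almost everywhere. -/
theorem hasExponent_of_ae {F : ℕ → ℂ → Matrix (Fin 2) (Fin 2) ℂ} {v : ℕ → UnitAddCircle → ℝ} {L : ℝ}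
    (hv : ∀ n, Integrable (v n)) (hF : ∀ n, ∀ᵐ x : UnitAddCircle, logNorm (F n (pt x)) = v n x)
    (hL : Tendsto (fun n : ℕ => (∫ x, v n x) / n) atTop (𝓝 L)) :
    HasExponent F ∧ exponent F = L := by
  have h1 : finiteExponent F = fun n : ℕ => (∫ x, v n x) / n := by
    funext n
    rw [finiteExponent, integral_congr_ae (hF n), one_div, inv_mul_eq_div]
  have h2 : exponent F = L := by
    rw [exponent, h1]
    exact hL.limUnder_eq
  refine ⟨⟨fun n _ => (hv n).congr ?_, ?_⟩, h2⟩
  · filter_upwards [hF n] with x hx using hx.symm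
  · rw [h2, h1]
    exact hL

namespace IsBoundedData

variable {s N : ℝ} {a b : ℂ → ℂ} {E : ℂ}

theorem ae_abs_logNorm_sub_logEntry_le (h : IsBoundedData s N a b E) (ω : ℝ) : ∀ᵐ x : UnitAddCircle, ∀ n,
    |logNorm (Ma a b ω E n (pt x)) - logEntry (transfer a b ω E) n x| ≤ Real.log 2 := by
  filter_upwards [h.ae_ne_zero ω] with x hx n
  exact abs_logNorm_sub_log_entryNorm_le (det_Ma hx n).1

theorem integrable_logNorm_Ma (h : IsBoundedData s N a b E) (ω : ℝ) (n : ℕ) :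
    Integrable fun x : UnitAddCircle => logNorm (Ma a b ω E n (pt x)) := by
  have hc : Continuous fun x => Ma a b ω E n (pt x) := by
    refine continuous_matrix fun i j => ?_
    exact continuous_comp_pt h.pos (h.analyticOnNhd_Ma ω n i j)
  refine ((h.integrable_logEntry ω n).abs.add (integrable_const (Real.log 2))).mono'
    hc.norm.measurable.log.aestronglyMeasurable ?_
  filter_upwards [h.ae_abs_logNorm_sub_logEntry_le ω] with x hx
  have h1 := abs_sub_abs_le_abs_sub (logNorm (Ma a b ω E n (pt x))) (logEntry (transfer a b ω E) n x)
  simp only [Pi.add_apply, Real.norm_eq_abs]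
  linarith [hx n]

theorem abs_integral_logNorm_Ma_sub_le (h : IsBoundedData s N a b E) (ω : ℝ) (n : ℕ) :
    |(∫ x : UnitAddCircle, logNorm (Ma a b ω E n (pt x))) - ∫ x, logEntry (transfer a b ω E) n x| ≤
      Real.log 2 := by
  rw [← integral_sub (h.integrable_logNorm_Ma ω n) (h.integrable_logEntry ω n)]
  have h1 := norm_integral_le_of_norm_le_const (μ := (volume : Measure UnitAddCircle)) (C := Real.log 2)
    (f := fun x => logNorm (Ma a b ω E n (pt x)) - logEntry (transfer a b ω E) n x) (by
      filter_upwards [h.ae_abs_logNorm_sub_logEntry_le ω] with x hx using hx n)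
  simpa using h1

theorem tendsto_logNorm_Ma (h : IsBoundedData s N a b E) {ω L : ℝ}
    (hL : Tendsto (fun n : ℕ => (∫ x, logEntry (transfer a b ω E) n x) / n) atTop (𝓝 L)) :
    Tendsto (fun n : ℕ => (∫ x : UnitAddCircle, logNorm (Ma a b ω E n (pt x))) / n) atTop (𝓝 L) := by
  have h1 : Tendsto (fun n : ℕ => Real.log 2 / n) atTop (𝓝 0) := tendsto_const_div_atTop_nhds_zero_nat _
  have h2 : Tendsto (fun n : ℕ => (∫ x : UnitAddCircle, logNorm (Ma a b ω E n (pt x))) / n -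
      (∫ x, logEntry (transfer a b ω E) n x) / n) atTop (𝓝 0) := by
    refine squeeze_zero_norm (fun n => ?_) h1
    rw [← sub_div, norm_div, Real.norm_natCast, Real.norm_eq_abs]
    gcongr
    exact h.abs_integral_logNorm_Ma_sub_le ω n
  simpa using h2.add hL

theorem integrable_rotSum_log (h : IsBoundedData s N a b E) (ω : ℝ) (n : ℕ) :
    Integrable (rotSum ω n fun y => Real.log ‖b (pt y)‖) :=
  integrable_rotSum h.integrable_log_norm ω n

theorem tendsto_sub_mean {u : ℕ → ℝ} {L D : ℝ} (hu : Tendsto (fun n : ℕ => u n / n) atTop (𝓝 L)) :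
    Tendsto (fun n : ℕ => (u n - n * D) / n) atTop (𝓝 (L - D)) := by
  refine (hu.sub_const D).congr' ?_
  filter_upwards [eventually_ge_atTop 1] with n hn
  have : (n : ℝ) ≠ 0 := by positivity
  field_simp

/-- The Lyapunov exponents exist, and those of `M` and `M^u` agree. -/
theorem hasExponent (h : IsBoundedData s N a b E) {ω L : ℝ}
    (hL : Tendsto (fun n : ℕ => (∫ x, logEntry (transfer a b ω E) n x) / n) atTop (𝓝 L)) :
    (HasExponent (M a b ω E) ∧ exponent (M a b ω E) = L - ∫ x, Real.log ‖b (pt x)‖) ∧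
      (HasExponent (Ma a b ω E) ∧ exponent (Ma a b ω E) = L) ∧
      HasExponent (Mu a b ω E) ∧ exponent (Mu a b ω E) = L - ∫ x, Real.log ‖b (pt x)‖ := by
  have hi := h.integrable_logNorm_Ma ω
  have hr := h.integrable_rotSum_log ω
  have hr' := fun n => (hr n).comp_add_right (ω : UnitAddCircle)
  have hrD : ∀ n : ℕ, ∫ x, rotSum ω n (fun y => Real.log ‖b (pt y)‖) x = n * ∫ x, Real.log ‖b (pt x)‖ :=
    integral_rotSum h.integrable_log_norm ω
  have hrD' : ∀ n : ℕ, ∫ x, rotSum ω n (fun y => Real.log ‖b (pt y)‖) (x + (ω : UnitAddCircle)) =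
      n * ∫ x, Real.log ‖b (pt x)‖ := fun n => by
    rw [integral_comp_add (rotSum ω n fun y => Real.log ‖b (pt y)‖), hrD]
  have hMa := h.tendsto_logNorm_Ma hL
  have hsub := tendsto_sub_mean (D := ∫ x, Real.log ‖b (pt x)‖) hMa
  have hne := h.ae_ne_zero ω
  refine ⟨hasExponent_of_ae (fun n => (hi n).sub (hr' n)) (fun n => ?_) (hsub.congr fun n => ?_),
    hasExponent_of_ae hi (fun n => .of_forall fun x => rfl) hMa,
    hasExponent_of_ae (fun n => (hi n).sub (((hr n).add (hr' n)).div_const 2)) (fun n => ?_)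
      (hsub.congr fun n => ?_)⟩
  · filter_upwards [hne] with x hx using (logNorm_M_and_Mu hx n).1
  · congr 1
    simp only [Pi.sub_apply]
    rw [integral_sub (hi n) (hr' n), hrD']
  · filter_upwards [hne] with x hx using (logNorm_M_and_Mu hx n).2
  · congr 1
    simp only [Pi.sub_apply, Pi.add_apply]
    have e : Integrable fun x => (rotSum ω n (fun y => Real.log ‖b (pt y)‖) x +
      rotSum ω n (fun y => Real.log ‖b (pt y)‖) (x + (ω : UnitAddCircle))) / 2 :=
      ((hr n).add (hr' n)).div_const 2
    rw [integral_sub (hi n) e, integral_div, integral_add (hr n) (hr' n), hrD, hrD']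
    ring

theorem finiteExponent_Mu (h : IsBoundedData s N a b E) (ω : ℝ) {n : ℕ} (hn : 1 ≤ n) :
    finiteExponent (Mu a b ω E) n = finiteExponent (Ma a b ω E) n - ∫ x, Real.log ‖b (pt x)‖ := by
  have hi := h.integrable_logNorm_Ma ω n
  have hr := h.integrable_rotSum_log ω n
  have hr' := hr.comp_add_right (ω : UnitAddCircle)
  have e : Integrable fun x => (rotSum ω n (fun y => Real.log ‖b (pt y)‖) x +
    rotSum ω n (fun y => Real.log ‖b (pt y)‖) (x + (ω : UnitAddCircle))) / 2 := (hr.add hr').div_const 2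
  have h1 : ∫ x, logNorm (Mu a b ω E n (pt x)) = (∫ x : UnitAddCircle, logNorm (Ma a b ω E n (pt x))) -
      n * ∫ x, Real.log ‖b (pt x)‖ := by
    rw [integral_congr_ae (by filter_upwards [h.ae_ne_zero ω] with x hx using (logNorm_M_and_Mu hx n).2),
      integral_sub hi e, integral_div, integral_add hr hr',
      integral_comp_add (rotSum ω n fun y => Real.log ‖b (pt y)‖), integral_rotSum h.integrable_log_norm]
    ring
  have hn0 : (n : ℝ) ≠ 0 := by positivity
  rw [finiteExponent, finiteExponent, h1]
  field_simp

end IsBoundedData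

/-! ### The large deviation estimates -/

/-- The centre may be moved by a multiple of `(log n)^q`, which is then traded for `(log n)^p`. For
`n ≥ 2` the quotient of the two powers is largest at `n = 2`, and the extra `1` in the constant
makes the inequality strict. -/
theorem deviation_lt {F : ℕ → ℂ → Matrix (Fin 2) (Fin 2) ℂ} {c C p q ℓ ℓ' : ℝ} {n : ℕ} (hc : 0 < c)
    (hC : 0 < C) (hpq : q < p) (hn : 2 ≤ n)
    (h : ∀ t : ℝ, HoldsOff (Real.exp (-(c * t) + C * Real.log n ^ q))
      fun x => |logNorm (F n (pt x)) - n * ℓ| ≤ t)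
    (hℓ : |n * ℓ' - n * ℓ| ≤ C * Real.log n ^ q) (δ : ℝ) :
    volume (deviationSet F n ℓ' δ) <
      ENNReal.ofReal (Real.exp (-c * δ * n + ((C + c * C) * Real.log 2 ^ (q - p) + 1) * Real.log n ^ p)) := by
  have hl2 : 0 < Real.log 2 := Real.log_pos (by norm_num)
  have hlog : Real.log 2 ≤ Real.log n := Real.log_le_log (by norm_num) (by exact_mod_cast hn)
  have hln : 0 < Real.log n := hl2.trans_le hlog
  have hG : Real.log n ^ q ≤ Real.log 2 ^ (q - p) * Real.log n ^ p := by
    calc Real.log n ^ q = Real.log n ^ (q - p) * Real.log n ^ p := by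
          rw [← Real.rpow_add hln]; congr 1; ring
      _ ≤ _ := by
          gcongr ?_ * _
          exact Real.rpow_le_rpow_of_nonpos hl2 hlog (by linarith)
  have hp : 0 < Real.log n ^ p := by positivity
  refine lt_of_le_of_lt (b := ENNReal.ofReal (Real.exp (-(c * (δ * n - C * Real.log n ^ q)) +
    C * Real.log n ^ q))) (le_trans (measure_mono fun x hx => ?_) (h (δ * n - C * Real.log n ^ q))) ?_
  · simp only [deviationSet, Set.mem_ofPred_eq] at hx ⊢
    intro h1
    have h2 := abs_sub_le (logNorm (F n (pt x))) (n * ℓ) (n * ℓ')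
    rw [abs_sub_comm (n * ℓ) (n * ℓ')] at h2
    linarith
  · refine (ENNReal.ofReal_lt_ofReal_iff (Real.exp_pos _)).2 (Real.exp_lt_exp.2 ?_)
    have h3 : (C + c * C) * Real.log n ^ q ≤ (C + c * C) * (Real.log 2 ^ (q - p) * Real.log n ^ p) := by
      gcongr
    linarith

open IsBoundedData in
theorem exists_deviation {α c ω s N γ : ℝ} (hα : 0 < α) (hc : 0 < c) (hω : UniformDiophantine α c ω)
    (hs : 0 < s) (hN : 1 ≤ N) (hγ : 0 < γ) :
    ∃ c₀ C : ℝ, 0 < c₀ ∧ 0 < C ∧ ∀ (a b : ℂ → ℂ) (E : ℂ), IsBoundedData s N a b E →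
      γ ≤ exponent (M a b ω E) → ∀ n : ℕ, 2 ≤ n →
      (|n * finiteExponent (Ma a b ω E) n - n * exponent (Ma a b ω E)| ≤ C * Real.log n ^ (α + 2) ∧
        |n * finiteExponent (Mu a b ω E) n - n * exponent (Mu a b ω E)| ≤ C * Real.log n ^ (α + 2)) ∧
      ∀ t : ℝ, (HoldsOff (Real.exp (-(c₀ * t) + C * Real.log n ^ (α + 2)))
          fun x => |logNorm (Ma a b ω E n (pt x)) - n * exponent (Ma a b ω E)| ≤ t) ∧
        HoldsOff (Real.exp (-(c₀ * t) + C * Real.log n ^ (α + 2)))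
          fun x => |logNorm (Mu a b ω E n (pt x)) - n * exponent (Mu a b ω E)| ≤ t := by
  obtain ⟨K, τ, hK, hτ, hgap⟩ := exists_isGappedCocycle hα hc hω hs hN
  obtain ⟨c₁, C₁, hc₁, hC₁, hdev⟩ := exists_full_deviation (q := α + 2) (H := 2 * N) (by linarith)
    (by linarith) hK.le hτ hγ
  have hl2 : 0 < Real.log 2 := Real.log_pos (by norm_num)
  have hl2' : Real.log 2 ≤ 1 := by linarith [Real.log_le_sub_one_of_pos (show (0 : ℝ) < 2 by norm_num)]
  set g := Real.log 2 ^ (α + 2) with hg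
  have hg0 : 0 < g := by positivity
  refine ⟨min c₁ τ / 3, C₁ + (1 + τ) * K + (c₁ + 2) * (1 / g), by positivity, by positivity, ?_⟩
  intro a b E h hE n hn
  obtain ⟨L, hL⟩ := h.exists_tendsto ω
  obtain ⟨⟨-, hM⟩, ⟨-, hMa⟩, -, hMu⟩ := h.hasExponent hL
  rw [hM] at hE
  have hcoc := hgap a b E γ L h hL hE
  obtain ⟨hfin, hdev⟩ := hdev _ _ _ _ _ hcoc n hn
  set D := ∫ x, Real.log ‖b (pt x)‖ with hD
  set G := Real.log n ^ (α + 2) with hG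
  have hgG : 1 ≤ 1 / g * G := by
    rw [one_div, inv_mul_eq_div, one_le_div hg0]
    exact Real.rpow_le_rpow hl2.le (Real.log_le_log (by norm_num) (by exact_mod_cast hn)) (by linarith)
  have hG0 : 0 ≤ G := Real.rpow_nonneg (Real.log_natCast_nonneg n) _
  have k1 : 0 ≤ C₁ * G := by positivity
  have k2 : 0 ≤ (1 + τ) * K * G := by positivity
  have k3 : c₁ * 1 ≤ c₁ * (1 / g * G) := by gcongr
  have hn0 : (n : ℝ) ≠ 0 := by positivity
  have hfinMa : |n * finiteExponent (Ma a b ω E) n - n * L| ≤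
      (C₁ + (1 + τ) * K + (c₁ + 2) * (1 / g)) * G := by
    have h1 : n * finiteExponent (Ma a b ω E) n = ∫ x : UnitAddCircle, logNorm (Ma a b ω E n (pt x)) := by
      rw [finiteExponent]
      field_simp
    have h2 := h.abs_integral_logNorm_Ma_sub_le ω n
    have h3 := abs_sub_le (∫ x : UnitAddCircle, logNorm (Ma a b ω E n (pt x)))
      (∫ x, logEntry (transfer a b ω E) n x) (n * L)
    rw [h1]
    linarith
  have hdevMa : ∀ t : ℝ, HoldsOff (Real.exp (-(c₁ * t) + (C₁ * G + c₁)))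
      fun x => |logNorm (Ma a b ω E n (pt x)) - n * L| ≤ t := by
    intro t
    -- Replacing the entry norm by the operator norm costs `log 2 ≤ 1`, so the deviation is applied
    -- at `t - 1`.
    refine ((hdev (t - 1)).mono_left (Real.exp_le_exp.2 (by linarith))).mono_ae ?_
    filter_upwards [h.ae_abs_logNorm_sub_logEntry_le ω] with x hx hx'
    have h3 := abs_sub_le (logNorm (Ma a b ω E n (pt x))) (logEntry (transfer a b ω E) n x) (n * L)
    linarith [hx n]
  refine ⟨⟨by rw [hMa]; exact hfinMa, ?_⟩, fun t => ?_⟩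
  · rw [hMu, h.finiteExponent_Mu ω (by omega)]
    convert hfinMa using 2
    ring
  · rcases le_or_gt t 0 with ht | ht
    · have h1 : 1 ≤ Real.exp (-(min c₁ τ / 3 * t) + (C₁ + (1 + τ) * K + (c₁ + 2) * (1 / g)) * G) := by
        refine Real.one_le_exp ?_
        have : min c₁ τ / 3 * t ≤ 0 := mul_nonpos_of_nonneg_of_nonpos (by positivity) ht
        linarith
      exact ⟨.of_one_le h1 _, .of_one_le h1 _⟩
    · have m1 : min c₁ τ * t ≤ c₁ * t := by gcongr; exact min_le_left _ _
      have m2 : min c₁ τ * t ≤ τ * t := by gcongr; exact min_le_right _ _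
      have m3 : 0 ≤ c₁ * t := by positivity
      rw [hMa, hMu]
      refine ⟨(hdevMa t).mono_left (Real.exp_le_exp.2 (by linarith)), ?_⟩
      -- The deviation for `M^u` is at most that for `M^a` plus half of those of two Birkhoff sums
      -- of `log |b|`; each gets `t/3`, and the three exceptional sets account for the factor `e² ≥
      -- 3`.
      have hβ := hcoc.holdsOff_abs_beta_sub_le hK.le hτ hn (t / 3)
      have hall := ((hdevMa (t / 3)).and (hβ.and (hβ.shift (ω : UnitAddCircle)) (Real.exp_pos _).le
        (Real.exp_pos _).le) (Real.exp_pos _).le (by positivity))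
      refine (hall.mono_left ?_).mono_ae ?_
      · set e := -(min c₁ τ / 3 * t) + (C₁ + (1 + τ) * K + c₁ * (1 / g)) * G with he
        have e1 : Real.exp (-(c₁ * (t / 3)) + (C₁ * G + c₁)) ≤ Real.exp e :=
          Real.exp_le_exp.2 (by linarith)
        have e2 : Real.exp (-(τ * (t / 3)) + (1 + τ) * K * G) ≤ Real.exp e :=
          Real.exp_le_exp.2 (by linarith)
        have e3 : (3 : ℝ) ≤ Real.exp 2 := by linarith [Real.add_one_le_exp (2 : ℝ)]
        have e4 : Real.exp e * 3 ≤ Real.exp e * Real.exp 2 := by gcongr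
        rw [← Real.exp_add] at e4
        have e5 : Real.exp (e + 2) ≤ Real.exp (-(min c₁ τ / 3 * t) +
            (C₁ + (1 + τ) * K + (c₁ + 2) * (1 / g)) * G) := Real.exp_le_exp.2 (by linarith)
        linarith
      · filter_upwards [h.ae_ne_zero ω] with x hx hx'
        rw [(logNorm_M_and_Mu hx n).2]
        obtain ⟨h1, h2, h3⟩ := hx'
        rw [abs_le] at h1 h2 h3 ⊢
        constructor <;> linarith

theorem norm_le_of_supNorm_le {ρ : ℝ} {f : ℂ → ℂ} {B : ℝ≥0} (h : supNorm ρ f ≤ B) {z : ℂ}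
    (hz : z ∈ annulus ρ) : ‖f z‖ ≤ B := by
  have h1 : ‖f z‖ₑ ≤ B := (le_iSup₂ (f := fun z (_ : z ∈ annulus ρ) => ‖f z‖ₑ) z hz).trans h
  exact_mod_cast h1

/-- The closed annulus with outer radius `1 + ρ/2` lies in the open one, so sup bounds apply on it;
the mean of `log |b|` on the unit circle is the value `D(1)`, covered by the norm of `b`. -/
theorem isBoundedData_of_norm_le {ρ₀ ρ : ℝ} (hρ₀ : 0 < ρ₀) (hρ0 : 0 < ρ) (hρ : ρ < 1) {A B R : ℝ≥0}
    {a b : ℂ → ℂ} {E : ℂ} (ha : AnalyticOnNhd ℂ a (closure (annulus ρ)))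
    (hb : AnalyticOnNhd ℂ b (closure (annulus ρ))) (hne : ∃ z : ℂ, ‖z‖ = 1 ∧ b z ≠ 0)
    (hA : supNorm ρ a ≤ A) (hB : starNorm ρ₀ ρ b ≤ B) (hE : ‖E‖ ≤ R) :
    IsBoundedData (Real.log (1 + ρ / 2)) (A + B + R + 1) a b E := by
  have hsub := closedAnnulus_subset_annulus hρ0 hρ
  have hcl := hsub.trans subset_closure
  refine ⟨Real.log_pos (by linarith), ?_, ha.mono hcl, hb.mono hcl, fun z hz => ?_, fun z hz => ?_, ?_, ?_⟩
  · have := A.coe_nonneg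
    have := B.coe_nonneg
    have := R.coe_nonneg
    linarith
  · have h1 := norm_le_of_supNorm_le hA (hsub hz)
    have h2 := norm_sub_le (a z) E
    have := B.coe_nonneg
    linarith
  · have h1 := norm_le_of_supNorm_le (le_self_add.trans hB) (hsub hz)
    have := A.coe_nonneg
    have := R.coe_nonneg
    linarith
  · obtain ⟨z, hz, hbz⟩ := hne
    obtain ⟨θ, hθ⟩ := exists_eq_norm_mul_pt z
    rw [hz, Complex.ofReal_one, one_mul] at hθ
    exact ⟨θ, hθ ▸ hbz⟩
  · have h1 : ‖logMean b 1‖ₑ ≤ B := by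
      refine le_trans ?_ (le_add_self.trans hB)
      exact le_iSup₂ (f := fun r (_ : r ∈ Set.Ioo (1 - ρ₀) (1 + ρ₀)) => ‖logMean b r‖ₑ) 1
        ⟨by linarith, by linarith⟩
    have h2 : ‖logMean b 1‖ ≤ B := by exact_mod_cast h1
    simp only [logMean, Complex.ofReal_one, one_mul, Real.norm_eq_abs] at h2
    have := A.coe_nonneg
    have := R.coe_nonneg
    linarith

end JacobiCocycle

theorem mainTheorem2 (α ω ρ₀ ρ γ : ℝ) (hα : 1 < α) (hω : ω ∈ Set.Ioo (0 : ℝ) 1)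
    (hdio : JacobiCocycle.IsDiophantine α ω)
    (hρ₀ : 0 < ρ₀) (hρ₀ρ : ρ₀ < ρ) (hρ : ρ < 1) (hγ : 0 < γ) (A B R : ℝ≥0) :
    ∃ c₀ : ℝ, 0 < c₀ ∧ ∀ p : ℝ, α + 2 < p → ∃ C₀ : ℝ, 0 < C₀ ∧
      ∀ (a b : ℂ → ℂ) (E : ℂ),
        AnalyticOnNhd ℂ a (closure (JacobiCocycle.annulus ρ)) →
        AnalyticOnNhd ℂ b (closure (JacobiCocycle.annulus ρ)) →
        (∀ z : ℂ, ‖z‖ = 1 → (a z).im = 0) →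
        (∃ z : ℂ, ‖z‖ = 1 ∧ b z ≠ 0) →
        JacobiCocycle.supNorm ρ a ≤ A →
        JacobiCocycle.starNorm ρ₀ ρ b ≤ B →
        ‖E‖ ≤ R →
        γ ≤ JacobiCocycle.exponent (JacobiCocycle.M a b ω E) →
        (JacobiCocycle.HasExponent (JacobiCocycle.M a b ω E) ∧
          JacobiCocycle.HasExponent (JacobiCocycle.Ma a b ω E) ∧
          JacobiCocycle.HasExponent (JacobiCocycle.Mu a b ω E)) ∧
        ∀ (δ : ℝ) (n : ℕ), 0 < δ → 1 < n →
          volume (JacobiCocycle.deviationSet (JacobiCocycle.Ma a b ω E) n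
              (JacobiCocycle.finiteExponent (JacobiCocycle.Ma a b ω E) n) δ)
            < ENNReal.ofReal (Real.exp (-c₀ * δ * n + C₀ * Real.log n ^ p)) ∧
          volume (JacobiCocycle.deviationSet (JacobiCocycle.Ma a b ω E) n
              (JacobiCocycle.exponent (JacobiCocycle.Ma a b ω E)) δ)
            < ENNReal.ofReal (Real.exp (-c₀ * δ * n + C₀ * Real.log n ^ p)) ∧
          volume (JacobiCocycle.deviationSet (JacobiCocycle.Mu a b ω E) n
              (JacobiCocycle.finiteExponent (JacobiCocycle.Mu a b ω E) n) δ)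
            < ENNReal.ofReal (Real.exp (-c₀ * δ * n + C₀ * Real.log n ^ p)) ∧
          volume (JacobiCocycle.deviationSet (JacobiCocycle.Mu a b ω E) n
              (JacobiCocycle.exponent (JacobiCocycle.Mu a b ω E)) δ)
            < ENNReal.ofReal (Real.exp (-c₀ * δ * n + C₀ * Real.log n ^ p)) := by
  have hρ0 : 0 < ρ := hρ₀.trans hρ₀ρ
  obtain ⟨c, hc, hdio⟩ := hdio.uniform (by linarith) hω
  obtain ⟨c₀, C, hc₀, hC, hdev⟩ := JacobiCocycle.exists_deviation (α := α) (s := Real.log (1 + ρ / 2))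
    (N := A + B + R + 1) (by linarith) hc hdio (Real.log_pos (by linarith))
    (by linarith [A.coe_nonneg, B.coe_nonneg, R.coe_nonneg]) hγ
  refine ⟨c₀, hc₀, fun p hp => ⟨(C + c₀ * C) * Real.log 2 ^ (α + 2 - p) + 1, ?_, ?_⟩⟩
  · have : 0 < Real.log 2 := Real.log_pos (by norm_num)
    positivity
  intro a b E ha hb _ hne hA hB hE hL
  have h := JacobiCocycle.isBoundedData_of_norm_le hρ₀ hρ0 hρ ha hb hne hA hB hE
  obtain ⟨L, hlim⟩ := h.exists_tendsto ω
  obtain ⟨⟨hM, -⟩, ⟨hMa, -⟩, hMu, -⟩ := h.hasExponent hlim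
  refine ⟨⟨hM, hMa, hMu⟩, fun δ n _ hn => ?_⟩
  obtain ⟨⟨hfa, hfu⟩, hd⟩ := hdev a b E h hL n hn
  have h0 : ∀ y : ℝ, |y - y| ≤ C * Real.log n ^ (α + 2) := fun y => by
    rw [sub_self, abs_zero]
    exact mul_nonneg hC.le (Real.rpow_nonneg (Real.log_natCast_nonneg n) _)
  exact ⟨JacobiCocycle.deviation_lt hc₀ hC hp hn (fun t => (hd t).1) hfa δ,
    JacobiCocycle.deviation_lt hc₀ hC hp hn (fun t => (hd t).1) (h0 _) δ,
    JacobiCocycle.deviation_lt hc₀ hC hp hn (fun t => (hd t).2) hfu δ,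
    JacobiCocycle.deviation_lt hc₀ hC hp hn (fun t => (hd t).2) (h0 _) δ⟩
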